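/- **Notation.** All rapidities are complex and $\theta_{ij}=\theta_i-\theta_j$. Put $$a(\theta)=-\frac{\Gamma(1-\frac{\theta}{2\pi i})\Gamma(\frac12+\frac{\theta}{2\pi i})}{\Gamma(1+\frac{\theta}{2\pi i})\Gamma(\frac12-\frac{\theta}{2\pi i})},\quad \tilde b(\theta)=\frac{\theta}{\theta-i\pi},\quad \tilde c(\theta)=\frac{-i\pi}{\theta-i\pi},$$ $\tilde S_{\alpha\beta}^{\delta\gamma}=\delta_{\alpha\gamma}\delta_{\beta\delta}\tilde b+\delta_{\alpha\delta}\delta_{\beta\gamma}\tilde c$ $(\alpha,\beta,\gamma,\delta\in\{1,2\})$, and let $S=a\tilde S$ be the $SU(2)$ S-matrix; $S_{ij}(\theta_{ij})$ acts on the tensor factors $i,j$ of $(\mathbb C^2)^{\otimes n}$ and exchanges them. Let $\epsilon_{\alpha\beta},\epsilon^{\alpha\beta}$ be antisymmetric with $\epsilon_{12}=\epsilon^{21}=1$. Let $\phi(\theta)=\Gamma(\frac{\theta}{2\pi i})\Gamma(\frac12-\frac{\theta}{2\pi i})$, $\tilde\phi(\theta)=\phi(-\theta)$, $\tau(z)=1/(\phi(z)\phi(-z))$.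 The minimal form factor is the meromorphic function $F(\theta)$ which for $0<\operatorname{Im}\theta<2\pi$ is $$F(\theta)=c\exp\int_0^\infty\frac{dt}{t\sinh^2t}\,e^{t/2}\sinh\tfrac t2\Bigl(1-\cosh t\bigl(1-\tfrac{\theta}{i\pi}\bigr)\Bigr),\qquad c=\Gamma(\tfrac14)^{-1}\exp\Bigl(-\int_0^\infty e^{t/2}\Bigl(\frac{\sinh\frac t2}{t\sinh^2t}-\frac{1}{2t\sinh t}\Bigr)dt\Bigr);$$ it satisfies $\phi(\theta)F(\theta)F(\theta+i\pi)=1$. **Ansatz.** Fix an integer $w\ge0$; below $n=w+2m$, $m=0,1,2,\dots$. Let $\tilde C(\underline\theta,z)$ be the component, with lower auxiliary index $1$ and upper auxiliary index $2$, of the monodromy matrix $\tilde S_{10}(\theta_1-z)\cdots\tilde S_{n0}(\theta_n-z)$, let $\Omega$ be the co-vector with $\Omega_{1\dots1}=1$ and all other components $0$, and put $\tilde\Psi(\underline\theta,\underline z)=\Omega\,\tilde C(\underline\theta,z_m)\cdots\tilde C(\underline\theta,z_1)$ and $\tilde h(\underline\theta,\underline z)=\prod_{i=1}^n\prod_{j=1}^m\tilde\phi(\theta_i-z_j)\prod_{1\le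 i<j\le m}\tau(z_i-z_j)$. For distinct $\theta_i$ with $|\operatorname{Im}\theta_{ij}|<\pi$ let $\mathcal C_{\underline\theta}$ consist of a horizontal line, from left to right, above all $\theta_i-2\pi i$ and below all $\theta_i-i\pi$, and of small clockwise circles around the $\theta_i$; let $R=\oint_\theta dz\,\tilde\phi(\theta-z)$ over such a circle. Given functions $p_{nm}(\underline\theta,\underline z)$ and constants $N_n$, put $$F_{\underline\alpha}(\underline\theta)=K_{\underline\alpha}(\underline\theta)\prod_{1\le i<j\le n}F(\theta_{ij}),\qquad K_{\underline\alpha}(\underline\theta)=\frac{N_n}{m!}\int_{\mathcal C_{\underline\theta}}\frac{dz_1}{R}\cdots\int_{\mathcal C_{\underline\theta}}\frac{dz_m}{R}\,\tilde h(\underline\theta,\underline z)\,p_{nm}(\underline\theta,\underline z)\,\tilde\Psi_{\underline\alpha}(\underline\theta,\underline z),$$ and for all other $\underline\theta$ define $F_{1\dots n}$ by analytic continuation. **Assumptions.** For every $n=w+2m$ let $\sigma=\sigma_n$ be a statistics factor, $\sigma_n^2=(-1)^n$. Let $p_{nm}$ be entire and let the integrals converge in the following sense: for $\underline\theta$ in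 a compact set, $|p_{nm}(\underline\theta,\underline z)|\le B\exp\bigl((1+\frac w2)\sum_j|\operatorname{Re}z_j|\bigr)$ with some constant $B$. Suppose that * $(\mathrm i')$ $p_{nm}(\underline\theta,\underline z)$ is symmetric under $\theta_i\leftrightarrow\theta_j$ and under $z_i\leftrightarrow z_j$; * $(\mathrm{ii}')$ $\sigma_n\,p_{nm}(\theta_1+2\pi i,\theta_2,\dots,\underline z)=(-1)^{m-1}p_{nm}(\underline\theta,\underline z)$ and $p_{nm}(\underline\theta,z_1+2\pi i,z_2,\dots)=(-1)^np_{nm}(\underline\theta,\underline z)$; * $(\mathrm{iii}')$ for $m\ge1$ and $\theta_{12}=i\pi$, both $p_{nm}(\underline\theta,\underline z)|_{z_1=\theta_1}$ and $(-1)^{m-1}\sigma_n\,p_{nm}(\underline\theta,\underline z)|_{z_1=\theta_2}$ are of the form $\sigma_n\,p_{n-2\,m-1}(\theta_3,\dots,\theta_n,z_2,\dots,z_m)+\tilde p$ with an additional term $\tilde p$ (not necessarily the same in the two cases) that either does not contribute, i.e. the integral of $\tilde h\,\tilde p\,\tilde\Psi_{\underline\alpha}$ for the variables $\theta_3,\dots,\theta_n$;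 $z_2,\dots,z_m$ vanishes for all $\underline\alpha$, or, if $n=2m\geq 4$, does not depend on $z_2,\dots,z_m$; * $i\pi\,\tilde\phi(i\pi)F(i\pi)\,N_n=2i\,N_{n-2}$ for $m\ge1$. **Theorem.** The analytic continuation exists: $F_{1\dots n}$ is a meromorphic function on $\mathbb C^n$, analytic where no $\theta_{ij}$ $(i\neq j)$ lies in $i\pi\mathbb Z$. These functions satisfy the form factor equations * (i) $F_{\dots ij\dots}(\dots,\theta_i,\theta_j,\dots)=F_{\dots ji\dots}(\dots,\theta_j,\theta_i,\dots)\,S_{ij}(\theta_{ij})$ for $j=i+1$; * (ii) $F_{1\dots n}(\theta_1+i\pi,\theta_2,\dots,\theta_n)\,\sigma_n\,\mathbf C^{\bar11}=F_{2\dots n1}(\theta_2,\dots,\theta_n,\theta_1-i\pi)\,\mathbf C^{1\bar1}$ with $\mathbf C^{\alpha\beta}=\epsilon^{\alpha\beta}$; * (iii) $\displaystyle\operatorname*{Res}_{\theta_{12}=i\pi}F_{1\dots n}(\theta_1,\dots,\theta_n)=2i\,\epsilon_{12}\,F_{3\dots n}(\theta_3,\dots,\theta_n)\bigl(\mathbf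 1-\sigma_n S_{2n}\cdots S_{23}\bigr)$ for $n\ge2$ (a pole of order at most one), where $F_{3\dots n}$ is zero if $m=0$. -/

import Mathlib

namespace SU2

noncomputable section

open Complex Filter Topology

/-! ### The SU(2) S-matrix

The two particle types `1, 2` are the elements `0, 1` of `Fin 2`. -/

/-- The highest weight amplitude
`a(θ) = -Γ(1 - θ/2πi) Γ(1/2 + θ/2πi) / (Γ(1 + θ/2πi) Γ(1/2 - θ/2πi))`. -/
def ampA (θ : ℂ) : ℂ :=
  -(Gamma (1 - θ / (2 * Real.pi * I)) * Gamma (1 / 2 + θ / (2 * Real.pi * I))) /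
    (Gamma (1 + θ / (2 * Real.pi * I)) * Gamma (1 / 2 - θ / (2 * Real.pi * I)))

/-- `b̃(θ) = θ / (θ - iπ)`. -/
def ampBt (θ : ℂ) : ℂ := θ / (θ - I * Real.pi)

/-- `c̃(θ) = -iπ / (θ - iπ)`. -/
def ampCt (θ : ℂ) : ℂ := -(I * Real.pi) / (θ - I * Real.pi)

/-- `Stilde θ α β δ γ` is the component with lower indices `α β` and upper indices `δ γ` of
`S̃(θ) = S(θ) / a(θ)`, that is `δ_{αγ} δ_{βδ} b̃(θ) + δ_{αδ} δ_{βγ} c̃(θ)`. -/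
def Stilde (θ : ℂ) (α β δ γ : Fin 2) : ℂ :=
  (if α = γ ∧ β = δ then ampBt θ else 0) + (if α = δ ∧ β = γ then ampCt θ else 0)

/-- The S-matrix, with amplitudes `b = a b̃` and `c = a c̃`; thus `b + c = a` and
`c(θ) = -(iπ/θ) b(θ)`. Index order as in `Stilde`. -/
def Smat (θ : ℂ) (α β δ γ : Fin 2) : ℂ := ampA θ * Stilde θ α β δ γ

/-- The charge conjugation matrix with lower indices, antisymmetric with `ε_{12} = 1`. -/
def epsLow (α β : Fin 2) : ℂ := !![0, 1; -1, 0] α β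

/-- The charge conjugation matrix with upper indices, antisymmetric with `ε^{21} = 1`. -/
def epsUp (α β : Fin 2) : ℂ := !![0, -1; 1, 0] α β

/-! ### Jost function and minimal form factor -/

/-- `φ(θ) = Γ(θ/2πi) Γ(1/2 - θ/2πi)`. -/
def jost (θ : ℂ) : ℂ :=
  Gamma (θ / (2 * Real.pi * I)) * Gamma (1 / 2 - θ / (2 * Real.pi * I))

/-- `φ̃(θ) = φ(θ) a(θ) = φ(-θ)`. -/
def jostT (θ : ℂ) : ℂ := jost (-θ)

/-- `τ(z) = 1 / (φ(z) φ(-z))`, which is `z sinh z / (4π³)`. -/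
def tau (z : ℂ) : ℂ := (jost z * jost (-z))⁻¹

/-- The normalization constant of the minimal form factor. -/
def minConst : ℝ :=
  (Real.Gamma (1 / 4))⁻¹ *
    Real.exp (-∫ t in Set.Ioi (0 : ℝ),
      Real.exp (t / 2) *
        (Real.sinh (t / 2) / (t * Real.sinh t ^ 2) - (1 / 2) / (t * Real.sinh t)))

/-- The integral representation of the minimal form factor; the integral converges absolutely
for `0 < Im θ < 2π`. -/
def minFFStrip (θ : ℂ) : ℂ :=
  minConst * exp (∫ t in Set.Ioi (0 : ℝ),
    ((1 / (t * Real.sinh t ^ 2) * Real.exp (t / 2) * Real.sinh (t / 2) : ℝ) : ℂ) *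
      (1 - cosh (t * (1 - θ / (I * Real.pi)))))

/-- The minimal form factor `F(θ)` on `-π < Im θ < 2π`: the integral representation for
`0 < Im θ`, and its analytic continuation through `φ(θ) F(θ) F(θ + iπ) = 1` below. -/
def minFF (θ : ℂ) : ℂ :=
  if 0 < θ.im then minFFStrip θ else (jost θ * minFFStrip (θ + I * Real.pi))⁻¹

/-! ### The off-shell Bethe ansatz co-vector -/

/-- `monodromy n θ z α r l α'` is the matrix element of the monodromy matrix
`S̃_{10}(θ₁ - z) ⋯ S̃_{n0}(θₙ - z)` with lower indices `α₁ … αₙ, r` and upper indices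
`l, α'₁ … α'ₙ`. -/
def monodromy : (n : ℕ) → (Fin n → ℂ) → ℂ → (Fin n → Fin 2) → Fin 2 → Fin 2 →
    (Fin n → Fin 2) → ℂ
  | 0, _, _, _, r, l, _ => if r = l then 1 else 0
  | n + 1, θ, z, α, r, l, α' =>
      ∑ h : Fin 2, Stilde (θ 0 - z) (α 0) h l (α' 0) *
        monodromy n (Fin.tail θ) z (Fin.tail α) r h (Fin.tail α')

/-- The operator `C̃(θ, z)`: the block of the monodromy matrix with lower auxiliary index `1`
and upper auxiliary index `2`. -/
def opC {n : ℕ} (θ : Fin n → ℂ) (z : ℂ) (α α' : Fin n → Fin 2) : ℂ :=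
  monodromy n θ z α 0 1 α'

/-- The Bethe ansatz co-vector `Ψ̃(θ, z) = Ω C̃(θ, z_m) ⋯ C̃(θ, z_1)`, where the pseudo-vacuum `Ω`
has all indices equal to `1`. -/
def betheCovector {n : ℕ} (θ : Fin n → ℂ) : (m : ℕ) → (Fin m → ℂ) → (Fin n → Fin 2) → ℂ
  | 0, _, α => if ∀ i, α i = 0 then 1 else 0
  | m + 1, z, α =>
      ∑ α' : Fin n → Fin 2, betheCovector θ m (Fin.tail z) α' * opC θ (z 0) α α'

/-- `h̃(θ, z) = ∏_{i,j} φ̃(θ_i - z_j) ∏_{i<j} τ(z_i - z_j)`. -/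
def hTilde {n m : ℕ} (θ : Fin n → ℂ) (z : Fin m → ℂ) : ℂ :=
  (∏ i, ∏ j, jostT (θ i - z j)) * ∏ i, ∏ j ∈ Finset.Ioi i, tau (z i - z j)

/-! ### The contour and the K-function -/

/-- The contour attached to `(θ, y, r)` consists of the line `Im z = y`, from left to right, and
of the circles of radius `r` about the `θ_i`, clockwise. It is admissible if the line runs above
all `θ_i - 2πi` and below all `θ_i - iπ` and each closed disk about `θ_i` contains no other point
`θ_j + iπk`, `k ∈ ℤ`. (All singularities of the integrand in `z` lie at such points.) Admissible
`y, r` exist exactly if the `θ_i` are distinct and `|Im (θ_i - θ_j)| < π`. -/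
def IsContour {n : ℕ} (θ : Fin n → ℂ) (y r : ℝ) : Prop :=
  0 < r ∧ (∀ i, (θ i).im - 2 * Real.pi < y ∧ y < (θ i).im - Real.pi) ∧
    ∀ i j, ∀ k : ℤ, (i = j ∧ k = 0) ∨ r < ‖θ i - θ j - k * (I * Real.pi)‖

/-- The integral of `f` over the contour attached to `(θ, y, r)`. -/
def contourInt {n : ℕ} (θ : Fin n → ℂ) (y r : ℝ) (f : ℂ → ℂ) : ℂ :=
  (∫ x : ℝ, f (x + y * I)) - ∑ i, ∮ z in C(θ i, r), f z

/-- `R = ∮ dz φ̃(θ - z)` over a small clockwise circle about `θ` (here `θ = 0`; the value does not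
depend on `θ`, nor on the radius below `π`). -/
def constR : ℂ := -∮ z in C(0, 1), jostT (0 - z)

/-- The iterated integral `∫ dz₁/R ⋯ ∫ dz_m/R f(z₁, …, z_m)`, each over the same contour. -/
def iterInt {n : ℕ} (θ : Fin n → ℂ) (y r : ℝ) : (m : ℕ) → ((Fin m → ℂ) → ℂ) → ℂ
  | 0, f => f Fin.elim0
  | m + 1, f =>
      contourInt θ y r (fun z₁ => iterInt θ y r m (fun z => f (Fin.cons z₁ z)) / constR)

/-- The off-shell Bethe ansatz integral of a weight `q(z)`. -/
def betheInt {n m : ℕ} (θ : Fin n → ℂ) (y r : ℝ) (q : (Fin m → ℂ) → ℂ) (α : Fin n → Fin 2) : ℂ :=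
  iterInt θ y r m (fun z => hTilde θ z * q z * betheCovector θ m z α)

/-- The K-function with p-function `p` and normalization constant `N`. -/
def funK {n m : ℕ} (N : ℂ) (p : (Fin n → ℂ) → (Fin m → ℂ) → ℂ) (y r : ℝ) (θ : Fin n → ℂ)
    (α : Fin n → Fin 2) : ℂ :=
  N / (m.factorial : ℂ) * betheInt θ y r (p θ) α

/-- The form factor ansatz: the K-function times the product of minimal form factors. -/
def ansatz {n m : ℕ} (N : ℂ) (p : (Fin n → ℂ) → (Fin m → ℂ) → ℂ) (y r : ℝ) (θ : Fin n → ℂ)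
    (α : Fin n → Fin 2) : ℂ :=
  funK N p y r θ α * ∏ i, ∏ j ∈ Finset.Ioi i, minFF (θ i - θ j)

/-! ### Co-vector valued functions and the form factor equations -/

/-- Functions of `n` rapidities with values in co-vectors on `(ℂ²)^{⊗ n}`. -/
abbrev CoVecFun (n : ℕ) : Type := (Fin n → ℂ) → (Fin n → Fin 2) → ℂ

/-- The set of generic rapidities: no difference `θ_i - θ_j`, `i ≠ j`, lies in `iπℤ`. -/
def generic (n : ℕ) : Set (Fin n → ℂ) :=
  {θ | ∀ i j, i ≠ j → ∀ k : ℤ, θ i - θ j ≠ k * (I * Real.pi)}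

/-- A function of several complex variables is meromorphic at `x` if near `x` it is a quotient
of analytic functions, the denominator not vanishing identically. -/
def MeroAt {n : ℕ} (f : (Fin n → ℂ) → ℂ) (x : Fin n → ℂ) : Prop :=
  ∃ g h : (Fin n → ℂ) → ℂ, AnalyticAt ℂ g x ∧ AnalyticAt ℂ h x ∧
    (∃ᶠ y in 𝓝 x, h y ≠ 0) ∧ ∀ᶠ y in 𝓝 x, h y ≠ 0 → f y = g y / h y

/-- `F` is the meromorphic function on `ℂⁿ` given by the ansatz: it is meromorphic on `ℂⁿ`,
analytic at generic rapidities, and equal to the ansatz wherever the contour consists of a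
horizontal line and circles. -/
def GivenByAnsatz {n m : ℕ} (N : ℂ) (p : (Fin n → ℂ) → (Fin m → ℂ) → ℂ) (F : CoVecFun n) : Prop :=
  (∀ α x, MeroAt (fun θ => F θ α) x) ∧
  (∀ α, AnalyticOnNhd ℂ (fun θ => F θ α) (generic n)) ∧
  ∀ θ y r, IsContour θ y r → ∀ α, F θ α = ansatz N p y r θ α

/-- Watson's equations: for `j = i + 1`,
`F_{…ij…}(…, θ_i, θ_j, …) = F_{…ji…}(…, θ_j, θ_i, …) S_{ij}(θ_i - θ_j)`. -/
def Watson {n : ℕ} (F : CoVecFun n) : Prop :=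
  ∀ i j : Fin n, (i : ℕ) + 1 = j → ∀ θ ∈ generic n, ∀ α : Fin n → Fin 2,
    F θ α = ∑ δ : Fin 2, ∑ γ : Fin 2,
      F (θ ∘ Equiv.swap i j) (Function.update (Function.update α i δ) j γ) *
        Smat (θ i - θ j) (α i) (α j) δ γ

/-- The crossing equation:
`F_{1…n}(θ₁ + iπ, θ₂, …, θₙ) σ C^{1̄1} = F_{2…n1}(θ₂, …, θₙ, θ₁ - iπ) C^{11̄}`. -/
def Crossing : (n : ℕ) → CoVecFun n → ℂ → Prop
  | 0, _, _ => True
  | n + 1, F, σ =>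
      ∀ (θ₁ : ℂ) (θ : Fin n → ℂ), (Fin.cons θ₁ θ : Fin (n + 1) → ℂ) ∈ generic (n + 1) →
        ∀ (β : Fin 2) (α : Fin n → Fin 2),
          ∑ α₁ : Fin 2, F (Fin.cons (θ₁ + I * Real.pi) θ) (Fin.cons α₁ α) * σ * epsUp β α₁ =
          ∑ α₁ : Fin 2, F (Fin.snoc (α := fun _ => ℂ) θ (θ₁ - I * Real.pi))
            (Fin.snoc (α := fun _ => Fin 2) α α₁) * epsUp α₁ β

/-- `scatter n θ₀ θ a α δ b` is the matrix element of `S_{0n}(θ₀ - θₙ) ⋯ S_{01}(θ₀ - θ₁)` with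
lower indices `a, α₁ … αₙ` and upper indices `δ₁ … δₙ, b`: the particle `0` starts on the left
with type `a` and ends on the right with type `b`. -/
def scatter : (n : ℕ) → ℂ → (Fin n → ℂ) → Fin 2 → (Fin n → Fin 2) → (Fin n → Fin 2) →
    Fin 2 → ℂ
  | 0, _, _, a, _, _, b => if a = b then 1 else 0
  | n + 1, θ₀, θ, a, α, δ, b =>
      ∑ c : Fin 2, Smat (θ₀ - θ 0) a (α 0) (δ 0) c *
        scatter n θ₀ (Fin.tail θ) c (Fin.tail α) (Fin.tail δ) b

/-- The annihilation pole equation: with `G` the form factor with two particles less,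
`Res_{θ₁₂ = iπ} F_{1…n}(θ) = 2i C_{12} G_{3…n}(θ₃, …, θₙ) (1 - σ S_{2n} ⋯ S_{23})`. -/
def Annihilation {n : ℕ} (F : CoVecFun (n + 2)) (G : CoVecFun n) (σ : ℂ) : Prop :=
  ∀ (θ₂ : ℂ) (θ : Fin n → ℂ), (Fin.cons θ₂ θ : Fin (n + 1) → ℂ) ∈ generic (n + 1) →
    ∀ (α₁ α₂ : Fin 2) (α : Fin n → Fin 2),
      Tendsto
        (fun θ₁ : ℂ => (θ₁ - θ₂ - I * Real.pi) *
          F (Fin.cons θ₁ (Fin.cons θ₂ θ : Fin (n + 1) → ℂ))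
            (Fin.cons α₁ (Fin.cons α₂ α : Fin (n + 1) → Fin 2)))
        (𝓝[≠] (θ₂ + I * Real.pi))
        (𝓝 (2 * I * (epsLow α₁ α₂ * G θ α -
          σ * ∑ b : Fin 2, ∑ δ : Fin n → Fin 2,
            epsLow α₁ b * G θ δ * scatter n θ₂ θ α₂ α δ b)))

/-- The annihilation pole equation for the form factor with the lowest number of particles, for which there is no
form factor with two particles less: the right-hand side is zero. -/
def AnnihilationLowest : (n : ℕ) → CoVecFun n → ℂ → Prop
  | 0, _, _ => True
  | 1, _, _ => True
  | _ + 2, F, σ => Annihilation F (fun _ _ => 0) σ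

/-! ### The equations for the p-function -/

/-- `p` is entire, and it grows in `z` at most as fast as is compatible with the absolute
convergence of the integral, locally uniformly in `θ`. (On the contour, for `n = w + 2m`, the other
factors of the integrand are
`O(∏ⱼ (1 + |Re zⱼ|)^{-2 - w/2} exp(-(1 + w/2) |Re zⱼ|))`.) -/
def PRegular {n m : ℕ} (w : ℕ) (p : (Fin n → ℂ) → (Fin m → ℂ) → ℂ) : Prop :=
  Differentiable ℂ (fun x : (Fin n → ℂ) × (Fin m → ℂ) => p x.1 x.2) ∧
  ∀ K : Set (Fin n → ℂ), IsCompact K → ∃ B : ℝ, ∀ θ ∈ K, ∀ z : Fin m → ℂ,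
    ‖p θ z‖ ≤ B * Real.exp ((1 + (w : ℝ) / 2) * ∑ j, |(z j).re|)

/-- Symmetry of the p-function in the `θ_i` and in the `z_j`. -/
def PSymm {n m : ℕ} (p : (Fin n → ℂ) → (Fin m → ℂ) → ℂ) : Prop :=
  (∀ (s : Equiv.Perm (Fin n)) θ z, p (θ ∘ s) z = p θ z) ∧
  (∀ (s : Equiv.Perm (Fin m)) θ z, p θ (z ∘ s) = p θ z)

/-- Behaviour of the p-function under shifts by `2πi` (for every variable, which by symmetry is the
same as for the first one); `(-1) ^ (m + 1)` is `(-1) ^ (m - 1)`. -/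
def PShift {n m : ℕ} (p : (Fin n → ℂ) → (Fin m → ℂ) → ℂ) (σ : ℂ) : Prop :=
  (∀ i θ z, σ * p (Function.update θ i (θ i + 2 * Real.pi * I)) z = (-1) ^ (m + 1) * p θ z) ∧
  (∀ j θ z, p θ (Function.update z j (z j + 2 * Real.pi * I)) = (-1) ^ n * p θ z)

/-- The additional terms `p̃` that are allowed in the recursion for the p-function: either the term does not
contribute to the Bethe ansatz integral, or (for `n = 2m > 0`) it does not depend on `z`. -/
def Negligible {n m : ℕ} (θ : Fin n → ℂ) (q : (Fin m → ℂ) → ℂ) : Prop :=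
  (n = 2 * m ∧ 0 < m ∧ ∃ c : ℂ, ∀ z, q z = c) ∨
  (∀ y r, IsContour θ y r → ∀ α, betheInt θ y r q α = 0)

/-- The recursion for `p = p_{n+2,m+1}` and `p' = p_{n,m}`: for `θ₁₂ = iπ`,
`p|_{z₁=θ₁} = σ p' + p̃` and `(-1)^m σ p|_{z₁=θ₂} = σ p' + p̃`, where the additional terms `p̃` in
the two equations may be different. -/
def PRecursion {n m : ℕ} (p : (Fin (n + 2) → ℂ) → (Fin (m + 1) → ℂ) → ℂ)
    (p' : (Fin n → ℂ) → (Fin m → ℂ) → ℂ) (σ : ℂ) : Prop :=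
  ∀ (θ₁ θ₂ : ℂ) (θ : Fin n → ℂ), θ₁ - θ₂ = I * Real.pi →
    ∃ q₁ q₂ : (Fin m → ℂ) → ℂ, Negligible θ q₁ ∧ Negligible θ q₂ ∧
      ∀ z : Fin m → ℂ,
        p (Fin.cons θ₁ (Fin.cons θ₂ θ : Fin (n + 1) → ℂ)) (Fin.cons θ₁ z) =
          σ * p' θ z + q₁ z ∧
        (-1) ^ m * σ * p (Fin.cons θ₁ (Fin.cons θ₂ θ : Fin (n + 1) → ℂ)) (Fin.cons θ₂ z) =
          σ * p' θ z + q₂ z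

end

end SU2

namespace SU2
noncomputable section
open Complex Filter Topology
open scoped Real
open MeasureTheory Set
open Finset (prod_mul_distrib prod_congr sum_congr mul_sum sum_add_distrib single_le_sum
  prod_le_prod prod_insert sum_insert prod_eq_zero sum_eq_zero prod_ne_zero_iff sum_range_succ
  sum_sub_distrib)
open Fin (tail prod_univ_succ cons_zero cons_succ prod_const cons_self_tail tail_cons
  sum_univ_two)
open Metric (ball closedBall mem_ball_self)
open Real (pi_pos norm_eq_abs sinh_pos_iff)
open Submodule (smul_mem subset_span span_induction)
local notation "iπ" => (I * (Real.pi : ℂ))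
local notation:62 a:63 "∷" v:62 => (Fin.cons a v : Fin (_ + 1) → _)
local notation:62 v:62 "∷ʳ" a:63 => Fin.snoc (α := fun _ => _) v a

/-! ### Functions of several complex variables -/

/-- Cauchy's integral formula on a polydisc. -/
theorem torusIntegral_cauchy {n : ℕ} : ∀ (f : (Fin n → ℂ) → ℂ) (c w : Fin n → ℂ) {R : ℝ}, 0 < R →
    w ∈ ball c R → ContinuousOn f (closedBall c R) →
    (∀ z ∈ closedBall c R, ∀ i,
      DifferentiableAt ℂ (fun t => f (Function.update z i t)) (z i)) →
    torusIntegral (fun ζ => (∏ i, (ζ i - w i)⁻¹) * f ζ) c (fun _ => R) =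
      (2 * π * I) ^ n * f w := by
  induction n with
  | zero =>
    intro f c w R _ _ _ _
    have : c = w := Subsingleton.elim _ _
    simp [this]
  | succ n ih =>
    intro f c w R hR hw hf hd
    have hmem : ∀ θ, torusMap c (fun _ => R) θ ∈ closedBall c R := by
      intro θ
      rw [mem_closedBall_iff_norm, pi_norm_le_iff_of_nonneg hR.le]
      intro i
      simp [torusMap, abs_of_pos hR]
    have hwi : ∀ i, ‖w i - c i‖ < R := by
      rw [mem_ball_iff_norm, pi_norm_lt_iff hR] at hw
      exact hw
    have hne : ∀ i (x : ℂ), ‖x - c i‖ = R → x - w i ≠ 0 := by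
      intro i x hx h
      rw [sub_eq_zero] at h
      rw [h] at hx
      exact (hwi i).ne hx
    have hInt : TorusIntegrable (fun ζ => (∏ i, (ζ i - w i)⁻¹) * f ζ) c (fun _ => R) := by
      refine ContinuousOn.integrableOn_compact isCompact_Icc ?_
      have hcm : Continuous (torusMap c (fun _ => R)) := by
        unfold torusMap; fun_prop
      refine ContinuousOn.mul ?_ (hf.comp hcm.continuousOn fun θ _ => hmem θ)
      refine continuousOn_finsetProd _ fun i _ => ContinuousOn.inv₀ ?_ ?_
      · exact ((continuous_apply i).comp hcm |>.sub continuous_const).continuousOn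
      · intro θ _
        refine hne i _ ?_
        simp [torusMap, abs_of_pos hR]
    rw [torusIntegral_succ hInt]
    have hin : ∀ x ∈ closedBall (c 0) R, ∀ y ∈ closedBall (c ∘ Fin.succ) R,
        (x ∷ y) ∈ closedBall c R := by
      intro x hx y hy
      rw [mem_closedBall_iff_norm] at hx hy ⊢
      rw [pi_norm_le_iff_of_nonneg hR.le] at hy ⊢
      intro i
      refine Fin.cases ?_ (fun i => ?_) i
      · simpa using hx
      · simpa using hy i
    have hwt : w ∘ Fin.succ ∈ ball (c ∘ Fin.succ) R := by
      rw [mem_ball_iff_norm, pi_norm_lt_iff hR]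
      intro i; exact hwi i.succ
    have key : ∀ x ∈ Metric.sphere (c 0) R,
        (torusIntegral (fun y => (∏ i, ((x ∷ y) i - w i)⁻¹) *
          f (x ∷ y)) (c ∘ Fin.succ) ((fun _ => R) ∘ Fin.succ)) =
        (x - w 0)⁻¹ * ((2 * π * I) ^ n * f (x ∷ (w ∘ Fin.succ))) := by
      intro x hx
      have hx' := Metric.sphere_subset_closedBall hx
      rw [← ih (fun y => f (x ∷ y)) (c ∘ Fin.succ) (w ∘ Fin.succ) hR hwt,
        ← torusIntegral_const_mul]
      · congr 1
        ext y
        simp only [prod_univ_succ, cons_zero, cons_succ, Function.comp_apply]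
        ring
      · refine hf.comp (Continuous.continuousOn ?_) fun y hy => hin x hx' y hy
        exact Continuous.finCons continuous_const continuous_id
      · intro y hy i
        have := hd _ (hin x hx' y hy) i.succ
        simpa [Fin.cons_update] using this
    rw [circleIntegral.integral_congr hR.le key]
    have hdf : DifferentiableOn ℂ (fun x => (2 * π * I) ^ n * f (x ∷ (w ∘ Fin.succ)))
        (closedBall (c 0) R) := by
      intro x hx
      have := hd _ (hin x hx _ (Metric.ball_subset_closedBall hwt)) 0
      simp only [Fin.update_cons_zero, cons_zero] at this
      exact (this.const_mul _).differentiableWithinAt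
    have h0 : w 0 ∈ ball (c 0) R := by
      rw [mem_ball_iff_norm]; exact hwi 0
    have := hdf.circleIntegral_sub_inv_smul h0
    simp only [smul_eq_mul] at this
    rw [this]
    have hcons : (w 0 ∷ (w ∘ Fin.succ)) = w := by
      ext i; refine Fin.cases ?_ (fun i => ?_) i <;> simp
    rw [hcons]; ring

/-- A continuous function that is holomorphic in each variable is analytic. -/
theorem analyticAt_of_separately {n : ℕ} {f : (Fin n → ℂ) → ℂ} {c : Fin n → ℂ} {R : ℝ}
    (hR : 0 < R) (hf : ContinuousOn f (closedBall c R))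
    (hd : ∀ z ∈ closedBall c R, ∀ i,
      DifferentiableAt ℂ (fun t => f (Function.update z i t)) (z i)) : AnalyticAt ℂ f c := by
  set T : Set (Fin n → ℝ) := Icc (0 : Fin n → ℝ) fun _ => 2 * π with hT
  have : CompactSpace T := isCompact_iff_compactSpace.1 isCompact_Icc
  have hcm : Continuous (torusMap c (fun _ => R)) := by
    unfold torusMap; fun_prop
  have hmem : ∀ θ, torusMap c (fun _ => R) θ ∈ closedBall c R := by
    intro θ
    rw [mem_closedBall_iff_norm, pi_norm_le_iff_of_nonneg hR.le]
    intro i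
    simp [torusMap, abs_of_pos hR]
  let ζ : Fin n → C(T, ℂ) := fun i =>
    ⟨fun θ => torusMap c (fun _ => R) θ i, by fun_prop⟩
  let h : C(T, ℂ) := ⟨fun θ => (∏ i, (R : ℂ) * exp (θ.1 i * I) * I) *
    f (torusMap c (fun _ => R) θ), by
      refine Continuous.mul (continuous_finsetProd _ fun i _ => ?_) ?_
      · have h1 : Continuous fun θ : T => θ.1 i := (continuous_apply i).comp continuous_subtype_val
        exact (continuous_const.mul (continuous_exp.comp
          ((continuous_ofReal.comp h1).mul continuous_const))).mul continuous_const
      · exact hf.comp_continuous (by fun_prop) fun θ => hmem θ⟩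
  let μ : Measure T := Measure.comap Subtype.val volume
  have hfin : IsFiniteMeasure μ := by
    constructor
    rw [comap_subtype_coe_apply measurableSet_Icc, image_univ, Subtype.range_coe]
    exact measure_Icc_lt_top
  have hInt : ∀ g : C(T, ℂ), Integrable (fun θ : T => g θ) μ := fun g =>
    (BoundedContinuousFunction.mkOfCompact g).integrable _
  let L₀ : C(T, ℂ) →ₗ[ℂ] ℂ :=
    { toFun := fun g => ∫ θ : T, (h * g) θ ∂μ
      map_add' := fun g g' => by
        rw [← integral_add (hInt _) (hInt _)]
        simp [mul_add]
      map_smul' := fun a g => by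
        rw [RingHom.id_apply, ← integral_smul]
        congr 1; ext θ; simp }
  let L : C(T, ℂ) →L[ℂ] ℂ := L₀.mkContinuous (‖h‖ * μ.real univ) fun g => by
    have := norm_integral_le_of_norm_le_const (μ := μ) (f := fun θ => (h * g) θ)
      (C := ‖h‖ * ‖g‖) (Eventually.of_forall fun θ => by
        simpa using mul_le_mul (h.norm_coe_le_norm θ) (g.norm_coe_le_norm θ) (norm_nonneg _)
          (norm_nonneg _))
    calc ‖L₀ g‖ ≤ _ := this
      _ = _ := by ring
  let Φ : (Fin n → ℂ) → C(T, ℂ) := fun w =>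
    ∏ i, Ring.inverse (ζ i - algebraMap ℂ C(T, ℂ) (w i))
  have hunit : ∀ w ∈ ball c R, ∀ i, IsUnit (ζ i - algebraMap ℂ C(T, ℂ) (w i)) := by
    intro w hw i
    rw [ContinuousMap.isUnit_iff_forall_ne_zero]
    intro θ h0
    rw [mem_ball_iff_norm, pi_norm_lt_iff hR] at hw
    have h1 := hw i
    have h2 : torusMap c (fun _ => R) θ i = w i := by
      simpa [ζ, sub_eq_zero, Algebra.algebraMap_eq_smul_one] using h0
    rw [Pi.sub_apply, ← h2] at h1
    simp [torusMap, abs_of_pos hR] at h1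
  have hΦ : AnalyticAt ℂ Φ c := by
    refine Finset.analyticAt_fun_prod _ fun i _ => ?_
    have hu := hunit c (mem_ball_self hR) i
    have h1 := analyticAt_inverse (𝕜 := ℂ) hu.unit
    rw [IsUnit.unit_spec] at h1
    have h2 : AnalyticAt ℂ (fun w : Fin n → ℂ => ζ i - algebraMap ℂ C(T, ℂ) (w i)) c := by
      refine analyticAt_const.sub ?_
      have := ((algebraMapCLM ℂ C(T, ℂ)).comp
        (ContinuousLinearMap.proj (R := ℂ) (φ := fun _ : Fin n => ℂ) i)).analyticAt c
      exact this
    exact h1.comp_of_eq h2 rfl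
  have hL : AnalyticAt ℂ (fun w => ((2 * π * I : ℂ) ^ n)⁻¹ * L (Φ w)) c :=
    analyticAt_const.mul ((L.analyticAt _).comp hΦ)
  refine hL.congr ?_
  filter_upwards [Metric.ball_mem_nhds c hR] with w hw
  have h1 := torusIntegral_cauchy f c w hR hw hf hd
  have h2 : L (Φ w) = torusIntegral (fun ζ => (∏ i, (ζ i - w i)⁻¹) * f ζ) c (fun _ => R) := by
    rw [torusIntegral, ← integral_subtype_comap measurableSet_Icc]
    change ∫ θ : T, (h * Φ w) θ ∂μ = _
    refine integral_congr_ae (Eventually.of_forall fun θ => ?_)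
    have h3 : (Φ w) θ = ∏ i, (torusMap c (fun _ => R) θ i - w i)⁻¹ := by
      simp only [Φ, ContinuousMap.prod_apply]
      refine prod_congr rfl fun i _ => ?_
      have h4 := Ring.inverse_mul_cancel _ (hunit w hw i)
      have h5 := congrArg (fun g : C(T, ℂ) => g θ) h4
      exact eq_inv_of_mul_eq_one_left h5
    simp only [ContinuousMap.mul_apply, h3, h, ContinuousMap.coe_mk, smul_eq_mul]
    ring
  rw [h2, h1, ← mul_assoc, inv_mul_cancel₀, one_mul]
  have : (π : ℂ) ≠ 0 := by exact_mod_cast Real.pi_ne_zero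
  exact pow_ne_zero _ (by simp [this])

theorem analyticAt_of_differentiable {n : ℕ} {f : (Fin n → ℂ) → ℂ} (hf : Differentiable ℂ f)
    (c : Fin n → ℂ) : AnalyticAt ℂ f c := by
  refine analyticAt_of_separately one_pos hf.continuous.continuousOn fun z _ i => ?_
  refine DifferentiableAt.comp (z i) (hf _) ?_
  exact (hasDerivAt_update z i (z i)).differentiableAt

/-- A dominated integral of functions that are holomorphic in a parameter is holomorphic. -/
theorem differentiableAt_integral_of_dominated {α : Type*} [MeasurableSpace α] {μ : Measure α}
    {F : ℂ → α → ℂ} {c : ℂ} {R : ℝ} (hR : 0 < R) {bound : α → ℝ}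
    (hm : ∀ t ∈ ball c R, AEStronglyMeasurable (F t) μ)
    (hd : ∀ x, DifferentiableOn ℂ (fun t => F t x) (ball c R))
    (hb : ∀ t ∈ ball c R, ∀ x, ‖F t x‖ ≤ bound x) (hbi : Integrable bound μ) :
    DifferentiableAt ℂ (fun t => ∫ x, F t x ∂μ) c := by
  have hR2 : 0 < R / 2 := by linarith
  have hderiv : ∀ t ∈ ball c (R / 2), ∀ x,
      HasDerivAt (fun t => F t x) (deriv (fun t => F t x) t) t := fun t ht x =>
    ((hd x).differentiableAt (Metric.isOpen_ball.mem_nhds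
      (Metric.ball_subset_ball (by linarith) ht))).hasDerivAt
  have hbd : ∀ t ∈ ball c (R / 2), ∀ x, ‖deriv (fun t => F t x) t‖ ≤ bound x / (R / 4) := by
    intro t ht x
    refine Complex.norm_deriv_le_of_forall_mem_sphere_norm_le (by linarith) ?_ ?_
    · refine DifferentiableOn.diffContOnCl ((hd x).mono ?_)
      rw [closure_ball _ (by linarith)]
      intro s hs
      rw [Metric.mem_closedBall] at hs
      rw [Metric.mem_ball] at ht ⊢
      linarith [dist_triangle s t c]
    · intro s hs
      refine hb s ?_ x
      rw [Metric.mem_sphere] at hs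
      rw [Metric.mem_ball] at ht ⊢
      linarith [dist_triangle s t c]
  have hc : c ∈ ball c R := mem_ball_self hR
  have hmd : AEStronglyMeasurable (fun x => deriv (fun t => F t x) c) μ := by
    let u : ℕ → ℂ := fun k => c + ((R / 2 * ((k : ℝ) + 1)⁻¹ : ℝ) : ℂ)
    have hu0 : ∀ k : ℕ, (R / 2 * ((k : ℝ) + 1)⁻¹ : ℝ) ≠ 0 := fun k => by positivity
    have hu : ∀ k, u k ∈ ball c R := by
      intro k
      have h1 : ((k : ℝ) + 1)⁻¹ ≤ 1 := inv_le_one_of_one_le₀ (by linarith [k.cast_nonneg (α := ℝ)])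
      have h0 : 0 < ((k : ℝ) + 1)⁻¹ := by positivity
      simp only [u, mem_ball_iff_norm, add_sub_cancel_left, norm_real, norm_eq_abs]
      rw [abs_of_pos (by positivity)]
      nlinarith
    have hlim : Tendsto u atTop (𝓝[≠] c) := by
      rw [tendsto_nhdsWithin_iff]
      constructor
      · have h1 : Tendsto (fun k : ℕ => (R / 2 * ((k : ℝ) + 1)⁻¹ : ℝ)) atTop (𝓝 (R / 2 * 0)) := by
          refine Tendsto.const_mul _ ?_
          simpa [one_div] using tendsto_one_div_add_atTop_nhds_zero_nat (𝕜 := ℝ)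
        have h2 := (continuous_ofReal.tendsto _).comp h1
        simpa [u] using h2.const_add c
      · refine Eventually.of_forall fun k => ?_
        simp only [u, mem_compl_iff, mem_singleton_iff]
        intro h
        have : ((R / 2 * ((k : ℝ) + 1)⁻¹ : ℝ) : ℂ) = 0 := by linear_combination h
        exact hu0 k (by exact_mod_cast this)
    refine aestronglyMeasurable_of_tendsto_ae atTop
      (f := fun k x => slope (fun t => F t x) c (u k)) (fun k => ?_) (Eventually.of_forall fun x => ?_)
    · simp only [slope_def_module]
      exact AEStronglyMeasurable.const_smul ((hm _ (hu k)).sub (hm _ hc)) (u k - c)⁻¹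
    · have h1 := (hderiv c (mem_ball_self hR2) x).tendsto_slope
      exact h1.comp hlim
  have := hasDerivAt_integral_of_dominated_loc_of_deriv_le (μ := μ) (F := F)
    (F' := fun t x => deriv (fun t => F t x) t) (x₀ := c) (s := ball c (R / 2))
    (bound := fun x => bound x / (R / 4)) (Metric.ball_mem_nhds _ hR2)
    (by filter_upwards [Metric.ball_mem_nhds c hR] with t ht using hm t ht)
    (hbi.mono' (hm c hc) (Eventually.of_forall fun x => hb c hc x)) hmd
    (Eventually.of_forall fun x t ht => hbd t ht x) (hbi.div_const _)
    (Eventually.of_forall fun x t ht => hderiv t ht x)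
  exact this.2.differentiableAt

/-- A dominated integral of functions that are analytic in several parameters is analytic. -/
theorem analyticAt_integral_of_dominated {n : ℕ} {α : Type*} [MeasurableSpace α] {μ : Measure α}
    {F : (Fin n → ℂ) → α → ℂ} {c : Fin n → ℂ} {R : ℝ} (hR : 0 < R) {bound : α → ℝ}
    (hm : ∀ t ∈ ball c R, AEStronglyMeasurable (F t) μ)
    (hd : ∀ x, DifferentiableOn ℂ (fun t => F t x) (ball c R))
    (hb : ∀ t ∈ ball c R, ∀ x, ‖F t x‖ ≤ bound x) (hbi : Integrable bound μ) :
    AnalyticAt ℂ (fun t => ∫ x, F t x ∂μ) c := by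
  have hsub : ∀ z ∈ closedBall c (R / 2), ball z (R / 2) ⊆ ball c R := by
    intro z hz s hs
    rw [Metric.mem_closedBall] at hz
    rw [Metric.mem_ball] at hs ⊢
    linarith [dist_triangle s z c]
  refine analyticAt_of_separately (R := R / 2) (by linarith) ?_ ?_
  · intro z hz
    refine ContinuousAt.continuousWithinAt ?_
    have hz' : ball c R ∈ 𝓝 z :=
      mem_of_superset (Metric.ball_mem_nhds z (by linarith)) (hsub z hz)
    refine continuousAt_of_dominated (bound := bound) ?_ ?_ hbi ?_
    · filter_upwards [hz'] with t ht using hm t ht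
    · filter_upwards [hz'] with t ht using Eventually.of_forall fun x => hb t ht x
    · exact Eventually.of_forall fun x => ((hd x).differentiableAt hz').continuousAt
  · intro z hz i
    have hup : ∀ t ∈ ball (z i) (R / 2), Function.update z i t ∈ ball c R := by
      intro t ht
      refine hsub z hz ?_
      rw [Metric.mem_ball, dist_pi_lt_iff (by linarith)]
      intro j
      by_cases hj : j = i
      · subst hj; simpa using ht
      · simp [hj]; linarith
    refine differentiableAt_integral_of_dominated (R := R / 2) (by linarith) (bound := bound)
      (fun t ht => hm _ (hup t ht)) (fun x => ?_) (fun t ht x => hb _ (hup t ht) x) hbi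
    refine (hd x).comp ?_ fun t ht => hup t ht
    exact fun t _ => (hasDerivAt_update z i t).differentiableAt.differentiableWithinAt

/-! ### Generic rapidities and meromorphic functions -/

theorem ipi_ne_zero : iπ ≠ 0 :=
  mul_ne_zero I_ne_zero (by exact_mod_cast Real.pi_ne_zero)

theorem sinh_eq_zero_iff {z : ℂ} : sinh z = 0 ↔ ∃ k : ℤ, z = k * iπ := by
  have h : sinh z = 0 ↔ sin (z * I) = 0 := by
    rw [sin_mul_I]; simp
  rw [h, sin_eq_zero_iff]
  constructor
  · rintro ⟨k, hk⟩
    refine ⟨-k, ?_⟩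
    have : z = -(z * I) * I := by linear_combination z * I_mul_I
    rw [this, hk]; push_cast; ring
  · rintro ⟨k, hk⟩
    refine ⟨-k, ?_⟩
    rw [hk]; push_cast
    linear_combination (k * π : ℂ) * I_mul_I

/-- A function whose zeros are the non-generic rapidities. -/
def disc {n : ℕ} (θ : Fin n → ℂ) : ℂ := ∏ i, ∏ j ∈ Finset.univ.erase i, sinh (θ i - θ j)

theorem mem_generic_iff {n : ℕ} {θ : Fin n → ℂ} : θ ∈ generic n ↔ disc θ ≠ 0 := by
  simp only [generic, disc, mem_ofPred_eq, prod_ne_zero_iff, Finset.mem_univ, true_imp_iff,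
    Finset.mem_erase, and_true, ne_eq, sinh_eq_zero_iff, not_exists]
  exact ⟨fun h i j hj k => h i j (Ne.symm hj) k, fun h i j hj k => h i j (Ne.symm hj) k⟩

theorem differentiable_disc {n : ℕ} : Differentiable ℂ (disc (n := n)) := by
  unfold disc; fun_prop

theorem isOpen_generic (n : ℕ) : IsOpen (generic n) := by
  have : generic n = disc ⁻¹' {0}ᶜ := by ext θ; simp [mem_generic_iff]
  rw [this]
  exact isOpen_compl_singleton.preimage differentiable_disc.continuous

theorem countable_line_notMem_generic {n : ℕ} (x : Fin n → ℂ) {y : Fin n → ℂ}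
    (hy : y ∈ generic n) : {t : ℂ | x + t • (y - x) ∉ generic n}.Countable := by
  have hsub : {t : ℂ | x + t • (y - x) ∉ generic n} ⊆ ⋃ i : Fin n, ⋃ j : Fin n, ⋃ k : ℤ,
      {t : ℂ | i ≠ j ∧ x i - x j + t * ((y i - y j) - (x i - x j)) = k * iπ} := by
    intro t ht
    simp only [generic, mem_ofPred_eq, not_forall, not_not] at ht
    obtain ⟨i, j, hij, k, hk⟩ := ht
    simp only [mem_iUnion, mem_ofPred_eq]
    refine ⟨i, j, k, hij, ?_⟩
    simp only [Pi.add_apply, Pi.smul_apply, Pi.sub_apply, smul_eq_mul] at hk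
    linear_combination hk
  refine Countable.mono hsub (countable_iUnion fun i => countable_iUnion fun j =>
    countable_iUnion fun k => Set.Subsingleton.countable ?_)
  rintro t ⟨hij, ht⟩ s ⟨-, hs⟩
  by_cases h0 : (y i - y j) - (x i - x j) = 0
  · rw [h0, mul_zero, add_zero] at ht
    exact absurd (by linear_combination ht + h0) (hy i j hij k)
  · exact mul_right_cancel₀ h0 (by linear_combination ht - hs)

theorem natCast_mem_generic (n : ℕ) : (fun i : Fin n => ((i : ℕ) : ℂ)) ∈ generic n := by
  intro i j hij k h
  have := congrArg re h
  simp at this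
  exact hij (Fin.ext (by exact_mod_cast sub_eq_zero.1 this))

theorem dense_generic (n : ℕ) : Dense (generic n) := by
  intro x
  rw [mem_closure_iff_frequently]
  have h := (countable_line_notMem_generic x (natCast_mem_generic n)).dense_compl ℂ
  have h0 := mem_closure_iff_frequently.1 (h 0)
  have hc : Tendsto (fun t : ℂ => x + t • ((fun i : Fin n => ((i : ℕ) : ℂ)) - x)) (𝓝 0) (𝓝 x) := by
    have : Continuous (fun t : ℂ => x + t • ((fun i : Fin n => ((i : ℕ) : ℂ)) - x)) := by fun_prop
    simpa using this.tendsto 0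
  refine hc.frequently (h0.mono fun t ht => ?_)
  simpa using ht

/-- The identity theorem on the set of generic rapidities. -/
theorem eq_zero_on_generic {n : ℕ} {f : (Fin n → ℂ) → ℂ} (hf : AnalyticOnNhd ℂ f (generic n))
    {x : Fin n → ℂ} (hx : x ∈ generic n) (h0 : ∀ᶠ y in 𝓝 x, f y = 0) :
    ∀ y ∈ generic n, f y = 0 := by
  intro y hy
  set S : Set ℂ := {t : ℂ | x + t • (y - x) ∉ generic n}ᶜ with hS
  have hcount := countable_line_notMem_generic x hy
  have hpre : IsPreconnected S := by
    refine (hcount.isPathConnected_compl_of_one_lt_rank ?_).isConnected.isPreconnected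
    rw [rank_real_complex]; norm_num
  have hl : AnalyticOnNhd ℂ (fun t : ℂ => x + t • (y - x)) S := fun t _ =>
    analyticAt_const.add (analyticAt_id.smul analyticAt_const)
  have hg : AnalyticOnNhd ℂ (fun t : ℂ => f (x + t • (y - x))) S :=
    hf.comp hl fun t ht => by simpa [hS] using ht
  have hc : Tendsto (fun t : ℂ => x + t • (y - x)) (𝓝 0) (𝓝 x) := by
    have : Continuous (fun t : ℂ => x + t • (y - x)) := by fun_prop
    simpa using this.tendsto 0
  have := hg.eqOn_zero_of_preconnected_of_eventuallyEq_zero hpre (z₀ := 0) (by simpa [hS] using hx)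
    (hc.eventually h0) (show (1 : ℂ) ∈ S by simpa [hS] using hy)
  simpa using this

/-- `f` is, near `x` and at generic rapidities, a quotient of analytic functions whose denominator
has no generic zero. -/
def MeroG {n : ℕ} (f : (Fin n → ℂ) → ℂ) (x : Fin n → ℂ) : Prop :=
  ∃ g h : (Fin n → ℂ) → ℂ, AnalyticAt ℂ g x ∧ AnalyticAt ℂ h x ∧
    ∀ᶠ y in 𝓝 x, y ∈ generic n → h y ≠ 0 ∧ f y = g y / h y

namespace MeroG
variable {n : ℕ} {f f' : (Fin n → ℂ) → ℂ} {x : Fin n → ℂ}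

theorem of_analyticAt (hf : AnalyticAt ℂ f x) : MeroG f x :=
  ⟨f, fun _ => 1, hf, analyticAt_const, Eventually.of_forall fun y _ => by simp⟩

theorem add (hf : MeroG f x) (hf' : MeroG f' x) : MeroG (fun y => f y + f' y) x := by
  obtain ⟨g, h, hg, hh, e⟩ := hf
  obtain ⟨g', h', hg', hh', e'⟩ := hf'
  refine ⟨fun y => g y * h' y + h y * g' y, fun y => h y * h' y, (hg.mul hh').add (hh.mul hg'),
    hh.mul hh', ?_⟩
  filter_upwards [e, e'] with y hy hy' hgen
  obtain ⟨h1, h2⟩ := hy hgen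
  obtain ⟨h1', h2'⟩ := hy' hgen
  exact ⟨mul_ne_zero h1 h1', by rw [h2, h2', div_add_div _ _ h1 h1']⟩

theorem mul (hf : MeroG f x) (hf' : MeroG f' x) : MeroG (fun y => f y * f' y) x := by
  obtain ⟨g, h, hg, hh, e⟩ := hf
  obtain ⟨g', h', hg', hh', e'⟩ := hf'
  refine ⟨fun y => g y * g' y, fun y => h y * h' y, hg.mul hg', hh.mul hh', ?_⟩
  filter_upwards [e, e'] with y hy hy' hgen
  obtain ⟨h1, h2⟩ := hy hgen
  obtain ⟨h1', h2'⟩ := hy' hgen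
  exact ⟨mul_ne_zero h1 h1', by rw [h2, h2', div_mul_div_comm]⟩

theorem const (c : ℂ) : MeroG (fun _ : Fin n → ℂ => c) x := of_analyticAt analyticAt_const

theorem sum {ι : Type*} (s : Finset ι) {F : ι → (Fin n → ℂ) → ℂ} (h : ∀ i ∈ s, MeroG (F i) x) :
    MeroG (fun y => ∑ i ∈ s, F i y) x := by
  classical
  induction s using Finset.induction_on with
  | empty => simpa using const 0
  | insert a s ha ih =>
    simp only [sum_insert ha]
    exact (h a (by simp)).add (ih fun i hi => h i (by simp [hi]))

theorem prod {ι : Type*} (s : Finset ι) {F : ι → (Fin n → ℂ) → ℂ} (h : ∀ i ∈ s, MeroG (F i) x) :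
    MeroG (fun y => ∏ i ∈ s, F i y) x := by
  classical
  induction s using Finset.induction_on with
  | empty => simpa using const 1
  | insert a s ha ih =>
    simp only [prod_insert ha]
    exact (h a (by simp)).mul (ih fun i hi => h i (by simp [hi]))

theorem congr (hf : MeroG f x) (h : ∀ᶠ y in 𝓝 x, y ∈ generic n → f y = f' y) : MeroG f' x := by
  obtain ⟨g, k, hg, hk, e⟩ := hf
  refine ⟨g, k, hg, hk, ?_⟩
  filter_upwards [e, h] with y hy hy' hgen
  exact ⟨(hy hgen).1, by rw [← hy' hgen, (hy hgen).2]⟩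

theorem meroAt (hf : MeroG f x) : MeroAt f x := by
  obtain ⟨g, h, hg, hh, e⟩ := hf
  have hd : AnalyticAt ℂ (disc (n := n)) x := analyticAt_of_differentiable differentiable_disc x
  refine ⟨fun y => g y * disc y, fun y => h y * disc y, hg.mul hd, hh.mul hd, ?_, ?_⟩
  · have h1 := mem_closure_iff_frequently.1 (dense_generic n x)
    refine (h1.and_eventually e).mono ?_
    rintro y ⟨hy, hy'⟩
    exact mul_ne_zero (hy' hy).1 (mem_generic_iff.1 hy)
  · filter_upwards [e] with y hy hne
    have h2 : disc y ≠ 0 := right_ne_zero_of_mul hne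
    rw [(hy (mem_generic_iff.2 h2)).2, mul_div_mul_right _ _ h2]

theorem analyticAt (hf : MeroG f x) (hx : x ∈ generic n) : AnalyticAt ℂ f x := by
  obtain ⟨g, h, hg, hh, e⟩ := hf
  refine (hg.div hh (e.self_of_nhds hx).1).congr ?_
  filter_upwards [e, (isOpen_generic n).mem_nhds hx] with y hy hy'
  exact ((hy hy').2).symm

end MeroG

/-! ### The Jost function -/

theorem pi_ne_zero' : (π : ℂ) ≠ 0 := by exact_mod_cast Real.pi_ne_zero

theorem two_pi_I_ne_zero' : (2 * π * I : ℂ) ≠ 0 := by simp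

theorem jost_add_ipi (θ : ℂ) : jost (θ + iπ) = jost (-θ) := by
  have h : (θ + iπ) / (2 * π * I) = 1 / 2 - -θ / (2 * π * I) := by
    field_simp [pi_ne_zero']; ring
  have h' : 1 / 2 - (θ + iπ) / (2 * π * I) = -θ / (2 * π * I) := by
    rw [h]; ring
  rw [jost, jost, h', h]; ring

theorem jost_add_two_ipi {θ : ℂ} (h0 : θ ≠ 0) (h1 : θ + iπ ≠ 0) :
    (θ + iπ) * jost (θ + 2 * iπ) = -θ * jost θ := by
  have hne : (2 * π * I : ℂ) ≠ 0 := two_pi_I_ne_zero'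
  have e1 : (θ + 2 * iπ) / (2 * π * I) = θ / (2 * π * I) + 1 := by
    field_simp [pi_ne_zero']
  have e2 : 1 / 2 - θ / (2 * π * I) = (1 / 2 - (θ / (2 * π * I) + 1)) + 1 := by ring
  have hs : θ / (2 * π * I) ≠ 0 := div_ne_zero h0 hne
  have hs' : 1 / 2 - (θ / (2 * π * I) + 1) = -(θ + iπ) / (2 * π * I) := by
    field_simp [pi_ne_zero']; ring
  have hs'' : 1 / 2 - (θ / (2 * π * I) + 1) ≠ 0 := by
    rw [hs']; exact div_ne_zero (neg_ne_zero.2 h1) hne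
  rw [jost, jost, e1, Gamma_add_one _ hs, e2, Gamma_add_one _ hs'', hs']
  ring

/-- `τ(z) = z sinh z / (4π³)`. -/
theorem tau_eq (z : ℂ) : tau z = z * sinh z / (4 * π ^ 3) := by
  obtain ⟨s, rfl⟩ : ∃ s : ℂ, z = 2 * π * I * s :=
    ⟨z / (2 * π * I), by field_simp [pi_ne_zero']⟩
  by_cases h0 : s = 0
  · simp [tau, h0, jost]
  have hp : 2 * π * I * s / (2 * π * I) = s := mul_div_cancel_left₀ _ two_pi_I_ne_zero'
  have hm : -(2 * π * I * s) / (2 * π * I) = -s := by rw [neg_div, hp]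
  have h1 : Gamma s * Gamma (1 - s) = π / sin (π * s) := Gamma_mul_Gamma_one_sub s
  have h2 : Gamma (1 - s) = -s * Gamma (-s) := by
    rw [← Gamma_add_one _ (neg_ne_zero.2 h0)]; ring_nf
  have h3 : Gamma (1 / 2 + s) * Gamma (1 / 2 - s) = π / cos (π * s) := by
    have := Gamma_mul_Gamma_one_sub (1 / 2 + s)
    rw [show 1 - (1 / 2 + s) = 1 / 2 - s by ring,
      show (π : ℂ) * (1 / 2 + s) = π * s + π / 2 by ring, sin_add_pi_div_two] at this
    exact this
  have h4 : Gamma s * Gamma (-s) = -(π / sin (π * s)) / s := by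
    rw [h2] at h1
    rw [eq_div_iff h0, ← h1]; ring
  have hsinh : sinh (2 * π * I * s) = I * (2 * sin (π * s) * cos (π * s)) := by
    rw [← sin_two_mul, show 2 * π * I * s = 2 * (π * s) * I by ring, sinh_mul_I]
    ring
  have h5 : jost (2 * π * I * s) * jost (-(2 * π * I * s)) =
      (Gamma s * Gamma (-s)) * (Gamma (1 / 2 + s) * Gamma (1 / 2 - s)) := by
    rw [jost, jost, hm, hp]; ring_nf
  rw [tau, h5, h3, h4, hsinh, mul_inv, inv_div, inv_div, div_neg, div_div_eq_mul_div]
  have := pi_ne_zero'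
  field_simp
  linear_combination (-4 * sin (s * π) * cos (s * π)) * I_sq

/-- The points `-2kiπ` and `(2k+1)iπ`, `k = 0, 1, …`, where the Jost function has poles. -/
def JostRegular (x : ℂ) : Prop := ∀ k : ℕ, x ≠ -(2 * k * iπ) ∧ x ≠ (2 * k + 1) * iπ

theorem JostRegular.of_generic {x : ℂ} (h : ∀ k : ℤ, x ≠ k * iπ) : JostRegular x := by
  intro k
  constructor
  · have := h (-(2 * k)); push_cast at this; intro h'; exact this (by rw [h']; ring)
  · have := h (2 * k + 1); push_cast at this; exact this

theorem JostRegular.left {x : ℂ} (h : JostRegular x) (k : ℕ) : x / (2 * π * I) ≠ -k := by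
  intro h'
  refine (h k).1 ?_
  rw [div_eq_iff two_pi_I_ne_zero'] at h'
  rw [h']; ring

theorem JostRegular.right {x : ℂ} (h : JostRegular x) (k : ℕ) :
    1 / 2 - x / (2 * π * I) ≠ -k := by
  intro h'
  refine (h k).2 ?_
  have : x / (2 * π * I) = k + 1 / 2 := by linear_combination -h'
  rw [div_eq_iff two_pi_I_ne_zero'] at this
  rw [this]; ring

theorem JostRegular.jost_ne_zero {x : ℂ} (h : JostRegular x) : jost x ≠ 0 :=
  mul_ne_zero (Gamma_ne_zero h.left) (Gamma_ne_zero h.right)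

theorem JostRegular.differentiableAt {x : ℂ} (h : JostRegular x) : DifferentiableAt ℂ jost x := by
  unfold jost
  refine DifferentiableAt.mul ?_ ?_
  · exact (differentiableAt_Gamma _ h.left).comp x (by fun_prop)
  · exact (differentiableAt_Gamma _ h.right).comp x (by fun_prop)

/-- `a(θ) = φ(-θ) / φ(θ)`. -/
theorem ampA_eq {θ : ℂ} (h : ∀ k : ℤ, θ ≠ k * iπ) : ampA θ = jost (-θ) / jost θ := by
  have hne : (2 * π * I : ℂ) ≠ 0 := two_pi_I_ne_zero'
  have h0 : θ ≠ 0 := by simpa using h 0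
  set s : ℂ := θ / (2 * π * I) with hs
  have hs0 : s ≠ 0 := div_ne_zero h0 hne
  have hm : -θ / (2 * π * I) = -s := by rw [hs]; ring
  have h2 : Gamma (1 - s) = -s * Gamma (-s) := by
    rw [← Gamma_add_one _ (neg_ne_zero.2 hs0)]; ring_nf
  have h3 : Gamma (1 + s) = s * Gamma s := by rw [← Gamma_add_one _ hs0, add_comm]
  have hr := JostRegular.of_generic h
  have g1 : Gamma s ≠ 0 := Gamma_ne_zero hr.left
  have g2 : Gamma (1 / 2 - s) ≠ 0 := Gamma_ne_zero hr.right
  rw [ampA, jost, jost, hm, ← hs, h2, h3, sub_neg_eq_add]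
  field_simp

theorem ne_int_ipi_neg {θ : ℂ} (h : ∀ k : ℤ, θ ≠ k * iπ) (k : ℤ) : -θ ≠ k * iπ := by
  intro h'
  refine h (-k) ?_
  push_cast
  linear_combination -h'

theorem ne_int_ipi_add {θ : ℂ} (h : ∀ k : ℤ, θ ≠ k * iπ) (l : ℤ) (k : ℤ) :
    θ + l * iπ ≠ k * iπ := by
  intro h'
  refine h (k - l) ?_
  push_cast
  linear_combination h'

theorem norm_jost_neg_ofReal (x : ℝ) : ‖jost (-(x : ℂ))‖ = ‖jost (x : ℂ)‖ := by
  have h1 : (starRingEnd ℂ) (jost x) = jost (-(x : ℂ)) := by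
    have e : (starRingEnd ℂ) ((x : ℂ) / (2 * π * I)) = -(x : ℂ) / (2 * π * I) := by
      rw [map_div₀, map_mul, map_mul, conj_ofReal, conj_ofReal, conj_I, Complex.conj_ofNat]
      rw [neg_div, mul_neg, div_neg]
    rw [jost, jost, map_mul, ← Gamma_conj, ← Gamma_conj, map_sub, e, map_div₀, map_one, Complex.conj_ofNat]
  rw [← h1]; simp

theorem norm_jost_ofReal_sq {x : ℝ} (hx : x ≠ 0) :
    ‖jost (x : ℂ)‖ ^ 2 * (|x| * |Real.sinh x|) = 4 * π ^ 3 := by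
  have h := tau_eq x
  have hne : (x : ℂ) * sinh x ≠ 0 := by
    rw [← ofReal_sinh, ← ofReal_mul]
    exact_mod_cast mul_ne_zero hx (Real.sinh_ne_zero.2 hx)
  rw [tau] at h
  have h2 := congrArg (fun z : ℂ => ‖z‖) h
  simp only [norm_inv, norm_mul, norm_jost_neg_ofReal, norm_div, norm_pow, norm_real,
    ← ofReal_sinh, norm_eq_abs, Complex.norm_ofNat] at h2
  have hj : ‖jost (x : ℂ)‖ ≠ 0 := by
    intro h0
    rw [h0] at h2
    have hp : |π| ≠ 0 := abs_ne_zero.2 Real.pi_ne_zero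
    have h3 : |x| * |Real.sinh x| ≠ 0 :=
      mul_ne_zero (abs_ne_zero.2 hx) (abs_ne_zero.2 (Real.sinh_ne_zero.2 hx))
    rw [mul_zero, inv_zero] at h2
    exact div_ne_zero h3 (by positivity) h2.symm
  rw [abs_of_pos pi_pos] at h2
  have hp := Real.pi_ne_zero
  field_simp at h2
  linear_combination -h2

/-! ### Growth of the Jost function -/

theorem norm_Gamma_le {s : ℂ} (hs : 0 < s.re) : ‖Gamma s‖ ≤ Real.Gamma s.re := by
  rw [Gamma_eq_integral hs, Real.Gamma_eq_integral hs, GammaIntegral]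
  refine (norm_integral_le_integral_norm _).trans (le_of_eq ?_)
  refine setIntegral_congr_fun measurableSet_Ioi fun x hx => ?_
  simp only [norm_mul, norm_real, norm_eq_abs, abs_of_pos (Real.exp_pos _)]
  rw [norm_cpow_eq_rpow_re_of_pos hx]
  simp

theorem exists_norm_Gamma_le {a b : ℝ} (ha : 0 < a) :
    ∃ C, ∀ s : ℂ, a ≤ s.re → s.re ≤ b → ‖Gamma s‖ ≤ C := by
  have hc : ContinuousOn Real.Gamma (Icc a b) := by
    intro x hx
    refine (Real.differentiableAt_Gamma fun m => ?_).continuousAt.continuousWithinAt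
    have h1 : 0 < x := ha.trans_le hx.1
    have h2 : (0 : ℝ) ≤ m := Nat.cast_nonneg m
    linarith
  obtain ⟨C, hC⟩ := isCompact_Icc.exists_bound_of_continuousOn hc
  exact ⟨C, fun s h1 h2 => (norm_Gamma_le (ha.trans_le h1)).trans
    ((le_abs_self _).trans (hC _ ⟨h1, h2⟩))⟩

theorem re_div_two_pi_I (z : ℂ) : (z / (2 * π * I)).re = z.im / (2 * π) := by
  have : z / (2 * π * I) = -(z * I) / ((2 * π : ℝ) : ℂ) := by
    push_cast
    field_simp [pi_ne_zero']
    rw [I_sq]; ring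
  rw [this, Complex.div_ofReal_re]; simp

/-- An auxiliary function without poles in the strip `|Im z| ≤ π`. -/
def jostAux (z : ℂ) : ℂ :=
  Gamma (1 + z / (2 * π * I)) ^ 2 * Gamma (3 / 2 - z / (2 * π * I)) ^ 2 * sinh z / (z + 3 * iπ) ^ 3

theorem jostAux_eq {z : ℂ} (h0 : z ≠ 0) (h1 : z ≠ iπ) :
    jostAux z = (z * (iπ - z)) ^ 2 * jost z ^ 2 * sinh z / (16 * π ^ 4 * (z + 3 * iπ) ^ 3) := by
  have hne : (2 * π * I : ℂ) ≠ 0 := two_pi_I_ne_zero'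
  obtain ⟨s, rfl⟩ : ∃ s : ℂ, z = 2 * π * I * s :=
    ⟨z / (2 * π * I), by field_simp [pi_ne_zero']⟩
  have hp : 2 * π * I * s / (2 * π * I) = s := mul_div_cancel_left₀ _ hne
  have hs0 : s ≠ 0 := by rintro rfl; simp at h0
  have hs1 : 1 / 2 - s ≠ 0 := by
    intro h; apply h1
    have : s = 1 / 2 := by linear_combination -h
    rw [this]; ring
  rw [jostAux, jost, hp, show (1 : ℂ) + s = s + 1 by ring, Gamma_add_one s hs0,
    show (3 / 2 : ℂ) - s = (1 / 2 - s) + 1 by ring, Gamma_add_one _ hs1,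
    ← div_div]
  congr 1
  have h2 : (2 * π * I * s * (iπ - 2 * π * I * s)) ^ 2 = 16 * π ^ 4 * (s * (1 / 2 - s)) ^ 2 := by
    have : I ^ 4 = 1 := I_pow_four
    linear_combination (16 * π ^ 4 * (s * (1 / 2 - s)) ^ 2) * this
  rw [h2]
  field_simp [pi_ne_zero']

theorem norm_ofReal_add_mul_ipi (x a : ℝ) : ‖(x : ℂ) + a * iπ‖ = √(x ^ 2 + (a * π) ^ 2) := by
  rw [show (x : ℂ) + a * iπ = x + ((a * π : ℝ) : ℂ) * I by push_cast; ring, norm_add_mul_I]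

theorem norm_ofReal_add_mul_ipi_le {x a b : ℝ} (h : a ^ 2 ≤ b ^ 2) :
    ‖(x : ℂ) + a * iπ‖ ≤ ‖(x : ℂ) + b * iπ‖ := by
  rw [norm_ofReal_add_mul_ipi, norm_ofReal_add_mul_ipi]
  apply Real.sqrt_le_sqrt
  have : 0 ≤ π ^ 2 := by positivity
  nlinarith

theorem norm_jostAux_top (x : ℝ) : ‖jostAux (x + iπ)‖ ≤ 1 / (4 * π) := by
  rcases eq_or_ne x 0 with rfl | hx
  · have : sinh (iπ) = 0 := sinh_eq_zero_iff.2 ⟨1, by simp⟩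
    simp only [jostAux, ofReal_zero, zero_add, this]
    simp; positivity
  have hx' : (x : ℂ) ≠ 0 := by exact_mod_cast hx
  have h0 : (x : ℂ) + iπ ≠ 0 := by
    intro h; have := congrArg re h; simp at this; exact hx this
  have hsinh : sinh (x + iπ) = -sinh x := by
    rw [mul_comm, sinh_add_pi_mul_I]
  rw [jostAux_eq h0 (by simpa using hx'), jost_add_ipi, hsinh]
  have h1 : ((x : ℂ) + iπ) * (iπ - (x + iπ)) = -(x * (x + iπ)) := by ring
  rw [h1]
  have h4 : (x : ℂ) + iπ + 3 * iπ = x + ((4 : ℝ) : ℂ) * iπ := by push_cast; ring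
  rw [h4, ← ofReal_sinh]
  simp only [norm_div, norm_mul, norm_pow, norm_neg, norm_real, Complex.norm_ofNat,
    norm_jost_neg_ofReal, norm_eq_abs, abs_of_pos pi_pos]
  have hj := norm_jost_ofReal_sq hx
  have hB : |x| ≤ ‖(x : ℂ) + ((4 : ℝ) : ℂ) * iπ‖ := by
    simpa using norm_ofReal_add_mul_ipi_le (x := x) (a := 0) (b := 4) (by norm_num)
  have hA : ‖(x : ℂ) + iπ‖ ≤ ‖(x : ℂ) + ((4 : ℝ) : ℂ) * iπ‖ := by
    simpa using norm_ofReal_add_mul_ipi_le (x := x) (a := 1) (b := 4) (by norm_num)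
  have hxp : 0 < |x| := abs_pos.2 hx
  generalize ‖(x : ℂ) + ((4 : ℝ) : ℂ) * iπ‖ = B at *
  have hA0 := norm_nonneg ((x : ℂ) + iπ)
  generalize ‖(x : ℂ) + iπ‖ = A at *
  have hBp : 0 < B := hxp.trans_le hB
  have e : (|x| * A) ^ 2 * ‖jost (x : ℂ)‖ ^ 2 * |Real.sinh x| = |x| * A ^ 2 * (4 * π ^ 3) := by
    rw [← hj]; ring
  rw [e, div_le_div_iff₀ (by positivity) (by positivity)]
  have : |x| * A ^ 2 ≤ B ^ 3 := by
    calc |x| * A ^ 2 ≤ B * B ^ 2 := by gcongr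
      _ = B ^ 3 := by ring
  have hπ := pi_pos
  have h5 := mul_le_mul_of_nonneg_left this (show 0 ≤ 16 * π ^ 4 by positivity)
  nlinarith [h5]

theorem norm_jostAux_bot (x : ℝ) : ‖jostAux (x - iπ)‖ ≤ 1 / (4 * π) := by
  rcases eq_or_ne x 0 with rfl | hx
  · have : sinh (-iπ) = 0 := sinh_eq_zero_iff.2 ⟨-1, by simp⟩
    simp only [jostAux, ofReal_zero, zero_sub, this]
    simp; positivity
  have hre : ∀ a : ℂ, a.re = 0 → (x : ℂ) + a ≠ 0 := by
    intro a ha h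
    have := congrArg re h; simp [ha] at this; exact hx this
  have h0 : (x : ℂ) - iπ ≠ 0 := by rw [sub_eq_add_neg]; exact hre _ (by simp)
  have h1 : (x : ℂ) - iπ ≠ iπ := by
    intro h; exact hre (-(2 * iπ)) (by simp) (by linear_combination h)
  have hsinh : sinh (x - iπ) = -sinh x := by
    rw [mul_comm, sinh_sub_pi_mul_I]
  have hx' : -(x : ℂ) ≠ 0 := by simpa using hx
  have hx'' : -(x : ℂ) + iπ ≠ 0 := by
    intro h; exact h0 (by linear_combination -h)
  have hshift := jost_add_two_ipi hx' hx''
  have hj2 : jost (x - iπ) = jost (-(x : ℂ) + 2 * iπ) := by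
    rw [show -(x : ℂ) + 2 * iπ = (iπ - x) + iπ by ring, jost_add_ipi]
    congr 1; ring
  rw [← hj2, neg_neg] at hshift
  have hnj : ‖(x : ℂ) - iπ‖ * ‖jost (x - iπ)‖ = |x| * ‖jost (x : ℂ)‖ := by
    have := congrArg (fun z : ℂ => ‖z‖) hshift
    simp only [norm_mul, norm_real, norm_jost_neg_ofReal, norm_eq_abs] at this
    rw [← this, ← norm_neg]; congr 2; ring
  rw [jostAux_eq h0 h1, hsinh]
  have h4 : (x : ℂ) - iπ + 3 * iπ = x + ((2 : ℝ) : ℂ) * iπ := by push_cast; ring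
  have h5 : iπ - ((x : ℂ) - iπ) = -(x + ((-2 : ℝ) : ℂ) * iπ) := by push_cast; ring
  rw [h4, h5, ← ofReal_sinh]
  simp only [norm_div, norm_mul, norm_pow, norm_neg, norm_real, Complex.norm_ofNat,
    norm_eq_abs, abs_of_pos pi_pos]
  have hj := norm_jost_ofReal_sq hx
  have hB : |x| ≤ ‖(x : ℂ) + ((2 : ℝ) : ℂ) * iπ‖ := by
    simpa using norm_ofReal_add_mul_ipi_le (x := x) (a := 0) (b := 2) (by norm_num)
  have hA : ‖(x : ℂ) + ((-2 : ℝ) : ℂ) * iπ‖ ≤ ‖(x : ℂ) + ((2 : ℝ) : ℂ) * iπ‖ :=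
    norm_ofReal_add_mul_ipi_le (by norm_num)
  have hxp : 0 < |x| := abs_pos.2 hx
  simp only [← norm_mul] at *
  rw [norm_mul] at hnj
  generalize ‖(x : ℂ) + ((2 : ℝ) : ℂ) * iπ‖ = B at *
  have hA0 := norm_nonneg ((x : ℂ) + ((-2 : ℝ) : ℂ) * iπ)
  rw [norm_mul ((x : ℂ) - iπ)]
  generalize ‖(x : ℂ) + ((-2 : ℝ) : ℂ) * iπ‖ = A at *
  have hBp : 0 < B := hxp.trans_le hB
  have e : (‖(x : ℂ) - iπ‖ * A) ^ 2 * ‖jost ((x : ℂ) - iπ)‖ ^ 2 * |Real.sinh x|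
      = |x| * A ^ 2 * (4 * π ^ 3) := by
    rw [← hj]
    linear_combination (A ^ 2 * |Real.sinh x| * (‖(x : ℂ) - iπ‖ * ‖jost (x - iπ)‖
      + |x| * ‖jost (x : ℂ)‖)) * hnj
  rw [e, div_le_div_iff₀ (by positivity) (by positivity)]
  have : |x| * A ^ 2 ≤ B ^ 3 := by
    calc |x| * A ^ 2 ≤ B * B ^ 2 := by gcongr
      _ = B ^ 3 := by ring
  have hπ := pi_pos
  have h5 := mul_le_mul_of_nonneg_left this (show 0 ≤ 16 * π ^ 4 by positivity)
  nlinarith [h5]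

theorem norm_sinh_le (z : ℂ) : ‖sinh z‖ ≤ rexp |z.re| := by
  rw [sinh, norm_div, Complex.norm_ofNat, div_le_iff₀ two_pos]
  refine (norm_sub_le _ _).trans ?_
  rw [norm_exp, norm_exp, neg_re]
  have h1 := Real.exp_le_exp.2 (le_abs_self z.re)
  have h2 := Real.exp_le_exp.2 (neg_le_abs z.re)
  linarith

theorem sinh_abs_le_norm_sinh (z : ℂ) : Real.sinh |z.re| ≤ ‖sinh z‖ := by
  rw [sinh, norm_div, Complex.norm_ofNat, le_div_iff₀ two_pos, Real.sinh_eq]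
  rcases le_total 0 z.re with h | h
  · have := norm_sub_norm_le (exp z) (exp (-z))
    rw [norm_exp, norm_exp, neg_re] at this
    rw [abs_of_nonneg h]; linarith
  · have := norm_sub_norm_le (exp (-z)) (exp z)
    rw [norm_exp, norm_exp, neg_re, norm_sub_rev] at this
    rw [abs_of_nonpos h, neg_neg]; linarith

theorem norm_jostAux_le {z : ℂ} (h : |z.im| ≤ π) : ‖jostAux z‖ ≤ 1 / (4 * π) := by
  rw [abs_le] at h
  have hπ := pi_pos
  have hre1 : ∀ z : ℂ, -π ≤ z.im → z.im ≤ π → 1 / 2 ≤ (1 + z / (2 * π * I)).re ∧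
      (1 + z / (2 * π * I)).re ≤ 2 ∧ 1 / 2 ≤ (3 / 2 - z / (2 * π * I)).re ∧
      (3 / 2 - z / (2 * π * I)).re ≤ 2 := by
    intro z h1 h2
    have e1 : z.im / (2 * π) ≤ 1 / 2 := by rw [div_le_iff₀ (by positivity)]; linarith
    have e2 : -(1 / 2) ≤ z.im / (2 * π) := by rw [le_div_iff₀ (by positivity)]; linarith
    have e3 : ((3 : ℂ) / 2).re = 3 / 2 := by norm_num
    simp only [add_re, sub_re, one_re, re_div_two_pi_I, e3]
    refine ⟨by linarith, by linarith, by linarith, by linarith⟩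
  have hne : ∀ z : ℂ, -π ≤ z.im → z.im ≤ π → z + 3 * iπ ≠ 0 := by
    intro z h1 h2 h3
    have := congrArg im h3
    simp at this; linarith
  have hG : ∀ s : ℂ, 1 / 2 ≤ s.re → DifferentiableAt ℂ Gamma s := by
    intro s hs
    refine differentiableAt_Gamma s fun m hm => ?_
    rw [hm] at hs; simp at hs
    have : (0 : ℝ) ≤ m := Nat.cast_nonneg m
    norm_num at hs; linarith
  have hda : ∀ z : ℂ, -π ≤ z.im → z.im ≤ π → DifferentiableAt ℂ jostAux z := by
    intro z h1 h2
    obtain ⟨a1, a2, a3, a4⟩ := hre1 z h1 h2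
    unfold jostAux
    refine DifferentiableAt.div ?_ (by fun_prop) (pow_ne_zero _ (hne z h1 h2))
    refine DifferentiableAt.mul (DifferentiableAt.mul ?_ ?_) (by fun_prop)
    · exact ((hG _ a1).comp z (by fun_prop : DifferentiableAt ℂ (fun z : ℂ => 1 + z / (2 * π * I)) z)).pow 2
    · exact ((hG _ a3).comp z (by fun_prop : DifferentiableAt ℂ (fun z : ℂ => 3 / 2 - z / (2 * π * I)) z)).pow 2
  refine PhragmenLindelof.horizontal_strip (a := -π) (b := π) (f := jostAux) ?_ ?_ ?_ ?_ h.1 h.2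
  · constructor
    · intro z hz
      exact (hda z hz.1.le hz.2.le).differentiableWithinAt
    · intro z hz
      have hcl : z ∈ im ⁻¹' Icc (-π) π := by
        refine closure_minimal ?_ (isClosed_Icc.preimage continuous_im) hz
        exact preimage_mono Ioo_subset_Icc_self
      exact (hda z hcl.1 hcl.2).continuousAt.continuousWithinAt
  · refine ⟨1 / 4, ?_, 4, ?_⟩
    · rw [lt_div_iff₀ (by linarith)]
      have := pi_pos
      linarith
    obtain ⟨C, hC⟩ := exists_norm_Gamma_le (a := 1 / 2) (b := 2) (by norm_num)
    refine Asymptotics.IsBigO.of_bound (C ^ 2 * C ^ 2) ?_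
    refine mem_inf_of_right ?_
    intro z hz
    obtain ⟨a1, a2, a3, a4⟩ := hre1 z hz.1.le hz.2.le
    have h3 : 1 ≤ ‖z + 3 * iπ‖ := by
      refine le_trans ?_ (abs_im_le_norm _)
      have := hz.1
      simp
      rw [abs_of_pos (by linarith)]
      have := Real.pi_gt_three; linarith
    have hC0 : 0 ≤ C := (norm_nonneg _).trans (hC _ a1 a2)
    show ‖jostAux z‖ ≤ C ^ 2 * C ^ 2 * ‖rexp (4 * rexp (1 / 4 * |z.re|))‖
    rw [jostAux, norm_div, norm_mul, norm_mul, norm_pow, norm_pow, norm_pow, norm_eq_abs,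
      abs_of_pos (Real.exp_pos _)]
    refine (div_le_self (by positivity) (one_le_pow₀ h3)).trans ?_
    have h4 : ‖sinh z‖ ≤ rexp (4 * rexp (1 / 4 * |z.re|)) := by
      refine (norm_sinh_le z).trans (Real.exp_le_exp.2 ?_)
      have := Real.add_one_le_exp (1 / 4 * |z.re|)
      linarith
    have := hC _ a1 a2
    have := hC _ a3 a4
    gcongr
  · intro z hz
    have : z = (z.re : ℂ) - iπ := by apply Complex.ext <;> simp [hz]
    rw [this]; exact norm_jostAux_bot _
  · intro z hz
    have : z = (z.re : ℂ) + iπ := by apply Complex.ext <;> simp [hz]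
    rw [this]; exact norm_jostAux_top _

theorem exp_le_sinh {t : ℝ} (ht : 1 ≤ t) : rexp t ≤ 4 * Real.sinh t := by
  rw [Real.sinh_eq]
  have h1 : 2 ≤ rexp t := by have := Real.add_one_le_exp t; linarith
  have h2 : rexp (-t) ≤ 1 := Real.exp_le_one_iff.2 (by linarith)
  linarith

theorem norm_le_abs_re_add {z : ℂ} {M : ℝ} (h : |z.im| ≤ M) : ‖z‖ ≤ |z.re| + M :=
  (norm_le_abs_re_add_abs_im z).trans (by linarith)

theorem ne_of_one_le_abs_re {z a : ℂ} (h : 1 ≤ |z.re|) (ha : a.re = 0) : z ≠ a := by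
  rintro rfl
  rw [ha] at h; norm_num at h

theorem norm_jost_sq_le_aux {z : ℂ} (h : |z.im| ≤ π) (h1 : 1 ≤ |z.re|) :
    ‖jost z‖ ^ 2 * (|z.re| * rexp |z.re|) ≤ 16 * π ^ 3 * (1 + 4 * π) ^ 3 := by
  have hπ := pi_pos
  have hb := norm_jostAux_le h
  rw [jostAux_eq (ne_of_one_le_abs_re h1 (by simp)) (ne_of_one_le_abs_re h1 (by simp))] at hb
  simp only [norm_div, norm_mul, norm_pow, norm_real, Complex.norm_ofNat, norm_eq_abs,
    abs_of_pos hπ] at hb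
  simp only [← norm_mul] at hb
  have hd : 0 < ‖z + 3 * iπ‖ := norm_pos_iff.2 fun h0 =>
    ne_of_one_le_abs_re (a := -(3 * iπ)) h1 (by simp) (by linear_combination h0)
  rw [div_le_div_iff₀ (by positivity) (by positivity)] at hb
  have hd2 : ‖z + 3 * iπ‖ ≤ |z.re| * (1 + 4 * π) := by
    refine (norm_le_abs_re_add (M := 4 * π) ?_).trans ?_
    · simp
      rw [abs_le] at h ⊢
      constructor <;> linarith
    · simp
      nlinarith
  have hz : |z.re| ≤ ‖z‖ := abs_re_le_norm z
  have hz' : |z.re| ≤ ‖iπ - z‖ := by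
    simpa using abs_re_le_norm (iπ - z)
  have hs := (exp_le_sinh h1).trans (mul_le_mul_of_nonneg_left (sinh_abs_le_norm_sinh z) (by norm_num))
  have hx : 0 < |z.re| := by linarith
  set x := |z.re| with hxdef
  have e1 : (x * x) ^ 2 * ‖jost z‖ ^ 2 * rexp x ≤
      ‖z * (iπ - z)‖ ^ 2 * ‖jost z‖ ^ 2 * (4 * ‖sinh z‖) := by
    rw [norm_mul]
    gcongr
  have e2 : 1 * (16 * π ^ 4 * ‖z + 3 * iπ‖ ^ 3) ≤ 16 * π ^ 4 * (x * (1 + 4 * π)) ^ 3 := by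
    rw [one_mul]; gcongr
  have e3 : (x * x) ^ 2 * ‖jost z‖ ^ 2 * rexp x * π ≤ 16 * π ^ 4 * (x * (1 + 4 * π)) ^ 3 := by
    calc _ ≤ ‖z * (iπ - z)‖ ^ 2 * ‖jost z‖ ^ 2 * (4 * ‖sinh z‖) * π := by gcongr
      _ = ‖z * (iπ - z)‖ ^ 2 * ‖jost z‖ ^ 2 * ‖sinh z‖ * (4 * π) := by ring
      _ ≤ _ := hb.trans e2
  have e4 : (x ^ 3 * π) * (‖jost z‖ ^ 2 * (x * rexp x)) ≤
      (x ^ 3 * π) * (16 * π ^ 3 * (1 + 4 * π) ^ 3) := by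
    calc _ = (x * x) ^ 2 * ‖jost z‖ ^ 2 * rexp x * π := by ring
      _ ≤ _ := e3
      _ = _ := by ring
  exact le_of_mul_le_mul_left e4 (by positivity)

theorem exists_norm_jost_sq_le (k : ℕ) : ∃ C : ℝ, ∀ z : ℂ, |z.im| ≤ (2 * k + 1) * π →
    1 ≤ |z.re| → ‖jost z‖ ^ 2 * (|z.re| * rexp |z.re|) ≤ C := by
  have hπ := pi_pos
  induction k with
  | zero =>
    exact ⟨_, fun z hz h1 => norm_jost_sq_le_aux (by simpa using hz) h1⟩
  | succ k ih =>
    obtain ⟨C, hC⟩ := ih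
    refine ⟨max C ((1 + (2 * (k + 1 : ℕ) + 1) * π) ^ 2 * C), fun z hz h1 => ?_⟩
    push_cast at hz ⊢
    by_cases h : |z.im| ≤ (2 * k + 1) * π
    · exact (hC z h h1).trans (le_max_left _ _)
    refine le_trans ?_ (le_max_right _ _)
    have hx : 0 < |z.re| := by linarith
    have hM : (0 : ℝ) ≤ (2 * ((k : ℝ) + 1) + 1) * π := by positivity
    suffices H : ∃ z' r : ℂ, z'.re = z.re ∧ |z'.im| ≤ (2 * k + 1) * π ∧ jost z = r * jost z' ∧
        ‖r‖ ≤ 1 + (2 * (k + 1) + 1) * π by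
      obtain ⟨z', r, hz're, hz'im, hj, hr⟩ := H
      have := hC z' hz'im (by rwa [hz're])
      rw [hj, norm_mul, mul_pow, mul_assoc]
      rw [hz're] at this
      gcongr
    have hdiv : ∀ a b : ℂ, |a.im| ≤ (2 * (k + 1) + 1) * π → a.re = z.re → b.re = z.re →
        ‖-(a / b)‖ ≤ 1 + (2 * (k + 1) + 1) * π := by
      intro a b ha har hbr
      have hb : |z.re| ≤ ‖b‖ := hbr ▸ abs_re_le_norm b
      rw [norm_neg, norm_div, div_le_iff₀ (hx.trans_le hb)]
      refine (norm_le_abs_re_add ha).trans ?_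
      rw [har]
      have : 1 * ((2 * ((k : ℝ) + 1) + 1) * π) ≤ ‖b‖ * ((2 * ((k : ℝ) + 1) + 1) * π) := by
        gcongr; linarith
      linarith
    push Not at h
    rcases le_total 0 z.im with hi | hi
    · rw [abs_of_nonneg hi] at h hz
      have hk : (0 : ℝ) ≤ k * π := by positivity
      refine ⟨z - 2 * iπ, -((z - 2 * iπ) / (z - iπ)), by simp, ?_, ?_, ?_⟩
      · simp; rw [abs_le]; constructor <;> linarith
      · have n1 : z - 2 * iπ ≠ 0 := fun h0 =>
          ne_of_one_le_abs_re (a := 2 * iπ) h1 (by simp) (by linear_combination h0)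
        have n2 : z - 2 * iπ + iπ ≠ 0 := fun h0 =>
          ne_of_one_le_abs_re (a := iπ) h1 (by simp) (by linear_combination h0)
        have := jost_add_two_ipi n1 n2
        rw [show z - 2 * iπ + iπ = z - iπ by ring, show z - 2 * iπ + 2 * iπ = z by ring] at this
        rw [show z - 2 * iπ + iπ = z - iπ by ring] at n2
        generalize jost (z - 2 * iπ) = J at *
        rw [neg_mul, div_mul_eq_mul_div, eq_neg_iff_add_eq_zero]
        field_simp
        linear_combination this
      · refine hdiv _ _ ?_ (by simp) (by simp)
        simp; rw [abs_le]; constructor <;> linarith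
    · rw [abs_of_nonpos hi] at h hz
      have hk : (0 : ℝ) ≤ k * π := by positivity
      refine ⟨z + 2 * iπ, -((z + iπ) / z), by simp, ?_, ?_, ?_⟩
      · simp; rw [abs_le]; constructor <;> linarith
      · have n1 : z ≠ 0 := ne_of_one_le_abs_re h1 (by simp)
        have n2 : z + iπ ≠ 0 := fun h0 =>
          ne_of_one_le_abs_re (a := -iπ) h1 (by simp) (by linear_combination h0)
        have := jost_add_two_ipi n1 n2
        generalize jost (z + 2 * iπ) = J at *
        rw [neg_mul, div_mul_eq_mul_div, eq_neg_iff_add_eq_zero]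
        field_simp
        linear_combination this
      · refine hdiv _ _ ?_ (by simp) (by simp)
        simp; rw [abs_le]; constructor <;> linarith

/-! ### The kernel of the integral transform -/

/-- The function `φ(x) / (-x - iπ)`, in a form that is symmetric under `x ↦ -x - iπ`. -/
def chi (x : ℂ) : ℂ :=
  Gamma (x / (2 * π * I)) * Gamma (-1 / 2 - x / (2 * π * I)) / (2 * iπ)

theorem tendsto_punctured {E : Type*} [TopologicalSpace E] {f : E → ℂ} {a : E} {b : ℂ}
    (hf : ContinuousAt f a) (hb : f a = b) (h : ∀ z, f z = b → z = a) : Tendsto f (𝓝[≠] a) (𝓝[≠] b) :=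
  tendsto_nhdsWithin_of_tendsto_nhds_of_eventually_within _
    (hb ▸ hf.tendsto.mono_left nhdsWithin_le_nhds)
    (by filter_upwards [self_mem_nhdsWithin] with z hz hz' using hz (h z hz'))

/-- The reciprocal of `chi`, an entire function. -/
def rchi (x : ℂ) : ℂ :=
  2 * iπ * ((Gamma (x / (2 * π * I)))⁻¹ * (Gamma (-1 / 2 - x / (2 * π * I)))⁻¹)

theorem two_ipi_ne_zero : 2 * iπ ≠ 0 := mul_ne_zero two_ne_zero ipi_ne_zero

theorem chi_eq_inv (x : ℂ) : chi x = (rchi x)⁻¹ := by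
  simp only [chi, rchi, mul_inv, inv_inv, div_eq_mul_inv]; ring

theorem differentiable_rchi : Differentiable ℂ rchi := by
  unfold rchi
  refine Differentiable.const_mul (Differentiable.mul ?_ ?_) _
  · exact differentiable_one_div_Gamma.comp (by fun_prop : Differentiable ℂ fun x : ℂ => x / (2 * π * I))
  · exact differentiable_one_div_Gamma.comp
      (by fun_prop : Differentiable ℂ fun x : ℂ => -1 / 2 - x / (2 * π * I))

theorem jost_eq_chi {x : ℂ} (h : x + iπ ≠ 0) : jost x = chi x * (-x - iπ) := by
  obtain ⟨s, rfl⟩ : ∃ s : ℂ, x = 2 * π * I * s :=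
    ⟨x / (2 * π * I), by field_simp [pi_ne_zero']⟩
  have hp : 2 * π * I * s / (2 * π * I) = s := mul_div_cancel_left₀ _ two_pi_I_ne_zero'
  have hs : -1 / 2 - s ≠ 0 := by
    intro h'; apply h
    have : s = -1 / 2 := by linear_combination -h'
    rw [this]; ring
  rw [jost, chi, hp, show 1 / 2 - s = (-1 / 2 - s) + 1 by ring, Gamma_add_one _ hs]
  field_simp [pi_ne_zero']
  ring

theorem rchi_eq_zero_iff {x : ℂ} :
    rchi x = 0 ↔ ∃ k : ℕ, x = -(2 * k * iπ) ∨ x = (2 * k - 1) * iπ := by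
  have hne : (2 * π * I : ℂ) ≠ 0 := two_pi_I_ne_zero'
  rw [rchi, mul_eq_zero, or_iff_right two_ipi_ne_zero, mul_eq_zero, inv_eq_zero, inv_eq_zero,
    Gamma_eq_zero_iff, Gamma_eq_zero_iff, ← exists_or]
  refine exists_congr fun k => or_congr ?_ ?_
  · rw [div_eq_iff hne]
    constructor <;> intro h <;> rw [h] <;> ring
  · constructor
    · intro h
      have : x / (2 * π * I) = k - 1 / 2 := by linear_combination -h
      rw [div_eq_iff hne] at this
      rw [this]; ring
    · rintro rfl
      field_simp [pi_ne_zero']; ring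

theorem rchi_ne_zero_of_generic {x : ℂ} (h : ∀ k : ℤ, x ≠ k * iπ) : rchi x ≠ 0 := by
  rw [Ne, rchi_eq_zero_iff]
  rintro ⟨k, rfl | rfl⟩
  · refine h (-(2 * k)) ?_; push_cast; ring
  · refine h (2 * k - 1) ?_; push_cast; ring

theorem chi_symm (x : ℂ) : chi (-x - iπ) = chi x := by
  have h1 : (-x - iπ) / (2 * π * I) = -1 / 2 - x / (2 * π * I) := by
    field_simp [pi_ne_zero']; ring
  rw [chi, chi, h1]; ring_nf

theorem chi_shift {x : ℂ} (h0 : x ≠ 0) (h3 : x + 3 * iπ ≠ 0) :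
    chi (x + 2 * iπ) * (-x - 3 * iπ) = chi x * x := by
  have hne : (2 * π * I : ℂ) ≠ 0 := two_pi_I_ne_zero'
  obtain ⟨s, rfl⟩ : ∃ s : ℂ, x = 2 * π * I * s :=
    ⟨x / (2 * π * I), by field_simp [pi_ne_zero']⟩
  have hp : 2 * π * I * s / (2 * π * I) = s := mul_div_cancel_left₀ _ hne
  have hp' : (2 * π * I * s + 2 * iπ) / (2 * π * I) = s + 1 := by
    field_simp [pi_ne_zero']
  have hs0 : s ≠ 0 := by rintro rfl; simp at h0
  have hs1 : -1 / 2 - (s + 1) ≠ 0 := by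
    intro h; apply h3
    have : s = -3 / 2 := by linear_combination -h
    rw [this]; ring
  rw [chi, chi, hp, hp', Gamma_add_one s hs0,
    show -1 / 2 - s = (-1 / 2 - (s + 1)) + 1 by ring, Gamma_add_one _ hs1]
  field_simp [pi_ne_zero']
  ring

/-- The residue of `chi` at `-2kiπ`. -/
def chiRes : ℕ → ℂ
  | 0 => Gamma (-1 / 2)
  | k + 1 => -(chiRes k * (2 * k - 1) / (2 * k + 2))

theorem chiRes_zero_ne_zero : chiRes 0 ≠ 0 := by
  refine Gamma_ne_zero fun m h => ?_
  have : (1 : ℂ) = 2 * m := by linear_combination -2 * h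
  have h2 : (1 : ℕ) = 2 * m := by exact_mod_cast this
  omega

theorem tendsto_chi_lower (k : ℕ) :
    Tendsto (fun x => (x + 2 * k * iπ) * chi x) (𝓝[≠] (-(2 * k * iπ))) (𝓝 (chiRes k)) := by
  have hne : (2 * π * I : ℂ) ≠ 0 := two_pi_I_ne_zero'
  induction k with
  | zero =>
    simp only [Nat.cast_zero, mul_zero, zero_mul, add_zero, neg_zero]
    have h1 : Tendsto (fun x : ℂ => x / (2 * π * I)) (𝓝[≠] 0) (𝓝[≠] 0) :=
      tendsto_punctured (by fun_prop) (zero_div _) fun x hx => (div_eq_zero_iff.1 hx).resolve_right hne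
    have h2 := tendsto_self_mul_Gamma_nhds_zero.comp h1
    have h3 : Tendsto (fun x : ℂ => Gamma (-1 / 2 - x / (2 * π * I))) (𝓝[≠] 0) (𝓝 (chiRes 0)) := by
      have hd : DifferentiableAt ℂ Gamma (-1 / 2 - 0 / (2 * π * I)) := by
        refine differentiableAt_Gamma _ fun m h => ?_
        rw [zero_div, sub_zero] at h
        have : (1 : ℂ) = 2 * m := by linear_combination -2 * h
        have h2 : (1 : ℕ) = 2 * m := by exact_mod_cast this
        omega
      have hc : ContinuousAt (fun x : ℂ => Gamma (-1 / 2 - x / (2 * π * I))) 0 :=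
        ContinuousAt.comp (f := fun x : ℂ => -1 / 2 - x / (2 * π * I)) hd.continuousAt (by fun_prop)
      have := hc.tendsto
      simp only [zero_div, sub_zero] at this
      exact this.mono_left nhdsWithin_le_nhds
    have h4 := h2.mul h3
    rw [one_mul] at h4
    refine h4.congr fun x => ?_
    simp only [chi, Function.comp]
    field_simp [pi_ne_zero']
  | succ k ih =>
    have hc0 : -(2 * ((k + 1 : ℕ) : ℂ) * iπ) ≠ 0 := by
      rw [neg_ne_zero]
      exact mul_ne_zero (mul_ne_zero two_ne_zero (by exact_mod_cast k.succ_ne_zero)) ipi_ne_zero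
    have hc3 : -(2 * ((k + 1 : ℕ) : ℂ) * iπ) + 3 * iπ ≠ 0 := by
      intro h
      have h' : ((3 : ℂ) - 2 * (k + 1 : ℕ)) * iπ = 0 := by linear_combination h
      have h'' := (mul_eq_zero.1 h').resolve_right ipi_ne_zero
      have h3 : (3 : ℂ) = ((2 * (k + 1) : ℕ) : ℂ) := by push_cast at h'' ⊢; linear_combination h''
      have : 3 = 2 * (k + 1) := by exact_mod_cast h3
      omega
    have h1 : Tendsto (fun x : ℂ => x + 2 * iπ) (𝓝[≠] (-(2 * ((k + 1 : ℕ) : ℂ) * iπ)))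
        (𝓝[≠] (-(2 * k * iπ))) :=
      tendsto_punctured (by fun_prop) (by push_cast; ring) fun x hx => by push_cast; linear_combination hx
    have h2 := ih.comp h1
    have h3 : Tendsto (fun x : ℂ => (-x - 3 * iπ) / x) (𝓝[≠] (-(2 * ((k + 1 : ℕ) : ℂ) * iπ)))
        (𝓝 ((-(-(2 * ((k + 1 : ℕ) : ℂ) * iπ)) - 3 * iπ) / (-(2 * ((k + 1 : ℕ) : ℂ) * iπ)))) := by
      refine Tendsto.mono_left ?_ nhdsWithin_le_nhds
      refine ContinuousAt.tendsto (f := fun x : ℂ => (-x - 3 * iπ) / x) ?_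
      exact ContinuousAt.div (by fun_prop) (by fun_prop) hc0
    have h4 := h2.mul h3
    have hlim : chiRes k * ((-(-(2 * ((k + 1 : ℕ) : ℂ) * iπ)) - 3 * iπ) /
        (-(2 * ((k + 1 : ℕ) : ℂ) * iπ))) = chiRes (k + 1) := by
      rw [chiRes]
      have hk : (k : ℂ) + 1 ≠ 0 := by exact_mod_cast k.succ_ne_zero
      have hk2 : 2 * (k : ℂ) + 2 ≠ 0 := by
        intro h; apply hk; linear_combination h / 2
      push_cast
      have hk3 : -(2 * ((k : ℂ) + 1) * iπ) ≠ 0 := by push_cast at hc0; exact hc0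
      rw [← mul_div_assoc, ← neg_div, div_eq_div_iff hk3 hk2]
      ring
    rw [hlim] at h4
    refine h4.congr' ?_
    have e0 : ∀ᶠ x in 𝓝[≠] (-(2 * ((k + 1 : ℕ) : ℂ) * iπ)), x ≠ 0 :=
      (continuousAt_id.eventually_ne hc0).filter_mono nhdsWithin_le_nhds
    have e3 : ∀ᶠ x in 𝓝[≠] (-(2 * ((k + 1 : ℕ) : ℂ) * iπ)), x + 3 * iπ ≠ 0 := by
      have : ContinuousAt (fun x : ℂ => x + 3 * iπ) (-(2 * ((k + 1 : ℕ) : ℂ) * iπ)) := by fun_prop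
      exact (this.eventually_ne hc3).filter_mono nhdsWithin_le_nhds
    filter_upwards [e0, e3] with x hx0 hx3
    have := chi_shift hx0 hx3
    simp only [Function.comp]
    push_cast
    generalize chi (x + 2 * iπ) = A at *
    generalize chi x = B at *
    field_simp
    linear_combination (x + 2 * (k + 1) * iπ) * this

theorem tendsto_chi_upper :
    Tendsto (fun x => (x + iπ) * chi x) (𝓝[≠] (-iπ)) (𝓝 (-chiRes 0)) := by
  have h1 : Tendsto (fun x : ℂ => -x - iπ) (𝓝[≠] (-iπ)) (𝓝[≠] 0) :=
    tendsto_punctured (by fun_prop) (by ring) fun x hx => by linear_combination -hx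
  have h0 := tendsto_chi_lower 0
  simp only [Nat.cast_zero, mul_zero, zero_mul, add_zero, neg_zero] at h0
  refine (h0.comp h1).neg.congr fun x => ?_
  simp only [Function.comp, chi_symm]
  ring

/-! ### Weights and decay -/

/-- The growth that is compensated by one factor `chi`. -/
def weight (x : ℝ) : ℝ := √((1 + |x|) ^ 3 * rexp |x|)

theorem weight_pos (x : ℝ) : 0 < weight x := Real.sqrt_pos.2 (by positivity)

theorem weight_add_le (x t : ℝ) : weight (x + t) ≤ weight x * weight t := by
  rw [weight, weight, weight, ← Real.sqrt_mul (by positivity)]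
  apply Real.sqrt_le_sqrt
  have h := abs_add_le x t
  have hx := abs_nonneg x
  have ht := abs_nonneg t
  calc (1 + |x + t|) ^ 3 * rexp |x + t| ≤ ((1 + |x|) * (1 + |t|)) ^ 3 * rexp (|x| + |t|) := by
        gcongr; nlinarith
    _ = _ := by rw [Real.exp_add]; ring

theorem weight_mono {x t : ℝ} (h : |x| ≤ |t|) : weight x ≤ weight t := by
  unfold weight; gcongr

theorem exists_norm_chi_le (M : ℝ) : ∃ C : ℝ, ∀ z : ℂ, |z.im| ≤ M → 1 ≤ |z.re| →
    ‖chi z‖ * weight z.re ≤ C := by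
  obtain ⟨k, hk⟩ := exists_nat_ge (M / (2 * π))
  obtain ⟨C, hC⟩ := exists_norm_jost_sq_le k
  have hπ := pi_pos
  refine ⟨√(8 * C), fun z hz h1 => ?_⟩
  have hx : 0 < |z.re| := by linarith
  rw [div_le_iff₀ (by positivity)] at hk
  have := hC z (hz.trans (by nlinarith)) h1
  apply Real.le_sqrt_of_sq_le
  have hne : z + iπ ≠ 0 := fun h0 =>
    ne_of_one_le_abs_re (a := -iπ) h1 (by simp) (by linear_combination h0)
  rw [jost_eq_chi hne, norm_mul, mul_pow] at this
  have hge : |z.re| ≤ ‖-z - iπ‖ := by simpa using abs_re_le_norm (-z - iπ)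
  rw [mul_pow, weight, Real.sq_sqrt (by positivity)]
  calc ‖chi z‖ ^ 2 * ((1 + |z.re|) ^ 3 * rexp |z.re|)
      ≤ ‖chi z‖ ^ 2 * ((2 * |z.re|) ^ 3 * rexp |z.re|) := by gcongr; linarith
    _ = 8 * (‖chi z‖ ^ 2 * |z.re| ^ 2 * (|z.re| * rexp |z.re|)) := by ring
    _ ≤ 8 * (‖chi z‖ ^ 2 * ‖-z - iπ‖ ^ 2 * (|z.re| * rexp |z.re|)) := by gcongr
    _ ≤ 8 * C := by linarith

/-- The line `Im x = h` contains no pole of `chi`. -/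
def ChiHeight (h : ℝ) : Prop := ∀ k : ℕ, h ≠ -(2 * k * π) ∧ h ≠ (2 * k - 1) * π

theorem ChiHeight.rchi_ne_zero {z : ℂ} (h : ChiHeight z.im) : rchi z ≠ 0 := by
  rw [Ne, rchi_eq_zero_iff]
  rintro ⟨k, rfl | rfl⟩
  · exact (h k).1 (by simp)
  · exact (h k).2 (by simp)

theorem differentiableAt_chi {z : ℂ} (h : rchi z ≠ 0) : DifferentiableAt ℂ chi z := by
  rw [show chi = fun x => (rchi x)⁻¹ from funext chi_eq_inv]
  exact (differentiable_rchi z).inv h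

theorem ChiHeight.exists_bound {h : ℝ} (hh : ChiHeight h) : ∃ δ > 0, ∃ C : ℝ, ∀ z : ℂ,
    |z.im - h| ≤ δ → rchi z ≠ 0 ∧ ‖chi z‖ * weight z.re ≤ C := by
  set K : Set ℂ := (fun x : ℝ => (x : ℂ) + h * I) '' Icc (-1) 1 with hK
  have hKc : IsCompact K := isCompact_Icc.image (by fun_prop)
  have hU : IsOpen {z : ℂ | rchi z ≠ 0} :=
    isOpen_ne.preimage differentiable_rchi.continuous
  have hKU : K ⊆ {z : ℂ | rchi z ≠ 0} := by
    rintro _ ⟨x, -, rfl⟩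
    refine ChiHeight.rchi_ne_zero ?_
    simpa using hh
  obtain ⟨δ, hδ, hsub⟩ := hKc.exists_cthickening_subset_open hU hKU
  have hc : ContinuousOn chi (Metric.cthickening δ K) := fun z hz =>
    (differentiableAt_chi (hsub hz)).continuousAt.continuousWithinAt
  obtain ⟨C₁, hC₁⟩ := hKc.cthickening.exists_bound_of_continuousOn hc
  obtain ⟨C₂, hC₂⟩ := exists_norm_chi_le (|h| + δ)
  have hmem : ∀ z : ℂ, |z.im - h| ≤ δ → |z.re| ≤ 1 → z ∈ Metric.cthickening δ K := by
    intro z h1 h2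
    refine Metric.mem_cthickening_of_dist_le z (z.re + h * I) δ K ⟨z.re, abs_le.1 h2, rfl⟩ ?_
    rw [dist_eq_norm]
    have : z - (z.re + h * I) = ((z.im - h : ℝ) : ℂ) * I := by
      apply Complex.ext <;> simp
    rw [this, norm_mul, norm_I, mul_one, norm_real]; exact h1
  have him : ∀ z : ℂ, |z.im - h| ≤ δ → |z.im| ≤ |h| + δ := by
    intro z hz
    have := abs_add_le (z.im - h) h
    rw [sub_add_cancel] at this; linarith
  refine ⟨δ, hδ, max (C₁ * weight 1) C₂, fun z hz => ?_⟩
  by_cases h1 : |z.re| ≤ 1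
  · have hm := hmem z hz h1
    refine ⟨hsub hm, le_trans ?_ (le_max_left _ _)⟩
    have h2 := hC₁ z hm
    have h3 : weight z.re ≤ weight 1 := weight_mono (by simpa using h1)
    have h4 := weight_pos z.re
    have h5 := norm_nonneg (chi z)
    gcongr
    linarith
  · push Not at h1
    refine ⟨?_, (hC₂ z (him z hz) h1.le).trans (le_max_right _ _)⟩
    rw [Ne, rchi_eq_zero_iff]
    rintro ⟨k, rfl | rfl⟩ <;> simp at h1 <;> norm_num at h1

/-- The product of the kernels attached to the rapidities `θ_i`. -/
def kern {n : ℕ} (θ : Fin n → ℂ) (z : ℂ) : ℂ := ∏ i, chi (z - θ i)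

/-- The line `Im z = y` contains no pole of the kernel. -/
def KernHeight {n : ℕ} (θ : Fin n → ℂ) (y : ℝ) : Prop := ∀ i, ChiHeight (y - (θ i).im)

theorem weight_pow_le_prod {n : ℕ} {θ : Fin n → ℂ} {A : ℝ} (hA : ∀ i, |(θ i).re| ≤ A) (x : ℝ) :
    weight x ^ n ≤ (∏ i, weight (x - (θ i).re)) * weight A ^ n := by
  have : ∀ i ∈ Finset.univ, weight x ≤ weight (x - (θ i).re) * weight A := by
    intro i _
    have h1 := weight_add_le (x - (θ i).re) (θ i).re
    rw [sub_add_cancel] at h1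
    refine h1.trans (mul_le_mul_of_nonneg_left (weight_mono ?_) (weight_pos _).le)
    exact (hA i).trans (le_abs_self A)
  have h2 := prod_le_prod (s := (Finset.univ : Finset (Fin n)))
    (fun i _ => (weight_pos x).le) this
  simpa [prod_mul_distrib] using h2

theorem abs_le_sum_abs {n : ℕ} (f : Fin n → ℝ) (i : Fin n) : |f i| ≤ ∑ i, |f i| :=
  single_le_sum (fun i _ => abs_nonneg (f i)) (Finset.mem_univ i)

theorem KernHeight.exists_bound {n : ℕ} {θ₀ : Fin n → ℂ} {y : ℝ} (h : KernHeight θ₀ y) :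
    ∃ δ > 0, ∃ C : ℝ, ∀ θ : Fin n → ℂ, (∀ i, ‖θ i - θ₀ i‖ ≤ δ) → ∀ z : ℂ, |z.im - y| ≤ δ →
      (∀ i, rchi (z - θ i) ≠ 0) ∧ ‖kern θ z‖ * weight z.re ^ n ≤ C := by
  choose δ hδ C hC using fun i => (h i).exists_bound
  obtain ⟨δ', hδ', hle⟩ : ∃ δ' > 0, ∀ i, δ' ≤ δ i / 2 := by
    rcases isEmpty_or_nonempty (Fin n) with he | he
    · exact ⟨1, one_pos, fun i => (he.false i).elim⟩
    · refine ⟨Finset.univ.inf' Finset.univ_nonempty fun i => δ i / 2, ?_, fun i =>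
        Finset.inf'_le _ (Finset.mem_univ i)⟩
      rw [gt_iff_lt, Finset.lt_inf'_iff]
      intro i _; exact half_pos (hδ i)
  refine ⟨min δ' 1, lt_min hδ' one_pos,
    (∏ i, C i) * weight ((∑ i, |(θ₀ i).re|) + 1) ^ n, fun θ hθ z hz => ?_⟩
  have key : ∀ i, |(z - θ i).im - (y - (θ₀ i).im)| ≤ δ i := by
    intro i
    have h1 : |(θ i - θ₀ i).im| ≤ δ' :=
      (abs_im_le_norm _).trans ((hθ i).trans (min_le_left _ _))
    have h2 := hz.trans (min_le_left _ _)
    have h3 := hle i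
    have : (z - θ i).im - (y - (θ₀ i).im) = (z.im - y) - (θ i - θ₀ i).im := by simp; ring
    rw [this]
    refine (abs_sub _ _).trans ?_
    linarith
  refine ⟨fun i => (hC i _ (key i)).1, ?_⟩
  have hA : ∀ i, |(θ i).re| ≤ (∑ i, |(θ₀ i).re|) + 1 := by
    intro i
    have h1 : |(θ i - θ₀ i).re| ≤ 1 := (abs_re_le_norm _).trans ((hθ i).trans (min_le_right _ _))
    have h2 : |(θ₀ i).re| ≤ ∑ i, |(θ₀ i).re| :=
      abs_le_sum_abs (fun i => (θ₀ i).re) i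
    have h3 := abs_add_le ((θ i - θ₀ i).re) (θ₀ i).re
    rw [sub_re, sub_add_cancel] at h3
    rw [sub_re] at h1
    linarith
  calc ‖kern θ z‖ * weight z.re ^ n
      ≤ ‖kern θ z‖ * ((∏ i, weight (z.re - (θ i).re)) * weight ((∑ i, |(θ₀ i).re|) + 1) ^ n) := by
        gcongr; exact weight_pow_le_prod hA _
    _ = (∏ i, ‖chi (z - θ i)‖ * weight ((z - θ i).re)) * weight ((∑ i, |(θ₀ i).re|) + 1) ^ n := by
        rw [kern, norm_prod, prod_mul_distrib]; simp only [sub_re]; ring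
    _ ≤ _ := by
        refine mul_le_mul_of_nonneg_right (prod_le_prod (fun i _ => ?_) fun i _ => ?_)
          (pow_nonneg (weight_pos _).le _)
        · exact mul_nonneg (norm_nonneg _) (weight_pos _).le
        · exact (hC i _ (key i)).2

theorem exists_norm_kern_le {n : ℕ} (θ : Fin n → ℂ) (M : ℝ) : ∃ A C : ℝ, ∀ z : ℂ, |z.im| ≤ M →
    A ≤ |z.re| → (∀ i, rchi (z - θ i) ≠ 0) ∧ ‖kern θ z‖ * weight z.re ^ n ≤ C := by
  have hS : ∀ i, |(θ i).re| ≤ ∑ i, |(θ i).re| := fun i =>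
    abs_le_sum_abs (fun i => (θ i).re) i
  have hS' : ∀ i, |(θ i).im| ≤ ∑ i, |(θ i).im| := fun i =>
    abs_le_sum_abs (fun i => (θ i).im) i
  obtain ⟨C, hC⟩ := exists_norm_chi_le (M + ∑ i, |(θ i).im|)
  refine ⟨(∑ i, |(θ i).re|) + 1, C ^ n * weight (∑ i, |(θ i).re|) ^ n, fun z hz hz1 => ?_⟩
  have h1 : ∀ i, 1 ≤ |(z - θ i).re| := by
    intro i
    have h3 := abs_add_le ((z - θ i).re) (θ i).re
    rw [sub_re, sub_add_cancel] at h3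
    rw [sub_re]
    have := hS i
    linarith
  have h2 : ∀ i, |(z - θ i).im| ≤ M + ∑ i, |(θ i).im| := by
    intro i
    rw [sub_im]
    refine (abs_sub _ _).trans ?_
    have := hS' i
    linarith
  refine ⟨fun i => ?_, ?_⟩
  · rw [Ne, rchi_eq_zero_iff]
    intro hk
    have h4 := h1 i
    rcases hk with ⟨k, hk | hk⟩ <;> rw [hk] at h4 <;> simp at h4 <;> norm_num at h4
  calc ‖kern θ z‖ * weight z.re ^ n
      ≤ ‖kern θ z‖ * ((∏ i, weight (z.re - (θ i).re)) * weight (∑ i, |(θ i).re|) ^ n) := by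
        gcongr; exact weight_pow_le_prod hS _
    _ = (∏ i, ‖chi (z - θ i)‖ * weight ((z - θ i).re)) * weight (∑ i, |(θ i).re|) ^ n := by
        rw [kern, norm_prod, prod_mul_distrib]; simp only [sub_re]; ring
    _ ≤ (∏ _i : Fin n, C) * weight (∑ i, |(θ i).re|) ^ n := by
        refine mul_le_mul_of_nonneg_right (prod_le_prod (fun i _ => ?_) fun i _ => ?_)
          (pow_nonneg (weight_pos _).le _)
        · exact mul_nonneg (norm_nonneg _) (weight_pos _).le
        · exact hC _ (h2 i) (h1 i)
    _ = _ := by simp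

/-! ### Moving a horizontal line across poles -/

theorem integrable_inv_sq_add_sq {e : ℝ} (he : e ≠ 0) : Integrable fun x : ℝ => (x ^ 2 + e ^ 2)⁻¹ := by
  have h := (integrable_inv_one_add_sq.comp_div he).const_mul (e ^ 2)⁻¹
  refine h.congr (Eventually.of_forall fun x => ?_)
  simp only
  rw [← mul_inv]; congr 1
  field_simp; ring

theorem integral_div_sq_add_sq {e : ℝ} (he : e ≠ 0) :
    ∫ x : ℝ, e * (x ^ 2 + e ^ 2)⁻¹ = |e| / e * π := by
  have h : ∀ x : ℝ, e * (x ^ 2 + e ^ 2)⁻¹ = e⁻¹ * (1 + (x / e) ^ 2)⁻¹ := by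
    intro x
    have h1 : x ^ 2 + e ^ 2 ≠ 0 := by positivity
    have h2 : 1 + (x / e) ^ 2 ≠ 0 := by positivity
    field_simp
    ring
  simp_rw [h]
  rw [integral_const_mul, Measure.integral_comp_div (fun x : ℝ => (1 + x ^ 2)⁻¹) e,
    integral_univ_inv_one_add_sq, smul_eq_mul]
  ring

theorem norm_ofReal_add_mul_I_sq (x e : ℝ) : ‖(x : ℂ) + e * I‖ ^ 2 = x ^ 2 + e ^ 2 := by
  rw [norm_add_mul_I, Real.sq_sqrt (by positivity)]

theorem ofReal_add_mul_I_ne_zero {x e : ℝ} (he : e ≠ 0) : (x : ℂ) + e * I ≠ 0 := by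
  intro h
  have := congrArg im h
  simp at this; exact he this

theorem integrable_inv_sub_inv {e E : ℝ} (he : e ≠ 0) (hE : E ≠ 0) :
    Integrable fun x : ℝ => ((x : ℂ) + e * I)⁻¹ - ((x : ℂ) + E * I)⁻¹ := by
  have h := ((integrable_inv_sq_add_sq he).add (integrable_inv_sq_add_sq hE)).const_mul (|E - e| / 2)
  have hc : ∀ e : ℝ, e ≠ 0 → Continuous fun x : ℝ => ((x : ℂ) + e * I)⁻¹ := fun e he =>
    Continuous.inv₀ (by fun_prop) fun x => ofReal_add_mul_I_ne_zero he
  refine h.mono' ((hc e he).sub (hc E hE)).aestronglyMeasurable (Eventually.of_forall fun x => ?_)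
  have n1 := ofReal_add_mul_I_ne_zero (x := x) he
  have n2 := ofReal_add_mul_I_ne_zero (x := x) hE
  rw [inv_sub_inv n1 n2]
  have e1 : (x : ℂ) + E * I - (x + e * I) = ((E - e : ℝ) : ℂ) * I := by push_cast; ring
  rw [e1, norm_div, norm_mul, norm_I, mul_one, norm_real, norm_eq_abs, norm_mul,
    Pi.add_apply, ← norm_ofReal_add_mul_I_sq, ← norm_ofReal_add_mul_I_sq]
  have p1 := norm_pos_iff.2 n1
  have p2 := norm_pos_iff.2 n2
  generalize ‖(x : ℂ) + e * I‖ = a at *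
  generalize ‖(x : ℂ) + E * I‖ = b at *
  have : (a * b)⁻¹ ≤ ((a ^ 2)⁻¹ + (b ^ 2)⁻¹) / 2 := by
    have := two_mul_le_add_sq a⁻¹ b⁻¹
    rw [inv_pow, inv_pow] at this
    rw [mul_inv]; linarith
  calc |E - e| / (a * b) = |E - e| * (a * b)⁻¹ := div_eq_mul_inv _ _
    _ ≤ |E - e| * (((a ^ 2)⁻¹ + (b ^ 2)⁻¹) / 2) := by gcongr
    _ = _ := by ring

theorem integral_inv_sub_inv {e E : ℝ} (he : e < 0) (hE : 0 < E) :
    ∫ x : ℝ, (((x : ℂ) + e * I)⁻¹ - ((x : ℂ) + E * I)⁻¹) = 2 * π * I := by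
  set D : ℝ → ℂ := fun x => ((x : ℂ) + e * I)⁻¹ - ((x : ℂ) + E * I)⁻¹ with hD
  have hInt : Integrable D := integrable_inv_sub_inv he.ne hE.ne'
  have h1 : ∫ x, D (-x) = ∫ x, D x := integral_neg_eq_self D volume
  have h2 : ∫ x, (D x + D (-x)) = (∫ x, D x) + ∫ x, D x := by
    rw [integral_add hInt hInt.comp_neg, h1]
  have h3 : ∀ x, D x + D (-x) =
      (((-2 : ℝ) * (e * (x ^ 2 + e ^ 2)⁻¹ - E * (x ^ 2 + E ^ 2)⁻¹) : ℝ) : ℂ) * I := by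
    intro x
    have key : ∀ a : ℝ, a ≠ 0 → ((x : ℂ) + a * I)⁻¹ + (((-x : ℝ) : ℂ) + a * I)⁻¹ =
        ((-2 * (a * (x ^ 2 + a ^ 2)⁻¹) : ℝ) : ℂ) * I := by
      intro a ha
      have n1 := ofReal_add_mul_I_ne_zero (x := x) ha
      have n2 := ofReal_add_mul_I_ne_zero (x := -x) ha
      have n3 : (x : ℂ) ^ 2 + (a : ℂ) ^ 2 ≠ 0 := by
        have : x ^ 2 + a ^ 2 ≠ 0 := by positivity
        exact_mod_cast this
      have e1 : ((x : ℂ) + a * I) * (((-x : ℝ) : ℂ) + a * I) = -((x : ℂ) ^ 2 + a ^ 2) := by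
        push_cast; ring_nf; rw [I_sq]; ring
      rw [← one_div, ← one_div, div_add_div _ _ n1 n2, e1]
      push_cast
      rw [div_neg]
      field_simp
      ring
    have k1 := key e he.ne
    have k2 := key E hE.ne'
    simp only [hD]
    rw [show ∀ a b c d : ℂ, a - b + (c - d) = (a + c) - (b + d) from fun a b c d => by ring, k1, k2]
    push_cast; ring
  simp_rw [h3] at h2
  rw [integral_mul_const, integral_complex_ofReal, integral_const_mul, integral_sub
    ((integrable_inv_sq_add_sq he.ne).const_mul e) ((integrable_inv_sq_add_sq hE.ne').const_mul E),
    integral_div_sq_add_sq he.ne, integral_div_sq_add_sq hE.ne', abs_of_neg he, abs_of_pos hE,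
    neg_div, div_self he.ne, div_self hE.ne'] at h2
  have h4 : ∫ x, D x = ((∫ x, D x) + ∫ x, D x) / 2 := by ring
  rw [h4, ← h2]
  push_cast; ring

theorem integral_strip_eq_zero {f : ℂ → ℂ} {a b : ℝ} (hab : a < b)
    (hf : ∀ z : ℂ, a ≤ z.im → z.im ≤ b → DifferentiableAt ℂ f z)
    (hInt : Integrable fun x : ℝ => f (x + a * I) - f (x + b * I))
    {g : ℝ → ℝ} (hg : Tendsto g atTop (𝓝 0))
    (hfg : ∀ᶠ T in atTop, ∀ z : ℂ, a ≤ z.im → z.im ≤ b → |z.re| = T → ‖f z‖ ≤ g T) :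
    ∫ x : ℝ, (f (x + a * I) - f (x + b * I)) = 0 := by
  have hlim := intervalIntegral_tendsto_integral hInt tendsto_neg_atTop_atBot tendsto_id
  refine tendsto_nhds_unique hlim ?_
  have hcont : ∀ y, a ≤ y → y ≤ b → Continuous fun x : ℝ => f (x + y * I) := by
    intro y h1 h2
    refine continuous_iff_continuousAt.2 fun x => ?_
    refine ContinuousAt.comp (f := fun x : ℝ => (x : ℂ) + y * I) (hf _ ?_ ?_).continuousAt (by fun_prop)
    · simpa using h1
    · simpa using h2
  have hrect : ∀ T : ℝ, 0 ≤ T → (∫ x in (-T)..T, (f (x + a * I) - f (x + b * I))) =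
      -(I • (∫ y in a..b, f (T + y * I)) - I • ∫ y in a..b, f (((-T : ℝ) : ℂ) + y * I)) := by
    intro T hT
    have hd : DifferentiableOn ℂ f (uIcc (-T) T ×ℂ uIcc a b) := by
      intro z hz
      rw [mem_reProdIm, uIcc_of_le hab.le] at hz
      exact (hf z hz.2.1 hz.2.2).differentiableWithinAt
    have h := integral_boundary_rect_eq_zero_of_differentiableOn f
      (((-T : ℝ) : ℂ) + a * I) ((T : ℂ) + b * I) (by simpa using hd)
    simp only [add_re, ofReal_re, mul_re, I_re, mul_zero, ofReal_im, I_im, mul_one, sub_self, add_zero,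
      add_im, mul_im, zero_add] at h
    rw [intervalIntegral.integral_sub ((hcont a le_rfl hab.le).intervalIntegrable _ _)
      ((hcont b hab.le le_rfl).intervalIntegrable _ _)]
    linear_combination h
  have hbound : ∀ᶠ T in atTop, ‖∫ x in (-T)..T, (f (x + a * I) - f (x + b * I))‖ ≤
      2 * (g T * |b - a|) := by
    filter_upwards [hfg, eventually_ge_atTop 0] with T hT hT0
    rw [hrect T hT0, norm_neg]
    have k : ∀ t : ℝ, |t| = T → ‖∫ y in a..b, f ((t : ℂ) + y * I)‖ ≤ g T * |b - a| := by
      intro t ht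
      refine intervalIntegral.norm_integral_le_of_norm_le_const fun y hy => ?_
      rw [uIoc_of_le hab.le] at hy
      exact hT _ (by simpa using hy.1.le) (by simpa using hy.2) (by simpa using ht)
    refine (norm_sub_le _ _).trans ?_
    rw [norm_smul, norm_smul, norm_I, one_mul, one_mul]
    have k1 := k T (abs_of_nonneg hT0)
    have k2 := k (-T) (by rw [abs_neg, abs_of_nonneg hT0])
    linarith
  have hz : Tendsto (fun T => 2 * (g T * |b - a|)) atTop (𝓝 0) := by
    simpa using (hg.mul_const |b - a|).const_mul 2
  exact squeeze_zero_norm' hbound hz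

theorem exists_differentiable_extension {f : ℂ → ℂ} {c A : ℂ} {U : Set ℂ} (hU : IsOpen U) (hc : c ∈ U)
    (hf : ∀ z ∈ U, z ≠ c → DifferentiableAt ℂ f z)
    (hA : Tendsto (fun z => (z - c) * f z) (𝓝[≠] c) (𝓝 A)) :
    ∃ v : ℂ, ∀ z ∈ U, DifferentiableAt ℂ (Function.update (fun z => f z - A / (z - c)) c v) z := by
  set h : ℂ → ℂ := fun z => f z - A / (z - c) with hh
  have hd : ∀ z ∈ U, z ≠ c → DifferentiableAt ℂ h z := fun z hz hzc =>
    (hf z hz hzc).sub ((differentiableAt_const A).div (by fun_prop) (sub_ne_zero.2 hzc))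
  have ho : Tendsto (fun z => (z - c) * h z) (𝓝[≠] c) (𝓝 0) := by
    have := hA.sub_const A
    rw [sub_self] at this
    refine this.congr' ?_
    filter_upwards [self_mem_nhdsWithin] with z hz
    have : z - c ≠ 0 := sub_ne_zero.2 hz
    simp only [hh]; field_simp
  have hlo : (fun z => h z - h c) =o[𝓝[≠] c] fun z => (z - c)⁻¹ := by
    rw [Asymptotics.isLittleO_iff_tendsto']
    · have h0 : Tendsto (fun z => (z - c) * h c) (𝓝[≠] c) (𝓝 0) := by
        have : ContinuousAt (fun z : ℂ => (z - c) * h c) c := by fun_prop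
        simpa using this.tendsto.mono_left nhdsWithin_le_nhds
      have := ho.sub h0
      rw [sub_zero] at this
      refine this.congr fun z => ?_
      rw [div_inv_eq_mul]; ring
    · filter_upwards [self_mem_nhdsWithin] with z hz h0
      exact absurd h0 (inv_ne_zero (sub_ne_zero.2 hz))
  have hdiff := differentiableOn_update_limUnder_of_isLittleO (hU.mem_nhds hc)
    (fun z hz => (hd z hz.1 hz.2).differentiableWithinAt) hlo
  exact ⟨_, fun z hz => hdiff.differentiableAt (hU.mem_nhds hz)⟩

theorem tendsto_div_sub_atTop (A : ℂ) (t : ℝ) : Tendsto (fun T : ℝ => ‖A‖ / (T - t)) atTop (𝓝 0) :=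
  (tendsto_const_nhds).div_atTop (tendsto_atTop_add_const_right _ _ tendsto_id)

/-- The residue theorem for a strip. -/
theorem integral_strip_sub {a b : ℝ} (hab : a < b) (S : Finset ℂ) (A : ℂ → ℂ) :
    ∀ {f : ℂ → ℂ}, (∀ c ∈ S, a < c.im ∧ c.im < b) →
    (∀ z : ℂ, a ≤ z.im → z.im ≤ b → z ∉ S → DifferentiableAt ℂ f z) →
    (∀ c ∈ S, Tendsto (fun z => (z - c) * f z) (𝓝[≠] c) (𝓝 (A c))) →
    (Integrable fun x : ℝ => f (x + a * I) - f (x + b * I)) →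
    (∃ g : ℝ → ℝ, Tendsto g atTop (𝓝 0) ∧
      ∀ᶠ T in atTop, ∀ z : ℂ, a ≤ z.im → z.im ≤ b → |z.re| = T → ‖f z‖ ≤ g T) →
    ∫ x : ℝ, (f (x + a * I) - f (x + b * I)) = 2 * π * I * ∑ c ∈ S, A c := by
  classical
  induction S using Finset.induction_on with
  | empty =>
    intro f _ hf _ hInt hg
    obtain ⟨g, hg, hfg⟩ := hg
    rw [Finset.sum_empty, mul_zero]
    exact integral_strip_eq_zero hab (fun z h1 h2 => hf z h1 h2 (by simp)) hInt hg hfg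
  | insert c S hcS ih =>
    intro f hS hf hA hInt hg
    obtain ⟨g, hg, hfg⟩ := hg
    have hc := hS c (Finset.mem_insert_self c S)
    obtain ⟨ε, hε, hU, hUS⟩ : ∃ ε > 0, (∀ z ∈ ball c ε, a ≤ z.im ∧ z.im ≤ b) ∧
        ∀ z ∈ ball c ε, z ∉ S := by
      have h1 : ∀ᶠ z in 𝓝 c, a < z.im := continuous_im.continuousAt.eventually (lt_mem_nhds hc.1)
      have h2 : ∀ᶠ z in 𝓝 c, z.im < b := continuous_im.continuousAt.eventually (gt_mem_nhds hc.2)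
      have h3 : ∀ᶠ z in 𝓝 c, z ∉ S :=
        (S.finite_toSet.isClosed.isOpen_compl).mem_nhds (by simpa using hcS)
      obtain ⟨ε, hε, h⟩ := Metric.eventually_nhds_iff_ball.1 (h1.and (h2.and h3))
      exact ⟨ε, hε, fun z hz => ⟨(h z hz).1.le, (h z hz).2.1.le⟩, fun z hz => (h z hz).2.2⟩
    obtain ⟨v, hv⟩ := exists_differentiable_extension (f := f) (A := A c) Metric.isOpen_ball
      (mem_ball_self hε) (fun z hz hzc => hf z (hU z hz).1 (hU z hz).2 (by
        rw [Finset.mem_insert, not_or]; exact ⟨hzc, hUS z hz⟩)) (hA c (Finset.mem_insert_self c S))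
    set h : ℂ → ℂ := Function.update (fun z => f z - A c / (z - c)) c v with hh
    have hne : ∀ z, z ≠ c → h z = f z - A c / (z - c) := fun z hz => by
      rw [hh, Function.update_of_ne hz]
    have hnea : ∀ x : ℝ, (x : ℂ) + a * I ≠ c := by
      intro x hx; rw [← hx] at hc; simp at hc
    have hneb : ∀ x : ℝ, (x : ℂ) + b * I ≠ c := by
      intro x hx; rw [← hx] at hc; simp at hc
    have hea : a - c.im ≠ 0 := sub_ne_zero.2 hc.1.ne
    have heb : b - c.im ≠ 0 := sub_ne_zero.2 hc.2.ne'
    have hsplit : ∀ x : ℝ, h (x + a * I) - h (x + b * I) = (f (x + a * I) - f (x + b * I)) -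
        A c * ((((x - c.re : ℝ) : ℂ) + (a - c.im : ℝ) * I)⁻¹ -
          (((x - c.re : ℝ) : ℂ) + (b - c.im : ℝ) * I)⁻¹) := by
      intro x
      rw [hne _ (hnea x), hne _ (hneb x)]
      have e : ∀ y : ℝ, (x : ℂ) + y * I - c = ((x - c.re : ℝ) : ℂ) + (y - c.im : ℝ) * I := by
        intro y
        apply Complex.ext <;> simp
      rw [e, e, div_eq_mul_inv, div_eq_mul_inv]; ring
    have hDint := ((integrable_inv_sub_inv hea heb).comp_sub_right c.re).const_mul (A c)
    have hDval : ∫ x : ℝ, A c * ((((x - c.re : ℝ) : ℂ) + (a - c.im : ℝ) * I)⁻¹ -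
          (((x - c.re : ℝ) : ℂ) + (b - c.im : ℝ) * I)⁻¹) = A c * (2 * π * I) := by
      rw [integral_const_mul, integral_sub_right_eq_self (fun x : ℝ =>
        (((x : ℂ) + (a - c.im : ℝ) * I)⁻¹ - ((x : ℂ) + (b - c.im : ℝ) * I)⁻¹)) c.re,
        integral_inv_sub_inv (by linarith [hc.1]) (by linarith [hc.2])]
    have hmain := ih (f := h) (fun d hd => hS d (Finset.mem_insert_of_mem hd)) ?_ ?_ ?_ ?_
    · simp_rw [hsplit] at hmain
      rw [integral_sub hInt hDint, hDval] at hmain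
      rw [sum_insert hcS]
      linear_combination hmain
    · intro z h1 h2 hzS
      by_cases hzc : z = c
      · rw [hzc]; exact hv c (mem_ball_self hε)
      · have : DifferentiableAt ℂ (fun z => f z - A c / (z - c)) z :=
          (hf z h1 h2 (by rw [Finset.mem_insert, not_or]; exact ⟨hzc, hzS⟩)).sub
            ((differentiableAt_const _).div (by fun_prop) (sub_ne_zero.2 hzc))
        refine this.congr_of_eventuallyEq ?_
        filter_upwards [isOpen_ne.mem_nhds hzc] with w hw using hne w hw
    · intro d hd
      have hdc : d ≠ c := fun h => hcS (h ▸ hd)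
      have h1 := hA d (Finset.mem_insert_of_mem hd)
      have h2 : Tendsto (fun z => (z - d) * (A c / (z - c))) (𝓝[≠] d) (𝓝 0) := by
        have : ContinuousAt (fun z => (z - d) * (A c / (z - c))) d :=
          ContinuousAt.mul (by fun_prop) (continuousAt_const.div (by fun_prop) (sub_ne_zero.2 hdc))
        simpa using this.tendsto.mono_left nhdsWithin_le_nhds
      have h3 := h1.sub h2
      rw [sub_zero] at h3
      refine h3.congr' ?_
      have : ∀ᶠ z in 𝓝[≠] d, z ≠ c := eventually_nhdsWithin_of_eventually_nhds (isOpen_ne.mem_nhds hdc)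
      filter_upwards [this] with z hz
      rw [hne z hz]; ring
    · simp_rw [hsplit]; exact hInt.sub hDint
    · refine ⟨fun T => g T + ‖A c‖ / (T - |c.re|), by
        simpa using hg.add (tendsto_div_sub_atTop (A c) |c.re|), ?_⟩
      filter_upwards [hfg, eventually_gt_atTop (|c.re|)] with T hT hTc z h1 h2 h3
      have hzc : T - |c.re| ≤ ‖z - c‖ := by
        refine le_trans ?_ (abs_re_le_norm _)
        rw [sub_re, ← h3]; exact abs_sub_abs_le_abs_sub _ _
      have hne' : z ≠ c := by
        rintro rfl; linarith
      rw [hne z hne']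
      refine (norm_sub_le _ _).trans (add_le_add (hT z h1 h2 h3) ?_)
      rw [norm_div]
      have : 0 < T - |c.re| := by linarith
      gcongr

theorem integral_strip_sub_indexed {ι : Type*} {a b : ℝ} (hab : a < b) (S : Finset ι) (c A : ι → ℂ)
    (hinj : ∀ i ∈ S, ∀ j ∈ S, c i = c j → i = j) {f : ℂ → ℂ} (hS : ∀ i ∈ S, a < (c i).im ∧ (c i).im < b)
    (hf : ∀ z : ℂ, a ≤ z.im → z.im ≤ b → (∀ i ∈ S, z ≠ c i) → DifferentiableAt ℂ f z)
    (hA : ∀ i ∈ S, Tendsto (fun z => (z - c i) * f z) (𝓝[≠] (c i)) (𝓝 (A i)))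
    (hInt : Integrable fun x : ℝ => f (x + a * I) - f (x + b * I))
    (hg : ∃ g : ℝ → ℝ, Tendsto g atTop (𝓝 0) ∧
      ∀ᶠ T in atTop, ∀ z : ℂ, a ≤ z.im → z.im ≤ b → |z.re| = T → ‖f z‖ ≤ g T) :
    ∫ x : ℝ, (f (x + a * I) - f (x + b * I)) = 2 * π * I * ∑ i ∈ S, A i := by
  classical
  have h := integral_strip_sub hab (S.image c) (fun z => ∑ i ∈ S with c i = z, A i) (f := f)
    ?_ ?_ ?_ hInt hg
  · rw [h, Finset.sum_fiberwise_of_maps_to fun i hi => Finset.mem_image_of_mem c hi]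
  · intro z hz
    obtain ⟨i, hi, rfl⟩ := Finset.mem_image.1 hz
    exact hS i hi
  · intro z h1 h2 hz
    refine hf z h1 h2 fun i hi h => hz ?_
    rw [h]; exact Finset.mem_image_of_mem c hi
  · intro z hz
    obtain ⟨i, hi, rfl⟩ := Finset.mem_image.1 hz
    have : (∑ j ∈ S with c j = c i, A j) = A i := by
      rw [Finset.sum_eq_single i]
      · intro j hj hji
        rw [Finset.mem_filter] at hj
        exact absurd (hinj j hj.1 i hi hj.2) hji
      · intro h; exact (h (by simp [hi])).elim
    simp only [this]
    exact hA i hi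

theorem circleIntegral_eq_residue {f : ℂ → ℂ} {c A : ℂ} {r : ℝ} (hr : 0 < r) {U : Set ℂ} (hU : IsOpen U)
    (hcU : closedBall c r ⊆ U) (hf : ∀ z ∈ U, z ≠ c → DifferentiableAt ℂ f z)
    (hA : Tendsto (fun z => (z - c) * f z) (𝓝[≠] c) (𝓝 A)) :
    (∮ z in C(c, r), f z) = 2 * π * I * A := by
  obtain ⟨v, hv⟩ := exists_differentiable_extension hU (hcU (Metric.mem_closedBall_self hr.le)) hf hA
  set h : ℂ → ℂ := Function.update (fun z => f z - A / (z - c)) c v with hh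
  have hne : ∀ z, z ≠ c → h z = f z - A / (z - c) := fun z hz => by
    rw [hh, Function.update_of_ne hz]
  have hsph : ∀ z ∈ Metric.sphere c r, z ≠ c := by
    rintro z hz rfl; simp at hz; exact hr.ne hz
  have h0 : (∮ z in C(c, r), h z) = 0 :=
    circleIntegral_eq_zero_of_differentiable_on_off_countable hr.le countable_empty
      (fun z hz => (hv z (hcU hz)).continuousAt.continuousWithinAt)
      fun z hz => hv z (hcU (Metric.ball_subset_closedBall hz.1))
  have e1 : (∮ z in C(c, r), f z) = ∮ z in C(c, r), (h z + A • (z - c)⁻¹) := by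
    refine circleIntegral.integral_congr hr.le fun z hz => ?_
    rw [hne z (hsph z hz), smul_eq_mul, div_eq_mul_inv]; ring
  have i1 : CircleIntegrable h c r := by
    refine ContinuousOn.circleIntegrable hr.le fun z hz => ?_
    exact (hv z (hcU (Metric.sphere_subset_closedBall hz))).continuousAt.continuousWithinAt
  have i2 : CircleIntegrable (fun z => A • (z - c)⁻¹) c r := by
    refine ContinuousOn.circleIntegrable hr.le fun z hz => ?_
    have := sub_ne_zero.2 (hsph z hz)
    exact ContinuousAt.continuousWithinAt (by fun_prop (disch := assumption))
  rw [e1, circleIntegral.integral_add i1 i2, h0, circleIntegral.integral_smul,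
    circleIntegral.integral_sub_center_inv _ hr.ne', smul_eq_mul]
  ring

/-! ### The integral transform in one variable -/

/-- Entire functions whose product with `n` factors `chi` is integrable on horizontal lines. -/
def admissible (n : ℕ) : Submodule ℂ (ℂ → ℂ) where
  carrier := {e | Differentiable ℂ e ∧ ∀ M : ℝ, ∃ C : ℝ, ∀ z : ℂ, |z.im| ≤ M →
    ‖e z‖ * (1 + |z.re|) ^ 2 ≤ C * weight z.re ^ n}
  zero_mem' := ⟨differentiable_const 0, fun M => ⟨0, fun z _ => by simp⟩⟩
  add_mem' := by
    rintro e e' ⟨hd, h⟩ ⟨hd', h'⟩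
    refine ⟨hd.add hd', fun M => ?_⟩
    obtain ⟨C, hC⟩ := h M
    obtain ⟨C', hC'⟩ := h' M
    refine ⟨C + C', fun z hz => ?_⟩
    rw [add_mul]
    refine le_trans ?_ (add_le_add (hC z hz) (hC' z hz))
    rw [← add_mul]
    exact mul_le_mul_of_nonneg_right (norm_add_le _ _) (by positivity)
  smul_mem' := by
    rintro c e ⟨hd, h⟩
    refine ⟨hd.const_smul c, fun M => ?_⟩
    obtain ⟨C, hC⟩ := h M
    refine ⟨‖c‖ * C, fun z hz => ?_⟩
    rw [Pi.smul_apply, norm_smul, mul_assoc, mul_assoc]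
    exact mul_le_mul_of_nonneg_left (hC z hz) (norm_nonneg c)

/-- The integral of `kern θ * e` over the line `Im z = y`. -/
def lineInt {n : ℕ} (θ : Fin n → ℂ) (y : ℝ) (e : ℂ → ℂ) : ℂ :=
  ∫ x : ℝ, kern θ (x + y * I) * e (x + y * I)

/-- The regular factors of `kern θ` at the pole `z` of its factor `i`. -/
def kernOther {n : ℕ} (θ : Fin n → ℂ) (i : Fin n) (z : ℂ) : ℂ :=
  ∏ l, if l = i then 1 else chi (z - θ l)

/-- The sum of the residues of `kern θ * e` at `θ_i - 2kiπ`, `k < N i`. -/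
def poleSum {n : ℕ} (θ : Fin n → ℂ) (N : Fin n → ℕ) (e : ℂ → ℂ) : ℂ :=
  ∑ i, ∑ k ∈ Finset.range (N i),
    chiRes k * kernOther θ i (θ i - 2 * k * iπ) * e (θ i - 2 * k * iπ)

/-- The integral over the line `Im z = y` and over clockwise circles about `θ_i - 2kiπ`,
`k < N i`. -/
def lineFun {n : ℕ} (θ : Fin n → ℂ) (y : ℝ) (N : Fin n → ℕ) (e : ℂ → ℂ) : ℂ :=
  lineInt θ y e - 2 * iπ * poleSum θ N e

/-- The line `Im z = y` runs below the points `θ_i - 2kiπ`, `k < N i`, and above those with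
`N i ≤ k`, and below all `θ_i - iπ`. -/
def GoodLine {n : ℕ} (θ : Fin n → ℂ) (y : ℝ) (N : Fin n → ℕ) : Prop :=
  ∀ i, y < (θ i).im - π ∧ (θ i).im - 2 * π * N i < y ∧ y < (θ i).im - 2 * π * (N i - 1)

section
variable {n : ℕ} {θ : Fin n → ℂ} {y : ℝ} {N : Fin n → ℕ} {e : ℂ → ℂ}

theorem GoodLine.kernHeight (h : GoodLine θ y N) : KernHeight θ y := by
  intro i k
  obtain ⟨h1, h2, h3⟩ := h i
  have hπ := pi_pos
  constructor
  · intro hk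
    rcases lt_or_ge k (N i) with hlt | hge
    · have : (k : ℝ) + 1 ≤ N i := by exact_mod_cast hlt
      nlinarith
    · have : (N i : ℝ) ≤ k := by exact_mod_cast hge
      nlinarith
  · intro hk
    have : (0 : ℝ) ≤ k := Nat.cast_nonneg k
    nlinarith

theorem GoodLine.lt_iff (h : GoodLine θ y N) (i : Fin n) (k : ℕ) :
    k < N i ↔ y < (θ i).im - 2 * π * k := by
  obtain ⟨h1, h2, h3⟩ := h i
  have hπ := pi_pos
  constructor
  · intro hlt
    have : (k : ℝ) + 1 ≤ N i := by exact_mod_cast hlt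
    nlinarith
  · intro hy
    by_contra hge
    have : (N i : ℝ) ≤ k := by exact_mod_cast not_lt.1 hge
    nlinarith

theorem exists_goodLine (θ : Fin n → ℂ) (B : ℝ) : ∃ y < B, ∃ N, GoodLine θ y N := by
  have hπ := pi_pos
  have hcount : (⋃ i : Fin n, ⋃ k : ℕ, {(θ i).im - 2 * π * k}).Countable :=
    countable_iUnion fun i => countable_iUnion fun k => countable_singleton _
  have hd := hcount.dense_compl ℝ
  obtain ⟨y, hy, hyB⟩ := hd.exists_mem_open (isOpen_Iio (a := min B (-(∑ i, |(θ i).im|) - π)))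
    nonempty_Iio
  rw [mem_Iio, lt_min_iff] at hyB
  have hlow : ∀ i, y < (θ i).im - π := by
    intro i
    have h2 : |(θ i).im| ≤ ∑ i, |(θ i).im| :=
      abs_le_sum_abs (fun i => (θ i).im) i
    have := neg_abs_le (θ i).im
    linarith [hyB.2]
  refine ⟨y, hyB.1, fun i => ⌈((θ i).im - y) / (2 * π)⌉₊, fun i => ⟨hlow i, ?_, ?_⟩⟩
  · have h1 := Nat.le_ceil (((θ i).im - y) / (2 * π))
    rw [div_le_iff₀ (by positivity)] at h1
    refine lt_of_le_of_ne (by linarith) fun h => hy ?_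
    exact mem_iUnion.2 ⟨i, mem_iUnion.2 ⟨_, h.symm⟩⟩
  · have h0 : 0 ≤ ((θ i).im - y) / (2 * π) := div_nonneg (by linarith [hlow i]) (by positivity)
    have h1 := Nat.ceil_lt_add_one h0
    rw [← sub_lt_iff_lt_add, lt_div_iff₀ (by positivity)] at h1
    linarith

theorem differentiableAt_chi_comp {E : Type*} [NormedAddCommGroup E] [NormedSpace ℂ E] {f : E → ℂ}
    {x : E} (hf : DifferentiableAt ℂ f x) (h : rchi (f x) ≠ 0) :
    DifferentiableAt ℂ (fun x => chi (f x)) x :=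
  (differentiableAt_chi h).comp x hf

theorem differentiableAt_kern {z : ℂ} (h : ∀ i, rchi (z - θ i) ≠ 0) :
    DifferentiableAt ℂ (kern θ) z := by
  unfold kern
  refine DifferentiableAt.fun_finsetProd fun i _ => ?_
  exact (differentiableAt_chi (h i)).comp z (by fun_prop : DifferentiableAt ℂ (fun z => z - θ i) z)

theorem exists_bound_of_bounds {C C' : ℝ} {a b : ℂ} {x : ℝ}
    (h : ‖a‖ * weight x ^ n ≤ C) (h' : ‖b‖ * (1 + |x|) ^ 2 ≤ C' * weight x ^ n) :
    ‖a * b‖ * (1 + |x|) ^ 2 ≤ C * C' := by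
  have hw := pow_pos (weight_pos x) n
  have hC : 0 ≤ C := le_trans (by positivity) h
  have hC' : 0 ≤ C' := by
    by_contra hneg
    have : C' * weight x ^ n < 0 := mul_neg_of_neg_of_pos (not_le.1 hneg) hw
    have h0 : 0 ≤ ‖b‖ * (1 + |x|) ^ 2 := by positivity
    linarith
  calc ‖a * b‖ * (1 + |x|) ^ 2 = ‖a‖ * (‖b‖ * (1 + |x|) ^ 2) := by rw [norm_mul]; ring
    _ ≤ ‖a‖ * (C' * weight x ^ n) := by gcongr
    _ = C' * (‖a‖ * weight x ^ n) := by ring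
    _ ≤ C' * C := by gcongr
    _ = C * C' := by ring

theorem le_div_one_add_sq {a C x : ℝ} (ha : 0 ≤ a) (h : a * (1 + |x|) ^ 2 ≤ C) :
    a ≤ C * (1 + x ^ 2)⁻¹ := by
  rw [← div_eq_mul_inv, le_div_iff₀ (by positivity)]
  refine le_trans ?_ h
  have : x ^ 2 = |x| ^ 2 := (sq_abs x).symm
  have h0 := abs_nonneg x
  gcongr
  nlinarith

theorem kern_exists_dominated {θ₀ : Fin n → ℂ} (h : KernHeight θ₀ y) (he : e ∈ admissible n) :
    ∃ R > 0, ∃ C : ℝ, ∀ θ ∈ ball θ₀ R, ∀ x : ℝ, (∀ i, rchi (x + y * I - θ i) ≠ 0) ∧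
      ‖kern θ (x + y * I) * e (x + y * I)‖ ≤ C * (1 + x ^ 2)⁻¹ := by
  obtain ⟨δ, hδ, C, hC⟩ := h.exists_bound
  obtain ⟨C', hC'⟩ := he.2 |y|
  refine ⟨δ, hδ, C * C', fun θ hθ x => ?_⟩
  have h1 : ∀ i, ‖θ i - θ₀ i‖ ≤ δ := by
    intro i
    rw [mem_ball_iff_norm] at hθ
    exact (norm_le_pi_norm (θ - θ₀) i).trans hθ.le
  obtain ⟨h2, h3⟩ := hC θ h1 (x + y * I) (by simpa using hδ.le)
  refine ⟨h2, le_div_one_add_sq (norm_nonneg _) ?_⟩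
  have h4 := hC' (x + y * I) (by simp)
  simp only [add_re, ofReal_re, mul_re, I_re, mul_zero, ofReal_im, I_im, mul_one, sub_self,
    add_zero] at h3 h4
  exact exists_bound_of_bounds h3 h4

theorem continuous_kern_line (h : ∀ x : ℝ, ∀ i, rchi (x + y * I - θ i) ≠ 0)
    (he : Differentiable ℂ e) : Continuous fun x : ℝ => kern θ (x + y * I) * e (x + y * I) := by
  refine continuous_iff_continuousAt.2 fun x => ?_
  have : ContinuousAt (fun z => kern θ z * e z) (x + y * I) :=
    (differentiableAt_kern (h x)).continuousAt.mul (he _).continuousAt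
  exact ContinuousAt.comp (f := fun x : ℝ => (x : ℂ) + y * I) this (by fun_prop)

theorem integrable_kern_line (h : KernHeight θ y) (he : e ∈ admissible n) :
    Integrable fun x : ℝ => kern θ (x + y * I) * e (x + y * I) := by
  obtain ⟨R, hR, C, hC⟩ := kern_exists_dominated h he
  have h0 := hC θ (mem_ball_self hR)
  exact (integrable_inv_one_add_sq.const_mul C).mono'
    (continuous_kern_line (fun x => (h0 x).1) he.1).aestronglyMeasurable
    (Eventually.of_forall fun x => (h0 x).2)

theorem analyticAt_lineInt {θ₀ : Fin n → ℂ} (h : KernHeight θ₀ y) (he : e ∈ admissible n) :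
    AnalyticAt ℂ (fun θ => lineInt θ y e) θ₀ := by
  obtain ⟨R, hR, C, hC⟩ := kern_exists_dominated h he
  refine analyticAt_integral_of_dominated hR (bound := fun x => C * (1 + x ^ 2)⁻¹) ?_ ?_ ?_
    (integrable_inv_one_add_sq.const_mul C)
  · intro θ hθ
    exact (continuous_kern_line (fun x => (hC θ hθ x).1) he.1).aestronglyMeasurable
  · intro x θ hθ
    refine DifferentiableAt.differentiableWithinAt ?_
    have hk : DifferentiableAt ℂ (fun θ : Fin n → ℂ => ∏ i, chi ((x : ℂ) + y * I - θ i)) θ :=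
      (HasFDerivAt.finsetProd fun i _ => (differentiableAt_chi_comp
        (f := fun θ : Fin n → ℂ => (x : ℂ) + y * I - θ i) (by fun_prop)
        ((hC θ hθ x).1 i)).hasFDerivAt).differentiableAt
    exact hk.mul_const _
  · intro θ hθ x
    exact (hC θ hθ x).2

theorem rchi_pole_ne_zero (hθ : θ ∈ generic n) {i l : Fin n} (hl : l ≠ i) (k : ℕ) :
    rchi (θ i - 2 * k * iπ - θ l) ≠ 0 := by
  refine rchi_ne_zero_of_generic fun m hm => hθ i l hl.symm (m + 2 * k) ?_
  push_cast; linear_combination hm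

theorem kern_eq_other (θ : Fin n → ℂ) (i : Fin n) (z : ℂ) :
    kern θ z = chi (z - θ i) * kernOther θ i z := by
  have h1 : kern θ z = ∏ l, ((if l = i then chi (z - θ l) else 1) *
      if l = i then 1 else chi (z - θ l)) := by
    unfold kern
    refine prod_congr rfl fun l _ => ?_
    split_ifs <;> simp
  rw [h1, prod_mul_distrib, Finset.prod_ite_eq' Finset.univ i]
  simp [kernOther]

theorem continuousAt_kernOther {i : Fin n} {z : ℂ} (h : ∀ l, l ≠ i → rchi (z - θ l) ≠ 0) :
    ContinuousAt (kernOther θ i) z := by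
  unfold kernOther
  refine tendsto_finsetProd _ fun l _ => ?_
  by_cases hl : l = i
  · simp [hl]
  · simp only [hl, if_false]
    exact ContinuousAt.comp (f := fun z => z - θ l) (differentiableAt_chi (h l hl)).continuousAt
      (by fun_prop)

theorem tendsto_kern_pole (hθ : θ ∈ generic n) (he : Differentiable ℂ e) (i : Fin n) (k : ℕ) :
    Tendsto (fun z => (z - (θ i - 2 * k * iπ)) * (kern θ z * e z)) (𝓝[≠] (θ i - 2 * k * iπ))
      (𝓝 (chiRes k * kernOther θ i (θ i - 2 * k * iπ) * e (θ i - 2 * k * iπ))) := by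
  have h1 : Tendsto (fun z : ℂ => z - θ i) (𝓝[≠] (θ i - 2 * k * iπ)) (𝓝[≠] (-(2 * k * iπ))) :=
    tendsto_punctured (by fun_prop) (by ring) fun z hz => by linear_combination hz
  have h2 := (tendsto_chi_lower k).comp h1
  have h3 : Tendsto (fun z => kernOther θ i z * e z) (𝓝[≠] (θ i - 2 * k * iπ))
      (𝓝 (kernOther θ i (θ i - 2 * k * iπ) * e (θ i - 2 * k * iπ))) := by
    refine Tendsto.mono_left ?_ nhdsWithin_le_nhds
    exact (continuousAt_kernOther fun l hl => rchi_pole_ne_zero hθ hl k).mul (he _).continuousAt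
  have h4 := h2.mul h3
  rw [show chiRes k * (kernOther θ i (θ i - 2 * k * iπ) * e (θ i - 2 * k * iπ)) =
    chiRes k * kernOther θ i (θ i - 2 * k * iπ) * e (θ i - 2 * k * iπ) from (mul_assoc _ _ _).symm] at h4
  refine h4.congr fun z => ?_
  simp only [Function.comp, kern_eq_other θ i z]
  ring

theorem exists_strip_bound (y y' : ℝ)
    (hgr : ∀ M : ℝ, ∃ C : ℝ, ∀ z : ℂ, |z.im| ≤ M → ‖e z‖ * (1 + |z.re|) ≤ C * weight z.re ^ n) :
    ∃ g : ℝ → ℝ, Tendsto g atTop (𝓝 0) ∧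
      ∀ᶠ T in atTop, ∀ z : ℂ, y ≤ z.im → z.im ≤ y' → |z.re| = T → ‖kern θ z * e z‖ ≤ g T := by
  obtain ⟨A, C, hC⟩ := exists_norm_kern_le θ (max |y| |y'|)
  obtain ⟨C', hC'⟩ := hgr (max |y| |y'|)
  refine ⟨fun T => C * C' * (1 + T)⁻¹, ?_, ?_⟩
  · have : Tendsto (fun T : ℝ => (1 + T)⁻¹) atTop (𝓝 0) :=
      tendsto_inv_atTop_zero.comp (tendsto_atTop_add_const_left _ _ tendsto_id)
    simpa using this.const_mul (C * C')
  · filter_upwards [eventually_ge_atTop A, eventually_ge_atTop 0] with T hT hT0 z h1 h2 h3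
    have him : |z.im| ≤ max |y| |y'| := abs_le_max_abs_abs h1 h2
    have h4 := (hC z him (by rw [h3]; exact hT)).2
    have h5 := hC' z him
    rw [h3] at h5
    have hw := pow_pos (weight_pos z.re) n
    rw [norm_mul, ← div_eq_mul_inv, le_div_iff₀ (by linarith)]
    refine le_of_mul_le_mul_right ?_ hw
    calc ‖kern θ z‖ * ‖e z‖ * (1 + T) * weight z.re ^ n
        = (‖kern θ z‖ * weight z.re ^ n) * (‖e z‖ * (1 + T)) := by ring
      _ ≤ C * (C' * weight z.re ^ n) := by
        refine mul_le_mul h4 h5 (by positivity) (le_trans (by positivity) h4)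
      _ = _ := by ring

theorem weak_growth_of_admissible (he : e ∈ admissible n) (M : ℝ) :
    ∃ C : ℝ, ∀ z : ℂ, |z.im| ≤ M → ‖e z‖ * (1 + |z.re|) ≤ C * weight z.re ^ n := by
  obtain ⟨C, hC⟩ := he.2 M
  refine ⟨C, fun z hz => le_trans ?_ (hC z hz)⟩
  have := abs_nonneg z.re
  refine mul_le_mul_of_nonneg_left ?_ (norm_nonneg _)
  nlinarith

theorem integral_kern_sub (hθ : θ ∈ generic n) {y' : ℝ} {N' : Fin n → ℕ} (h : GoodLine θ y N)
    (h' : GoodLine θ y' N') (hy : y < y') (he : Differentiable ℂ e)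
    (hgr : ∀ M : ℝ, ∃ C : ℝ, ∀ z : ℂ, |z.im| ≤ M → ‖e z‖ * (1 + |z.re|) ≤ C * weight z.re ^ n)
    (hInt : Integrable fun x : ℝ => kern θ (x + y * I) * e (x + y * I) -
      kern θ (x + y' * I) * e (x + y' * I)) :
    ∫ x : ℝ, (kern θ (x + y * I) * e (x + y * I) - kern θ (x + y' * I) * e (x + y' * I)) =
      2 * iπ * (poleSum θ N e - poleSum θ N' e) := by
  classical
  have hπ := pi_pos
  set S : Finset (Σ _ : Fin n, ℕ) :=
    Finset.univ.sigma fun i => Finset.range (N i) \ Finset.range (N' i) with hSdef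
  have hmemS : ∀ p : Σ _ : Fin n, ℕ, p ∈ S ↔ p.2 < N p.1 ∧ ¬ p.2 < N' p.1 := by
    rintro ⟨i, k⟩
    simp [hSdef]
  have hNN : ∀ i, N' i ≤ N i := by
    intro i
    by_contra hlt
    have h1 := (h'.lt_iff i (N i)).1 (not_le.1 hlt)
    have h2 := (h i).2.1
    linarith
  have hmain := integral_strip_sub_indexed hy S (fun p => θ p.1 - 2 * p.2 * iπ)
    (fun p => chiRes p.2 * kernOther θ p.1 (θ p.1 - 2 * p.2 * iπ) * e (θ p.1 - 2 * p.2 * iπ))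
    (f := fun z => kern θ z * e z) ?_ ?_ ?_ ?_ hInt ?_
  · rw [hSdef, Finset.sum_sigma, sum_congr rfl fun i _ =>
      Finset.sum_sdiff_eq_sub (Finset.range_subset_range.2 (hNN i)), sum_sub_distrib] at hmain
    rw [hmain]
    simp only [poleSum]
    ring
  · rintro ⟨i, k⟩ - ⟨j, l⟩ - hij
    simp only at hij
    by_cases hne : i = j
    · subst hne
      have : (2 * iπ) * ((k : ℂ) - l) = 0 := by linear_combination -hij
      have h1 := (mul_eq_zero.1 this).resolve_left two_ipi_ne_zero
      have : k = l := by exact_mod_cast sub_eq_zero.1 h1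
      rw [this]
    · exact absurd (by push_cast; linear_combination hij) (hθ i j hne (2 * k - 2 * l))
  · rintro ⟨i, k⟩ hp
    rw [hmemS] at hp
    have h1 := (h.lt_iff i k).1 hp.1
    have h2 := mt (h'.lt_iff i k).2 hp.2
    simp only [not_lt] at h2
    have h3 := (h'.kernHeight i k).1
    simp only [sub_im, mul_im, mul_re, I_re, I_im, ofReal_re, ofReal_im, re_ofNat, im_ofNat, natCast_re,
      natCast_im]
    constructor
    · linarith
    · refine lt_of_le_of_ne (by linarith) fun h4 => h3 (by linarith)
  · intro z h1 h2 hz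
    refine (differentiableAt_kern fun i hi => ?_).mul (he z)
    rw [rchi_eq_zero_iff] at hi
    obtain ⟨k, hk | hk⟩ := hi
    · have him : z.im = (θ i).im - 2 * π * k := by
        have := congrArg im hk
        simp at this; linarith
      refine hz ⟨i, k⟩ ?_ (by linear_combination hk)
      rw [hmemS]
      have h3 := (h.kernHeight i k).1
      constructor
      · rw [h.lt_iff, ← him]
        exact lt_of_le_of_ne h1 fun h4 => h3 (by linarith)
      · intro h4
        rw [h'.lt_iff] at h4
        linarith
    · have him : z.im = (θ i).im + (2 * k - 1) * π := by
        have := congrArg im hk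
        simp at this; linarith
      have h3 := (h' i).1
      have : (0 : ℝ) ≤ k := Nat.cast_nonneg k
      nlinarith
  · rintro ⟨i, k⟩ -
    exact tendsto_kern_pole hθ he i k
  · exact exists_strip_bound y y' hgr

theorem lineFun_eq_of_lt (hθ : θ ∈ generic n) {y' : ℝ} {N' : Fin n → ℕ} (h : GoodLine θ y N)
    (h' : GoodLine θ y' N') (hy : y < y') (he : e ∈ admissible n) :
    lineFun θ y N e = lineFun θ y' N' e := by
  have i1 := integrable_kern_line h.kernHeight he
  have i2 := integrable_kern_line h'.kernHeight he
  have hmain := integral_kern_sub hθ h h' hy he.1 (weak_growth_of_admissible he) (i1.sub i2)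
  rw [integral_sub i1 i2] at hmain
  simp only [lineFun, lineInt]
  linear_combination hmain

theorem lineFun_eq (hθ : θ ∈ generic n) {y' : ℝ} {N' : Fin n → ℕ} (h : GoodLine θ y N)
    (h' : GoodLine θ y' N') (he : e ∈ admissible n) : lineFun θ y N e = lineFun θ y' N' e := by
  rcases lt_trichotomy y y' with hlt | rfl | hgt
  · exact lineFun_eq_of_lt hθ h h' hlt he
  · have : N = N' := by
      funext i
      refine eq_of_forall_lt_iff fun k => ?_
      rw [h.lt_iff, h'.lt_iff]
    rw [this]
  · exact (lineFun_eq_of_lt hθ h' h hgt he).symm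
end

section
variable {n : ℕ} {θ : Fin n → ℂ} {y : ℝ} {N : Fin n → ℕ} {e : ℂ → ℂ}

theorem constR_eq : constR = 2 * iπ ^ 2 * chiRes 0 := by
  have h0 := tendsto_chi_lower 0
  simp only [Nat.cast_zero, mul_zero, zero_mul, add_zero, neg_zero] at h0
  have h1 : Tendsto (fun z : ℂ => -z - iπ) (𝓝[≠] 0) (𝓝 (-iπ)) := by
    have : ContinuousAt (fun z : ℂ => -z - iπ) 0 := by fun_prop
    simpa using this.tendsto.mono_left nhdsWithin_le_nhds
  have hreg : ∀ z ∈ ball (0 : ℂ) 2, z ≠ 0 → JostRegular z ∧ z + iπ ≠ 0 := by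
    intro z hz hz0
    have hn : ‖z‖ < 2 := by simpa using hz
    have hπ := Real.pi_gt_three
    have him := abs_im_le_norm z
    refine ⟨fun k => ⟨?_, ?_⟩, ?_⟩
    · rintro rfl
      rcases Nat.eq_zero_or_pos k with rfl | hk
      · simp at hz0
      · have hk1 : (1 : ℝ) ≤ k := by exact_mod_cast hk
        have h3 := hn
        simp at h3
        rw [abs_of_pos pi_pos] at h3
        nlinarith
    · rintro rfl
      have hk1 : (0 : ℝ) ≤ k := Nat.cast_nonneg k
      simp only [mul_im, add_re, mul_re, re_ofNat, natCast_re, im_ofNat, natCast_im, one_re, I_re,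
        ofReal_re, I_im, ofReal_im, add_im, one_im, mul_zero, zero_mul, sub_zero, add_zero, one_mul,
        zero_add, sub_self] at him
      rw [abs_of_nonneg (by positivity)] at him
      nlinarith
    · intro h
      have : z = -iπ := by linear_combination h
      rw [this] at hn
      simp at hn
      rw [abs_of_pos pi_pos] at hn
      linarith
  have hres := circleIntegral_eq_residue (f := jost) (c := 0) (A := chiRes 0 * (-iπ)) one_pos
    (Metric.isOpen_ball (x := (0 : ℂ)) (ε := 2)) (Metric.closedBall_subset_ball (by norm_num))
    (fun z hz hz0 => (hreg z hz hz0).1.differentiableAt) ?_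
  · have : constR = -∮ z in C(0, 1), jost z := by
      simp [constR, jostT]
    rw [this, hres]; ring
  · refine (h0.mul h1).congr' ?_
    have hb : ball (0 : ℂ) 2 ∈ 𝓝[≠] (0 : ℂ) :=
      mem_nhdsWithin_of_mem_nhds (Metric.ball_mem_nhds _ two_pos)
    filter_upwards [self_mem_nhdsWithin, hb] with z hz hzb
    rw [jost_eq_chi (hreg z hzb hz).2]; ring

theorem constR_ne_zero : constR ≠ 0 := by
  rw [constR_eq]
  exact mul_ne_zero (mul_ne_zero two_ne_zero (pow_ne_zero 2 ipi_ne_zero)) chiRes_zero_ne_zero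

theorem lineFun_add (h : KernHeight θ y) {e' : ℂ → ℂ} (he : e ∈ admissible n)
    (he' : e' ∈ admissible n) : lineFun θ y N (e + e') = lineFun θ y N e + lineFun θ y N e' := by
  have h1 : lineInt θ y (e + e') = lineInt θ y e + lineInt θ y e' := by
    simp only [lineInt, Pi.add_apply, mul_add]
    exact integral_add (integrable_kern_line h he) (integrable_kern_line h he')
  simp only [lineFun, h1, poleSum, Pi.add_apply, mul_add, sum_add_distrib]
  ring

theorem lineFun_smul (c : ℂ) (e : ℂ → ℂ) : lineFun θ y N (c • e) = c * lineFun θ y N e := by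
  have h1 : lineInt θ y (c • e) = c * lineInt θ y e := by
    simp only [lineInt, Pi.smul_apply, smul_eq_mul]
    rw [← integral_const_mul]
    exact integral_congr_ae (Eventually.of_forall fun x => by simp only; ring)
  have h2 : poleSum θ N (c • e) = c * poleSum θ N e := by
    simp only [poleSum, Pi.smul_apply, smul_eq_mul, mul_sum]
    exact sum_congr rfl fun i _ => sum_congr rfl fun k _ => by ring
  rw [lineFun, lineFun, h1, h2]; ring

theorem exists_betheFun (θ : Fin n → ℂ) : ∃ L : (ℂ → ℂ) →ₗ[ℂ] ℂ, θ ∈ generic n →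
    ∀ y N e, GoodLine θ y N → e ∈ admissible n → L e = lineFun θ y N e / constR := by
  obtain ⟨y, -, N, h⟩ := exists_goodLine θ 0
  let f : admissible n →ₗ[ℂ] ℂ :=
    { toFun := fun e => lineFun θ y N e / constR
      map_add' := fun e e' => by
        rw [Submodule.coe_add, lineFun_add h.kernHeight e.2 e'.2, add_div]
      map_smul' := fun c e => by
        rw [Submodule.coe_smul, lineFun_smul, RingHom.id_apply, smul_eq_mul, mul_div_assoc] }
  obtain ⟨L, hL⟩ := f.exists_extend
  refine ⟨L, fun hθ y' N' e h' he => ?_⟩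
  have : L e = f ⟨e, he⟩ := by rw [← hL]; rfl
  rw [this]
  change lineFun θ y N e / constR = _
  rw [lineFun_eq hθ h h' he]

/-- The contour integral `∫ dz/R kern(θ, z) e(z)`, continued analytically in `θ`, as a functional of
the function `e`; it is extended from the admissible functions to a linear functional on all
functions. -/
def betheFun (θ : Fin n → ℂ) : (ℂ → ℂ) →ₗ[ℂ] ℂ := (exists_betheFun θ).choose

theorem betheFun_eq (hθ : θ ∈ generic n) (h : GoodLine θ y N) (he : e ∈ admissible n) :
    betheFun θ e = lineFun θ y N e / constR :=
  (exists_betheFun θ).choose_spec hθ y N e h he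

theorem eventually_goodLine (h : GoodLine θ y N) : ∀ᶠ θ' in 𝓝 θ, GoodLine θ' y N := by
  refine eventually_all.2 fun i => ?_
  have hc : ContinuousAt (fun θ' : Fin n → ℂ => (θ' i).im) θ :=
    (continuous_im.comp (continuous_apply i)).continuousAt
  obtain ⟨h1, h2, h3⟩ := h i
  have e1 := hc.eventually (lt_mem_nhds (show y + π < (θ i).im by linarith))
  have e2 := hc.eventually (gt_mem_nhds (show (θ i).im < y + 2 * π * N i by linarith))
  have e3 := hc.eventually (lt_mem_nhds (show y + 2 * π * (N i - 1) < (θ i).im by linarith))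
  filter_upwards [e1, e2, e3] with θ' a1 a2 a3
  exact ⟨by linarith, by linarith, by linarith⟩

theorem meroG_chi {f : (Fin n → ℂ) → ℂ} (hf : Differentiable ℂ f) {x : Fin n → ℂ}
    (hg : ∀ θ ∈ generic n, ∀ k : ℤ, f θ ≠ k * iπ) : MeroG (fun θ => chi (f θ)) x := by
  refine ⟨fun _ => 1, fun θ => rchi (f θ), analyticAt_const,
    analyticAt_of_differentiable (differentiable_rchi.comp hf) x, Eventually.of_forall fun θ hθ => ?_⟩
  exact ⟨rchi_ne_zero_of_generic (hg θ hθ), by simp only [chi_eq_inv, one_div]⟩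

theorem meroG_betheFun (he : e ∈ admissible n) (x : Fin n → ℂ) : MeroG (fun θ => betheFun θ e) x := by
  obtain ⟨y, -, N, h⟩ := exists_goodLine x 0
  have h1 : MeroG (fun θ => lineInt θ y e) x := MeroG.of_analyticAt (analyticAt_lineInt h.kernHeight he)
  have h2 : MeroG (fun θ => poleSum θ N e) x := by
    unfold poleSum
    refine MeroG.sum _ fun i _ => MeroG.sum _ fun k _ => MeroG.mul (MeroG.mul (MeroG.const _) ?_) ?_
    · unfold kernOther
      refine MeroG.prod _ fun l _ => ?_
      by_cases hl : l = i
      · simpa [hl] using MeroG.const 1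
      · simp only [hl, if_false]
        refine meroG_chi (by fun_prop) fun θ hθ m hm => hθ i l (Ne.symm hl) (m + 2 * k) ?_
        push_cast; linear_combination hm
    · refine MeroG.of_analyticAt (analyticAt_of_differentiable ?_ x)
      exact he.1.comp (by fun_prop : Differentiable ℂ fun θ : Fin n → ℂ => θ i - 2 * k * iπ)
  have h3 := (h1.add ((MeroG.const (-(2 * iπ))).mul h2)).mul (MeroG.const constR⁻¹)
  refine h3.congr ?_
  filter_upwards [eventually_goodLine h] with θ hθ hgen
  rw [betheFun_eq hgen hθ he, lineFun, div_eq_mul_inv]; ring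

theorem generic_comp_perm {n : ℕ} {θ : Fin n → ℂ} (hθ : θ ∈ generic n) (s : Equiv.Perm (Fin n)) :
    θ ∘ s ∈ generic n :=
  fun i j hij k => hθ (s i) (s j) (fun h => hij (s.injective h)) k

theorem kern_comp_perm (s : Equiv.Perm (Fin n)) (z : ℂ) : kern (θ ∘ s) z = kern θ z := by
  simp only [kern, Function.comp]
  exact Equiv.prod_comp s fun i => chi (z - θ i)

theorem betheFun_comp_perm (hθ : θ ∈ generic n) (s : Equiv.Perm (Fin n)) (he : e ∈ admissible n) :
    betheFun (θ ∘ s) e = betheFun θ e := by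
  obtain ⟨y, -, N, h⟩ := exists_goodLine θ 0
  have h' : GoodLine (θ ∘ s) y (N ∘ s) := fun i => h (s i)
  rw [betheFun_eq hθ h he, betheFun_eq (generic_comp_perm hθ s) h' he, lineFun, lineFun]
  have h1 : lineInt (θ ∘ s) y e = lineInt θ y e := by simp only [lineInt, kern_comp_perm]
  have h2 : poleSum (θ ∘ s) (N ∘ s) e = poleSum θ N e := by
    unfold poleSum
    rw [← Equiv.sum_comp s (fun i => ∑ k ∈ Finset.range (N i),
      chiRes k * kernOther θ i (θ i - 2 * k * iπ) * e (θ i - 2 * k * iπ))]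
    refine sum_congr rfl fun i _ => sum_congr rfl fun k _ => ?_
    have : kernOther (θ ∘ s) i (θ (s i) - 2 * k * iπ) = kernOther θ (s i) (θ (s i) - 2 * k * iπ) := by
      simp only [kernOther, Function.comp]
      rw [← Equiv.prod_comp s (fun l => if l = s i then 1 else chi (θ (s i) - 2 * k * iπ - θ l))]
      simp only [EmbeddingLike.apply_eq_iff_eq]
    simp only [Function.comp] at this ⊢
    rw [this]
  rw [h1, h2]

theorem chiRes_succ_mul (k : ℕ) :
    chiRes (k + 1) * -(2 * ((k + 1 : ℕ) : ℂ) * iπ) = chiRes k * ((2 * k - 1) * iπ) := by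
  have hk2 : 2 * (k : ℂ) + 2 ≠ 0 := by
    have : ((2 * k + 2 : ℕ) : ℂ) ≠ 0 := by exact_mod_cast (by omega : 2 * k + 2 ≠ 0)
    simpa using this
  rw [chiRes]
  push_cast
  have : chiRes k * (2 * k - 1) / (2 * k + 2) * (2 * k + 2) = chiRes k * (2 * k - 1) :=
    div_mul_cancel₀ _ hk2
  linear_combination iπ * this

/-- Shifting the integration variable by `2πi`. -/
theorem betheFun_sub_shift (hθ : θ ∈ generic n) (he : Differentiable ℂ e)
    (hgr : ∀ M : ℝ, ∃ C : ℝ, ∀ z : ℂ, |z.im| ≤ M →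
      ‖(∏ i, (θ i - z - iπ)) * e z‖ * (1 + |z.re|) ≤ C * weight z.re ^ n)
    (had : (fun z => (∏ i, (θ i - z - iπ)) * e z - (∏ i, (z - θ i)) * e (z + 2 * iπ)) ∈
      admissible n) :
    betheFun θ (fun z => (∏ i, (θ i - z - iπ)) * e z - (∏ i, (z - θ i)) * e (z + 2 * iπ)) = 0 := by
  have hπ := pi_pos
  obtain ⟨y, -, N, h⟩ := exists_goodLine θ 0
  have h' : GoodLine θ (y - 2 * π) fun i => N i + 1 := by
    intro i
    obtain ⟨a1, a2, a3⟩ := h i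
    push_cast
    exact ⟨by linarith, by linarith, by linarith⟩
  rw [betheFun_eq hθ h' had, lineFun]
  have e1 : ∀ x : ℝ, kern θ (x + y * I) * ((∏ i, (θ i - (x + y * I) - iπ)) * e (x + y * I)) =
      kern θ (x + (y - 2 * π : ℝ) * I) * ((∏ i, ((x + (y - 2 * π : ℝ) * I) - θ i)) *
        e (x + (y - 2 * π : ℝ) * I + 2 * iπ)) := by
    intro x
    have hz : (x : ℂ) + (y - 2 * π : ℝ) * I + 2 * iπ = x + y * I := by push_cast; ring
    simp only [hz]
    rw [← mul_assoc, ← mul_assoc, kern, kern, ← prod_mul_distrib, ← prod_mul_distrib]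
    congr 1
    refine prod_congr rfl fun i _ => ?_
    have a1 := (h i).1
    have n0 : (x : ℂ) + (y - 2 * π : ℝ) * I - θ i ≠ 0 := by
      intro h0
      have := congrArg im h0
      simp at this; linarith
    have n3 : (x : ℂ) + (y - 2 * π : ℝ) * I - θ i + 3 * iπ ≠ 0 := by
      intro h0
      have := congrArg im h0
      simp at this; linarith
    rw [← chi_shift n0 n3]
    congr 1
    · congr 1; push_cast; ring
    · push_cast; ring
  have e2 : poleSum θ N (fun z => (∏ i, (θ i - z - iπ)) * e z) =
      poleSum θ (fun i => N i + 1) fun z => (∏ i, (z - θ i)) * e (z + 2 * iπ) := by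
    unfold poleSum
    refine sum_congr rfl fun i _ => ?_
    rw [Finset.sum_range_succ']
    have z0 : ∏ l, (θ i - 2 * ((0 : ℕ) : ℂ) * iπ - θ l) = 0 :=
      prod_eq_zero (Finset.mem_univ i) (by simp)
    simp only [z0, zero_mul, mul_zero, add_zero]
    refine sum_congr rfl fun k _ => ?_
    have hz : θ i - 2 * ((k + 1 : ℕ) : ℂ) * iπ + 2 * iπ = θ i - 2 * k * iπ := by push_cast; ring
    simp only [hz]
    suffices H : chiRes k * kernOther θ i (θ i - 2 * k * iπ) * ∏ l, (θ l - (θ i - 2 * k * iπ) - iπ) =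
        chiRes (k + 1) * kernOther θ i (θ i - 2 * ((k + 1 : ℕ) : ℂ) * iπ) *
          ∏ l, (θ i - 2 * ((k + 1 : ℕ) : ℂ) * iπ - θ l) by
      linear_combination e (θ i - 2 * k * iπ) * H
    rw [mul_assoc (chiRes k), mul_assoc (chiRes (k + 1)), kernOther, kernOther, ← prod_mul_distrib,
      ← prod_mul_distrib, ← Finset.mul_prod_erase Finset.univ _ (Finset.mem_univ i),
      ← Finset.mul_prod_erase Finset.univ _ (Finset.mem_univ i), ← mul_assoc (chiRes k),
      ← mul_assoc (chiRes (k + 1))]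
    congr 1
    · simp only [if_true, one_mul]
      have := chiRes_succ_mul k
      linear_combination -this
    · refine prod_congr rfl fun l hl => ?_
      have hli : l ≠ i := Finset.ne_of_mem_erase hl
      simp only [hli, if_false]
      have n0 : θ i - 2 * ((k + 1 : ℕ) : ℂ) * iπ - θ l ≠ 0 := by
        intro h0
        refine hθ i l hli.symm (2 * (k + 1)) ?_
        push_cast at h0 ⊢; linear_combination h0
      have n3 : θ i - 2 * ((k + 1 : ℕ) : ℂ) * iπ - θ l + 3 * iπ ≠ 0 := by
        intro h0
        refine hθ i l hli.symm (2 * (k + 1) - 3) ?_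
        push_cast at h0 ⊢; linear_combination h0
      rw [← chi_shift n0 n3]
      congr 1
      · congr 1; push_cast; ring
      · push_cast; ring
  have e3 : ∀ x : ℝ, kern θ (x + (y - 2 * π : ℝ) * I) * ((∏ i, (θ i - (x + (y - 2 * π : ℝ) * I) - iπ)) *
      e (x + (y - 2 * π : ℝ) * I) - (∏ i, ((x + (y - 2 * π : ℝ) * I) - θ i)) *
        e (x + (y - 2 * π : ℝ) * I + 2 * iπ)) = kern θ (x + (y - 2 * π : ℝ) * I) *
      ((∏ i, (θ i - (x + (y - 2 * π : ℝ) * I) - iπ)) * e (x + (y - 2 * π : ℝ) * I)) -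
      kern θ (x + y * I) * ((∏ i, (θ i - (x + y * I) - iπ)) * e (x + y * I)) := by
    intro x
    rw [mul_sub, e1]
  have hInt := integrable_kern_line h'.kernHeight had
  simp only [e3] at hInt
  have hmain := integral_kern_sub hθ h' h (by linarith)
    (e := fun z => (∏ i, (θ i - z - iπ)) * e z) ?_ hgr hInt
  · have e4 : poleSum θ (fun i => N i + 1) (fun z => (∏ i, (θ i - z - iπ)) * e z -
        (∏ i, (z - θ i)) * e (z + 2 * iπ)) =
        poleSum θ (fun i => N i + 1) (fun z => (∏ i, (θ i - z - iπ)) * e z) -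
        poleSum θ N (fun z => (∏ i, (θ i - z - iπ)) * e z) := by
      rw [e2]
      simp only [poleSum, mul_sub, sum_sub_distrib]
    rw [e4, lineInt]
    simp only [e3]
    rw [hmain, sub_self, zero_div]
  · exact fun z => (DifferentiableAt.fun_finsetProd fun i _ => by fun_prop).mul (he z)

theorem generic_cons_iff {t : ℂ} : (t ∷ θ) ∈ generic (n + 1) ↔
    θ ∈ generic n ∧ ∀ i, ∀ k : ℤ, t - θ i ≠ k * iπ := by
  constructor
  · intro h
    refine ⟨fun i j hij k => ?_, fun i k => ?_⟩
    · simpa using h i.succ j.succ (by simpa using hij) k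
    · simpa using h 0 i.succ (Fin.succ_ne_zero i).symm k
  · rintro ⟨h1, h2⟩ i j hij k
    cases i using Fin.cases with
    | zero =>
      cases j using Fin.cases with
      | zero => exact absurd rfl hij
      | succ j => simpa using h2 j k
    | succ i =>
      cases j using Fin.cases with
      | zero =>
        intro h
        refine h2 i (-k) ?_
        simp only [cons_succ, cons_zero] at h
        push_cast; linear_combination -h
      | succ j => simpa using h1 i j (by simpa using hij) k

/-- Shifting the first rapidity by `2πi`. -/
theorem betheFun_cons_shift {t : ℂ} (hθ : (t ∷ θ) ∈ generic (n + 1))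
    (h1 : (fun z => (z - t - 2 * iπ) * e z) ∈ admissible (n + 1))
    (h2 : (fun z => (t - z - iπ) * e z) ∈ admissible (n + 1)) :
    betheFun (t + 2 * iπ ∷ θ) (fun z => (z - t - 2 * iπ) * e z) =
      betheFun (t ∷ θ) fun z => (t - z - iπ) * e z := by
  have hπ := pi_pos
  obtain ⟨g1, g2⟩ := generic_cons_iff.1 hθ
  have hθ' : (t + 2 * iπ ∷ θ) ∈ generic (n + 1) := by
    refine generic_cons_iff.2 ⟨g1, fun i k h => g2 i (k - 2) ?_⟩
    push_cast; linear_combination h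
  obtain ⟨y, -, N, h⟩ := exists_goodLine (t ∷ θ) 0
  obtain ⟨N₀, M, rfl⟩ : ∃ (N₀ : ℕ) (M : Fin n → ℕ), N = (N₀ ∷ M) :=
    ⟨N 0, tail N, (cons_self_tail N).symm⟩
  have h' : GoodLine (t + 2 * iπ ∷ θ) y
      (N₀ + 1 ∷ M) := by
    intro i
    have hi := h i
    cases i using Fin.cases with
    | zero =>
      simp only [cons_zero] at hi ⊢
      obtain ⟨a1, a2, a3⟩ := hi
      simp
      exact ⟨by linarith, by linarith, by linarith⟩
    | succ i => simpa using hi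
  rw [betheFun_eq hθ' h' h1, betheFun_eq hθ h h2, lineFun, lineFun]
  have key : ∀ z : ℂ, z - t - 2 * iπ ≠ 0 → z - t + iπ ≠ 0 →
      chi (z - (t + 2 * iπ)) * (z - t - 2 * iπ) = chi (z - t) * (t - z - iπ) := by
    intro z n0 n3
    have := chi_shift n0 (by intro h0; exact n3 (by linear_combination h0))
    rw [show z - t - 2 * iπ + 2 * iπ = z - t by ring] at this
    rw [show z - (t + 2 * iπ) = z - t - 2 * iπ by ring, ← this]
    ring
  have e1 : lineInt (t + 2 * iπ ∷ θ) y (fun z => (z - t - 2 * iπ) * e z) =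
      lineInt (t ∷ θ) y fun z => (t - z - iπ) * e z := by
    unfold lineInt
    congr 1
    funext x
    have a1 := (h 0).1
    simp only [cons_zero] at a1
    simp only [kern, prod_univ_succ, cons_zero, cons_succ]
    have := key (x + y * I) (by
      intro h0
      have := congrArg im h0
      simp at this; linarith) (by
      intro h0
      have := congrArg im h0
      simp at this; linarith)
    linear_combination (∏ i, chi ((x : ℂ) + y * I - θ i)) * e (x + y * I) * this
  have e2 : poleSum (t + 2 * iπ ∷ θ) (N₀ + 1 ∷ M)
      (fun z => (z - t - 2 * iπ) * e z) =
      poleSum (t ∷ θ) (N₀ ∷ M)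
        fun z => (t - z - iπ) * e z := by
    unfold poleSum
    rw [Fin.sum_univ_succ, Fin.sum_univ_succ]
    congr 1
    · simp only [cons_zero]
      rw [Finset.sum_range_succ']
      have z0 : t + 2 * iπ - 2 * ((0 : ℕ) : ℂ) * iπ - t - 2 * iπ = 0 := by push_cast; ring
      rw [z0, zero_mul, mul_zero, add_zero]
      refine sum_congr rfl fun k _ => ?_
      have hz : t + 2 * iπ - 2 * ((k + 1 : ℕ) : ℂ) * iπ = t - 2 * k * iπ := by push_cast; ring
      rw [hz]
      have hk : kernOther (t + 2 * iπ ∷ θ) 0 (t - 2 * k * iπ) =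
          kernOther (t ∷ θ) 0 (t - 2 * k * iπ) := by
        simp [kernOther, prod_univ_succ]
      rw [hk]
      have := chiRes_succ_mul k
      push_cast at this
      linear_combination (kernOther (t ∷ θ) 0 (t - 2 * k * iπ)) *
        e (t - 2 * k * iπ) * this
    · refine sum_congr rfl fun i _ => ?_
      simp only [cons_succ]
      refine sum_congr rfl fun k _ => ?_
      simp only [kernOther, prod_univ_succ, cons_zero, cons_succ,
        (Fin.succ_ne_zero i).symm, if_false]
      have := key (θ i - 2 * k * iπ) (by
        intro h0
        refine g2 i (-(2 * k) - 2) ?_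
        push_cast; linear_combination -h0) (by
        intro h0
        refine g2 i (-(2 * k) + 1) ?_
        push_cast; linear_combination -h0)
      linear_combination chiRes k * (∏ l : Fin n, if l.succ = i.succ then 1 else
        chi (θ i - 2 * k * iπ - θ l)) * e (θ i - 2 * k * iπ) * this
  rw [e1, e2]

/-! ### Comparison with the contour integral -/

theorem IsContour.generic {r : ℝ} (h : IsContour θ y r) : θ ∈ generic n := by
  intro i j hij k hk
  rcases h.2.2 i j k with ⟨h1, -⟩ | h1
  · exact hij h1
  · rw [hk, sub_self, norm_zero] at h1
    exact absurd h.1 (not_lt.2 h1.le)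

theorem IsContour.goodLine {r : ℝ} (h : IsContour θ y r) : GoodLine θ y fun _ => 1 := by
  intro i
  obtain ⟨h1, h2⟩ := h.2.1 i
  have hπ := pi_pos
  push_cast
  exact ⟨h2, by linarith, by linarith⟩

theorem contourInt_kern {r : ℝ} (h : IsContour θ y r) (he : e ∈ admissible n) :
    contourInt θ y r (fun z => kern θ z * e z) = constR * betheFun θ e := by
  rw [betheFun_eq h.generic h.goodLine he, mul_div_cancel₀ _ constR_ne_zero, contourInt, lineFun]
  congr 1
  rw [poleSum, mul_sum]
  refine sum_congr rfl fun i _ => ?_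
  have hU : IsOpen {z : ℂ | ∏ l, rchi (z - θ l) ≠ 0} := by
    refine isOpen_ne.preimage (continuous_finsetProd _ fun l _ => ?_)
    exact differentiable_rchi.continuous.comp (by fun_prop)
  have hz : ∀ z : ℂ, ‖z - θ i‖ ≤ r → z ≠ θ i → ∏ l, rchi (z - θ l) ≠ 0 := by
    intro z hzr hzi
    rw [prod_ne_zero_iff]
    intro l _
    refine rchi_ne_zero_of_generic fun k hk => ?_
    rcases h.2.2 l i (-k) with ⟨h1, h2⟩ | h1
    · have : k = 0 := by omega
      rw [this, h1] at hk
      simp at hk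
      exact hzi (sub_eq_zero.1 hk)
    · have e1 : θ l - θ i - ((-k : ℤ) : ℂ) * iπ = z - θ i := by push_cast; linear_combination -hk
      rw [e1] at h1
      linarith
  have hres := circleIntegral_eq_residue (f := fun z => kern θ z * e z) h.1
    (hU.union (Metric.isOpen_ball (x := θ i) (ε := r))) (fun z hzr => ?_) (fun z hzU hzi => ?_)
    (by simpa using tendsto_kern_pole h.generic he.1 i 0)
  · rw [hres]
    simp only [Finset.sum_range_one, Nat.cast_zero, mul_zero, zero_mul, sub_zero]
    ring
  · by_cases hzi : z = θ i
    · right; rw [hzi]; exact mem_ball_self h.1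
    · left; exact hz z (by simpa [dist_eq_norm] using hzr) hzi
  · have : ∏ l, rchi (z - θ l) ≠ 0 := by
      rcases hzU with h1 | h1
      · exact h1
      · exact hz z (by simpa [dist_eq_norm] using (Metric.ball_subset_closedBall h1)) hzi
    rw [prod_ne_zero_iff] at this
    exact (differentiableAt_kern fun l => this l (Finset.mem_univ l)).mul (he.1 z)
end

/-! ### The integral representation of the minimal form factor -/

theorem norm_cosh_le (z : ℂ) : ‖cosh z‖ ≤ rexp |z.re| := by
  rw [cosh, norm_div, Complex.norm_ofNat, div_le_iff₀ two_pos]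
  refine (norm_add_le _ _).trans ?_
  rw [norm_exp, norm_exp, neg_re]
  have h1 := Real.exp_le_exp.2 (le_abs_self z.re)
  have h2 := Real.exp_le_exp.2 (neg_le_abs z.re)
  linarith

theorem norm_sinh_le_mul (z : ℂ) : ‖sinh z‖ ≤ ‖z‖ * rexp |z.re| := by
  have h := norm_image_sub_le_of_norm_deriv_le_segment_01' (f := fun s : ℝ => sinh (s * z))
    (f' := fun s : ℝ => cosh (s * z) * z) (C := ‖z‖ * rexp |z.re|) ?_ ?_
  · simpa using h
  · intro s _
    have h1 : HasDerivAt (fun s : ℂ => s * z) z s := by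
      simpa using (hasDerivAt_id (s : ℂ)).mul_const z
    exact (HasDerivAt.csinh h1).comp_ofReal.hasDerivWithinAt
  · intro s hs
    rw [norm_mul, mul_comm]
    gcongr
    refine (norm_cosh_le _).trans (Real.exp_le_exp.2 ?_)
    simp only [mul_re, ofReal_re, ofReal_im, zero_mul, sub_zero, abs_mul, abs_of_nonneg hs.1]
    exact mul_le_of_le_one_left (abs_nonneg _) hs.2.le

theorem norm_one_sub_cosh_le (w : ℂ) : ‖1 - cosh w‖ ≤ ‖w‖ ^ 2 / 2 * rexp |w.re| := by
  have h1 : 1 - cosh w = -2 * sinh (w / 2) ^ 2 := by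
    have h2 := cosh_two_mul (w / 2)
    have h3 := cosh_sq (w / 2)
    rw [show 2 * (w / 2) = w by ring] at h2
    rw [h2, h3]; ring
  have h2 := norm_sinh_le_mul (w / 2)
  have h3 : (w / 2).re = w.re / 2 := by simp
  rw [h1, norm_mul, norm_neg, Complex.norm_ofNat, norm_pow]
  rw [h3, norm_div, Complex.norm_ofNat, abs_div, abs_two] at h2
  calc 2 * ‖sinh (w / 2)‖ ^ 2 ≤ 2 * (‖w‖ / 2 * rexp (|w.re| / 2)) ^ 2 := by gcongr
    _ = ‖w‖ ^ 2 / 2 * (rexp (|w.re| / 2) * rexp (|w.re| / 2)) := by ring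
    _ = _ := by rw [← Real.exp_add, add_halves]

theorem div_sinh_le {t : ℝ} (ht : 0 < t) : t / Real.sinh t ≤ (1 + 2 * t) * rexp (-t) := by
  have hs : 0 < Real.sinh t := sinh_pos_iff.2 ht
  rw [div_le_iff₀ hs]
  have h1 : rexp (-t) * Real.sinh t = (1 - rexp (-(2 * t))) / 2 := by
    rw [Real.sinh_eq, show -(2 * t) = -t + -t by ring, Real.exp_add]
    have : rexp (-t) * rexp t = 1 := by rw [← Real.exp_add]; simp
    linear_combination this / 2
  have h2 : (1 + 2 * t) * rexp (-(2 * t)) ≤ 1 := by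
    have h3 := Real.add_one_le_exp (2 * t)
    have h4 : rexp (2 * t) * rexp (-(2 * t)) = 1 := by rw [← Real.exp_add]; simp
    have := mul_le_mul_of_nonneg_right h3 (Real.exp_pos (-(2 * t))).le
    linarith
  rw [mul_assoc, h1]
  nlinarith

theorem integrableOn_div_sinh {b : ℝ} (hb : b < 1) :
    IntegrableOn (fun t : ℝ => t / Real.sinh t * rexp (b * t)) (Ioi 0) := by
  have hc : 0 < 1 - b := by linarith
  have h1 : IntegrableOn (fun t : ℝ => (1 + 4 / (1 - b)) * rexp (-((1 - b) / 2) * t)) (Ioi 0) :=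
    (integrableOn_exp_mul_Ioi (by linarith) 0).const_mul _
  refine h1.mono' ?_ ?_
  · refine ContinuousOn.aestronglyMeasurable ?_ measurableSet_Ioi
    refine ContinuousOn.mul (ContinuousOn.div continuousOn_id Real.continuous_sinh.continuousOn ?_)
      (by fun_prop)
    intro t ht; exact (sinh_pos_iff.2 ht).ne'
  · refine (ae_restrict_mem measurableSet_Ioi).mono fun t ht => ?_
    have ht : 0 < t := ht
    have hs : 0 < Real.sinh t := sinh_pos_iff.2 ht
    rw [norm_eq_abs, abs_of_nonneg (by positivity)]
    have h2 : 1 + 2 * t ≤ (1 + 4 / (1 - b)) * rexp ((1 - b) / 2 * t) := by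
      have h3 := Real.add_one_le_exp ((1 - b) / 2 * t)
      have h4 : (1 + 4 / (1 - b)) * ((1 - b) / 2 * t + 1) = 1 + 2 * t + ((1 - b) / 2 * t + 4 / (1 - b)) := by
        field_simp; ring
      have h5 : 0 ≤ (1 - b) / 2 * t + 4 / (1 - b) := by positivity
      have h6 : 0 ≤ 1 + 4 / (1 - b) := by positivity
      nlinarith
    calc t / Real.sinh t * rexp (b * t) ≤ ((1 + 2 * t) * rexp (-t)) * rexp (b * t) := by
          gcongr; exact div_sinh_le ht
      _ ≤ ((1 + 4 / (1 - b)) * rexp ((1 - b) / 2 * t) * rexp (-t)) * rexp (b * t) := by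
          gcongr
      _ = (1 + 4 / (1 - b)) * rexp (-((1 - b) / 2) * t) := by
          rw [mul_assoc, mul_assoc, ← Real.exp_add, ← Real.exp_add]; congr 2; ring

/-- The weight in the exponent of the minimal form factor. -/
def minKern (t : ℝ) : ℝ := 1 / (t * Real.sinh t ^ 2) * rexp (t / 2) * Real.sinh (t / 2)

theorem sinh_eq_two_mul_half (t : ℝ) : Real.sinh t = 2 * Real.sinh (t / 2) * Real.cosh (t / 2) := by
  rw [← Real.sinh_two_mul]; congr 1; ring

theorem minKern_eq {t : ℝ} (ht : 0 < t) :
    minKern t = rexp (t / 2) / (2 * t * Real.cosh (t / 2) * Real.sinh t) := by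
  have hs : 0 < Real.sinh t := sinh_pos_iff.2 ht
  have hh : 0 < Real.sinh (t / 2) := sinh_pos_iff.2 (by linarith)
  have hc : 0 < Real.cosh (t / 2) := Real.cosh_pos _
  have := sinh_eq_two_mul_half t
  rw [minKern, eq_div_iff (by positivity)]
  field_simp
  linear_combination -this

theorem minKern_nonneg {t : ℝ} (ht : 0 < t) : 0 ≤ minKern t := by
  have hs : 0 < Real.sinh t := sinh_pos_iff.2 ht
  have hc : 0 < Real.cosh (t / 2) := Real.cosh_pos _
  rw [minKern_eq ht]; positivity

theorem exp_half_le (t : ℝ) : rexp (t / 2) ≤ 2 * Real.cosh (t / 2) := by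
  rw [Real.cosh_eq]; have := Real.exp_pos (-(t / 2)); linarith

theorem minKern_mul_sq_le {t : ℝ} (ht : 0 < t) : minKern t * t ^ 2 ≤ t / Real.sinh t := by
  have hs : 0 < Real.sinh t := sinh_pos_iff.2 ht
  have hc : 0 < Real.cosh (t / 2) := Real.cosh_pos _
  rw [minKern_eq ht, div_mul_eq_mul_div, div_le_div_iff₀ (by positivity) hs]
  have := exp_half_le t
  calc rexp (t / 2) * t ^ 2 * Real.sinh t ≤ (2 * Real.cosh (t / 2)) * t ^ 2 * Real.sinh t := by
        gcongr
    _ = _ := by ring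

theorem continuousOn_minKern : ContinuousOn minKern (Ioi 0) := by
  unfold minKern
  refine ContinuousOn.mul (ContinuousOn.mul (ContinuousOn.div continuousOn_const ?_ ?_) ?_) ?_
  · exact (continuous_id.mul (Real.continuous_sinh.pow 2)).continuousOn
  · intro t ht
    have ht : 0 < t := ht
    have hs : 0 < Real.sinh t := sinh_pos_iff.2 ht
    positivity
  · fun_prop
  · exact (Real.continuous_sinh.comp (by fun_prop)).continuousOn

theorem norm_minKern_mul_le {t b A : ℝ} (ht : 0 < t) {v : ℂ} (hb : |v.re| ≤ b) (hA : ‖v‖ ≤ A) :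
    ‖((minKern t : ℝ) : ℂ) * (1 - cosh (t * v))‖ ≤
      A ^ 2 / 2 * (t / Real.sinh t * rexp (b * t)) := by
  have hs : 0 < Real.sinh t := sinh_pos_iff.2 ht
  have hk := minKern_nonneg ht
  rw [norm_mul, norm_real, norm_eq_abs, abs_of_nonneg hk]
  have h1 := norm_one_sub_cosh_le (t * v)
  rw [norm_mul, norm_real, norm_eq_abs, abs_of_pos ht] at h1
  have h2 : |((t : ℂ) * v).re| ≤ b * t := by
    simp only [mul_re, ofReal_re, ofReal_im, zero_mul, sub_zero, abs_mul, abs_of_pos ht]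
    nlinarith
  calc minKern t * ‖1 - cosh (t * v)‖ ≤ minKern t * ((t * ‖v‖) ^ 2 / 2 * rexp |((t : ℂ) * v).re|) := by
        gcongr
    _ ≤ minKern t * ((t * A) ^ 2 / 2 * rexp (b * t)) := by gcongr
    _ = A ^ 2 / 2 * ((minKern t * t ^ 2) * rexp (b * t)) := by ring
    _ ≤ _ := by gcongr; exact minKern_mul_sq_le ht

theorem aestronglyMeasurable_minKern_mul (v : ℂ) :
    AEStronglyMeasurable (fun t : ℝ => ((minKern t : ℝ) : ℂ) * (1 - cosh (t * v)))
      (volume.restrict (Ioi 0)) := by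
  refine ContinuousOn.aestronglyMeasurable ?_ measurableSet_Ioi
  exact (continuous_ofReal.comp_continuousOn continuousOn_minKern).mul (by fun_prop)

theorem integrableOn_minKern_mul {v : ℂ} (hv : |v.re| < 1) :
    IntegrableOn (fun t : ℝ => ((minKern t : ℝ) : ℂ) * (1 - cosh (t * v))) (Ioi 0) := by
  refine ((integrableOn_div_sinh hv).const_mul (‖v‖ ^ 2 / 2)).mono'
    (aestronglyMeasurable_minKern_mul v) ?_
  exact (ae_restrict_mem measurableSet_Ioi).mono fun t ht => norm_minKern_mul_le ht le_rfl le_rfl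

/-- The exponent of the minimal form factor as a function of `1 - θ / iπ`. -/
def minExp (v : ℂ) : ℂ := ∫ t in Ioi (0 : ℝ), ((minKern t : ℝ) : ℂ) * (1 - cosh (t * v))

theorem minFFStrip_eq (θ : ℂ) : minFFStrip θ = minConst * exp (minExp (1 - θ / iπ)) := rfl

theorem differentiableAt_minExp {v : ℂ} (hv : |v.re| < 1) : DifferentiableAt ℂ minExp v := by
  have hR : 0 < (1 - |v.re|) / 2 := by linarith
  have hball : ∀ w ∈ ball v ((1 - |v.re|) / 2), |w.re| ≤ (1 + |v.re|) / 2 ∧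
      ‖w‖ ≤ ‖v‖ + (1 - |v.re|) / 2 := by
    intro w hw
    rw [mem_ball_iff_norm] at hw
    have h1 := abs_re_le_norm (w - v)
    have h2 := abs_add_le (w - v).re v.re
    have h3 := norm_add_le (w - v) v
    rw [sub_re, sub_add_cancel] at h2
    rw [sub_add_cancel] at h3
    rw [sub_re] at h1
    constructor <;> linarith
  have hbi := (integrableOn_div_sinh (b := (1 + |v.re|) / 2) (by linarith)).const_mul
    ((‖v‖ + (1 - |v.re|) / 2) ^ 2 / 2)
  set F : ℂ → ℝ → ℂ := fun w t => (Ioi (0 : ℝ)).indicator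
    (fun t => ((minKern t : ℝ) : ℂ) * (1 - cosh (t * w))) t with hF
  have hmain : DifferentiableAt ℂ (fun w => ∫ t, F w t) v := by
    refine differentiableAt_integral_of_dominated hR
      (bound := (Ioi (0 : ℝ)).indicator fun t => (‖v‖ + (1 - |v.re|) / 2) ^ 2 / 2 *
        (t / Real.sinh t * rexp ((1 + |v.re|) / 2 * t))) ?_ ?_ ?_ ?_
    · intro w _
      exact (aestronglyMeasurable_indicator_iff measurableSet_Ioi).2 (aestronglyMeasurable_minKern_mul w)
    · intro t
      by_cases ht : t ∈ Ioi (0 : ℝ)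
      · simp only [hF, indicator_of_mem ht]
        fun_prop
      · simp only [hF, indicator_of_notMem ht]
        fun_prop
    · intro w hw t
      by_cases ht : t ∈ Ioi (0 : ℝ)
      · simp only [hF, indicator_of_mem ht]
        exact norm_minKern_mul_le ht (hball w hw).1 (hball w hw).2
      · simp only [hF, indicator_of_notMem ht]
        simp
    · exact (integrable_indicator_iff measurableSet_Ioi).2 hbi
  have : minExp = fun w => ∫ t, F w t := by
    funext w
    rw [minExp, ← integral_indicator measurableSet_Ioi]
  rw [this]; exact hmain

theorem minExp_neg (v : ℂ) : minExp (-v) = minExp v := by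
  simp [minExp, cosh_neg]

theorem minConst_ne_zero : minConst ≠ 0 :=
  mul_ne_zero (inv_ne_zero (Real.Gamma_pos_of_pos (by norm_num)).ne') (Real.exp_pos _).ne'

theorem minFFStrip_ne_zero (θ : ℂ) : minFFStrip θ ≠ 0 := by
  rw [minFFStrip_eq]
  exact mul_ne_zero (by exact_mod_cast minConst_ne_zero) (exp_ne_zero _)

theorem one_sub_div_ipi_re (θ : ℂ) : (1 - θ / iπ).re = 1 - θ.im / π := by
  have : θ / iπ = -(θ * I) / ((π : ℝ) : ℂ) := by
    field_simp [pi_ne_zero']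
    rw [I_sq]; ring
  rw [this, sub_re, Complex.div_ofReal_re]; simp

theorem differentiableAt_minFFStrip {θ : ℂ} (h0 : 0 < θ.im) (h1 : θ.im < 2 * π) :
    DifferentiableAt ℂ minFFStrip θ := by
  have hv : |(1 - θ / iπ).re| < 1 := by
    rw [one_sub_div_ipi_re, abs_lt]
    have h2 : 0 < θ.im / π := div_pos h0 pi_pos
    have h3 : θ.im / π < 2 := by rw [div_lt_iff₀ pi_pos]; exact h1
    constructor <;> linarith
  have : minFFStrip = fun θ => minConst * exp (minExp (1 - θ / iπ)) := funext minFFStrip_eq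
  rw [this]
  refine DifferentiableAt.const_mul (DifferentiableAt.cexp ?_) _
  exact DifferentiableAt.comp (g := minExp) θ (differentiableAt_minExp hv)
    (by fun_prop : DifferentiableAt ℂ (fun θ : ℂ => 1 - θ / iπ) θ)

theorem minFFStrip_reflect (θ : ℂ) : minFFStrip (2 * iπ - θ) = minFFStrip θ := by
  rw [minFFStrip_eq, minFFStrip_eq, ← minExp_neg]
  congr 3
  field_simp [pi_ne_zero']
  ring

/-! ### The functional equation of the minimal form factor -/

theorem frullani_exp {a b : ℝ} (ha : 0 < a) (hab : a ≤ b) :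
    IntegrableOn (fun x : ℝ => x⁻¹ * (rexp (-(a * x)) - rexp (-(b * x)))) (Ioi 0) ∧
    ∫ x in Ioi (0 : ℝ), x⁻¹ * (rexp (-(a * x)) - rexp (-(b * x))) = Real.log (b / a) := by
  have hInt : IntegrableOn (fun x : ℝ => x⁻¹ * (rexp (-(a * x)) - rexp (-(b * x)))) (Ioi 0) := by
    have h1 : IntegrableOn (fun t : ℝ => (b - a) * rexp (-a * t)) (Ioi 0) :=
      (integrableOn_exp_mul_Ioi (by linarith) 0).const_mul _
    refine h1.mono' ?_ ?_
    · refine ContinuousOn.aestronglyMeasurable ?_ measurableSet_Ioi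
      refine ContinuousOn.mul (continuousOn_inv₀.mono fun x hx => (ne_of_gt hx)) (by fun_prop)
    · refine (ae_restrict_mem measurableSet_Ioi).mono fun x hx => ?_
      have hx : 0 < x := hx
      have h2 : rexp (-(b * x)) = rexp (-(a * x)) * rexp (-((b - a) * x)) := by
        rw [← Real.exp_add]; congr 1; ring
      have h3 := Real.add_one_le_exp (-((b - a) * x))
      have h4 : rexp (-((b - a) * x)) ≤ 1 :=
        Real.exp_le_one_iff.2 (by have := mul_nonneg (sub_nonneg.2 hab) hx.le; linarith)
      have h5 := Real.exp_pos (-(a * x))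
      rw [h2, show rexp (-(a * x)) - rexp (-(a * x)) * rexp (-((b - a) * x)) =
        rexp (-(a * x)) * (1 - rexp (-((b - a) * x))) by ring, norm_eq_abs,
        abs_of_nonneg (mul_nonneg (inv_nonneg.2 hx.le) (mul_nonneg h5.le (by linarith)))]
      calc x⁻¹ * (rexp (-(a * x)) * (1 - rexp (-((b - a) * x))))
          ≤ x⁻¹ * (rexp (-(a * x)) * ((b - a) * x)) := by gcongr; linarith
        _ = (b - a) * rexp (-a * x) := by field_simp
  refine ⟨hInt, ?_⟩
  have hc : Continuous fun x : ℝ => rexp (-x) := by fun_prop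
  have h := Frullani.integral_Ioi_eq (f := fun x : ℝ => rexp (-x)) (a := a) (b := b) (L := 1) (R := 0)
    (hc.continuousOn.locallyIntegrableOn measurableSet_Ioi) ha (ha.trans_le hab)
    (by simpa using hc.continuousAt.tendsto.mono_left (nhdsWithin_le_nhds (a := (0 : ℝ))))
    Real.tendsto_exp_neg_atTop_nhds_zero (by simpa using hInt)
  simpa using h

/-- The weight `e^{t/2} / (t sinh t)`. -/
def gamKern (t : ℝ) : ℝ := rexp (t / 2) / (t * Real.sinh t)

theorem integral_gamKern_partial {δ : ℝ} (h0 : 0 < δ) (h1 : δ < 1 / 2) (n : ℕ) :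
    rexp (∫ t in Ioi (0 : ℝ), gamKern t * (1 - Real.cosh (t * δ)) * (1 - rexp (-(2 * n * t)))) =
      ∏ k ∈ Finset.range n, ((2 * k + 1 / 2 + δ) * (2 * k + 1 / 2 - δ) / (2 * k + 1 / 2) ^ 2) := by
  have hpos : ∀ k : ℕ, 0 < 2 * (k : ℝ) + 1 / 2 - δ := fun k => by
    have : (0 : ℝ) ≤ k := Nat.cast_nonneg k
    linarith
  set T : ℕ → ℝ → ℝ := fun k x =>
    x⁻¹ * (rexp (-((2 * k + 1 / 2) * x)) - rexp (-((2 * k + 1 / 2 + δ) * x))) -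
    x⁻¹ * (rexp (-((2 * k + 1 / 2 - δ) * x)) - rexp (-((2 * k + 1 / 2) * x))) with hT
  have hA : ∀ k : ℕ, 0 < 2 * (k : ℝ) + 1 / 2 := fun k => by positivity
  have hInt : ∀ k, IntegrableOn (T k) (Ioi 0) := fun k =>
    (frullani_exp (hA k) (by linarith)).1.sub (frullani_exp (hpos k) (by linarith)).1
  have hval : ∀ k, ∫ x in Ioi (0 : ℝ), T k x =
      Real.log ((2 * k + 1 / 2 + δ) * (2 * k + 1 / 2 - δ) / (2 * k + 1 / 2) ^ 2) := by
    intro k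
    simp only [hT]
    rw [integral_sub (frullani_exp (hA k) (by linarith)).1 (frullani_exp (hpos k) (by linarith)).1,
      (frullani_exp (hA k) (by linarith)).2, (frullani_exp (hpos k) (by linarith)).2,
      ← Real.log_div (by have := hA k; positivity) (by have := hA k; have := hpos k; positivity)]
    congr 1
    have := hA k; have := hpos k
    field_simp
  have hsum : ∀ t : ℝ, 0 < t → ∀ n : ℕ,
      gamKern t * (1 - Real.cosh (t * δ)) * (1 - rexp (-(2 * n * t))) =
        ∑ k ∈ Finset.range n, T k t := by
    intro t ht n
    have hs : 0 < Real.sinh t := sinh_pos_iff.2 ht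
    induction n with
    | zero => simp
    | succ n ih =>
      rw [sum_range_succ, ← ih]
      simp only [hT]
      have key : gamKern t * (rexp (-(2 * n * t)) - rexp (-(2 * (n + 1 : ℕ) * t))) =
          2 * t⁻¹ * rexp (-((2 * n + 1 / 2) * t)) := by
        have e1 : rexp (-(2 * (n + 1 : ℕ) * t)) = rexp (-(2 * n * t)) * rexp (-t) * rexp (-t) := by
          rw [← Real.exp_add, ← Real.exp_add]; congr 1; push_cast; ring
        have e2 : rexp (-((2 * n + 1 / 2) * t)) = rexp (t / 2) * rexp (-(2 * n * t)) * rexp (-t) := by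
          rw [← Real.exp_add, ← Real.exp_add]; congr 1; ring
        have e3 : 1 - rexp (-t) * rexp (-t) = 2 * Real.sinh t * rexp (-t) := by
          rw [Real.sinh_eq]
          have : rexp (-t) * rexp t = 1 := by rw [← Real.exp_add]; simp
          linear_combination -this
        rw [gamKern, e1, e2]
        field_simp
        linear_combination e3
      have c1 : rexp (-((2 * n + 1 / 2 + δ) * t)) + rexp (-((2 * n + 1 / 2 - δ) * t)) =
          2 * rexp (-((2 * n + 1 / 2) * t)) * Real.cosh (t * δ) := by
        rw [Real.cosh_eq, show -((2 * n + 1 / 2 + δ) * t) = -((2 * n + 1 / 2) * t) + -(t * δ) by ring,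
          show -((2 * n + 1 / 2 - δ) * t) = -((2 * n + 1 / 2) * t) + t * δ by ring, Real.exp_add,
          Real.exp_add]
        ring
      linear_combination (1 - Real.cosh (t * δ)) * key + t⁻¹ * c1
  have e : ∫ t in Ioi (0 : ℝ), gamKern t * (1 - Real.cosh (t * δ)) * (1 - rexp (-(2 * n * t))) =
      ∑ k ∈ Finset.range n, ∫ t in Ioi (0 : ℝ), T k t := by
    rw [← integral_finsetSum _ fun k _ => hInt k]
    exact setIntegral_congr_fun measurableSet_Ioi fun t ht => hsum t ht n
  rw [e, Real.exp_sum]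
  refine prod_congr rfl fun k _ => ?_
  rw [hval, Real.exp_log]
  have := hA k; have := hpos k
  positivity

theorem abs_one_sub_cosh_le (x : ℝ) : |1 - Real.cosh x| ≤ x ^ 2 / 2 * rexp |x| := by
  have := norm_one_sub_cosh_le x
  rw [← ofReal_cosh, ← ofReal_one, ← ofReal_sub, norm_real, norm_real, ofReal_re, norm_eq_abs,
    norm_eq_abs, sq_abs] at this
  exact this

theorem integrableOn_gamKern {δ : ℝ} (h0 : 0 < δ) (h1 : δ < 1 / 2) :
    IntegrableOn (fun t : ℝ => gamKern t * (1 - Real.cosh (t * δ))) (Ioi 0) := by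
  refine ((integrableOn_div_sinh (b := 1 / 2 + δ) (by linarith)).const_mul (δ ^ 2 / 2)).mono' ?_ ?_
  · refine ContinuousOn.aestronglyMeasurable ?_ measurableSet_Ioi
    unfold gamKern
    refine ContinuousOn.mul (ContinuousOn.div (by fun_prop)
      (continuous_id.mul Real.continuous_sinh).continuousOn fun t ht => ?_)
      (continuous_const.sub (Real.continuous_cosh.comp (by fun_prop))).continuousOn
    have ht : 0 < t := ht
    have hs : 0 < Real.sinh t := sinh_pos_iff.2 ht
    exact (mul_pos ht hs).ne'
  · refine (ae_restrict_mem measurableSet_Ioi).mono fun t ht => ?_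
    have ht : 0 < t := ht
    have hs : 0 < Real.sinh t := sinh_pos_iff.2 ht
    have hg : 0 ≤ gamKern t := by unfold gamKern; positivity
    rw [norm_mul, norm_eq_abs, norm_eq_abs, abs_of_nonneg hg]
    have := abs_one_sub_cosh_le (t * δ)
    rw [abs_of_pos (by positivity : 0 < t * δ)] at this
    calc gamKern t * |1 - Real.cosh (t * δ)| ≤ gamKern t * ((t * δ) ^ 2 / 2 * rexp (t * δ)) := by gcongr
      _ = δ ^ 2 / 2 * (t / Real.sinh t * (rexp (t / 2) * rexp (t * δ))) := by
          rw [gamKern]; field_simp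
      _ = _ := by rw [← Real.exp_add]; congr 4; ring

theorem exp_integral_gamKern {δ : ℝ} (h0 : 0 < δ) (h1 : δ < 1 / 2) :
    rexp (∫ t in Ioi (0 : ℝ), gamKern t * (1 - Real.cosh (t * δ))) *
      (Real.Gamma (1 / 4 + δ / 2) * Real.Gamma (1 / 4 - δ / 2)) = Real.Gamma (1 / 4) ^ 2 := by
  have hpart : Tendsto (fun n : ℕ => ∫ t in Ioi (0 : ℝ),
      gamKern t * (1 - Real.cosh (t * δ)) * (1 - rexp (-(2 * n * t)))) atTop
      (𝓝 (∫ t in Ioi (0 : ℝ), gamKern t * (1 - Real.cosh (t * δ)))) := by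
    have hi := integrableOn_gamKern h0 h1
    refine tendsto_integral_of_dominated_convergence
      (fun t => ‖gamKern t * (1 - Real.cosh (t * δ))‖) (fun n => ?_) hi.norm (fun n => ?_) ?_
    · exact hi.aestronglyMeasurable.mul
        (by fun_prop : Continuous fun t : ℝ => 1 - rexp (-(2 * n * t))).aestronglyMeasurable
    · refine (ae_restrict_mem measurableSet_Ioi).mono fun t ht => ?_
      have ht : 0 < t := ht
      rw [norm_mul]
      refine mul_le_of_le_one_right (norm_nonneg _) ?_
      have hle : rexp (-(2 * n * t)) ≤ 1 := Real.exp_le_one_iff.2 (by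
        have : (0 : ℝ) ≤ 2 * n * t := by positivity
        linarith)
      rw [norm_eq_abs, abs_of_nonneg (by linarith)]
      have := Real.exp_pos (-(2 * n * t))
      linarith
    · refine (ae_restrict_mem measurableSet_Ioi).mono fun t ht => ?_
      have ht : 0 < t := ht
      have hz : Tendsto (fun n : ℕ => rexp (-(2 * n * t))) atTop (𝓝 0) := by
        refine Real.tendsto_exp_neg_atTop_nhds_zero.comp ?_
        have : Tendsto (fun n : ℕ => (n : ℝ) * (2 * t)) atTop atTop :=
          tendsto_natCast_atTop_atTop.atTop_mul_const (by positivity)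
        refine this.congr fun n => by ring
      simpa using ((hz.const_sub 1).const_mul (gamKern t * (1 - Real.cosh (t * δ))))
  have hexp := (Real.continuous_exp.tendsto _).comp hpart
  have hG := ((Real.GammaSeq_tendsto_Gamma (1 / 4 + δ / 2)).mul
    (Real.GammaSeq_tendsto_Gamma (1 / 4 - δ / 2)))
  have hsucc := hexp.comp (tendsto_add_atTop_nat 1)
  have hprod := hsucc.mul hG
  have hR := (Real.GammaSeq_tendsto_Gamma (1 / 4)).pow 2
  refine tendsto_nhds_unique hprod (hR.congr' ?_)
  filter_upwards [eventually_gt_atTop 0] with n hn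
  have hn' : (0 : ℝ) < n := by exact_mod_cast hn
  simp only [Function.comp]
  rw [integral_gamKern_partial h0 h1]
  simp only [Real.GammaSeq]
  have hp : ∀ x : ℝ, 0 < x → (∏ j ∈ Finset.range (n + 1), (x + (j : ℝ))) ≠ 0 := fun x hx =>
    prod_ne_zero_iff.2 fun j _ => by positivity
  have hpw : (n : ℝ) ^ (1 / 4 + δ / 2) * (n : ℝ) ^ (1 / 4 - δ / 2) = (n : ℝ) ^ (1 / 4 : ℝ) * (n : ℝ) ^ (1 / 4 : ℝ) := by
    rw [← Real.rpow_add hn', ← Real.rpow_add hn']; congr 1; ring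
  have hP : ∏ k ∈ Finset.range (n + 1), ((2 * (k : ℝ) + 1 / 2 + δ) * (2 * k + 1 / 2 - δ) / (2 * k + 1 / 2) ^ 2) =
      (∏ j ∈ Finset.range (n + 1), (1 / 4 + δ / 2 + (j : ℝ))) *
      (∏ j ∈ Finset.range (n + 1), (1 / 4 - δ / 2 + (j : ℝ))) /
      (∏ j ∈ Finset.range (n + 1), (1 / 4 + (j : ℝ))) ^ 2 := by
    rw [← prod_mul_distrib, ← Finset.prod_pow, ← Finset.prod_div_distrib]
    refine prod_congr rfl fun k _ => ?_
    have : (0 : ℝ) < 2 * k + 1 / 2 := by positivity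
    have : (0 : ℝ) < 1 / 4 + k := by positivity
    rw [div_eq_div_iff (by positivity) (by positivity)]
    ring
  rw [hP]
  have p1 := hp (1 / 4 + δ / 2) (by linarith)
  have p2 := hp (1 / 4 - δ / 2) (by linarith)
  have p3 := hp (1 / 4) (by norm_num)
  generalize ∏ j ∈ Finset.range (n + 1), (1 / 4 + δ / 2 + (j : ℝ)) = P1 at *
  generalize ∏ j ∈ Finset.range (n + 1), (1 / 4 - δ / 2 + (j : ℝ)) = P2 at *
  generalize ∏ j ∈ Finset.range (n + 1), (1 / 4 + (j : ℝ)) = P3 at *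
  generalize (n : ℝ) ^ (1 / 4 + δ / 2) = A1 at *
  generalize (n : ℝ) ^ (1 / 4 - δ / 2) = A2 at *
  generalize (n : ℝ) ^ (1 / 4 : ℝ) = A3 at *
  generalize ((n.factorial : ℕ) : ℝ) = f at *
  have : P1 * P2 / P3 ^ 2 * (A1 * f / P1 * (A2 * f / P2)) = (A1 * A2) * f ^ 2 / P3 ^ 2 := by
    field_simp
  rw [this, hpw]; ring

/-- The weight in the normalization constant of the minimal form factor. -/
def constKern (t : ℝ) : ℝ := rexp (t / 2) *
  (Real.sinh (t / 2) / (t * Real.sinh t ^ 2) - (1 / 2) / (t * Real.sinh t))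

theorem constKern_eq {t : ℝ} (ht : 0 < t) :
    constKern t = gamKern t / 2 * ((1 - Real.cosh (t / 2)) / Real.cosh (t / 2)) := by
  have hs : 0 < Real.sinh (t / 2) := sinh_pos_iff.2 (by linarith)
  have hc : 0 < Real.cosh (t / 2) := Real.cosh_pos _
  rw [constKern, gamKern, sinh_eq_two_mul_half t]
  field_simp

theorem integrableOn_constKern : IntegrableOn constKern (Ioi 0) := by
  refine ((integrableOn_div_sinh (b := 1 / 2) (by norm_num)).const_mul (1 / 8)).mono' ?_ ?_
  · refine ContinuousOn.aestronglyMeasurable ?_ measurableSet_Ioi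
    unfold constKern
    have hcs : Continuous fun t : ℝ => Real.sinh (t / 2) := Real.continuous_sinh.comp (by fun_prop)
    refine ContinuousOn.mul (by fun_prop) (ContinuousOn.sub (ContinuousOn.div hcs.continuousOn
      (continuous_id.mul (Real.continuous_sinh.pow 2)).continuousOn fun t ht => ?_)
      (ContinuousOn.div continuousOn_const
      (continuous_id.mul Real.continuous_sinh).continuousOn fun t ht => ?_))
    · have hs : 0 < Real.sinh t := sinh_pos_iff.2 ht
      exact (mul_pos ht (pow_pos hs 2)).ne'
    · have hs : 0 < Real.sinh t := sinh_pos_iff.2 ht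
      exact (mul_pos ht hs).ne'
  · refine (ae_restrict_mem measurableSet_Ioi).mono fun t ht => ?_
    have ht : 0 < t := ht
    have hs : 0 < Real.sinh t := sinh_pos_iff.2 ht
    have hc : 0 < Real.cosh (t / 2) := Real.cosh_pos _
    have hg : 0 ≤ gamKern t / 2 := by unfold gamKern; positivity
    rw [constKern_eq ht, norm_mul, norm_eq_abs, norm_eq_abs, abs_of_nonneg hg, abs_div,
      abs_of_pos hc]
    have h1 := abs_one_sub_cosh_le (t / 2)
    rw [abs_of_pos (by positivity : 0 < t / 2)] at h1
    have h2 := exp_half_le t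
    have h3 : |1 - Real.cosh (t / 2)| / Real.cosh (t / 2) ≤ t ^ 2 / 4 := by
      rw [div_le_iff₀ hc]
      refine h1.trans ?_
      nlinarith [sq_nonneg t]
    calc gamKern t / 2 * (|1 - Real.cosh (t / 2)| / Real.cosh (t / 2)) ≤ gamKern t / 2 * (t ^ 2 / 4) := by
          gcongr
      _ = 1 / 8 * (t / Real.sinh t * rexp (1 / 2 * t)) := by
          rw [gamKern, show 1 / 2 * t = t / 2 by ring]; field_simp; norm_num

theorem minFFStrip_mul_axis {δ : ℝ} (h0 : 0 < δ) (h1 : δ < 1 / 2) :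
    jost (iπ * (1 / 2 - δ)) * minFFStrip (iπ * (1 / 2 - δ)) * minFFStrip (iπ * (1 / 2 - δ) + iπ) = 1 := by
  have hA : |(((1 / 2 + δ : ℝ) : ℂ)).re| < 1 := by
    rw [ofReal_re, abs_of_pos (by linarith)]; linarith
  have hB : |(((δ - 1 / 2 : ℝ) : ℂ)).re| < 1 := by
    rw [ofReal_re, abs_of_neg (by linarith)]; linarith
  have v1 : 1 - iπ * (1 / 2 - δ) / iπ = ((1 / 2 + δ : ℝ) : ℂ) := by
    rw [mul_div_cancel_left₀ _ ipi_ne_zero]; push_cast; ring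
  have v2 : 1 - (iπ * (1 / 2 - δ) + iπ) / iπ = ((δ - 1 / 2 : ℝ) : ℂ) := by
    rw [add_div, mul_div_cancel_left₀ _ ipi_ne_zero, div_self ipi_ne_zero]; push_cast; ring
  rw [minFFStrip_eq, minFFStrip_eq, v1, v2]
  have hsum : minExp ((1 / 2 + δ : ℝ) : ℂ) + minExp ((δ - 1 / 2 : ℝ) : ℂ) =
      ((2 * (∫ t in Ioi (0 : ℝ), constKern t) +
        ∫ t in Ioi (0 : ℝ), gamKern t * (1 - Real.cosh (t * δ)) : ℝ) : ℂ) := by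
    rw [minExp, minExp, ← integral_add (integrableOn_minKern_mul hA) (integrableOn_minKern_mul hB),
      ← integral_const_mul, ← integral_add (integrableOn_constKern.const_mul 2)
        (integrableOn_gamKern h0 h1), ← integral_complex_ofReal]
    refine setIntegral_congr_fun measurableSet_Ioi fun t ht => ?_
    have ht : 0 < t := ht
    have hs : 0 < Real.sinh (t / 2) := sinh_pos_iff.2 (by linarith)
    have hc : 0 < Real.cosh (t / 2) := Real.cosh_pos _
    rw [← ofReal_mul, ← ofReal_mul, ← ofReal_cosh, ← ofReal_cosh, ← ofReal_one, ← ofReal_sub,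
      ← ofReal_sub, ← ofReal_mul, ← ofReal_mul, ← ofReal_add]
    congr 1
    rw [show t * (1 / 2 + δ) = t * δ + t / 2 by ring, show t * (δ - 1 / 2) = t * δ - t / 2 by ring,
      Real.cosh_add, Real.cosh_sub, minKern_eq ht, constKern_eq ht, gamKern]
    have hs' : Real.sinh t ≠ 0 := (sinh_pos_iff.2 ht).ne'
    field_simp
    ring
  have hg := exp_integral_gamKern h0 h1
  have hG4 : 0 < Real.Gamma (1 / 4) := Real.Gamma_pos_of_pos (by norm_num)
  have hj : jost (iπ * (1 / 2 - δ)) =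
      ((Real.Gamma (1 / 4 + δ / 2) * Real.Gamma (1 / 4 - δ / 2) : ℝ) : ℂ) := by
    have e1 : iπ * (1 / 2 - δ) / (2 * π * I) = ((1 / 4 - δ / 2 : ℝ) : ℂ) := by
      push_cast; field_simp [pi_ne_zero']; ring
    have e2 : 1 / 2 - iπ * (1 / 2 - δ) / (2 * π * I) = ((1 / 4 + δ / 2 : ℝ) : ℂ) := by
      rw [e1]; push_cast; ring
    rw [jost, e2, e1, Gamma_ofReal, Gamma_ofReal, ← ofReal_mul, mul_comm]
  have hcd : minConst = (Real.Gamma (1 / 4))⁻¹ * rexp (-∫ t in Ioi (0 : ℝ), constKern t) := rfl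
  rw [hj, mul_assoc, show ∀ a b c : ℂ, a * b * (a * c) = a * a * (b * c) from fun a b c => by ring,
    ← exp_add, hsum, ← ofReal_exp, ← ofReal_mul, ← ofReal_mul, ← ofReal_mul, ← ofReal_one]
  congr 1
  rw [hcd, Real.exp_add]
  have e3 : rexp (-∫ t in Ioi (0 : ℝ), constKern t) * rexp (-∫ t in Ioi (0 : ℝ), constKern t) *
      rexp (2 * ∫ t in Ioi (0 : ℝ), constKern t) = 1 := by
    rw [← Real.exp_add, ← Real.exp_add, ← Real.exp_zero]; congr 1; ring
  generalize rexp (-∫ t in Ioi (0 : ℝ), constKern t) = a at *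
  generalize rexp (2 * ∫ t in Ioi (0 : ℝ), constKern t) = b at *
  generalize rexp (∫ t in Ioi (0 : ℝ), gamKern t * (1 - Real.cosh (t * δ))) = c at *
  generalize Real.Gamma (1 / 4 + δ / 2) * Real.Gamma (1 / 4 - δ / 2) = g at *
  generalize Real.Gamma (1 / 4) = G at *
  field_simp
  linear_combination (c * g) * e3 + hg

theorem jostRegular_of_strip {θ : ℂ} (h0 : 0 < θ.im) (h1 : θ.im < π) : JostRegular θ := by
  intro k
  have hk : (0 : ℝ) ≤ k * π := by positivity
  constructor
  · rintro rfl
    simp at h0; linarith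
  · rintro rfl
    simp at h1; nlinarith

/-- `φ(θ) F(θ) F(θ + iπ) = 1`. -/
theorem minFFStrip_mul {θ : ℂ} (h0 : 0 < θ.im) (h1 : θ.im < π) :
    jost θ * minFFStrip θ * minFFStrip (θ + iπ) = 1 := by
  have hπ := pi_pos
  set U : Set ℂ := im ⁻¹' Ioo 0 π with hU
  have hUo : IsOpen U := isOpen_Ioo.preimage continuous_im
  have hconv : IsPreconnected U := by
    have : Convex ℝ U := (convex_Ioo 0 π).linear_preimage imLm
    exact this.isPreconnected
  have hd : DifferentiableOn ℂ (fun θ => jost θ * minFFStrip θ * minFFStrip (θ + iπ)) U := by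
    intro z hz
    refine DifferentiableAt.differentiableWithinAt ?_
    refine DifferentiableAt.mul (DifferentiableAt.mul (jostRegular_of_strip hz.1 hz.2).differentiableAt
      (differentiableAt_minFFStrip hz.1 (by linarith [hz.2]))) ?_
    refine DifferentiableAt.comp (g := minFFStrip) z (differentiableAt_minFFStrip ?_ ?_) (by fun_prop)
    · have := hz.1; simp; linarith
    · have := hz.2; simp; linarith
  have ha := hd.analyticOnNhd hUo
  have hc : AnalyticOnNhd ℂ (fun _ : ℂ => (1 : ℂ)) U := fun z _ => analyticAt_const
  have hz0 : iπ * (1 / 2 - ((1 / 4 : ℝ) : ℂ)) ∈ U := by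
    constructor <;> simp <;> linarith
  refine ha.eqOn_of_preconnected_of_frequently_eq hc hconv hz0 ?_ (show θ ∈ U from ⟨h0, h1⟩)
  have htend : Tendsto (fun δ : ℝ => iπ * (1 / 2 - (δ : ℂ))) (𝓝[≠] (1 / 4))
      (𝓝[≠] (iπ * (1 / 2 - ((1 / 4 : ℝ) : ℂ)))) := by
    refine tendsto_punctured (by fun_prop) rfl fun δ h => ?_
    have h2 := mul_left_cancel₀ ipi_ne_zero h
    have h3 : (δ : ℂ) = ((1 / 4 : ℝ) : ℂ) := by linear_combination -h2
    exact_mod_cast h3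
  refine htend.frequently (Eventually.frequently ?_)
  have : Ioo (0 : ℝ) (1 / 2) ∈ 𝓝[≠] (1 / 4 : ℝ) :=
    mem_nhdsWithin_of_mem_nhds (Ioo_mem_nhds (by norm_num) (by norm_num))
  filter_upwards [this] with δ hδ
  exact minFFStrip_mul_axis hδ.1 hδ.2

/-! ### The minimal form factor on the whole plane -/

/-- The continuation of the minimal form factor by `n` steps downwards. -/
def minDown : ℕ → ℂ → ℂ
  | 0, θ => minFFStrip θ
  | n + 1, θ => (jost θ * minDown n (θ + iπ))⁻¹

/-- The strip in which the `n`-th continuation is the minimal form factor. -/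
def downStrip (n : ℕ) : Set ℂ := {θ | -(n * π) < θ.im ∧ θ.im < (2 - n) * π}

theorem minDown_succ_eq (n : ℕ) : ∀ {θ : ℂ}, -(n * π) < θ.im → θ.im < (1 - n) * π →
    minDown (n + 1) θ = minDown n θ := by
  have hπ := pi_pos
  induction n with
  | zero =>
    intro θ h0 h1
    simp only [minDown]
    have h := minFFStrip_mul (θ := θ) (by simpa using h0) (by simpa using h1)
    rw [inv_eq_iff_eq_inv]
    exact eq_inv_of_mul_eq_one_left (by linear_combination h)
  | succ n ih =>
    intro θ h0 h1
    rw [minDown, ih, ← minDown]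
    · push_cast at h0; simp; linarith
    · push_cast at h1; simp; linarith

/-- The number of steps for a point below the real line. -/
def downStep (θ : ℂ) : ℕ := if 0 < θ.im then 0 else ⌊-θ.im / π⌋₊ + 1

theorem mem_downStrip_downStep {θ : ℂ} (h : θ.im < 2 * π) : θ ∈ downStrip (downStep θ) := by
  have hπ := pi_pos
  rw [downStep]
  split_ifs with h0
  · exact ⟨by simpa using h0, by simpa using h⟩
  · have hn : 0 ≤ -θ.im / π := div_nonneg (by linarith) hπ.le
    have h1 := Nat.lt_floor_add_one (-θ.im / π)
    have h2 := Nat.floor_le hn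
    rw [div_lt_iff₀ hπ] at h1
    rw [le_div_iff₀ hπ] at h2
    constructor
    · push_cast; linarith
    · push_cast; linarith

theorem minDown_eq_of_mem {n m : ℕ} {θ : ℂ} (hn : θ ∈ downStrip n) (hm : θ ∈ downStrip m) :
    minDown n θ = minDown m θ := by
  have hπ := pi_pos
  wlog hle : n ≤ m generalizing n m
  · exact (this hm hn (le_of_not_ge hle)).symm
  have h1 : (m : ℝ) < n + 2 := by
    have a1 := hn.1
    have a2 := hm.2
    by_contra hge
    push Not at hge
    nlinarith
  have h2 : m < n + 2 := by exact_mod_cast h1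
  rcases (by omega : m = n ∨ m = n + 1) with rfl | rfl
  · rfl
  · have a2 := hm.2
    push_cast at a2
    exact (minDown_succ_eq n hn.1 (by linarith)).symm

/-- The minimal form factor as a meromorphic function on the plane. -/
def minGlobal (θ : ℂ) : ℂ :=
  if θ.im < 2 * π then minDown (downStep θ) θ else minDown (downStep (2 * iπ - θ)) (2 * iπ - θ)

theorem minGlobal_eq_minDown {n : ℕ} {θ : ℂ} (hn : θ ∈ downStrip n) : minGlobal θ = minDown n θ := by
  have hπ := pi_pos
  have h : θ.im < 2 * π := by
    have := hn.2
    have : (0 : ℝ) ≤ n * π := by positivity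
    nlinarith
  rw [minGlobal, if_pos h]
  exact minDown_eq_of_mem (mem_downStrip_downStep h) hn

theorem minGlobal_reflect (θ : ℂ) : minGlobal (2 * iπ - θ) = minGlobal θ := by
  have hπ := pi_pos
  have him : (2 * iπ - θ).im = 2 * π - θ.im := by simp
  by_cases h1 : θ.im < 2 * π
  · by_cases h2 : 0 < θ.im
    · have e1 : minGlobal θ = minDown 0 θ :=
        minGlobal_eq_minDown (n := 0) ⟨by simpa using h2, by simpa using h1⟩
      have e2 : minGlobal (2 * iπ - θ) = minDown 0 (2 * iπ - θ) :=
        minGlobal_eq_minDown (n := 0) ⟨by rw [him]; push_cast; linarith, by rw [him]; push_cast; linarith⟩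
      rw [e1, e2]
      exact minFFStrip_reflect θ
    · rw [minGlobal, if_neg (by rw [him]; linarith), minGlobal, if_pos h1]
      simp
  · rw [minGlobal, if_pos (by rw [him]; linarith), minGlobal, if_neg h1]

theorem minGlobal_eq_minFF {θ : ℂ} (h0 : -π < θ.im) (h1 : θ.im < 2 * π) : minGlobal θ = minFF θ := by
  have hπ := pi_pos
  rw [minFF]
  split_ifs with h
  · exact minGlobal_eq_minDown (n := 0) ⟨by simpa using h, by simpa using h1⟩
  · exact minGlobal_eq_minDown (n := 1) ⟨by simpa using h0, by push_cast; linarith⟩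

theorem minDown_ne_zero (n : ℕ) : ∀ {θ : ℂ}, (∀ k : ℤ, θ ≠ k * iπ) → minDown n θ ≠ 0 := by
  induction n with
  | zero => intro θ _; exact minFFStrip_ne_zero θ
  | succ n ih =>
    intro θ h
    refine inv_ne_zero (mul_ne_zero (JostRegular.of_generic h).jost_ne_zero (ih ?_))
    simpa using ne_int_ipi_add h 1

theorem minGlobal_ne_zero {θ : ℂ} (h : ∀ k : ℤ, θ ≠ k * iπ) : minGlobal θ ≠ 0 := by
  rw [minGlobal]
  split_ifs
  · exact minDown_ne_zero _ h
  · refine minDown_ne_zero _ fun k => ?_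
    have := ne_int_ipi_add (ne_int_ipi_neg h) 2 k
    intro h'; exact this (by push_cast; linear_combination h')

theorem jost_mul_minGlobal {θ : ℂ} (h : ∀ k : ℤ, θ ≠ k * iπ) :
    jost θ * minGlobal θ * minGlobal (θ + iπ) = 1 := by
  have hπ := pi_pos
  have key : ∀ {θ : ℂ}, (∀ k : ℤ, θ ≠ k * iπ) → θ.im < π →
      jost θ * minGlobal θ * minGlobal (θ + iπ) = 1 := by
    intro θ h hlt
    have hm : (θ + iπ).im < 2 * π := by simp; linarith
    have h1 := mem_downStrip_downStep hm
    set n := downStep (θ + iπ)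
    have h2 : θ ∈ downStrip (n + 1) := by
      obtain ⟨a1, a2⟩ := h1
      simp at a1 a2
      constructor <;> push_cast <;> linarith
    rw [minGlobal_eq_minDown h1, minGlobal_eq_minDown h2, minDown]
    have n1 := (JostRegular.of_generic h).jost_ne_zero
    have n2 := minDown_ne_zero n (θ := θ + iπ) (by simpa using ne_int_ipi_add h 1)
    field_simp
  rcases lt_or_ge θ.im π with hlt | hge
  · exact key h hlt
  · have h' : ∀ k : ℤ, iπ - θ ≠ k * iπ := fun k hk =>
      ne_int_ipi_add (ne_int_ipi_neg h) 1 k (by push_cast; linear_combination hk)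
    have := key h' (by simp; linarith)
    rw [show iπ - θ + iπ = 2 * iπ - θ by ring, minGlobal_reflect,
      show iπ - θ = 2 * iπ - (θ + iπ) by ring, minGlobal_reflect,
      show 2 * iπ - (θ + iπ) = -θ + iπ by ring, jost_add_ipi, neg_neg] at this
    linear_combination this

/-- `F(θ) = a(θ) F(-θ)`. -/
theorem minGlobal_eq_ampA_mul {θ : ℂ} (h : ∀ k : ℤ, θ ≠ k * iπ) :
    minGlobal θ = ampA θ * minGlobal (-θ) := by
  have h1 := jost_mul_minGlobal h
  have h2 := jost_mul_minGlobal (ne_int_ipi_neg h)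
  rw [show -θ + iπ = 2 * iπ - (θ + iπ) by ring, minGlobal_reflect] at h2
  have n1 := (JostRegular.of_generic h).jost_ne_zero
  have n3 : minGlobal (θ + iπ) ≠ 0 := minGlobal_ne_zero (by simpa using ne_int_ipi_add h 1)
  rw [ampA_eq h, div_mul_eq_mul_div, eq_div_iff n1]
  refine mul_right_cancel₀ n3 ?_
  linear_combination h1 - h2

/-- Near `x` the function is a quotient of analytic functions without zeros outside `iπℤ`. -/
def MeroStrip (f : ℂ → ℂ) (x : ℂ) : Prop :=
  ∃ g h : ℂ → ℂ, AnalyticAt ℂ g x ∧ AnalyticAt ℂ h x ∧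
    ∀ᶠ y in 𝓝 x, (∀ k : ℤ, y ≠ k * iπ) → g y ≠ 0 ∧ h y ≠ 0 ∧ f y = g y / h y

theorem meroStrip_minDown (n : ℕ) : ∀ {x : ℂ}, x ∈ downStrip n → MeroStrip (minDown n) x := by
  have hπ := pi_pos
  induction n with
  | zero =>
    intro x hx
    have hx1 : 0 < x.im := by simpa using hx.1
    have hx2 : x.im < 2 * π := by simpa using hx.2
    refine ⟨minFFStrip, fun _ => 1, ?_, analyticAt_const, Eventually.of_forall fun y _ =>
      ⟨minFFStrip_ne_zero y, one_ne_zero, by simp [minDown]⟩⟩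
    have hUo : IsOpen (im ⁻¹' Ioo 0 (2 * π)) := isOpen_Ioo.preimage continuous_im
    have : DifferentiableOn ℂ minFFStrip (im ⁻¹' Ioo 0 (2 * π)) := fun z hz =>
      (differentiableAt_minFFStrip hz.1 hz.2).differentiableWithinAt
    exact this.analyticOnNhd hUo x ⟨hx1, hx2⟩
  | succ n ih =>
    intro x hx
    have hx' : x + iπ ∈ downStrip n := by
      obtain ⟨a1, a2⟩ := hx
      push_cast at a1 a2
      constructor <;> simp <;> linarith
    obtain ⟨g, h, hg, hh, e⟩ := ih hx'
    have hadd : AnalyticAt ℂ (fun y : ℂ => y + iπ) x := by fun_prop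
    have hrj : AnalyticAt ℂ (fun y : ℂ => (Gamma (y / (2 * π * I)))⁻¹ *
        (Gamma (1 / 2 - y / (2 * π * I)))⁻¹) x := by
      refine Differentiable.analyticAt ?_ x
      refine Differentiable.mul ?_ ?_
      · exact differentiable_one_div_Gamma.comp (by fun_prop : Differentiable ℂ fun x : ℂ => x / (2 * π * I))
      · exact differentiable_one_div_Gamma.comp
          (by fun_prop : Differentiable ℂ fun x : ℂ => 1 / 2 - x / (2 * π * I))
    refine ⟨fun y => ((Gamma (y / (2 * π * I)))⁻¹ * (Gamma (1 / 2 - y / (2 * π * I)))⁻¹) * h (y + iπ),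
      fun y => g (y + iπ), hrj.mul (AnalyticAt.comp (g := h) hh hadd),
      AnalyticAt.comp (g := g) hg hadd, ?_⟩
    have hc : ContinuousAt (fun y : ℂ => y + iπ) x := by fun_prop
    filter_upwards [hc.eventually e] with y hy hgen
    obtain ⟨h1, h2, h3⟩ := hy (by simpa using ne_int_ipi_add hgen 1)
    have hj := (JostRegular.of_generic hgen).jost_ne_zero
    rw [jost, mul_ne_zero_iff] at hj
    refine ⟨mul_ne_zero (mul_ne_zero (inv_ne_zero hj.1) (inv_ne_zero hj.2)) h2, h1, ?_⟩
    rw [minDown, h3, jost]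
    field_simp

theorem meroStrip_minGlobal (x : ℂ) : MeroStrip minGlobal x := by
  have hπ := pi_pos
  have hopen : ∀ n, IsOpen (downStrip n) := fun n => by
    have : downStrip n = im ⁻¹' Ioo (-(n * π)) ((2 - n) * π) := rfl
    rw [this]; exact isOpen_Ioo.preimage continuous_im
  have key : ∀ x : ℂ, x.im < 2 * π → MeroStrip minGlobal x := by
    intro x hx
    have hm := mem_downStrip_downStep hx
    obtain ⟨g, h, hg, hh, e⟩ := meroStrip_minDown _ hm
    refine ⟨g, h, hg, hh, ?_⟩
    filter_upwards [e, (hopen _).mem_nhds hm] with y hy hy' hgen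
    rw [minGlobal_eq_minDown hy']
    exact hy hgen
  by_cases hx : x.im < 2 * π
  · exact key x hx
  · obtain ⟨g, h, hg, hh, e⟩ := key (2 * iπ - x) (by simp; linarith)
    have hsub : AnalyticAt ℂ (fun y : ℂ => 2 * iπ - y) x := by fun_prop
    have hc : ContinuousAt (fun y : ℂ => 2 * iπ - y) x := by fun_prop
    refine ⟨fun y => g (2 * iπ - y), fun y => h (2 * iπ - y), AnalyticAt.comp (g := g) hg hsub,
      AnalyticAt.comp (g := h) hh hsub, ?_⟩
    filter_upwards [hc.eventually e] with y hy hgen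
    rw [← minGlobal_reflect]
    refine hy fun k hk => ?_
    exact ne_int_ipi_add (ne_int_ipi_neg hgen) 2 k (by push_cast; linear_combination hk)

theorem differentiableAt_minGlobal {x : ℂ} (hx : ∀ k : ℤ, x ≠ k * iπ) :
    DifferentiableAt ℂ minGlobal x := by
  obtain ⟨g, h, hg, hh, e⟩ := meroStrip_minGlobal x
  have hopen : ∀ᶠ y in 𝓝 x, ∀ k : ℤ, y ≠ k * iπ := by
    have hs : sinh x ≠ 0 := fun h0 => by
      obtain ⟨k, hk⟩ := sinh_eq_zero_iff.1 h0; exact hx k hk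
    filter_upwards [(continuous_sinh.continuousAt).eventually_ne hs] with y hy k hk
    exact hy (sinh_eq_zero_iff.2 ⟨k, hk⟩)
  have : (fun y => g y / h y) =ᶠ[𝓝 x] minGlobal := by
    filter_upwards [e, hopen] with y hy hy'
    exact (hy hy').2.2.symm
  exact (hg.differentiableAt.div hh.differentiableAt (e.self_of_nhds hx).2.1).congr_of_eventuallyEq
    this.symm

theorem meroG_minGlobal {n : ℕ} {i j : Fin n} (hij : i ≠ j) (x : Fin n → ℂ) :
    MeroG (fun θ => minGlobal (θ i - θ j)) x := by
  obtain ⟨g, h, hg, hh, e⟩ := meroStrip_minGlobal (x i - x j)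
  have hsub : AnalyticAt ℂ (fun θ : Fin n → ℂ => θ i - θ j) x :=
    analyticAt_of_differentiable (by fun_prop) x
  refine ⟨fun θ => g (θ i - θ j), fun θ => h (θ i - θ j), AnalyticAt.comp (g := g) hg hsub,
    AnalyticAt.comp (g := h) hh hsub, ?_⟩
  filter_upwards [hsub.continuousAt.eventually e] with θ hθ hgen
  exact (hθ (hgen i j hij)).2

/-! ### The monodromy matrix without denominators -/

/-- Co-vectors on `(ℂ²)^{⊗ n}`. -/
abbrev CoVec (n : ℕ) : Type := (Fin n → Fin 2) → ℂ

/-- The components with first index `a`. -/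
def slice {n : ℕ} (a : Fin 2) : CoVec (n + 1) →ₗ[ℂ] CoVec n where
  toFun v β := v (a ∷ β)
  map_add' _ _ := rfl
  map_smul' _ _ := rfl

/-- The components with last index `a`. -/
def sliceLast {n : ℕ} (a : Fin 2) : CoVec (n + 1) →ₗ[ℂ] CoVec n where
  toFun v β := v (β ∷ʳ a)
  map_add' _ _ := rfl
  map_smul' _ _ := rfl

theorem slice_apply {n : ℕ} (a : Fin 2) (v : CoVec (n + 1)) (β : Fin n → Fin 2) :
    slice a v β = v (a ∷ β) := rfl

theorem sliceLast_apply {n : ℕ} (a : Fin 2) (v : CoVec (n + 1)) (β : Fin n → Fin 2) :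
    sliceLast a v β = v (β ∷ʳ a) := rfl

theorem slice_ext {n : ℕ} {v w : CoVec (n + 1)} (h : ∀ a, slice a v = slice a w) : v = w := by
  funext α
  rw [← cons_self_tail α]
  exact congrFun (h (α 0)) (tail α)

theorem slice_sliceLast {n : ℕ} (a b : Fin 2) (v : CoVec (n + 2)) :
    slice a (sliceLast b v) = sliceLast b (slice a v) := by
  funext β
  simp only [slice_apply, sliceLast_apply, Fin.cons_snoc_eq_snoc_cons]

/-- Kronecker's delta. -/
def kd (a b : Fin 2) : ℂ := if a = b then 1 else 0

/-- The block with lower auxiliary index `r` and upper auxiliary index `l` of the monodromy matrix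
times `∏ (θ_i - z - iπ)`, acting on co-vectors. -/
def tmat : (n : ℕ) → (Fin n → ℂ) → ℂ → Fin 2 → Fin 2 → CoVec n →ₗ[ℂ] CoVec n
  | 0, _, _, r, l => kd l r • LinearMap.id
  | n + 1, θ, z, r, l =>
    { toFun := fun v α => (θ 0 - z) * tmat n (tail θ) z r l (slice (α 0) v) (tail α) -
        kd (α 0) l * iπ * ∑ c, tmat n (tail θ) z r c (slice c v) (tail α)
      map_add' := fun v w => by
        funext α
        simp only [map_add, Pi.add_apply, sum_add_distrib]
        ring
      map_smul' := fun c v => by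
        funext α
        simp only [map_smul, Pi.smul_apply, smul_eq_mul, RingHom.id_apply, ← mul_sum]
        ring }

section
variable {n : ℕ}

theorem tmat_zero (θ : Fin 0 → ℂ) (z : ℂ) (r l : Fin 2) (v : CoVec 0) :
    tmat 0 θ z r l v = kd l r • v := rfl

theorem slice_tmat (θ : Fin (n + 1) → ℂ) (z : ℂ) (r l a : Fin 2) (v : CoVec (n + 1)) :
    slice a (tmat (n + 1) θ z r l v) = (θ 0 - z) • tmat n (tail θ) z r l (slice a v) -
      (kd a l * iπ) • (tmat n (tail θ) z r 0 (slice 0 v) + tmat n (tail θ) z r 1 (slice 1 v)) := by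
  funext β
  rw [slice_apply, tmat]
  simp [sum_univ_two]
  ring

theorem fin_two_cases (l : Fin 2) : l = 0 ∨ l = 1 := by fin_cases l <;> simp

theorem kd_same (a : Fin 2) : kd a a = 1 := if_pos rfl
theorem kd_zero_one : kd 0 1 = 0 := rfl
theorem kd_one_zero : kd 1 0 = 0 := rfl

theorem tmat_rtt (θ : Fin n → ℂ) (z z' : ℂ) : ∀ (r r' l l' : Fin 2) (v : CoVec n),
    (z - z') • tmat n θ z r l (tmat n θ z' r' l' v) - iπ • tmat n θ z r l' (tmat n θ z' r' l v) =
    (z - z') • tmat n θ z' r' l' (tmat n θ z r l v) - iπ • tmat n θ z' r l' (tmat n θ z r' l v) := by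
  induction n with
  | zero =>
    intro r r' l l' v
    simp only [tmat_zero, smul_smul]
    congr 2
    ring
  | succ n ih =>
    intro r r' l l' v
    refine slice_ext fun a => ?_
    have ih := ih (tail θ)
    have h0 := ih r r' l l' (slice a v)
    have h1 := fun c => ih r r' c l' (slice c v)
    have h2 := fun c => ih r r' l c (slice c v)
    have h3 := fun c => ih r r' c l (slice c v)
    have h4 := fun c => ih r r' l' c (slice c v)
    simp only [map_sub, map_smul, slice_tmat, map_add]
    rcases fin_two_cases l with rfl | rfl <;>
    rcases fin_two_cases l' with rfl | rfl <;>
    simp only [kd_same, kd_zero_one, kd_one_zero, zero_mul, one_mul, zero_smul, sub_zero]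
    · linear_combination (norm := module) ((θ 0 - z) * (θ 0 - z')) • h0 - ((θ 0 - z') * iπ * kd a 0) • (h1 0 + h1 1)
        - ((θ 0 - z) * iπ * kd a 0) • (h2 0 + h2 1) + (iπ ^ 2 * kd a 0) • (h3 0 + h3 1)
    · linear_combination (norm := module) ((θ 0 - z) * (θ 0 - z')) • h0 - ((θ 0 - z') * iπ * kd a 0) • (h1 0 + h1 1)
        - ((θ 0 - z) * iπ * kd a 1) • (h2 0 + h2 1) + (iπ ^ 2 * kd a 1) • (h3 0 + h3 1)
    · linear_combination (norm := module) ((θ 0 - z) * (θ 0 - z')) • h0 - ((θ 0 - z') * iπ * kd a 1) • (h1 0 + h1 1)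
        - ((θ 0 - z) * iπ * kd a 0) • (h2 0 + h2 1) + (iπ ^ 2 * kd a 0) • (h3 0 + h3 1)
    · linear_combination (norm := module) ((θ 0 - z) * (θ 0 - z')) • h0 - ((θ 0 - z') * iπ * kd a 1) • (h1 0 + h1 1)
        - ((θ 0 - z) * iπ * kd a 1) • (h2 0 + h2 1) + (iπ ^ 2 * kd a 1) • (h3 0 + h3 1)
end

section
variable {n : ℕ}
theorem tmat_C_comm (θ : Fin n → ℂ) (z z' : ℂ) (v : CoVec n) :
    tmat n θ z 0 1 (tmat n θ z' 0 1 v) = tmat n θ z' 0 1 (tmat n θ z 0 1 v) := by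
  have h1 := tmat_rtt θ z z' 0 0 1 1 v
  have h2 := tmat_rtt θ z' z 0 0 1 1 v
  rw [← sub_smul, ← sub_smul] at h1 h2
  by_cases h : z - z' - iπ = 0
  · refine (smul_right_injective _ (?_ : z' - z - iπ ≠ 0) h2).symm
    intro h'
    exact ipi_ne_zero (by linear_combination (-1 / 2) * (h + h'))
  · exact smul_right_injective _ h h1

theorem tmat_A_C (θ : Fin n → ℂ) {z z' : ℂ} (hz : z ≠ z') (v : CoVec n) :
    tmat n θ z 0 0 (tmat n θ z' 0 1 v) = (1 - iπ / (z - z')) • tmat n θ z' 0 1 (tmat n θ z 0 0 v) +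
      (iπ / (z - z')) • tmat n θ z 0 1 (tmat n θ z' 0 0 v) := by
  have h1 := tmat_rtt θ z z' 0 0 0 1 v
  have h : z - z' ≠ 0 := sub_ne_zero.2 hz
  refine smul_right_injective _ h ?_
  simp only [smul_add, smul_smul, mul_sub, mul_div_cancel₀ _ h, mul_one]
  linear_combination (norm := module) h1

theorem tmat_D_C (θ : Fin n → ℂ) {z z' : ℂ} (hz : z ≠ z') (v : CoVec n) :
    tmat n θ z 1 1 (tmat n θ z' 0 1 v) = (1 - -iπ / (z - z')) • tmat n θ z' 0 1 (tmat n θ z 1 1 v) +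
      (-iπ / (z - z')) • tmat n θ z 0 1 (tmat n θ z' 1 1 v) := by
  have h1 := tmat_rtt θ z' z 0 1 1 1 v
  have h : z - z' ≠ 0 := sub_ne_zero.2 hz
  refine smul_right_injective _ h ?_
  simp only [smul_add, smul_smul, mul_sub, mul_div_cancel₀ _ h, mul_one]
  linear_combination (norm := module) h1

/-- The pseudo-vacuum. -/
def vac (n : ℕ) : CoVec n := fun α => if ∀ i, α i = 0 then 1 else 0

theorem slice_zero_vac : slice 0 (vac (n + 1)) = vac n := by
  funext β
  simp [slice_apply, vac, Fin.forall_fin_succ]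

theorem slice_one_vac : slice 1 (vac (n + 1)) = 0 := by
  funext β
  simp [slice_apply, vac, Fin.forall_fin_succ]

theorem tmat_A_vac (θ : Fin n → ℂ) (z : ℂ) :
    tmat n θ z 0 0 (vac n) = (∏ i, (θ i - z - iπ)) • vac n := by
  induction n with
  | zero => simp [tmat_zero, kd_same]
  | succ n ih =>
    refine slice_ext fun a => ?_
    rw [slice_tmat, map_smul, slice_zero_vac, slice_one_vac, prod_univ_succ, ih (tail θ)]
    rcases fin_two_cases a with rfl | rfl
    · simp only [slice_zero_vac, ih (tail θ), kd_same, map_zero, tail]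
      module
    · simp [slice_one_vac, kd_one_zero]

theorem tmat_B_vac (θ : Fin n → ℂ) (z : ℂ) : tmat n θ z 1 0 (vac n) = 0 := by
  induction n with
  | zero => simp [tmat_zero, kd_zero_one]
  | succ n ih =>
    refine slice_ext fun a => ?_
    rw [slice_tmat, slice_zero_vac, slice_one_vac, ih (tail θ)]
    rcases fin_two_cases a with rfl | rfl
    · simp [slice_zero_vac, ih (tail θ)]
    · simp [slice_one_vac]

theorem tmat_D_vac (θ : Fin n → ℂ) (z : ℂ) :
    tmat n θ z 1 1 (vac n) = (∏ i, (θ i - z)) • vac n := by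
  induction n with
  | zero => simp [tmat_zero, kd_same]
  | succ n ih =>
    refine slice_ext fun a => ?_
    rw [slice_tmat, map_smul, slice_zero_vac, slice_one_vac, prod_univ_succ,
      tmat_B_vac (tail θ)]
    rcases fin_two_cases a with rfl | rfl
    · simp only [slice_zero_vac, ih (tail θ), kd_zero_one, tail]
      module
    · simp [slice_one_vac]

instance leftCommutative_tmat (θ : Fin n → ℂ) :
    LeftCommutative fun (z : ℂ) (v : CoVec n) => tmat n θ z 0 1 v :=
  ⟨fun z z' v => tmat_C_comm θ z z' v⟩

/-- The Bethe co-vector without denominators, for a multiset of spectral parameters. -/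
def bvec (θ : Fin n → ℂ) (s : Multiset ℂ) : CoVec n :=
  s.foldr (fun z v => tmat n θ z 0 1 v) (vac n)

theorem bvec_zero (θ : Fin n → ℂ) : bvec θ 0 = vac n := rfl

theorem bvec_cons (θ : Fin n → ℂ) (z : ℂ) (s : Multiset ℂ) :
    bvec θ (z ::ₘ s) = tmat n θ z 0 1 (bvec θ s) :=
  Multiset.foldr_cons (fun z v => tmat n θ z 0 1 v) (vac n) z s

/-- The action of a diagonal block of the monodromy matrix on a Bethe co-vector. -/
theorem diag_bvec (θ : Fin n → ℂ) {X : ℂ → CoVec n →ₗ[ℂ] CoVec n} {κ : ℂ} {ev : ℂ → ℂ}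
    (hX : ∀ z z' v, z ≠ z' → X z (tmat n θ z' 0 1 v) =
      (1 - κ / (z - z')) • tmat n θ z' 0 1 (X z v) + (κ / (z - z')) • tmat n θ z 0 1 (X z' v))
    (hev : ∀ z, X z (vac n) = ev z • vac n) (s : Finset ℂ) : ∀ z ∉ s,
    X z (bvec θ s.1) = (ev z * ∏ k ∈ s, (1 - κ / (z - k))) • bvec θ s.1 +
      ∑ j ∈ s, (κ / (z - j) * ev j * ∏ k ∈ s.erase j, (1 - κ / (j - k))) •
        tmat n θ z 0 1 (bvec θ (s.erase j).1) := by
  induction s using Finset.induction_on with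
  | empty => intro z _; simp [bvec_zero, hev]
  | insert a s ha ih =>
    intro z hz
    have hza : z ≠ a := fun h => hz (by simp [h])
    have hzs : z ∉ s := fun h => hz (by simp [h])
    rw [Finset.insert_val_of_notMem ha, bvec_cons, hX z a _ hza, ih z hzs, ih a ha,
      sum_insert ha, Finset.erase_insert ha, prod_insert ha]
    have hj : ∀ j ∈ s, tmat n θ z 0 1 (bvec θ ((insert a s).erase j).1) =
        tmat n θ z 0 1 (tmat n θ a 0 1 (bvec θ (s.erase j).1)) := by
      intro j hj
      have hja : a ≠ j := fun h => ha (h ▸ hj)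
      rw [Finset.erase_insert_of_ne hja, Finset.insert_val_of_notMem
        (fun h => ha (Finset.mem_of_mem_erase h)), bvec_cons]
    have hp : ∀ j ∈ s, ∏ k ∈ (insert a s).erase j, (1 - κ / (j - k)) =
        (1 - κ / (j - a)) * ∏ k ∈ s.erase j, (1 - κ / (j - k)) := by
      intro j hj
      have hja : a ≠ j := fun h => ha (h ▸ hj)
      rw [Finset.erase_insert_of_ne hja, prod_insert
        (fun h => ha (Finset.mem_of_mem_erase h))]
    have hs : ∑ j ∈ s, (κ / (z - j) * ev j * ∏ k ∈ (insert a s).erase j, (1 - κ / (j - k))) •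
          tmat n θ z 0 1 (bvec θ ((insert a s).erase j).1) =
        (1 - κ / (z - a)) • ∑ j ∈ s, (κ / (z - j) * ev j * ∏ k ∈ s.erase j, (1 - κ / (j - k))) •
            tmat n θ a 0 1 (tmat n θ z 0 1 (bvec θ (s.erase j).1)) +
          (κ / (z - a)) • ∑ j ∈ s, (κ / (a - j) * ev j * ∏ k ∈ s.erase j, (1 - κ / (j - k))) •
            tmat n θ z 0 1 (tmat n θ a 0 1 (bvec θ (s.erase j).1)) := by
      rw [Finset.smul_sum, Finset.smul_sum, ← sum_add_distrib]
      refine sum_congr rfl fun j hjs => ?_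
      rw [hj j hjs, hp j hjs, tmat_C_comm θ a z, smul_smul, smul_smul, ← add_smul]
      congr 1
      have h1 : z - a ≠ 0 := sub_ne_zero.2 hza
      have h2 : z - j ≠ 0 := sub_ne_zero.2 fun h => hzs (h ▸ hjs)
      have h3 : a - j ≠ 0 := sub_ne_zero.2 fun h => ha (h ▸ hjs)
      have h4 : j - a ≠ 0 := sub_ne_zero.2 fun h => ha (h ▸ hjs)
      rw [show j - a = -(a - j) by ring]
      field_simp
      ring
    rw [hs]
    simp only [map_add, map_sum, map_smul]
    module

/-- The lowering operator: `(sumLow v)(α) = ∑_{i : α_i = 0} v(α with α_i replaced by 1)`. -/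
def sumLow : (n : ℕ) → CoVec n →ₗ[ℂ] CoVec n
  | 0 => 0
  | n + 1 =>
    { toFun := fun v α => sumLow n (slice (α 0) v) (tail α) + kd (α 0) 0 * slice 1 v (tail α)
      map_add' := fun v w => by
        funext α
        simp only [map_add, Pi.add_apply]
        ring
      map_smul' := fun c v => by
        funext α
        simp only [map_smul, Pi.smul_apply, smul_eq_mul, RingHom.id_apply]
        ring }

theorem slice_sumLow (a : Fin 2) (v : CoVec (n + 1)) :
    slice a (sumLow (n + 1) v) = sumLow n (slice a v) + kd a 0 • slice 1 v := by
  funext β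
  rw [slice_apply, sumLow]
  simp [tail_cons]

theorem sumLow_vac : sumLow n (vac n) = 0 := by
  induction n with
  | zero => rfl
  | succ n ih =>
    refine slice_ext fun a => ?_
    rw [slice_sumLow, slice_one_vac, map_zero]
    rcases fin_two_cases a with rfl | rfl
    · simp [slice_zero_vac, ih]
    · simp [slice_one_vac]

theorem sumLow_tmat (θ : Fin n → ℂ) (z : ℂ) : ∀ (r l : Fin 2) (v : CoVec n),
    sumLow n (tmat n θ z r l v) = tmat n θ z r l (sumLow n v) + kd l 1 • tmat n θ z r 0 v -
      kd r 0 • tmat n θ z 1 l v := by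
  induction n with
  | zero =>
    intro r l v
    simp only [tmat_zero, smul_smul, sumLow, LinearMap.zero_apply, smul_zero]
    rcases fin_two_cases r with rfl | rfl <;> rcases fin_two_cases l with rfl | rfl <;>
      simp [kd_same, kd_zero_one, kd_one_zero]
  | succ n ih =>
    intro r l v
    have ih := ih (tail θ)
    refine slice_ext fun a => ?_
    simp only [map_sub, map_add, map_smul, slice_sumLow, slice_tmat, ih]
    rcases fin_two_cases a with rfl | rfl <;> rcases fin_two_cases l with rfl | rfl <;>
      simp only [kd_same, kd_zero_one, kd_one_zero, zero_mul, one_mul, zero_smul, one_smul, add_zero] <;>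
      module

theorem sumLow_bvec (θ : Fin n → ℂ) (s : Finset ℂ) :
    sumLow n (bvec θ s.1) = ∑ p ∈ s, ((∏ i, (θ i - p - iπ)) * ∏ k ∈ s.erase p, (1 - iπ / (p - k)) -
      (∏ i, (θ i - p)) * ∏ k ∈ s.erase p, (1 - -iπ / (p - k))) • bvec θ (s.erase p).1 := by
  induction s using Finset.induction_on with
  | empty => simp [bvec_zero, sumLow_vac]
  | insert a s ha ih =>
    have hA := diag_bvec θ (X := fun z => tmat n θ z 0 0) (fun z z' v h => tmat_A_C θ h v)
      (tmat_A_vac θ) s a ha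
    have hD := diag_bvec θ (X := fun z => tmat n θ z 1 1) (fun z z' v h => tmat_D_C θ h v)
      (tmat_D_vac θ) s a ha
    rw [Finset.insert_val_of_notMem ha, bvec_cons, sumLow_tmat, ih, kd_same, kd_same, one_smul,
      one_smul, hA, hD, sum_insert ha, Finset.erase_insert ha, map_sum]
    have hs : ∀ j ∈ s, ((∏ i, (θ i - j - iπ)) * ∏ k ∈ (insert a s).erase j, (1 - iπ / (j - k)) -
        (∏ i, (θ i - j)) * ∏ k ∈ (insert a s).erase j, (1 - -iπ / (j - k))) •
          bvec θ ((insert a s).erase j).1 =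
        tmat n θ a 0 1 (((∏ i, (θ i - j - iπ)) * ∏ k ∈ s.erase j, (1 - iπ / (j - k)) -
          (∏ i, (θ i - j)) * ∏ k ∈ s.erase j, (1 - -iπ / (j - k))) • bvec θ (s.erase j).1) +
        (iπ / (a - j) * (∏ i, (θ i - j - iπ)) * ∏ k ∈ s.erase j, (1 - iπ / (j - k))) •
          tmat n θ a 0 1 (bvec θ (s.erase j).1) -
        (-iπ / (a - j) * (∏ i, (θ i - j)) * ∏ k ∈ s.erase j, (1 - -iπ / (j - k))) •
          tmat n θ a 0 1 (bvec θ (s.erase j).1) := by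
      intro j hj
      have hja : a ≠ j := fun h => ha (h ▸ hj)
      have hn : a ∉ s.erase j := fun h => ha (Finset.mem_of_mem_erase h)
      rw [Finset.erase_insert_of_ne hja, Finset.insert_val_of_notMem hn, bvec_cons,
        prod_insert hn, prod_insert hn, map_smul, ← add_smul, ← sub_smul]
      congr 1
      rw [show j - a = -(a - j) by ring]
      simp only [div_neg, neg_div]
      ring
    rw [sum_congr rfl hs, sum_sub_distrib, sum_add_distrib]
    module
end

section
variable {n : ℕ}

theorem slice_zero_bvec (θ : Fin (n + 1) → ℂ) (s : Multiset ℂ) :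
    slice 0 (bvec θ s) = (s.map fun z => θ 0 - z).prod • bvec (tail θ) s := by
  induction s using Multiset.induction_on with
  | empty => simp [bvec_zero, slice_zero_vac]
  | cons z s ih =>
    rw [bvec_cons, slice_tmat, ih, bvec_cons, kd_zero_one, map_smul, Multiset.map_cons,
      Multiset.prod_cons]
    module

theorem sliceLast_zero_eq (b : Fin 2) (v : CoVec 1) : sliceLast b v = slice b v := by
  funext β
  rw [sliceLast_apply, slice_apply]
  congr 1
  funext i
  fin_cases i
  rfl

theorem sliceLast_tmat : ∀ (n : ℕ) (θ : Fin (n + 1) → ℂ) (z : ℂ) (r l b : Fin 2) (v : CoVec (n + 1)),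
    sliceLast b (tmat (n + 1) θ z r l v) =
      (θ (Fin.last n) - z) • tmat n (Fin.init θ) z r l (sliceLast b v) -
        iπ • tmat n (Fin.init θ) z b l (sliceLast r v) := by
  intro n
  induction n with
  | zero =>
    intro θ z r l b v
    rw [sliceLast_zero_eq, sliceLast_zero_eq, sliceLast_zero_eq, slice_tmat]
    simp only [tmat_zero]
    rw [show (Fin.last 0) = 0 from rfl]
    rcases fin_two_cases b with rfl | rfl <;> rcases fin_two_cases r with rfl | rfl <;>
      rcases fin_two_cases l with rfl | rfl <;>
      simp only [kd_same, kd_zero_one, kd_one_zero, zero_mul, one_mul, zero_smul, one_smul] <;> module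
  | succ n ih =>
    intro θ z r l b v
    have ih := ih (tail θ) z
    have h0 : tail θ (Fin.last n) = θ (Fin.last (n + 1)) := rfl
    have h1 : Fin.init (tail θ) = tail (Fin.init θ) := rfl
    have h2 : Fin.init θ 0 = θ 0 := rfl
    rw [h0, h1] at ih
    refine slice_ext fun a => ?_
    rw [slice_sliceLast, slice_tmat]
    simp only [map_sub, map_smul, map_add, slice_tmat, ih, slice_sliceLast, h2]
    module

theorem sliceLast_vac : sliceLast 0 (vac (n + 1)) = vac n := by
  funext β
  simp [sliceLast_apply, vac, Fin.forall_fin_succ']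

theorem sliceLast_zero_bvec (θ : Fin (n + 1) → ℂ) (s : Multiset ℂ) :
    sliceLast 0 (bvec θ s) =
      (s.map fun z => θ (Fin.last n) - z - iπ).prod • bvec (Fin.init θ) s := by
  induction s using Multiset.induction_on with
  | empty => simp [bvec_zero, sliceLast_vac]
  | cons z s ih =>
    rw [bvec_cons, sliceLast_tmat, ih, bvec_cons, map_smul, Multiset.map_cons, Multiset.prod_cons]
    module

theorem sliceLast_sumLow (b : Fin 2) (v : CoVec (n + 1)) :
    sliceLast b (sumLow (n + 1) v) = sumLow n (sliceLast b v) + kd b 0 • sliceLast 1 v := by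
  induction n with
  | zero =>
    rw [sliceLast_zero_eq, slice_sumLow, sliceLast_zero_eq, sliceLast_zero_eq]
  | succ n ih =>
    refine slice_ext fun a => ?_
    rw [slice_sliceLast, slice_sumLow]
    simp only [map_add, map_smul, ih, slice_sumLow, slice_sliceLast]
    module

theorem slice_zero_bvec_sub (θ : Fin (n + 1) → ℂ) (s : Multiset ℂ) :
    slice 0 (bvec θ ((θ 0 - iπ) ::ₘ s)) = (iπ * (s.map fun z => θ 0 - z).prod) •
      tmat n (tail θ) (θ 0 - iπ) 0 1 (bvec (tail θ) s) := by
  rw [bvec_cons, slice_tmat, slice_zero_bvec, kd_zero_one, map_smul]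
  module

theorem slice_one_bvec_sub (θ : Fin (n + 1) → ℂ) (s : Multiset ℂ) :
    slice 1 (bvec θ ((θ 0 - iπ) ::ₘ s)) = -(iπ * (s.map fun z => θ 0 - z).prod) •
      tmat n (tail θ) (θ 0 - iπ) 0 0 (bvec (tail θ) s) := by
  rw [bvec_cons, slice_tmat, slice_zero_bvec, kd_same, map_smul]
  module

theorem slice_zero_bvec_self (θ : Fin (n + 1) → ℂ) (s : Multiset ℂ) :
    slice 0 (bvec θ (θ 0 ::ₘ s)) = 0 := by
  rw [slice_zero_bvec]
  simp

theorem slice_one_bvec_self (θ : Fin (n + 1) → ℂ) (s : Multiset ℂ) :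
    slice 1 (bvec θ (θ 0 ::ₘ s)) = -(iπ * (∏ i, (tail θ i - θ 0 - iπ)) *
      (s.map fun z => θ 0 - z - iπ).prod) • bvec (tail θ) s := by
  induction s using Multiset.induction_on with
  | empty =>
    rw [bvec_cons, bvec_zero, slice_tmat, slice_zero_vac, slice_one_vac, tmat_A_vac, kd_same]
    simp [bvec_zero, neg_smul, smul_smul]
  | cons z s ih =>
    rw [Multiset.cons_swap, bvec_cons, slice_tmat, ih, slice_zero_bvec_self, kd_same, map_smul,
      ← bvec_cons, Multiset.map_cons, Multiset.prod_cons]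
    simp only [map_zero]
    module

/-! ### Exchange of neighbouring rapidities -/

/-- The exchange operator `x v(… α_j α_i …) - iπ v(… α_i α_j …)`. -/
def exch (i j : Fin n) (x : ℂ) : CoVec n →ₗ[ℂ] CoVec n where
  toFun v α := x * v (α ∘ Equiv.swap i j) - iπ * v α
  map_add' v w := by funext α; simp only [Pi.add_apply]; ring
  map_smul' c v := by funext α; simp only [Pi.smul_apply, smul_eq_mul, RingHom.id_apply]; ring

theorem exch_apply (i j : Fin n) (x : ℂ) (v : CoVec n) (α : Fin n → Fin 2) :
    exch i j x v α = x * v (α ∘ Equiv.swap i j) - iπ * v α := rfl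

theorem cons_comp_swap_succ {γ : Type*} (a : γ) (α : Fin n → γ) (i j : Fin n) :
    (Fin.cons a α : Fin (n + 1) → γ) ∘ Equiv.swap i.succ j.succ = Fin.cons a (α ∘ Equiv.swap i j) := by
  funext k
  refine Fin.cases ?_ (fun k => ?_) k
  · simp [Equiv.swap_apply_of_ne_of_ne (Fin.succ_ne_zero i).symm (Fin.succ_ne_zero j).symm]
  · simp only [Function.comp, cons_succ]
    rw [← (Fin.succ_injective n).map_swap, cons_succ]

theorem cons_cons_comp_swap {γ : Type*} (a b : γ) (α : Fin n → γ) :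
    (Fin.cons a (Fin.cons b α : Fin (n + 1) → γ) : Fin (n + 2) → γ) ∘ Equiv.swap 0 1 =
      Fin.cons b (Fin.cons a α : Fin (n + 1) → γ) := by
  funext k
  refine Fin.cases ?_ (fun k => Fin.cases ?_ (fun k => ?_) k) k
  · simp only [Function.comp, Equiv.swap_apply_left, cons_zero]
    rfl
  · rw [Function.comp, Fin.succ_zero_eq_one, Equiv.swap_apply_right]
    rfl
  · rw [Function.comp, Equiv.swap_apply_of_ne_of_ne (Fin.succ_ne_zero _)
      (by rw [← Fin.succ_zero_eq_one]; exact fun h => Fin.succ_ne_zero _ (Fin.succ_injective _ h))]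
    rfl

theorem slice_exch_succ (i j : Fin n) (x : ℂ) (a : Fin 2) (v : CoVec (n + 1)) :
    slice a (exch i.succ j.succ x v) = exch i j x (slice a v) := by
  funext β
  simp only [slice_apply, exch_apply, cons_comp_swap_succ]

theorem slice_slice_exch (x : ℂ) (a b : Fin 2) (v : CoVec (n + 2)) :
    slice b (slice a (exch 0 1 x v)) = x • slice a (slice b v) - iπ • slice b (slice a v) := by
  funext β
  simp only [slice_apply, exch_apply, cons_cons_comp_swap, Pi.sub_apply, Pi.smul_apply, smul_eq_mul]

theorem tmat_exch (θ : Fin n → ℂ) (z : ℂ) (r : Fin 2) (i j : Fin n) (hij : (i : ℕ) + 1 = j) :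
    ∀ (l : Fin 2) (v : CoVec n), tmat n θ z r l (exch i j (θ i - θ j) v) =
      exch i j (θ i - θ j) (tmat n (θ ∘ Equiv.swap i j) z r l v) := by
  induction n with
  | zero => exact i.elim0
  | succ n ih =>
    obtain ⟨j, rfl⟩ : ∃ j' : Fin n, j = j'.succ := ⟨j.pred (by intro h; simp [h] at hij), by simp⟩
    rw [Fin.val_succ, add_left_inj] at hij
    obtain ⟨t, θ, rfl⟩ : ∃ t θ', θ = Fin.cons t θ' := ⟨θ 0, tail θ, (cons_self_tail θ).symm⟩
    intro l v
    rcases Fin.eq_zero_or_eq_succ i with rfl | ⟨i, rfl⟩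
    · cases n with
      | zero => exact j.elim0
      | succ n =>
        obtain rfl : j = 0 := Fin.ext hij.symm
        obtain ⟨s, θ, rfl⟩ : ∃ s θ', θ = Fin.cons s θ' :=
          ⟨θ 0, tail θ, (cons_self_tail θ).symm⟩
        rw [Fin.succ_zero_eq_one, cons_cons_comp_swap]
        refine slice_ext fun a => slice_ext fun b => ?_
        have e1 : (t ∷ s ∷ θ) 1 = s := rfl
        rw [slice_slice_exch]
        simp only [slice_tmat, tail_cons, cons_zero, map_sub, map_smul, map_add,
          slice_slice_exch, e1]
        rcases fin_two_cases a with rfl | rfl <;> rcases fin_two_cases b with rfl | rfl <;>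
          rcases fin_two_cases l with rfl | rfl <;>
          simp only [kd_same, kd_zero_one, kd_one_zero, zero_mul, one_mul, zero_smul, sub_zero] <;>
          module
    · rw [Fin.val_succ] at hij
      refine slice_ext fun a => ?_
      have ih := ih θ i j hij
      simp only [cons_comp_swap_succ, slice_exch_succ, slice_tmat, cons_zero, tail_cons,
        cons_succ, ih, map_sub, map_smul, map_add]

theorem exch_bvec (θ : Fin n → ℂ) (i j : Fin n) (hij : (i : ℕ) + 1 = j) (s : Multiset ℂ) :
    exch i j (θ i - θ j) (bvec (θ ∘ Equiv.swap i j) s) = (θ i - θ j - iπ) • bvec θ s := by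
  induction s using Multiset.induction_on with
  | empty =>
    funext α
    have : (∀ k, (α ∘ Equiv.swap i j) k = 0) ↔ ∀ k, α k = 0 :=
      ⟨fun h k => by simpa using h (Equiv.swap i j k), fun h k => h _⟩
    simp only [exch_apply, bvec_zero, vac, this, Pi.smul_apply, smul_eq_mul]
    ring
  | cons z s ih => rw [bvec_cons, ← tmat_exch θ z 0 i j hij, ih, map_smul, bvec_cons]

/-! ### The monodromy matrix and the scattering matrix in terms of `tmat` -/

theorem sum_cons {M : Type*} [AddCommMonoid M] (f : (Fin (n + 1) → Fin 2) → M) :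
    ∑ α, f α = ∑ a, ∑ β, f (a ∷ β) := by
  rw [← Fintype.sum_prod_type']
  exact Fintype.sum_equiv (Fin.consEquiv fun _ => Fin 2).symm _ _ fun α => by simp [Fin.consEquiv]

theorem tmat_eq_monodromy (θ : Fin n → ℂ) (z : ℂ) (h : ∀ i, θ i - z - iπ ≠ 0) :
    ∀ (r l : Fin 2) (v : CoVec n) (α : Fin n → Fin 2), tmat n θ z r l v α =
      (∏ i, (θ i - z - iπ)) * ∑ α', v α' * monodromy n θ z α r l α' := by
  induction n with
  | zero =>
    intro r l v α
    rw [Fintype.sum_subsingleton _ α]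
    simp [tmat_zero, monodromy, kd, eq_comm]
  | succ n ih =>
    intro r l v α
    obtain ⟨a, β, rfl⟩ : ∃ a β, α = Fin.cons a β := ⟨α 0, tail α, (cons_self_tail α).symm⟩
    have ih := ih (tail θ) fun i => h i.succ
    rw [← slice_apply a (tmat (n + 1) θ z r l v), slice_tmat]
    have h0 := h 0
    set Q := ∏ i, (tail θ i - z - iπ) with hQ
    have hm : ∀ r l (w : CoVec n), ∑ β', w β' * monodromy n (tail θ) z β r l β' * Q =
        tmat n (tail θ) z r l w β := by
      intro r l w
      rw [ih, ← Finset.sum_mul, mul_comm]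
    rw [sum_cons, prod_univ_succ, show ∏ i : Fin n, (θ i.succ - z - iπ) = Q from rfl]
    simp only [monodromy, cons_zero, tail_cons, sum_univ_two]
    have key : ∀ c h' : Fin 2, ∀ s : ℂ, ∑ β', v (c ∷ β') * (s *
        monodromy n (tail θ) z β r h' β') * Q = s * tmat n (tail θ) z r h' (slice c v) β := by
      intro c h' s
      rw [← hm, mul_sum]
      exact sum_congr rfl fun β' _ => by rw [slice_apply]; ring
    simp only [Pi.sub_apply, Pi.smul_apply, Pi.add_apply, smul_eq_mul]
    have e : ∀ c, (∑ β', v (c ∷ β') * (Stilde (θ 0 - z) a 0 l c *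
        monodromy n (tail θ) z β r 0 β' + Stilde (θ 0 - z) a 1 l c *
        monodromy n (tail θ) z β r 1 β')) * Q =
        Stilde (θ 0 - z) a 0 l c * tmat n (tail θ) z r 0 (slice c v) β +
        Stilde (θ 0 - z) a 1 l c * tmat n (tail θ) z r 1 (slice c v) β := by
      intro c
      rw [← key, ← key, ← sum_add_distrib, Finset.sum_mul]
      exact sum_congr rfl fun β' _ => by ring
    rw [mul_assoc _ Q, mul_comm Q, add_mul, e 0, e 1]
    have hb : ampBt (θ 0 - z) = (θ 0 - z) / (θ 0 - z - iπ) := rfl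
    have hc : ampCt (θ 0 - z) = -iπ / (θ 0 - z - iπ) := rfl
    rcases fin_two_cases a with rfl | rfl <;> rcases fin_two_cases l with rfl | rfl <;>
      simp [Stilde, kd, hb, hc] <;> field_simp <;> ring

/-- The Bethe co-vector without denominators. -/
def bpoly (θ : Fin n → ℂ) {m : ℕ} (z : Fin m → ℂ) : CoVec n := bvec θ (Finset.univ.val.map z)

theorem map_univ_cons {γ : Type*} {m : ℕ} (a : γ) (z : Fin m → γ) :
    Finset.univ.val.map (Fin.cons a z : Fin (m + 1) → γ) = a ::ₘ Finset.univ.val.map z := by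
  rw [Fin.univ_succ, Finset.cons_val, Multiset.map_cons, Finset.map_val, Multiset.map_map]
  simp

theorem bpoly_cons (θ : Fin n → ℂ) {m : ℕ} (a : ℂ) (z : Fin m → ℂ) :
    bpoly θ (a ∷ z) = tmat n θ a 0 1 (bpoly θ z) := by
  rw [bpoly, map_univ_cons, bvec_cons, bpoly]

theorem bpoly_comp_perm (θ : Fin n → ℂ) {m : ℕ} (s : Equiv.Perm (Fin m)) (z : Fin m → ℂ) :
    bpoly θ (z ∘ s) = bpoly θ z := by
  rw [bpoly, bpoly, ← Multiset.map_map, Multiset.map_univ_val_equiv]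

theorem bpoly_eq_betheCovector (θ : Fin n → ℂ) {m : ℕ} (z : Fin m → ℂ)
    (h : ∀ j i, θ i - z j - iπ ≠ 0) (α : Fin n → Fin 2) :
    bpoly θ z α = (∏ j, ∏ i, (θ i - z j - iπ)) * betheCovector θ m z α := by
  induction m generalizing α with
  | zero => simp [bpoly, bvec_zero, vac, betheCovector]
  | succ m ih =>
    obtain ⟨a, z, rfl⟩ : ∃ a z', z = Fin.cons a z' := ⟨z 0, tail z, (cons_self_tail z).symm⟩
    have h' : ∀ j i, θ i - z j - iπ ≠ 0 := fun j i => by simpa using h j.succ i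
    rw [bpoly_cons, tmat_eq_monodromy θ a (fun i => by simpa using h 0 i), betheCovector,
      prod_univ_succ]
    simp only [cons_zero, cons_succ, tail_cons, opC, ih z h']
    rw [mul_assoc]
    congr 1
    rw [mul_sum]
    exact sum_congr rfl fun α' _ => by ring

/-- The scattering matrix acting on a co-vector. -/
def scAct (t : ℂ) (θ : Fin n → ℂ) (a b : Fin 2) (G : CoVec n) : CoVec n :=
  fun α => ∑ δ, G δ * scatter n t θ a α δ b

theorem scAct_eq (t : ℂ) (θ : Fin n → ℂ) (h : ∀ i, t - θ i - iπ ≠ 0) :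
    ∀ (a b : Fin 2) (G : CoVec n), scAct t θ a b G =
      ((-1) ^ (a + b : ℕ) * ∏ i, (-ampA (t - θ i) / (t - θ i - iπ))) •
        tmat n θ (t - iπ) (1 - b) (1 - a) G := by
  induction n with
  | zero =>
    intro a b G
    funext α
    rw [scAct, Fintype.sum_subsingleton _ α]
    rcases fin_two_cases a with rfl | rfl <;> rcases fin_two_cases b with rfl | rfl <;>
      simp [tmat_zero, scatter, kd]
  | succ n ih =>
    intro a b G
    have ih := ih (tail θ) fun i => h i.succ
    refine slice_ext fun c => ?_
    have h0 := h 0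
    have e : slice c (scAct t θ a b G) = (ampA (t - θ 0) / (t - θ 0 - iπ)) •
        ((t - θ 0) • scAct t (tail θ) a b (slice c G) - iπ • scAct t (tail θ) c b (slice a G)) := by
      funext β
      have key : ∀ d e : Fin 2, ∀ s : ℂ, ∑ β', G (d ∷ β') * (s *
          scatter n t (tail θ) e β β' b) = s * scAct t (tail θ) e b (slice d G) β := by
        intro d e s
        rw [scAct, mul_sum]
        exact sum_congr rfl fun β' _ => by rw [slice_apply]; ring
      rw [slice_apply, scAct, sum_cons]
      simp only [scatter, cons_zero, tail_cons, sum_univ_two, mul_add,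
        sum_add_distrib, key, Pi.smul_apply, Pi.sub_apply, smul_eq_mul]
      have hb : ampBt (t - θ 0) = (t - θ 0) / (t - θ 0 - iπ) := rfl
      have hc : ampCt (t - θ 0) = -iπ / (t - θ 0 - iπ) := rfl
      rcases fin_two_cases a with rfl | rfl <;> rcases fin_two_cases c with rfl | rfl <;>
        simp [Smat, Stilde, hb, hc] <;> field_simp <;> ring
    rw [e, ih, ih, map_smul, slice_tmat, prod_univ_succ]
    change _ = ((-1) ^ (a + b : ℕ) * (-ampA (t - θ 0) / (t - θ 0 - iπ) *
      ∏ i, (-ampA (t - tail θ i) / (t - tail θ i - iπ)))) • _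
    set Q := ∏ i, (-ampA (t - tail θ i) / (t - tail θ i - iπ))
    funext β
    simp only [Pi.sub_apply, Pi.smul_apply, Pi.add_apply, smul_eq_mul]
    rcases fin_two_cases a with rfl | rfl <;> rcases fin_two_cases c with rfl | rfl <;>
      rcases fin_two_cases b with rfl | rfl <;>
      simp [kd] <;> field_simp <;> ring

theorem sumLow_scAct (t : ℂ) (θ : Fin n → ℂ) (h : ∀ i, t - θ i - iπ ≠ 0) {G : CoVec n}
    (hG : sumLow n G = 0) (a b : Fin 2) :
    sumLow n (scAct t θ a b G) = kd b 1 • scAct t θ a 0 G - kd a 0 • scAct t θ 1 b G := by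
  simp only [scAct_eq t θ h, map_smul, sumLow_tmat, hG, map_zero]
  rcases fin_two_cases a with rfl | rfl <;> rcases fin_two_cases b with rfl | rfl <;>
    simp [kd]
  all_goals module
end

/-! ### Iterated functionals and separable functions -/

section

/-- The functional `f ↦ L_{z₁} ⋯ L_{z_m} f(z₁, …, z_m)`. -/
def tens (L : (ℂ → ℂ) →ₗ[ℂ] ℂ) : (m : ℕ) → ((Fin m → ℂ) → ℂ) →ₗ[ℂ] ℂ
  | 0 => LinearMap.proj Fin.elim0
  | m + 1 =>
    { toFun := fun f => L fun a => tens L m fun z => f (a ∷ z)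
      map_add' := fun f g => by
        rw [← map_add]
        congr 1
        funext a
        exact map_add (tens L m) _ _
      map_smul' := fun c f => by
        rw [← map_smul]
        congr 1
        funext a
        exact map_smul (tens L m) _ _ }

theorem tens_zero (L : (ℂ → ℂ) →ₗ[ℂ] ℂ) (f : (Fin 0 → ℂ) → ℂ) : tens L 0 f = f Fin.elim0 := rfl

theorem tens_succ (L : (ℂ → ℂ) →ₗ[ℂ] ℂ) (m : ℕ) (f : (Fin (m + 1) → ℂ) → ℂ) :
    tens L (m + 1) f = L fun a => tens L m fun z => f (a ∷ z) := rfl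

/-- Multiplication of functions of one variable by `g`. -/
def mulFun (g : ℂ → ℂ) : (ℂ → ℂ) →ₗ[ℂ] (ℂ → ℂ) := LinearMap.mulLeft ℂ g

theorem tens_comp_mulFun (L : (ℂ → ℂ) →ₗ[ℂ] ℂ) (g : ℂ → ℂ) : ∀ (m : ℕ) (f : (Fin m → ℂ) → ℂ),
    tens (L ∘ₗ mulFun g) m f = tens L m fun z => (∏ j, g (z j)) * f z := by
  intro m
  induction m with
  | zero => intro f; simp [tens_zero]
  | succ m ih =>
    intro f
    rw [tens_succ, tens_succ, LinearMap.comp_apply]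
    congr 1
    funext a
    rw [show mulFun g = LinearMap.mulLeft ℂ g from rfl, LinearMap.mulLeft_apply, Pi.mul_apply]
    rw [show LinearMap.mulLeft ℂ g = mulFun g from rfl, ih, ← smul_eq_mul, ← map_smul]
    congr 1
    funext z
    simp [prod_univ_succ, mul_assoc]

theorem tens_prod (L : (ℂ → ℂ) →ₗ[ℂ] ℂ) : ∀ (m : ℕ) (e : Fin m → ℂ → ℂ),
    tens L m (fun z => ∏ j, e j (z j)) = ∏ j, L (e j) := by
  intro m
  induction m with
  | zero => intro e; simp [tens_zero]
  | succ m ih =>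
    intro e
    rw [tens_succ, prod_univ_succ, ← ih, mul_comm, ← smul_eq_mul, ← map_smul]
    congr 1
    funext a
    rw [Pi.smul_apply, smul_eq_mul, mul_comm, ← smul_eq_mul, ← map_smul]
    congr 1
    funext z
    simp [prod_univ_succ]

theorem tens_const_mul_prod (L : (ℂ → ℂ) →ₗ[ℂ] ℂ) {m : ℕ} (c : ℂ) (e : Fin m → ℂ → ℂ) :
    tens L m (fun z => c * ∏ j, e j (z j)) = c * ∏ j, L (e j) := by
  rw [← tens_prod, ← smul_eq_mul, ← map_smul]
  rfl

/-- Finite sums of products `∏ e_j(z_j)` with `e_j ∈ V_j`. -/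
def Sep {m : ℕ} (V : Fin m → Submodule ℂ (ℂ → ℂ)) : Submodule ℂ ((Fin m → ℂ) → ℂ) :=
  Submodule.span ℂ {f | ∃ e : Fin m → ℂ → ℂ, (∀ j, e j ∈ V j) ∧ f = fun z => ∏ j, e j (z j)}

variable {m : ℕ} {V V' V'' : Fin m → Submodule ℂ (ℂ → ℂ)} {f g : (Fin m → ℂ) → ℂ}

theorem Sep.induction {P : ((Fin m → ℂ) → ℂ) → Prop} (hf : f ∈ Sep V)
    (hp : ∀ e : Fin m → ℂ → ℂ, (∀ j, e j ∈ V j) → P fun z => ∏ j, e j (z j))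
    (h0 : P 0) (ha : ∀ f g, P f → P g → P (f + g)) (hs : ∀ (c : ℂ) f, P f → P (c • f)) : P f := by
  induction hf using span_induction with
  | mem f hf => obtain ⟨e, he, rfl⟩ := hf; exact hp e he
  | zero => exact h0
  | add f g _ _ hf hg => exact ha f g hf hg
  | smul c f _ hf => exact hs c f hf

theorem tens_congr_of_sep {L L' : (ℂ → ℂ) →ₗ[ℂ] ℂ} (hf : f ∈ Sep V)
    (h : ∀ j, ∀ e ∈ V j, L e = L' e) : tens L m f = tens L' m f := by
  refine Sep.induction (P := fun f => tens L m f = tens L' m f) hf ?_ ?_ ?_ ?_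
  · intro e he
    rw [tens_prod, tens_prod]
    exact prod_congr rfl fun j _ => h j _ (he j)
  · simp
  · intro f g hf hg; rw [map_add, map_add, hf, hg]
  · intro c f hf; rw [map_smul, map_smul, hf]

theorem tens_comp_perm (L : (ℂ → ℂ) →ₗ[ℂ] ℂ) (hf : f ∈ Sep V) (s : Equiv.Perm (Fin m)) :
    tens L m (fun z => f (z ∘ s)) = tens L m f := by
  refine Sep.induction (P := fun f => tens L m (fun z => f (z ∘ s)) = tens L m f) hf ?_ ?_ ?_ ?_
  · intro e _
    have : (fun z : Fin m → ℂ => ∏ j, e j ((z ∘ s) j)) = fun z => ∏ j, e (s.symm j) (z j) := by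
      funext z
      rw [← Equiv.prod_comp s fun j => e (s.symm j) (z j)]
      simp
    rw [this, tens_prod, tens_prod, ← Equiv.prod_comp s]
    simp
  · exact rfl
  · intro f g hf hg
    rw [map_add, ← hf, ← hg, ← map_add]
    rfl
  · intro c f hf
    rw [map_smul, ← hf, ← map_smul]
    rfl

theorem tens_succ_inner (L : (ℂ → ℂ) →ₗ[ℂ] ℂ) {V : Fin (m + 1) → Submodule ℂ (ℂ → ℂ)}
    {f : (Fin (m + 1) → ℂ) → ℂ} (hf : f ∈ Sep V) :
    tens L (m + 1) f = tens L m fun z => L fun a => f (a ∷ z) := by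
  refine Sep.induction (P := fun f => tens L (m + 1) f =
    tens L m fun z => L fun a => f (a ∷ z)) hf ?_ ?_ ?_ ?_
  · intro e _
    rw [tens_prod, prod_univ_succ, ← tens_prod, ← smul_eq_mul, ← map_smul]
    congr 1
    funext z
    rw [Pi.smul_apply, smul_eq_mul, mul_comm, ← smul_eq_mul, ← map_smul]
    congr 1
    funext a
    simp [prod_univ_succ, mul_comm]
  · rw [map_zero, ← map_zero (tens L m)]
    congr 1
    funext z
    exact (map_zero L).symm
  · intro f g hf hg
    rw [map_add, hf, hg, ← map_add]
    congr 1
    funext z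
    exact (map_add L _ _).symm
  · intro c f hf
    rw [map_smul, hf, ← map_smul]
    congr 1
    funext z
    exact (map_smul L _ _).symm

theorem Sep.cons {V : Fin (m + 1) → Submodule ℂ (ℂ → ℂ)} {f : (Fin (m + 1) → ℂ) → ℂ}
    (hf : f ∈ Sep V) (a : ℂ) : (fun z => f (a ∷ z)) ∈ Sep (tail V) := by
  refine Sep.induction (P := fun f => (fun z => f (a ∷ z)) ∈ Sep (tail V)) hf ?_ (zero_mem _)
    (fun _ _ => add_mem) fun c _ => smul_mem _ c
  intro e he
  have : (fun z : Fin m → ℂ => ∏ j, e j ((a ∷ z) j)) =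
      (e 0 a) • fun z : Fin m → ℂ => ∏ j, e (Fin.succ j) (z j) := by
    funext z
    simp [prod_univ_succ]
  rw [this]
  exact smul_mem _ _ (subset_span ⟨fun j => e j.succ, fun j => he _, rfl⟩)

theorem Sep.apply_mem {V : Fin (m + 1) → Submodule ℂ (ℂ → ℂ)} {f : (Fin (m + 1) → ℂ) → ℂ}
    (hf : f ∈ Sep V) (z : Fin m → ℂ) : (fun a => f (a ∷ z)) ∈ V 0 := by
  refine Sep.induction (P := fun f => (fun a => f (a ∷ z)) ∈ V 0) hf ?_ (zero_mem _)
    (fun _ _ => add_mem) fun c _ => smul_mem _ c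
  intro e he
  have : (fun a => ∏ j, e j ((a ∷ z) j)) =
      (∏ j, e (Fin.succ j) (z j)) • e 0 := by
    funext a
    simp [prod_univ_succ, mul_comm]
  rw [this]
  exact smul_mem _ _ (he 0)

theorem Sep.tens_mem {V : Fin (m + 1) → Submodule ℂ (ℂ → ℂ)} {f : (Fin (m + 1) → ℂ) → ℂ}
    (hf : f ∈ Sep V) (L : (ℂ → ℂ) →ₗ[ℂ] ℂ) :
    (fun a => tens L m fun z => f (a ∷ z)) ∈ V 0 := by
  refine Sep.induction (P := fun f => (fun a => tens L m fun z => f (a ∷ z)) ∈ V 0)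
    hf ?_ ?_ ?_ ?_
  · intro e he
    have : (fun a => tens L m fun z => ∏ j, e j ((a ∷ z) j)) =
        (∏ j, L (e (Fin.succ j))) • e 0 := by
      funext a
      rw [Pi.smul_apply, smul_eq_mul, mul_comm, ← tens_prod, ← smul_eq_mul, ← map_smul]
      congr 1
      funext z
      simp [prod_univ_succ]
    rw [this]
    exact smul_mem _ _ (he 0)
  · have : (fun a : ℂ => tens L m fun z => (0 : (Fin (m + 1) → ℂ) → ℂ) (a ∷ z)) = 0 :=
      funext fun a => map_zero (tens L m)
    rw [this]
    exact zero_mem _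
  · intro f g hf hg
    have : (fun a : ℂ => tens L m fun z => (f + g) (a ∷ z)) =
        (fun a => tens L m fun z => f (a ∷ z)) + fun a => tens L m fun z => g (a ∷ z) :=
      funext fun a => map_add (tens L m) _ _
    rw [this]
    exact add_mem hf hg
  · intro c f hf
    have : (fun a : ℂ => tens L m fun z => (c • f) (a ∷ z)) =
        c • fun a => tens L m fun z => f (a ∷ z) :=
      funext fun a => map_smul (tens L m) _ _
    rw [this]
    exact smul_mem _ c hf

/-! ### Separable functions depending holomorphically on parameters -/

variable {X Y : Type*} [NormedAddCommGroup X] [NormedSpace ℂ X] [NormedAddCommGroup Y] [NormedSpace ℂ Y]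

/-- Finite sums of products `c(x) ∏ e_j(z_j)` with `c` holomorphic and `e_j ∈ V_j`. -/
def PSep (X : Type*) [NormedAddCommGroup X] [NormedSpace ℂ X] {m : ℕ}
    (V : Fin m → Submodule ℂ (ℂ → ℂ)) : Submodule ℂ (X → (Fin m → ℂ) → ℂ) :=
  Submodule.span ℂ {f | ∃ c : X → ℂ, Differentiable ℂ c ∧ ∃ e : Fin m → ℂ → ℂ, (∀ j, e j ∈ V j) ∧
    f = fun x z => c x * ∏ j, e j (z j)}

variable {F G : X → (Fin m → ℂ) → ℂ}

theorem PSep.induction {P : (X → (Fin m → ℂ) → ℂ) → Prop} (hF : F ∈ PSep X V)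
    (hp : ∀ c : X → ℂ, Differentiable ℂ c → ∀ e : Fin m → ℂ → ℂ, (∀ j, e j ∈ V j) →
      P fun x z => c x * ∏ j, e j (z j))
    (h0 : P 0) (ha : ∀ F G, P F → P G → P (F + G)) (hs : ∀ (c : ℂ) F, P F → P (c • F)) : P F := by
  induction hF using span_induction with
  | mem f hf => obtain ⟨c, hc, e, he, rfl⟩ := hf; exact hp c hc e he
  | zero => exact h0
  | add f g _ _ hf hg => exact ha f g hf hg
  | smul c f _ hf => exact hs c f hf

theorem PSep.pure {c : X → ℂ} (hc : Differentiable ℂ c) {e : Fin m → ℂ → ℂ} (he : ∀ j, e j ∈ V j) :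
    (fun x z => c x * ∏ j, e j (z j)) ∈ PSep X V :=
  subset_span ⟨c, hc, e, he, rfl⟩

theorem PSep.sep (hF : F ∈ PSep X V) (x : X) : F x ∈ Sep V := by
  refine PSep.induction (P := fun F => F x ∈ Sep V) hF ?_ (zero_mem _)
    (fun _ _ => add_mem) fun c _ => smul_mem _ c
  intro c _ e he
  exact smul_mem _ (c x) (subset_span ⟨e, he, rfl⟩)

theorem PSep.mono (hF : F ∈ PSep X V) (h : ∀ j, V j ≤ V' j) : F ∈ PSep X V' := by
  refine Submodule.span_mono ?_ hF
  rintro _ ⟨c, hc, e, he, rfl⟩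
  exact ⟨c, hc, e, fun j => h j (he j), rfl⟩

theorem PSep.mul (hF : F ∈ PSep X V) (hG : G ∈ PSep X V') (h : ∀ j, V j * V' j ≤ V'' j) :
    (fun x z => F x z * G x z) ∈ PSep X V'' := by
  refine PSep.induction (P := fun F => (fun x z => F x z * G x z) ∈ PSep X V'') hF ?_ ?_ ?_ ?_
  · intro c hc e he
    refine PSep.induction (P := fun G => (fun x z => c x * (∏ j, e j (z j)) * G x z) ∈ PSep X V'')
      hG ?_ ?_ ?_ ?_
    · intro c' hc' e' he'
      have : (fun x (z : Fin m → ℂ) => c x * (∏ j, e j (z j)) * (c' x * ∏ j, e' j (z j))) =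
          fun x z => (c x * c' x) * ∏ j, (e j * e' j) (z j) := by
        funext x z
        simp only [Pi.mul_apply, prod_mul_distrib]
        ring
      rw [this]
      exact PSep.pure (hc.mul hc') fun j => h j (Submodule.mul_mem_mul (he j) (he' j))
    · convert zero_mem (PSep X V'') using 1
      funext x z; simp
    · intro f g hf hg
      convert add_mem hf hg using 1
      funext x z; simp [mul_add]
    · intro a f hf
      convert smul_mem _ a hf using 1
      funext x z; simp; ring
  · convert zero_mem (PSep X V'') using 1
    funext x z; simp
  · intro f g hf hg
    convert add_mem hf hg using 1
    funext x z; simp [add_mul]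
  · intro a f hf
    convert smul_mem _ a hf using 1
    funext x z; simp; ring

theorem PSep.comp (hF : F ∈ PSep X V) {φ : Y → X} (hφ : Differentiable ℂ φ) :
    (fun y => F (φ y)) ∈ PSep Y V := by
  refine PSep.induction (P := fun F => (fun y => F (φ y)) ∈ PSep Y V) hF ?_ (zero_mem _)
    (fun _ _ => add_mem) fun c _ => smul_mem _ c
  intro c hc e he
  exact PSep.pure (hc.comp hφ) he

/-- Substitution of a function of the parameters for the first variable. -/
theorem PSep.subst {V : Fin (m + 1) → Submodule ℂ (ℂ → ℂ)} {F : X → (Fin (m + 1) → ℂ) → ℂ}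
    (hF : F ∈ PSep X V) (hV : ∀ e ∈ V 0, Differentiable ℂ e) {ζ : X → ℂ} (hζ : Differentiable ℂ ζ) :
    (fun x z => F x (ζ x ∷ z)) ∈ PSep X (tail V) := by
  refine PSep.induction (P := fun F => (fun x z => F x (ζ x ∷ z)) ∈ PSep X (tail V))
    hF ?_ (zero_mem _)
    (fun _ _ => add_mem) fun c _ => smul_mem _ c
  intro c hc e he
  have : (fun x (z : Fin m → ℂ) => c x * ∏ j, e j ((ζ x ∷ z) j)) =
      fun x z => (c x * e 0 (ζ x)) * ∏ j, e (Fin.succ j) (z j) := by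
    funext x z
    simp [prod_univ_succ, mul_assoc]
  rw [this]
  exact PSep.pure (hc.mul ((hV _ (he 0)).comp hζ)) fun j => he _

/-- Adding a first variable. -/
theorem PSep.comp_tail (hF : F ∈ PSep X V) {e : ℂ → ℂ} {W : Submodule ℂ (ℂ → ℂ)} (he : e ∈ W) :
    (fun x (z : Fin (m + 1) → ℂ) => e (z 0) * F x (tail z)) ∈ PSep X (W ∷ V) := by
  refine PSep.induction (P := fun F => (fun x (z : Fin (m + 1) → ℂ) => e (z 0) * F x (tail z)) ∈
    PSep X (W ∷ V)) hF ?_ ?_ ?_ ?_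
  · intro c hc e' he'
    have : (fun x (z : Fin (m + 1) → ℂ) => e (z 0) * (c x * ∏ j, e' j (tail z j))) =
        fun x z => c x * ∏ j, (Fin.cons e e' : Fin (m + 1) → ℂ → ℂ) j (z j) := by
      funext x z
      simp [prod_univ_succ, tail]
      ring
    rw [this]
    exact PSep.pure hc fun j => by refine Fin.cases ?_ (fun j => ?_) j <;> simp [he, he']
  · convert zero_mem (PSep X (W ∷ V)) using 1
    funext x z; simp
  · intro f g hf hg
    convert add_mem hf hg using 1
    funext x z; simp [mul_add]
  · intro a f hf
    convert smul_mem _ a hf using 1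
    funext x z; simp; ring

theorem PSep.tendsto_tens {ι : Type*} {l : Filter ι} (hF : F ∈ PSep X V) {x : ι → X} {x₀ : X}
    (hx : Tendsto x l (𝓝 x₀)) {L : ι → (ℂ → ℂ) →ₗ[ℂ] ℂ} {L₀ : (ℂ → ℂ) →ₗ[ℂ] ℂ}
    (hL : ∀ j, ∀ e ∈ V j, Tendsto (fun i => L i e) l (𝓝 (L₀ e))) :
    Tendsto (fun i => tens (L i) m (F (x i))) l (𝓝 (tens L₀ m (F x₀))) := by
  refine PSep.induction (P := fun F => Tendsto (fun i => tens (L i) m (F (x i))) l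
    (𝓝 (tens L₀ m (F x₀)))) hF ?_ ?_ ?_ ?_
  · intro c hc e he
    simp only [tens_const_mul_prod]
    exact ((hc.continuous.tendsto x₀).comp hx).mul (tendsto_finsetProd _ fun j _ => hL j _ (he j))
  · simpa using tendsto_const_nhds
  · intro f g hf hg; simpa using hf.add hg
  · intro c f hf; simpa using hf.const_mul c

theorem PSep.meroG_tens {n : ℕ} {F : (Fin n → ℂ) → (Fin m → ℂ) → ℂ} (hF : F ∈ PSep (Fin n → ℂ) V)
    {L : (Fin n → ℂ) → (ℂ → ℂ) →ₗ[ℂ] ℂ} {x : Fin n → ℂ}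
    (hL : ∀ j, ∀ e ∈ V j, MeroG (fun θ => L θ e) x) : MeroG (fun θ => tens (L θ) m (F θ)) x := by
  refine PSep.induction (P := fun F => MeroG (fun θ => tens (L θ) m (F θ)) x) hF ?_ ?_ ?_ ?_
  · intro c hc e he
    simp only [tens_const_mul_prod]
    exact (MeroG.of_analyticAt (analyticAt_of_differentiable hc x)).mul
      (MeroG.prod _ fun j _ => hL j _ (he j))
  · simpa using MeroG.const 0
  · intro f g hf hg; simpa using hf.add hg
  · intro c f hf; simpa using (MeroG.const c).mul hf
end

/-! ### Exponential polynomials -/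

section

/-- Linear combinations of `z^a exp(κz)` with `a ≤ d` and real `κ`, `|κ| ≤ K`. -/
def Vdeg (d : ℕ) (K : ℝ) : Submodule ℂ (ℂ → ℂ) :=
  Submodule.span ℂ {e | ∃ a ≤ d, ∃ κ : ℝ, |κ| ≤ K ∧ e = fun z => z ^ a * exp (κ * z)}

theorem mem_Vdeg {d a : ℕ} {K κ : ℝ} (ha : a ≤ d) (hκ : |κ| ≤ K) :
    (fun z : ℂ => z ^ a * exp (κ * z)) ∈ Vdeg d K :=
  subset_span ⟨a, ha, κ, hκ, rfl⟩

theorem pow_mem_Vdeg {d a : ℕ} (ha : a ≤ d) : (fun z : ℂ => z ^ a) ∈ Vdeg d 0 := by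
  simpa using mem_Vdeg (κ := 0) ha (by simp)

theorem one_mem_Vdeg : (fun _ : ℂ => (1 : ℂ)) ∈ Vdeg 0 0 := by
  simpa using pow_mem_Vdeg (le_refl 0)

theorem exp_mem_Vdeg {K κ : ℝ} (hκ : |κ| ≤ K) : (fun z : ℂ => exp (κ * z)) ∈ Vdeg 0 K := by
  simpa using mem_Vdeg (le_refl 0) hκ

theorem Vdeg_mono {d d' : ℕ} {K K' : ℝ} (hd : d ≤ d') (hK : K ≤ K') : Vdeg d K ≤ Vdeg d' K' := by
  refine Submodule.span_mono ?_
  rintro _ ⟨a, ha, κ, hκ, rfl⟩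
  exact ⟨a, ha.trans hd, κ, hκ.trans hK, rfl⟩

theorem Vdeg_mul_le (d d' : ℕ) (K K' : ℝ) : Vdeg d K * Vdeg d' K' ≤ Vdeg (d + d') (K + K') := by
  rw [Vdeg, Vdeg, Submodule.span_mul_span, Submodule.span_le]
  rintro _ ⟨_, ⟨a, ha, κ, hκ, rfl⟩, _, ⟨a', ha', κ', hκ', rfl⟩, rfl⟩
  have : (fun z : ℂ => z ^ a * exp (κ * z)) * (fun z : ℂ => z ^ a' * exp (κ' * z)) =
      fun z : ℂ => z ^ (a + a') * exp (((κ + κ' : ℝ) : ℂ) * z) := by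
    funext z
    simp only [Pi.mul_apply]
    push_cast
    rw [pow_add, add_mul, exp_add]
    ring
  change (_ * _ : ℂ → ℂ) ∈ _
  rw [this]
  exact mem_Vdeg (add_le_add ha ha') ((abs_add_le _ _).trans (add_le_add hκ hκ'))

theorem mul_mem_Vdeg {d d' : ℕ} {K K' : ℝ} {e e' : ℂ → ℂ} (he : e ∈ Vdeg d K) (he' : e' ∈ Vdeg d' K') :
    (fun z => e z * e' z) ∈ Vdeg (d + d') (K + K') :=
  Vdeg_mul_le _ _ _ _ (Submodule.mul_mem_mul he he')

theorem differentiable_of_mem_Vdeg {d : ℕ} {K : ℝ} {e : ℂ → ℂ} (he : e ∈ Vdeg d K) :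
    Differentiable ℂ e := by
  induction he using span_induction with
  | mem f hf => obtain ⟨a, _, κ, _, rfl⟩ := hf; fun_prop
  | zero => exact differentiable_const 0
  | add f g _ _ hf hg => exact hf.add hg
  | smul c f _ hf => exact hf.const_smul c

theorem weight_sq_pow (x : ℝ) (n : ℕ) : (weight x ^ n) ^ 2 = ((1 + |x|) ^ 3 * rexp |x|) ^ n := by
  rw [← pow_mul, mul_comm n 2, pow_mul, weight, Real.sq_sqrt (by positivity)]

theorem norm_monomial_le {a : ℕ} {κ K M : ℝ} (hκ : |κ| ≤ K) (hM : 0 ≤ M) {z : ℂ} (hz : |z.im| ≤ M) :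
    ‖z ^ a * exp (κ * z)‖ ≤ (1 + M) ^ a * ((1 + |z.re|) ^ a * rexp (K * |z.re|)) := by
  rw [norm_mul, norm_pow, Complex.norm_exp, ← mul_assoc, ← mul_pow]
  have h1 : ‖z‖ ≤ (1 + M) * (1 + |z.re|) := by
    have := Complex.norm_le_abs_re_add_abs_im z
    nlinarith [mul_nonneg hM (abs_nonneg z.re)]
  refine mul_le_mul (pow_le_pow_left₀ (norm_nonneg _) h1 a) (Real.exp_le_exp.2 ?_)
    (Real.exp_pos _).le (by positivity)
  simp only [mul_re, ofReal_re, ofReal_im, zero_mul, sub_zero]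
  calc κ * z.re ≤ |κ * z.re| := le_abs_self _
    _ = |κ| * |z.re| := abs_mul _ _
    _ ≤ K * |z.re| := by gcongr

theorem exists_growth_of_mem_Vdeg {d n r : ℕ} {K : ℝ} {e : ℂ → ℂ} (he : e ∈ Vdeg d K)
    (hd : 2 * d + 2 * r ≤ 3 * n) (hK : 2 * K ≤ n) (M : ℝ) :
    ∃ C : ℝ, ∀ z : ℂ, |z.im| ≤ M → ‖e z‖ * (1 + |z.re|) ^ r ≤ C * weight z.re ^ n := by
  induction he using span_induction with
  | mem f hf =>
    obtain ⟨a, ha, κ, hκ, rfl⟩ := hf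
    refine ⟨(1 + |M|) ^ a, fun z hz => ?_⟩
    have h1 := norm_monomial_le (a := a) hκ (abs_nonneg M) (hz.trans (le_abs_self M))
    have hx := abs_nonneg z.re
    have h2 : (1 + |z.re|) ^ (a + r) * rexp (K * |z.re|) ≤ weight z.re ^ n := by
      refine le_of_sq_le_sq ?_ (pow_nonneg (weight_pos _).le _)
      rw [weight_sq_pow, mul_pow, mul_pow, ← pow_mul, ← pow_mul, ← Real.exp_nat_mul,
        ← Real.exp_nat_mul]
      refine mul_le_mul (pow_le_pow_right₀ (by linarith) (by omega)) (Real.exp_le_exp.2 ?_)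
        (Real.exp_pos _).le (by positivity)
      push_cast
      nlinarith
    calc _ ≤ (1 + |M|) ^ a * ((1 + |z.re|) ^ a * rexp (K * |z.re|)) * (1 + |z.re|) ^ r := by gcongr
      _ = (1 + |M|) ^ a * ((1 + |z.re|) ^ (a + r) * rexp (K * |z.re|)) := by ring
      _ ≤ _ := by gcongr
  | zero => exact ⟨0, fun z _ => by simp⟩
  | add f g _ _ hf hg =>
    obtain ⟨C, hC⟩ := hf
    obtain ⟨C', hC'⟩ := hg
    refine ⟨C + C', fun z hz => ?_⟩
    have h3 := hC z hz
    have h4 := hC' z hz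
    have : ‖(f + g) z‖ * (1 + |z.re|) ^ r ≤ (‖f z‖ + ‖g z‖) * (1 + |z.re|) ^ r := by
      gcongr; exact norm_add_le _ _
    linarith
  | smul c f _ hf =>
    obtain ⟨C, hC⟩ := hf
    refine ⟨‖c‖ * C, fun z hz => ?_⟩
    rw [Pi.smul_apply, norm_smul, mul_assoc, mul_assoc]
    exact mul_le_mul_of_nonneg_left (hC z hz) (norm_nonneg c)

theorem Vdeg_le_admissible {d n : ℕ} {K : ℝ} (hd : 2 * d + 4 ≤ 3 * n) (hK : 2 * K ≤ n) :
    Vdeg d K ≤ admissible n := fun _ he =>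
  ⟨differentiable_of_mem_Vdeg he, exists_growth_of_mem_Vdeg he hd hK⟩

theorem prod_mem_Vdeg {ι : Type*} (s : Finset ι) {e : ι → ℂ → ℂ} {d : ι → ℕ} {K : ι → ℝ}
    (h : ∀ i ∈ s, e i ∈ Vdeg (d i) (K i)) :
    (fun z => ∏ i ∈ s, e i z) ∈ Vdeg (∑ i ∈ s, d i) (∑ i ∈ s, K i) := by
  classical
  induction s using Finset.induction_on with
  | empty => simpa using one_mem_Vdeg
  | insert a s ha ih =>
    simp only [prod_insert ha, sum_insert ha]
    exact mul_mem_Vdeg (h a (by simp)) (ih fun i hi => h i (by simp [hi]))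

theorem eval_mem_Vdeg {P : Polynomial ℂ} {d : ℕ} (hP : P.natDegree ≤ d) :
    (fun z => P.eval z) ∈ Vdeg d 0 := by
  have : (fun z => P.eval z) = ∑ a ∈ Finset.range (d + 1), P.coeff a • fun z : ℂ => z ^ a := by
    funext z
    rw [Polynomial.eval_eq_sum_range' (n := d + 1) (by omega), Finset.sum_apply]
    rfl
  rw [this]
  exact Submodule.sum_mem _ fun a ha => smul_mem _ _
    (pow_mem_Vdeg (Nat.lt_succ_iff.1 (Finset.mem_range.1 ha)))

variable {m : ℕ} {X Y : Type*} [NormedAddCommGroup X] [NormedSpace ℂ X] [NormedAddCommGroup Y]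
  [NormedSpace ℂ Y] {d d' : Fin m → ℕ} {K K' : Fin m → ℝ} {F G : X → (Fin m → ℂ) → ℂ}

/-- Exponential polynomials in `z` with bounds on degrees and exponents, whose coefficients depend
holomorphically on parameters. -/
abbrev PDeg (X : Type*) [NormedAddCommGroup X] [NormedSpace ℂ X] {m : ℕ} (d : Fin m → ℕ)
    (K : Fin m → ℝ) : Submodule ℂ (X → (Fin m → ℂ) → ℂ) :=
  PSep X fun j => Vdeg (d j) (K j)

theorem PDeg.mul (hF : F ∈ PDeg X d K) (hG : G ∈ PDeg X d' K') :
    (fun x z => F x z * G x z) ∈ PDeg X (d + d') (K + K') :=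
  PSep.mul hF hG fun _ => Vdeg_mul_le _ _ _ _

theorem PDeg.mono (hF : F ∈ PDeg X d K) (hd : ∀ j, d j ≤ d' j) (hK : ∀ j, K j ≤ K' j) :
    F ∈ PDeg X d' K' :=
  PSep.mono hF fun j => Vdeg_mono (hd j) (hK j)

theorem PDeg.const {c : X → ℂ} (hc : Differentiable ℂ c) :
    (fun x _ => c x) ∈ PDeg X (0 : Fin m → ℕ) (0 : Fin m → ℝ) := by
  have := PSep.pure (V := fun _ : Fin m => Vdeg 0 0) hc (e := fun _ _ => 1) fun _ => one_mem_Vdeg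
  simp only [Finset.prod_const_one, mul_one] at this
  exact this

theorem PDeg.coord {e : ℂ → ℂ} {a : ℕ} {k : ℝ} (i : Fin m) (he : e ∈ Vdeg a k) :
    (fun _ z => e (z i)) ∈ PDeg X (Pi.single i a) (Pi.single i k) := by
  have : (fun (_ : X) (z : Fin m → ℂ) => e (z i)) = fun x z => (1 : ℂ) *
      ∏ j, (if j = i then e else fun _ => 1) (z j) := by
    funext x z
    simp only [ite_apply, one_mul, Finset.prod_ite_eq', Finset.mem_univ, if_true]
  rw [this]
  refine PSep.pure (differentiable_const 1) fun j => ?_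
  by_cases h : j = i
  · subst h; simpa using he
  · simpa [h] using one_mem_Vdeg

theorem PDeg.prod {ι : Type*} (s : Finset ι) {F : ι → X → (Fin m → ℂ) → ℂ} {d : ι → Fin m → ℕ}
    {K : ι → Fin m → ℝ} (h : ∀ i ∈ s, F i ∈ PDeg X (d i) (K i)) :
    (fun x z => ∏ i ∈ s, F i x z) ∈ PDeg X (∑ i ∈ s, d i) (∑ i ∈ s, K i) := by
  classical
  induction s using Finset.induction_on with
  | empty => simpa using PDeg.const (m := m) (differentiable_const (1 : ℂ) : Differentiable ℂ fun _ : X => _)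
  | insert a s ha ih =>
    simp only [prod_insert ha, sum_insert ha]
    exact PDeg.mul (h a (by simp)) (ih fun i hi => h i (by simp [hi]))

theorem tmat_mem_PDeg {n : ℕ} : ∀ {θ : X → Fin n → ℂ}, (∀ i, Differentiable ℂ fun x => θ x i) →
    ∀ {v : X → (Fin m → ℂ) → CoVec n}, (∀ α, (fun x z => v x z α) ∈ PDeg X d K) →
    ∀ (r l : Fin 2) (α : Fin n → Fin 2),
      (fun x (z : Fin (m + 1) → ℂ) => tmat n (θ x) (z 0) r l (v x (tail z)) α) ∈
        PDeg X ((if r = l then n else n - 1) ∷ d)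
          (0 ∷ K) := by
  induction n with
  | zero =>
    intro θ _ v hv r l α
    have h := PSep.comp_tail (hv α) one_mem_Vdeg
    simp only [one_mul] at h
    have h' : (fun x (z : Fin (m + 1) → ℂ) => tmat 0 (θ x) (z 0) r l (v x (tail z)) α) =
        kd l r • fun x (z : Fin (m + 1) → ℂ) => v x (tail z) α := by
      funext x z
      simp [tmat_zero]
    rw [h']
    refine smul_mem _ _ (PSep.mono h fun j => ?_)
    refine Fin.cases ?_ (fun j => ?_) j
    · simp
    · simp
  | succ n ih =>
    intro θ hθ v hv r l α
    have ih := fun c l β => ih (θ := fun x => tail (θ x)) (fun i => hθ i.succ)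
      (v := fun x z => slice c (v x z)) (fun α => hv (c ∷ α)) r l β
    obtain ⟨a, β, rfl⟩ : ∃ a β, α = Fin.cons a β := ⟨α 0, tail α, (cons_self_tail α).symm⟩
    have e : (fun x (z : Fin (m + 1) → ℂ) => tmat (n + 1) (θ x) (z 0) r l (v x (tail z))
        (a ∷ β)) = (fun x z => (θ x 0 - z 0) *
          tmat n (tail (θ x)) (z 0) r l (slice a (v x (tail z))) β) -
        (kd a l * iπ) • ((fun x z => tmat n (tail (θ x)) (z 0) r 0 (slice 0 (v x (tail z))) β) +
          fun x z => tmat n (tail (θ x)) (z 0) r 1 (slice 1 (v x (tail z))) β) := by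
      funext x z
      rw [← slice_apply a (tmat (n + 1) (θ x) (z 0) r l (v x (tail z))), slice_tmat]
      simp
    have hlin : (fun (x : X) (z : Fin (m + 1) → ℂ) => θ x 0 - z 0) ∈
        PDeg X (Pi.single 0 1 : Fin (m + 1) → ℕ) 0 := by
      refine Submodule.sub_mem (PDeg X (Pi.single 0 1 : Fin (m + 1) → ℕ) 0)
        (PDeg.mono (PDeg.const (hθ 0)) (by simp) (by simp)) ?_
      have := PDeg.coord (X := X) (m := m + 1) 0 (pow_mem_Vdeg (le_refl 1))
      simpa using this
    have hmul := PDeg.mul hlin (ih a l β)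
    rw [e]
    refine sub_mem ?_ (smul_mem _ _ (add_mem ?_ ?_))
    · by_cases hrl : r = l
      · refine PDeg.mono hmul (fun j => ?_) fun j => ?_
        · refine Fin.cases ?_ (fun j => ?_) j <;> simp [hrl]
          omega
        · simp
      · cases n with
        | zero =>
          have hk : kd l r = 0 := if_neg (Ne.symm hrl)
          have : (fun x (z : Fin (m + 1) → ℂ) => (θ x 0 - z 0) *
              tmat 0 (tail (θ x)) (z 0) r l (slice a (v x (tail z))) β) = 0 := by
            funext x z
            simp [tmat_zero, hk]
          rw [this]
          exact zero_mem _
        | succ n =>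
          refine PDeg.mono hmul (fun j => ?_) fun j => ?_
          · refine Fin.cases ?_ (fun j => ?_) j <;> simp [hrl]
            omega
          · simp
    all_goals
      refine PDeg.mono (ih _ _ β) (fun j => ?_) fun j => le_rfl
      refine Fin.cases ?_ (fun j => ?_) j
      · simp only [cons_zero]; split_ifs <;> omega
      · simp

theorem bpoly_mem_PDeg {n : ℕ} (m : ℕ) (α : Fin n → Fin 2) :
    (fun (θ : Fin n → ℂ) (z : Fin m → ℂ) => bpoly θ z α) ∈ PDeg (Fin n → ℂ) (fun _ => n - 1) 0 := by
  induction m generalizing α with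
  | zero =>
    have : (fun (θ : Fin n → ℂ) (z : Fin 0 → ℂ) => bpoly θ z α) = fun _ _ => vac n α := rfl
    rw [this]
    exact PDeg.mono (PDeg.const (differentiable_const _)) (fun j => j.elim0) fun j => j.elim0
  | succ m ih =>
    have h := tmat_mem_PDeg (θ := fun θ : Fin n → ℂ => θ) (fun i => by fun_prop) ih 0 1 α
    have e : (fun (θ : Fin n → ℂ) (z : Fin (m + 1) → ℂ) => bpoly θ z α) =
        fun θ z => tmat n θ (z 0) 0 1 (bpoly θ (tail z)) α := by
      funext θ z
      rw [← bpoly_cons, cons_self_tail]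
    rw [e]
    refine PDeg.mono h (fun j => ?_) fun j => ?_
    · refine Fin.cases ?_ (fun j => ?_) j <;> simp
    · refine Fin.cases ?_ (fun j => ?_) j <;> simp

/-- `∏_{i<j} τ(z_i - z_j)`. -/
def tauProd {m : ℕ} (z : Fin m → ℂ) : ℂ := ∏ i, ∏ j ∈ Finset.Ioi i, tau (z i - z j)

theorem tau_mem_PDeg (i j : Fin m) :
    (fun (_ : X) (z : Fin m → ℂ) => tau (z i - z j)) ∈
      PDeg X (Pi.single i 1 + Pi.single j 1) (Pi.single i 1 + Pi.single j 1) := by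
  have hz : ∀ i : Fin m, (fun (_ : X) (z : Fin m → ℂ) => z i) ∈ PDeg X (Pi.single i 1) 0 := by
    intro i
    have := PDeg.coord (X := X) (m := m) i (pow_mem_Vdeg (le_refl 1))
    simpa using this
  have he : ∀ (i : Fin m) (κ : ℝ), |κ| ≤ 1 →
      (fun (_ : X) (z : Fin m → ℂ) => exp (κ * z i)) ∈ PDeg X 0 (Pi.single i 1) := by
    intro i κ hκ
    have := PDeg.coord (X := X) (m := m) i (exp_mem_Vdeg hκ)
    simpa using this
  have h1 : (fun (_ : X) (z : Fin m → ℂ) => z i - z j) ∈ PDeg X (Pi.single i 1 + Pi.single j 1) 0 :=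
    sub_mem (PDeg.mono (hz i) (fun k => by simp) fun k => le_rfl)
      (PDeg.mono (hz j) (fun k => by simp) fun k => le_rfl)
  have h2 : (fun (_ : X) (z : Fin m → ℂ) => exp (((1 : ℝ) : ℂ) * z i) * exp (((-1 : ℝ) : ℂ) * z j) -
      exp (((-1 : ℝ) : ℂ) * z i) * exp (((1 : ℝ) : ℂ) * z j)) ∈
      PDeg X (0 + 0) (Pi.single i 1 + Pi.single j 1) :=
    sub_mem (PDeg.mul (he i 1 (by simp)) (he j (-1) (by simp)))
      (PDeg.mul (he i (-1) (by simp)) (he j 1 (by simp)))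
  have h3 := smul_mem _ ((8 * (π : ℂ) ^ 3)⁻¹) (PDeg.mul h1 h2)
  rw [add_zero, add_zero, zero_add] at h3
  convert h3 using 1
  funext x z
  simp only [Pi.smul_apply, smul_eq_mul, tau_eq, Complex.sinh, ← exp_add]
  push_cast
  rw [one_mul, one_mul, neg_one_mul, neg_one_mul, show -(z i - z j) = -z i + z j by ring,
    show z i - z j = z i + -z j by ring]
  field_simp
  ring

theorem sum_pair_single {R : Type*} [Semiring R] (k : Fin m) :
    (∑ i : Fin m, ∑ j ∈ Finset.Ioi i, ((Pi.single i 1 + Pi.single j 1 : Fin m → R))) k =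
      ((m - 1 : ℕ) : R) := by
  have h1 : ∑ i : Fin m, ∑ j ∈ Finset.Ioi i, (Pi.single (M := fun _ => R) i 1 k) =
      ((Finset.Ioi k).card : R) := by
    rw [Finset.sum_eq_single k]
    · simp
    · intro i _ hik; simp [Pi.single_eq_of_ne (Ne.symm hik)]
    · simp
  have h2 : ∑ i : Fin m, ∑ j ∈ Finset.Ioi i, (Pi.single (M := fun _ => R) j 1 k) =
      ((Finset.Iio k).card : R) := by
    rw [Finset.card_eq_sum_ones, Finset.sum_comm' (t' := Finset.univ) (s' := fun j => Finset.Iio j)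
      (by simp), Finset.sum_eq_single k]
    · simp
    · intro i _ hik; simp [Pi.single_eq_of_ne (Ne.symm hik)]
    · simp
  simp only [Finset.sum_apply, Pi.add_apply, sum_add_distrib]
  rw [h1, h2, ← Nat.cast_add, Fin.card_Ioi, Fin.card_Iio]
  congr 1
  omega

theorem tauProd_mem_PDeg : (fun (_ : X) (z : Fin m → ℂ) => tauProd z) ∈
    PDeg X (fun _ => m - 1) fun _ => ((m - 1 : ℕ) : ℝ) := by
  have h := PDeg.prod (X := X) (m := m) Finset.univ fun i (_ : i ∈ Finset.univ) =>
    PDeg.prod (X := X) (m := m) (Finset.Ioi i)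
      fun j (_ : j ∈ Finset.Ioi i) => tau_mem_PDeg i j
  refine PDeg.mono h (fun k => (sum_pair_single k).le) fun k => (sum_pair_single k).le
end

/-! ### Periodic entire functions of exponential type -/

section

theorem exists_polynomial_of_growth (D : ℕ) : ∀ {f : ℂ → ℂ}, Differentiable ℂ f →
    ∀ {C : ℝ}, (∀ z, ‖f z‖ ≤ C * (1 + ‖z‖) ^ D) →
    ∃ P : Polynomial ℂ, P.natDegree ≤ D ∧ ∀ z, f z = P.eval z := by
  induction D with
  | zero =>
    intro f hf C hC
    refine ⟨Polynomial.C (f 0), by simp, fun z => ?_⟩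
    rw [Polynomial.eval_C]
    refine hf.apply_eq_apply_of_bounded ?_ z 0
    refine isBounded_iff_forall_norm_le.2 ⟨C, ?_⟩
    rintro _ ⟨w, rfl⟩
    simpa using hC w
  | succ D ih =>
    intro f hf C hC
    have hd : Differentiable ℂ (dslope f 0) := by
      have := (Complex.differentiableOn_dslope (s := univ) (c := 0) (f := f) univ_mem).2
        hf.differentiableOn
      exact differentiableOn_univ.1 this
    obtain ⟨B, hB⟩ := (isCompact_closedBall (0 : ℂ) 1).exists_bound_of_continuousOn
      hd.continuous.continuousOn
    have hC0 : 0 ≤ C := by simpa using (norm_nonneg _).trans (hC 0)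
    have hB0 : 0 ≤ B := (norm_nonneg _).trans (hB 0 (by simp))
    obtain ⟨P, hP, hPf⟩ := ih hd (C := B + 4 * C) (fun z => by
      have h1 : 1 ≤ (1 + ‖z‖) ^ D := one_le_pow₀ (by linarith [norm_nonneg z])
      rcases le_total ‖z‖ 1 with hz | hz
      · have := hB z (by simpa using hz)
        nlinarith
      · have hz0 : z ≠ 0 := fun h => by simp [h] at hz; linarith
        have h2 : ‖dslope f 0 z‖ * ‖z‖ ≤ 2 * C * (1 + ‖z‖) ^ (D + 1) := by
          rw [← norm_mul, mul_comm, dslope_of_ne _ hz0, slope_def_module, sub_zero, smul_eq_mul,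
            mul_inv_cancel_left₀ hz0]
          refine (norm_sub_le _ _).trans ?_
          have := hC 0
          have h4 := hC z
          have h3 : C * 1 ≤ C * (1 + ‖z‖) ^ (D + 1) :=
            mul_le_mul_of_nonneg_left (one_le_pow₀ (by linarith [norm_nonneg z])) hC0
          simp at this
          linarith
        have h5 : 2 * C * (1 + ‖z‖) ^ (D + 1) ≤ 4 * C * (1 + ‖z‖) ^ D * ‖z‖ := by
          rw [pow_succ]
          have : 0 ≤ C * (1 + ‖z‖) ^ D := by positivity
          nlinarith
        have h6 := le_of_mul_le_mul_right (h2.trans h5) (by linarith)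
        have : 0 ≤ B * (1 + ‖z‖) ^ D := by positivity
        linarith)
    refine ⟨Polynomial.C (f 0) + Polynomial.X * P, ?_, fun z => ?_⟩
    · refine (Polynomial.natDegree_add_le _ _).trans (max_le (by simp) ?_)
      refine Polynomial.natDegree_mul_le.trans ?_
      have := Polynomial.natDegree_X_le (R := ℂ)
      omega
    · have := sub_smul_dslope f 0 z
      rw [hPf z] at this
      simp only [sub_zero, smul_eq_mul] at this
      simp [this]

/-- Nodes for the interpolation in `exp z`. -/
def expNode (k : ℕ) : ℂ := exp (k : ℂ)

theorem expNode_injective : Function.Injective expNode := by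
  intro a b h
  have : rexp a = rexp b := by
    have : ((rexp a : ℝ) : ℂ) = (rexp b : ℝ) := by push_cast; exact h
    exact_mod_cast this
  exact_mod_cast Real.exp_injective this

/-- The exponential interpolation functions. -/
def expBasis (w : ℕ) (k : ℕ) (z : ℂ) : ℂ :=
  exp ((1 + (w : ℂ) / 2) * (k - z)) *
    (Lagrange.basis (Finset.range (w + 3)) expNode k).eval (exp z)

theorem expBasis_mem (w : ℕ) {k : ℕ} (hk : k ∈ Finset.range (w + 3)) :
    expBasis w k ∈ Vdeg 0 (1 + (w : ℝ) / 2) := by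
  set P := Lagrange.basis (Finset.range (w + 3)) expNode k with hP
  have hdeg : P.natDegree ≤ w + 2 := by
    have := Lagrange.degree_basis (expNode_injective.injOn (s := (Finset.range (w + 3) : Set ℕ))) hk
    rw [Finset.card_range, ← hP] at this
    exact (Polynomial.natDegree_eq_of_degree_eq_some this).le
  have e : expBasis w k = ∑ a ∈ Finset.range (w + 3), (exp ((1 + (w : ℂ) / 2) * k) * P.coeff a) •
      fun z : ℂ => exp (((a - (1 + (w : ℝ) / 2) : ℝ) : ℂ) * z) := by
    funext z
    rw [expBasis, ← hP, Polynomial.eval_eq_sum_range' (n := w + 3) (by omega), Finset.sum_apply,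
      mul_sum]
    refine sum_congr rfl fun a _ => ?_
    rw [Pi.smul_apply, smul_eq_mul, ← exp_nat_mul, mul_sub, sub_eq_add_neg, exp_add]
    push_cast
    rw [sub_mul, sub_eq_add_neg, exp_add]
    ring
  rw [e]
  refine Submodule.sum_mem _ fun a ha => smul_mem _ _ (exp_mem_Vdeg ?_)
  have h1 : (a : ℝ) ≤ w + 2 := by
    have := Finset.mem_range.1 ha
    exact_mod_cast (by omega : a ≤ w + 2)
  have h2 : (0 : ℝ) ≤ a := Nat.cast_nonneg a
  rw [abs_le]
  constructor <;> linarith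

theorem eq_sum_expBasis {w : ℕ} {f : ℂ → ℂ} (hf : Differentiable ℂ f)
    (hper : ∀ z, f (z + 2 * π * I) = (-1) ^ w * f z) {B : ℝ}
    (hB : ∀ z, ‖f z‖ ≤ B * rexp ((1 + (w : ℝ) / 2) * |z.re|)) (z : ℂ) :
    f z = ∑ k ∈ Finset.range (w + 3), expBasis w k z * f k := by
  set g : ℂ → ℂ := fun t => exp ((1 + (w : ℂ) / 2) * (2 * π * I * t)) * f (2 * π * I * t) with hg
  have hgd : Differentiable ℂ g := by
    refine Differentiable.mul (by fun_prop) (hf.comp (by fun_prop))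
  have hgp : Function.Periodic g ((1 : ℝ) : ℂ) := by
    intro t
    have h1 : 2 * π * I * (t + ((1 : ℝ) : ℂ)) = 2 * π * I * t + 2 * π * I := by push_cast; ring
    have h2 : exp ((1 + (w : ℂ) / 2) * (2 * π * I)) = (-1) ^ w := by
      rw [show (1 + (w : ℂ) / 2) * (2 * π * I) = 2 * π * I + w * (π * I) by ring, exp_add,
        exp_two_pi_mul_I, one_mul, exp_nat_mul, exp_pi_mul_I]
    have h3 : ((-1 : ℂ) ^ w) * (-1) ^ w = 1 := by rw [← mul_pow]; simp
    simp only [hg]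
    rw [h1, hper, mul_add, exp_add, h2]
    linear_combination (exp ((1 + (w : ℂ) / 2) * (2 * π * I * t)) * f (2 * π * I * t)) * h3
  have hB0 : 0 ≤ B := by
    have := (norm_nonneg _).trans (hB 0)
    simpa using this
  have hgb : ∀ t, ‖g t‖ ≤ B * rexp ((1 + (w : ℝ) / 2) * (|(2 * π * I * t).re| + (2 * π * I * t).re)) := by
    intro t
    have h1 : ((1 + (w : ℂ) / 2) * (2 * π * I * t)).re = (1 + (w : ℝ) / 2) * (2 * π * I * t).re := by
      rw [show (1 + (w : ℂ) / 2) = ((1 + (w : ℝ) / 2 : ℝ) : ℂ) by push_cast; ring, re_ofReal_mul]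
    simp only [hg]
    rw [norm_mul, Complex.norm_exp, h1, mul_add, Real.exp_add]
    calc _ ≤ rexp ((1 + (w : ℝ) / 2) * (2 * π * I * t).re) *
          (B * rexp ((1 + (w : ℝ) / 2) * |(2 * π * I * t).re|)) := by gcongr; exact hB _
      _ = _ := by ring
  set G := Function.Periodic.cuspFunction 1 g with hG
  have hGd : Differentiable ℂ G := by
    intro q
    by_cases hq : q = 0
    · subst hq
      refine Function.Periodic.differentiableAt_cuspFunction_zero one_pos hgp
        (Eventually.of_forall fun z => hgd z) ?_
      refine Asymptotics.IsBigO.of_bound B ?_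
      filter_upwards [tendsto_comap.eventually (eventually_ge_atTop (0 : ℝ))] with t ht
      refine (hgb t).trans ?_
      have : (2 * π * I * t).re ≤ 0 := by
        simp
        have := pi_pos
        positivity
      rw [abs_of_nonpos this]
      simp
    · have := Function.Periodic.differentiableAt_cuspFunction one_ne_zero hgp
        (hgd (Function.Periodic.invQParam 1 q))
      rwa [Function.Periodic.qParam_right_inv one_ne_zero hq] at this
  have hGz : ∀ z, G (exp z) = exp ((1 + (w : ℂ) / 2) * z) * f z := by
    intro z
    have h2 : (2 * π * I : ℂ) ≠ 0 := two_pi_I_ne_zero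
    have h1 := Function.Periodic.eq_cuspFunction one_ne_zero hgp (z / (2 * π * I))
    rw [Function.Periodic.qParam] at h1
    simp only [ofReal_one, div_one, mul_div_cancel₀ z h2, hg] at h1
    exact h1
  have hGb' : ∀ z, ‖G (exp z)‖ ≤ B * (1 + ‖exp z‖) ^ (w + 2) := by
    intro z
    have h2 : (2 * π * I : ℂ) ≠ 0 := two_pi_I_ne_zero
    have h1 := hgb (z / (2 * π * I))
    simp only [mul_div_cancel₀ z h2, hg] at h1
    rw [hGz]
    refine h1.trans (mul_le_mul_of_nonneg_left ?_ hB0)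
    rw [Complex.norm_exp]
    rcases le_total z.re 0 with hz | hz
    · rw [abs_of_nonpos hz]
      simpa using one_le_pow₀ (n := w + 2) (by linarith [Real.exp_pos z.re] : 1 ≤ 1 + rexp z.re)
    · rw [abs_of_nonneg hz, show (1 + (w : ℝ) / 2) * (z.re + z.re) = ((w + 2 : ℕ) : ℝ) * z.re by
        push_cast; ring, Real.exp_nat_mul]
      exact pow_le_pow_left₀ (Real.exp_pos _).le (by linarith) _
  have hGb : ∀ q, ‖G q‖ ≤ B * (1 + ‖q‖) ^ (w + 2) := by
    have hcl : IsClosed {q : ℂ | ‖G q‖ ≤ B * (1 + ‖q‖) ^ (w + 2)} :=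
      isClosed_le hGd.continuous.norm (by fun_prop)
    have hsub : ({0}ᶜ : Set ℂ) ⊆ {q : ℂ | ‖G q‖ ≤ B * (1 + ‖q‖) ^ (w + 2)} := by
      intro q hq
      have := hGb' (log q)
      rwa [exp_log hq] at this
    intro q
    exact closure_minimal hsub hcl (dense_compl_singleton (0 : ℂ) q)
  obtain ⟨P, hP, hPG⟩ := exists_polynomial_of_growth (w + 2) hGd hGb
  have hI := Lagrange.eq_interpolate (expNode_injective.injOn (s := (Finset.range (w + 3) : Set ℕ)))
    (f := P) (by
      rw [Finset.card_range]
      exact (Polynomial.degree_le_natDegree).trans_lt (by exact_mod_cast (by omega)))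
  have h1 := hGz z
  rw [hPG, hI, Lagrange.interpolate_apply, Polynomial.eval_finsetSum] at h1
  have h2 : f z = exp (-((1 + (w : ℂ) / 2) * z)) * (exp ((1 + (w : ℂ) / 2) * z) * f z) := by
    rw [← mul_assoc, ← exp_add]; simp
  rw [h2, ← h1, mul_sum]
  refine sum_congr rfl fun k _ => ?_
  have h3 := hGz k
  rw [hPG] at h3
  rw [Polynomial.eval_mul, Polynomial.eval_C, expNode, h3, expBasis, mul_sub, sub_eq_add_neg, exp_add]
  ring

variable {X : Type*} [NormedAddCommGroup X] [NormedSpace ℂ X]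

theorem mem_PDeg_of_periodic {w m : ℕ} {F : X → (Fin m → ℂ) → ℂ}
    (hx : ∀ z, Differentiable ℂ fun x => F x z)
    (hz : ∀ x j z, Differentiable ℂ fun a => F x (Function.update z j a))
    (hper : ∀ x j z a, F x (Function.update z j (a + 2 * π * I)) = (-1) ^ w * F x (Function.update z j a))
    (hB : ∀ x j z, ∃ B : ℝ, ∀ a, ‖F x (Function.update z j a)‖ ≤
      B * rexp ((1 + (w : ℝ) / 2) * |a.re|)) :
    F ∈ PDeg X (fun _ => 0) fun _ => 1 + (w : ℝ) / 2 := by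
  induction m with
  | zero =>
    have : F = fun x _ => F x Fin.elim0 := by
      funext x z
      rw [Subsingleton.elim z Fin.elim0]
    rw [this]
    exact PDeg.mono (PDeg.const (hx _)) (fun j => j.elim0) fun j => j.elim0
  | succ m ih =>
    have e : F = ∑ k ∈ Finset.range (w + 3), fun x z => expBasis w k (z 0) *
        F x ((k : ℂ) ∷ (tail z)) := by
      funext x z
      obtain ⟨B, hB⟩ := hB x 0 z
      have := eq_sum_expBasis (hz x 0 z) (hper x 0 z) hB (z 0)
      rw [Function.update_eq_self] at this
      rw [this, Finset.sum_apply, Finset.sum_apply]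
      refine sum_congr rfl fun k _ => ?_
      rw [← cons_self_tail z, Fin.update_cons_zero, tail_cons, cons_zero]
    rw [e]
    refine Submodule.sum_mem _ fun k hk => ?_
    refine PSep.mono (PSep.comp_tail (ih (F := fun x z => F x ((k : ℂ) ∷ z)) ?_ ?_ ?_ ?_)
      (expBasis_mem w hk)) fun j => ?_
    · exact fun z => hx _
    · intro x j z
      simpa only [Fin.cons_update] using hz x j.succ ((k : ℂ) ∷ z)
    · intro x j z
      simpa only [Fin.cons_update] using hper x j.succ ((k : ℂ) ∷ z)
    · intro x j z
      simpa only [Fin.cons_update] using hB x j.succ ((k : ℂ) ∷ z)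
    · refine Fin.cases ?_ (fun j => ?_) j
      · simp
      · simp

/-- The entire functions of type `(0, 1 + w / 2)` in each integration variable. -/
abbrev PWeight (w n : ℕ) {m : ℕ} : Submodule ℂ ((Fin n → ℂ) → (Fin m → ℂ) → ℂ) :=
  PDeg (Fin n → ℂ) (fun _ => 0) fun _ => 1 + (w : ℝ) / 2

theorem PRegular.mem_PDeg {w m n : ℕ} {p : (Fin n → ℂ) → (Fin m → ℂ) → ℂ} {σ : ℂ}
    (hreg : PRegular w p) (hshift : PShift p σ) (hn : (-1 : ℂ) ^ n = (-1) ^ w) :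
    p ∈ PWeight w n := by
  refine mem_PDeg_of_periodic ?_ ?_ ?_ ?_
  · intro z
    exact hreg.1.comp (f := fun x => (x, z)) (by fun_prop)
  · intro x j z
    refine hreg.1.comp (f := fun a => (x, Function.update z j a)) ?_
    refine (differentiable_const x).prodMk ?_
    intro a
    exact (hasDerivAt_update z j a).differentiableAt
  · intro x j z a
    have := hshift.2 j x (Function.update z j a)
    simpa [hn] using this
  · intro x j z
    obtain ⟨B, hB⟩ := hreg.2 {x} isCompact_singleton
    refine ⟨B * rexp ((1 + (w : ℝ) / 2) * ∑ i ∈ Finset.univ.erase j, |(z i).re|), fun a => ?_⟩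
    refine (hB x rfl _).trans_eq ?_
    have h1 : ∑ i, |(Function.update z j a i).re| =
        ∑ i ∈ Finset.univ.erase j, |(z i).re| + |a.re| := by
      rw [← Finset.sum_erase_add _ _ (Finset.mem_univ j), Function.update_self]
      congr 1
      exact sum_congr rfl fun i hi => by rw [Function.update_of_ne (Finset.ne_of_mem_erase hi)]
    rw [mul_assoc, ← Real.exp_add, ← mul_add, h1]
end

/-! ### The highest weight property -/

section
variable {n m : ℕ}

theorem tens_comp_linear (L : (ℂ → ℂ) →ₗ[ℂ] ℂ) {n' : ℕ} (T : CoVec n →ₗ[ℂ] CoVec n')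
    (f : (Fin m → ℂ) → CoVec n) :
    T (fun α => tens L m fun z => f z α) = fun β => tens L m fun z => T (f z) β := by
  funext β
  rw [LinearMap.pi_apply_eq_sum_univ T, Finset.sum_apply]
  have : (fun z => T (f z) β) = ∑ α, (T (fun j => if α = j then 1 else 0) β) • fun z => f z α := by
    funext z
    rw [LinearMap.pi_apply_eq_sum_univ T, Finset.sum_apply, Finset.sum_apply]
    exact sum_congr rfl fun α _ => by simp [mul_comm]
  rw [this, map_sum]
  exact sum_congr rfl fun α _ => by simp [mul_comm]

/-- `sinh z / (4π³)`. -/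
def sinhN (z : ℂ) : ℂ := sinh z / (4 * π ^ 3)

theorem tau_eq_sinhN (z : ℂ) : tau z = z * sinhN z := by rw [tau_eq, sinhN, mul_div_assoc]

theorem sinhN_add (z : ℂ) : sinhN (z + 2 * iπ) = sinhN z := by
  rw [sinhN, sinhN, show z + 2 * iπ = z + π * I + π * I by ring, Complex.sinh_add_pi_mul_I,
    Complex.sinh_add_pi_mul_I, neg_neg]

theorem sinhN_eq_zero {z : ℂ} (k : ℤ) (h : z = k * iπ) : sinhN z = 0 := by
  rw [sinhN, sinh_eq_zero_iff.2 ⟨k, h⟩, zero_div]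

theorem tauProd_comp_perm (s : Equiv.Perm (Fin m)) (z : Fin m → ℂ) : tauProd (z ∘ s) = tauProd z := by
  have h1 := s.prod_Ioi_comp_eq_sign_mul_prod (f := fun i j => z i - z j) (fun i j => by ring)
  have h2 := s.prod_Ioi_comp_eq_sign_mul_prod (f := fun i j => sinhN (z i - z j)) (fun i j => by
    rw [sinhN, sinhN, ← neg_sub (z j), Complex.sinh_neg, neg_div])
  have h3 : (((Equiv.Perm.sign s : ℤˣ) : ℤ) : ℂ) * ((Equiv.Perm.sign s : ℤˣ) : ℤ) = 1 := by
    rw [← Int.cast_mul, ← Units.val_mul, Int.units_mul_self]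
    simp
  simp only [tauProd, tau_eq_sinhN, prod_mul_distrib, Function.comp]
  rw [h1, h2]
  linear_combination ((∏ i, ∏ j ∈ Finset.Ioi i, (z i - z j)) *
    ∏ i, ∏ j ∈ Finset.Ioi i, sinhN (z i - z j)) * h3

theorem tauProd_cons (a : ℂ) (z : Fin m → ℂ) :
    tauProd (a ∷ z) = (∏ k, tau (a - z k)) * tauProd z := by
  rw [tauProd, prod_univ_succ, tauProd]
  congr 1
  · rw [Fin.prod_Ioi_zero]
    simp
  · refine prod_congr rfl fun i _ => ?_
    rw [Fin.prod_Ioi_succ]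
    simp

theorem tauProd_removeNth (p : Fin (m + 1)) (z : Fin (m + 1) → ℂ) :
    tauProd z = (∏ k, tau (z p - p.removeNth z k)) * tauProd (p.removeNth z) := by
  rw [← tauProd_cons, Fin.cons_removeNth_eq_comp_cycleRange_symm, tauProd_comp_perm]

theorem tauProd_eq_zero {z : Fin m → ℂ} {i j : Fin m} (hij : i ≠ j) {k : ℤ}
    (h : z i - z j = k * iπ) : tauProd z = 0 := by
  cases m with
  | zero => exact i.elim0
  | succ m =>
    obtain ⟨l, rfl⟩ := Fin.exists_succAbove_eq hij.symm
    rw [tauProd_removeNth i, prod_eq_zero (Finset.mem_univ l), zero_mul]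
    rw [tau_eq_sinhN, Fin.removeNth_apply, sinhN_eq_zero k h, mul_zero]

/-- The one-variable factor in the action of `sumLow` on Bethe co-vectors. -/
def lowFactor (θ : Fin n → ℂ) (a : ℂ) (z : Fin m → ℂ) : ℂ :=
  (∏ k, sinhN (a - z k)) * ((∏ i, (θ i - a - iπ)) * ∏ k, (a - z k - iπ) -
    (∏ i, (θ i - a)) * ∏ k, (a - z k + iπ))

theorem map_erase_eq {z : Fin (m + 1) → ℂ} (hz : Function.Injective z) (p : Fin (m + 1)) :
    (Finset.univ.map ⟨z, hz⟩).erase (z p) =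
      Finset.univ.map ⟨p.removeNth z, hz.comp Fin.succAbove_right_injective⟩ := by
  ext x
  simp only [Finset.mem_erase, Finset.mem_map, Finset.mem_univ, true_and, Function.Embedding.coeFn_mk]
  constructor
  · rintro ⟨h, k, rfl⟩
    obtain ⟨l, rfl⟩ := Fin.exists_succAbove_eq (fun h' => h (by rw [h']) : k ≠ p)
    exact ⟨l, rfl⟩
  · rintro ⟨l, rfl⟩
    exact ⟨fun h => Fin.succAbove_ne p l (hz h), _, rfl⟩

theorem tauProd_smul_sumLow (θ : Fin n → ℂ) (z : Fin (m + 1) → ℂ) :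
    tauProd z • sumLow n (bpoly θ z) = ∑ p, (tauProd (p.removeNth z) *
      lowFactor θ (z p) (p.removeNth z)) • bpoly θ (p.removeNth z) := by
  by_cases hz : Function.Injective z
  · have h := sumLow_bvec θ (Finset.univ.map ⟨z, hz⟩)
    rw [Finset.map_val, Finset.sum_map] at h
    rw [bpoly]
    refine (congrArg (tauProd z • ·) h).trans ?_
    rw [Finset.smul_sum]
    refine sum_congr rfl fun p _ => ?_
    simp only [Function.Embedding.coeFn_mk, map_erase_eq hz p, Finset.map_val, Finset.prod_map, smul_smul]
    rw [bpoly]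
    congr 1
    rw [tauProd_removeNth p, mul_sub, lowFactor]
    have key : ∀ κ : ℂ, (∏ k, tau (z p - p.removeNth z k)) * ∏ k, (1 - κ / (z p - p.removeNth z k)) =
        (∏ k, sinhN (z p - p.removeNth z k)) * ∏ k, (z p - p.removeNth z k - κ) := by
      intro κ
      rw [← prod_mul_distrib, ← prod_mul_distrib]
      refine prod_congr rfl fun k _ => ?_
      have : z p - p.removeNth z k ≠ 0 :=
        sub_ne_zero.2 fun h => Fin.succAbove_ne p k (hz h).symm
      rw [tau_eq_sinhN]
      field_simp
    have h1 := key iπ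
    have h2 := key (-iπ)
    simp only [sub_neg_eq_add] at h2
    linear_combination (tauProd (p.removeNth z)) * ((∏ i, (θ i - z p - iπ)) * h1 -
      (∏ i, (θ i - z p)) * h2)
  · rw [Function.Injective] at hz
    push Not at hz
    obtain ⟨i, j, hij, hne⟩ := hz
    rw [tauProd_eq_zero hne (k := 0) (by simp [hij]), zero_smul, eq_comm]
    refine sum_eq_zero fun p _ => ?_
    have hl : ∀ i j : Fin (m + 1), i ≠ j → z i = z j → lowFactor θ (z i) (i.removeNth z) = 0 := by
      intro i j hne hij
      obtain ⟨l, rfl⟩ := Fin.exists_succAbove_eq hne.symm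
      rw [lowFactor, prod_eq_zero (Finset.mem_univ l), zero_mul]
      exact sinhN_eq_zero 0 (by rw [Fin.removeNth_apply, hij]; simp)
    by_cases hpi : p = i
    · rw [hpi, hl i j hne hij, mul_zero, zero_smul]
    by_cases hpj : p = j
    · rw [hpj, hl j i hne.symm hij.symm, mul_zero, zero_smul]
    obtain ⟨i', rfl⟩ := Fin.exists_succAbove_eq (Ne.symm hpi)
    obtain ⟨j', rfl⟩ := Fin.exists_succAbove_eq (Ne.symm hpj)
    rw [tauProd_eq_zero (z := p.removeNth z) (i := i') (j := j') (fun h => hne (by rw [h])) (k := 0)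
      (by simp [Fin.removeNth_apply, hij]), zero_mul, zero_smul]

/-! The algebra of all separable functions. -/

theorem Sep.psep {V : Fin m → Submodule ℂ (ℂ → ℂ)} {f : (Fin m → ℂ) → ℂ} (hf : f ∈ Sep V) :
    (fun _ => f) ∈ PSep ℂ V := by
  refine Sep.induction (P := fun f => (fun _ => f) ∈ PSep ℂ V) hf ?_ ?_ ?_ ?_
  · intro e he
    simpa using PSep.pure (differentiable_const (1 : ℂ)) he
  · exact zero_mem _
  · intro f g hf hg; exact add_mem hf hg
  · intro c f hf; exact smul_mem _ c hf

/-- The algebra of finite sums of products of functions of one variable. -/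
def sepAlg (m : ℕ) : Subalgebra ℂ ((Fin m → ℂ) → ℂ) where
  carrier := (Sep fun _ : Fin m => (⊤ : Submodule ℂ (ℂ → ℂ)))
  add_mem' := fun h h' => add_mem h h'
  mul_mem' := fun h h' =>
    PSep.sep (PSep.mul (Sep.psep h) (Sep.psep h') (V'' := fun _ => ⊤) fun _ => le_top) 0
  algebraMap_mem' := fun c => by
    have h : (fun z : Fin m → ℂ => ∏ j, (fun _ => (1 : ℂ)) (z j)) ∈ Sep fun _ : Fin m => ⊤ :=
      subset_span ⟨fun _ _ => 1, fun _ => trivial, rfl⟩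
    have e : algebraMap ℂ ((Fin m → ℂ) → ℂ) c = c • fun z : Fin m → ℂ => ∏ j, (fun _ => (1 : ℂ)) (z j) := by
      funext z
      simp
    rw [e]
    exact smul_mem _ c h

theorem coord_mem_sepAlg (e : ℂ → ℂ) (i : Fin m) : (fun z : Fin m → ℂ => e (z i)) ∈ sepAlg m := by
  refine subset_span ⟨fun j => if j = i then e else fun _ => 1, fun _ => trivial, ?_⟩
  funext z
  simp only [ite_apply, Finset.prod_ite_eq', Finset.mem_univ, if_true]

theorem const_mem_sepAlg (c : ℂ) : (fun _ : Fin m → ℂ => c) ∈ sepAlg m := (sepAlg m).algebraMap_mem c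

theorem Sep.mem_sepAlg {V : Fin m → Submodule ℂ (ℂ → ℂ)} {f : (Fin m → ℂ) → ℂ} (hf : f ∈ Sep V) :
    f ∈ sepAlg m :=
  PSep.sep (PSep.mono (Sep.psep hf) fun _ => le_top) 0

theorem comp_tail_mem_sepAlg {f : (Fin m → ℂ) → ℂ} (hf : f ∈ sepAlg m) :
    (fun z : Fin (m + 1) → ℂ => f (tail z)) ∈ sepAlg (m + 1) := by
  have := PSep.sep (PSep.comp_tail (Sep.psep hf) (Submodule.mem_top (x := fun _ : ℂ => (1 : ℂ)))) 0
  simp only [one_mul] at this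
  exact Sep.mem_sepAlg this

theorem prod_mem_sepAlg {ι : Type*} (s : Finset ι) {f : ι → (Fin m → ℂ) → ℂ}
    (h : ∀ i ∈ s, f i ∈ sepAlg m) : (fun z => ∏ i ∈ s, f i z) ∈ sepAlg m := by
  have := (sepAlg m).prod_mem h
  convert this using 1
  funext z
  simp

theorem sinhN_mem_sepAlg (i j : Fin m) : (fun z : Fin m → ℂ => sinhN (z i - z j)) ∈ sepAlg m := by
  have h := fun (e e' : ℂ → ℂ) => mul_mem (coord_mem_sepAlg e i) (coord_mem_sepAlg e' j)
  have := Subalgebra.smul_mem _ (sub_mem (h sinh cosh) (h cosh sinh)) ((4 * (π : ℂ) ^ 3)⁻¹)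
  convert this using 1
  funext z
  simp [sinhN, Complex.sinh_sub, div_eq_inv_mul]

theorem linear_mem_sepAlg (i j : Fin m) (c : ℂ) : (fun z : Fin m → ℂ => z i - z j + c) ∈ sepAlg m :=
  add_mem (sub_mem (coord_mem_sepAlg id i) (coord_mem_sepAlg id j)) (const_mem_sepAlg c)

theorem lowFactor_mem_sepAlg (θ : Fin n → ℂ) :
    (fun z : Fin (m + 1) → ℂ => lowFactor θ (z 0) (tail z)) ∈ sepAlg (m + 1) := by
  refine mul_mem (prod_mem_sepAlg _ fun k _ => sinhN_mem_sepAlg 0 k.succ) (sub_mem ?_ ?_)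
  · refine mul_mem (coord_mem_sepAlg (fun a => ∏ i, (θ i - a - iπ)) 0) (prod_mem_sepAlg _ fun k _ => ?_)
    exact linear_mem_sepAlg 0 k.succ (-iπ)
  · refine mul_mem (coord_mem_sepAlg (fun a => ∏ i, (θ i - a)) 0) (prod_mem_sepAlg _ fun k _ => ?_)
    exact linear_mem_sepAlg 0 k.succ iπ

theorem prod_sub_prod_mem_Vdeg {ι : Type*} [Fintype ι] (a b : ι → ℂ) :
    (fun z => ∏ i, (z - a i) - ∏ i, (z - b i)) ∈ Vdeg (Fintype.card ι - 1) 0 := by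
  have hm : ∀ a : ι → ℂ, (∏ i, (Polynomial.X - Polynomial.C (a i))).Monic := fun a =>
    Polynomial.monic_prod_of_monic _ _ fun i _ => Polynomial.monic_X_sub_C _
  have hd : ∀ a : ι → ℂ, (∏ i, (Polynomial.X - Polynomial.C (a i))).natDegree = Fintype.card ι := by
    intro a
    rw [Polynomial.natDegree_prod_of_monic _ _ fun i _ => Polynomial.monic_X_sub_C _]
    simp
  have h : (∏ i, (Polynomial.X - Polynomial.C (a i)) -
      ∏ i, (Polynomial.X - Polynomial.C (b i))).natDegree ≤ Fintype.card ι - 1 := by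
    rw [Polynomial.natDegree_le_iff_coeff_eq_zero]
    intro N hN
    rcases (show N = Fintype.card ι ∨ Fintype.card ι < N by omega) with rfl | h
    · rw [Polynomial.coeff_sub]
      have h1 := (hm a).coeff_natDegree
      have h2 := (hm b).coeff_natDegree
      rw [hd] at h1 h2
      rw [h1, h2, sub_self]
    · rw [Polynomial.coeff_sub, Polynomial.coeff_eq_zero_of_natDegree_lt (by rw [hd]; exact h),
        Polynomial.coeff_eq_zero_of_natDegree_lt (by rw [hd]; exact h), sub_self]
  have := eval_mem_Vdeg h
  simpa [Polynomial.eval_prod] using this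

theorem sinhN_sub_mem_Vdeg (c : ℂ) : (fun z => sinhN (z - c)) ∈ Vdeg 0 1 := by
  have h1 := smul_mem _ (exp (-c) / (8 * (π : ℂ) ^ 3)) (exp_mem_Vdeg (K := 1) (κ := 1) (by simp))
  have h2 := smul_mem _ (exp c / (8 * (π : ℂ) ^ 3)) (exp_mem_Vdeg (K := 1) (κ := -1) (by simp))
  convert sub_mem h1 h2 using 1
  funext z
  simp only [sinhN, Complex.sinh, Pi.sub_apply, Pi.smul_apply, smul_eq_mul]
  rw [show -(z - c) = c + -z by ring, show z - c = -c + z by ring, exp_add, exp_add]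
  push_cast
  simp only [one_mul, neg_one_mul]
  have := pi_ne_zero'
  field_simp
  ring

/-- The integral of `lowFactor` times a quasi-periodic function vanishes. -/
theorem betheFun_lowFactor {θ : Fin n → ℂ} (hθ : θ ∈ generic n) {w : ℕ} (hn : n = w + 2 * (m + 1))
    {q : ℂ → ℂ} (hq : q ∈ Vdeg 0 (1 + (w : ℝ) / 2)) (hper : ∀ a, q (a + 2 * iπ) = (-1) ^ n * q a)
    (z : Fin m → ℂ) : betheFun θ (fun a => q a * lowFactor θ a z) = 0 := by
  set e : ℂ → ℂ := fun a => (∏ k, sinhN (a - z k)) * (∏ k, (a - z k - iπ)) * q a with he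
  have hs : (fun a => ∏ k, sinhN (a - z k)) ∈ Vdeg 0 m := by
    simpa using prod_mem_Vdeg Finset.univ fun k (_ : k ∈ Finset.univ) => sinhN_sub_mem_Vdeg (z k)
  have hsq := mul_mem_Vdeg hs hq
  have hK : 2 * ((m : ℝ) + (1 + (w : ℝ) / 2)) ≤ n := by rw [hn]; push_cast; linarith
  have hlin : ∀ c : ℂ, (fun a : ℂ => a - c) ∈ Vdeg 1 0 := by
    intro c
    have h1 := pow_mem_Vdeg (le_refl 1)
    have h2 := smul_mem _ c (Vdeg_mono (Nat.zero_le _) le_rfl one_mem_Vdeg : _ ∈ Vdeg 1 0)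
    convert sub_mem h1 h2 using 1
    funext a
    simp
  have hlin' : ∀ c : ℂ, (fun a : ℂ => c - a) ∈ Vdeg 1 0 := by
    intro c
    convert Submodule.neg_mem _ (hlin c) using 1
    funext a
    simp
  have hper' : ∀ a, e (a + 2 * iπ) = (-1) ^ n * ((∏ k, sinhN (a - z k)) * (∏ k, (a - z k + iπ)) * q a) := by
    intro a
    have h1 : ∀ k, a + 2 * iπ - z k = a - z k + 2 * iπ := fun k => by ring
    have h2 : ∀ k, a - z k + 2 * iπ - iπ = a - z k + iπ := fun k => by ring
    simp only [he, hper, h1, sinhN_add, h2]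
    ring
  have hD : ∀ a, ∏ i, (a - θ i) = (-1) ^ n * ∏ i, (θ i - a) := by
    intro a
    have : ∀ i, a - θ i = -1 * (θ i - a) := fun i => by ring
    simp only [this, prod_mul_distrib]
    simp
  have h1 : ((-1 : ℂ) ^ n) * (-1) ^ n = 1 := by rw [← mul_pow]; simp
  have heq : (fun a => q a * lowFactor θ a z) =
      fun a => (∏ i, (θ i - a - iπ)) * e a - (∏ i, (a - θ i)) * e (a + 2 * iπ) := by
    funext a
    rw [hper', hD, lowFactor]
    simp only [he]
    linear_combination ((∏ i, (θ i - a)) * (∏ k, sinhN (a - z k)) * (∏ k, (a - z k + iπ)) * q a) * h1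
  rw [heq]
  have hg1 : (fun a => (∏ i, (θ i - a - iπ)) * e a) ∈ Vdeg (n + m) ((m : ℝ) + (1 + (w : ℝ) / 2)) := by
    have a1 := prod_mem_Vdeg Finset.univ fun i (_ : i ∈ Finset.univ) => hlin' (θ i - iπ)
    have a2 := prod_mem_Vdeg Finset.univ fun k (_ : k ∈ Finset.univ) => hlin (z k + iπ)
    have := mul_mem_Vdeg (mul_mem_Vdeg a1 a2) hsq
    simp only [Finset.sum_const, Finset.card_univ, Fintype.card_fin, smul_eq_mul, mul_one, smul_zero,
      add_zero, zero_add] at this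
    convert this using 1
    funext a
    simp only [he]
    have e1 : ∀ i, θ i - iπ - a = θ i - a - iπ := fun i => by ring
    have e2 : ∀ k, a - (z k + iπ) = a - z k - iπ := fun k => by ring
    simp only [e1, e2]
    ring
  refine betheFun_sub_shift hθ ?_ ?_ ?_
  · have : e = fun a => ((∏ k, sinhN (a - z k)) * q a) * ∏ k, (a - z k - iπ) := by
      funext a; simp only [he]; ring
    rw [this]
    refine (differentiable_of_mem_Vdeg hsq).mul fun a => ?_
    exact DifferentiableAt.fun_finsetProd fun k _ => by fun_prop
  · intro M
    have := exists_growth_of_mem_Vdeg (r := 1) (n := n) hg1 (by omega) hK M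
    simpa using this
  · rw [← heq]
    have a1 := prod_sub_prod_mem_Vdeg (Sum.elim (fun i => θ i - iπ) fun k => z k + iπ)
      (Sum.elim θ fun k => z k - iπ)
    have a2 := smul_mem _ ((-1) ^ n) (mul_mem_Vdeg hsq a1)
    refine Vdeg_le_admissible (d := n + m - 1) (K := (m : ℝ) + (1 + (w : ℝ) / 2)) (by omega) hK ?_
    simp only [Fintype.card_sum, Fintype.card_fin, zero_add, add_zero, Fintype.prod_sum_type,
      Sum.elim_inl, Sum.elim_inr] at a2
    convert a2 using 1
    funext a
    have e1 : ∏ i, (θ i - a - iπ) = (-1) ^ n * ∏ i, (a - (θ i - iπ)) := by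
      have : ∀ i, θ i - a - iπ = -1 * (a - (θ i - iπ)) := fun i => by ring
      simp only [this, prod_mul_distrib]
      simp
    have e2 : ∀ k, a - (z k + iπ) = a - z k - iπ := fun k => by ring
    have e3 : ∀ k, a - (z k - iπ) = a - z k + iπ := fun k => by ring
    simp only [Pi.smul_apply, smul_eq_mul, e2, e3, lowFactor, hD, e1]
    linear_combination (q a * (∏ k, sinhN (a - z k)) * (∏ i, (θ i - a)) * (∏ k, (a - z k + iπ))) * h1

/-- The off-shell Bethe integral is a highest weight co-vector. -/
theorem sumLow_tens {θ : Fin n → ℂ} (hθ : θ ∈ generic n) {w : ℕ} (hn : n = w + 2 * m)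
    {q : (Fin m → ℂ) → ℂ} (hq : q ∈ Sep fun _ => Vdeg 0 (1 + (w : ℝ) / 2))
    (hsymm : ∀ (s : Equiv.Perm (Fin m)) z, q (z ∘ s) = q z)
    (hper : ∀ j z, q (Function.update z j (z j + 2 * iπ)) = (-1) ^ n * q z) :
    sumLow n (fun α => tens (betheFun θ) m fun z => tauProd z * q z * bpoly θ z α) = 0 := by
  rw [tens_comp_linear (betheFun θ) (sumLow n) (fun z α => tauProd z * q z * bpoly θ z α)]
  funext α
  have h0 : ∀ z : Fin m → ℂ, sumLow n (fun α => tauProd z * q z * bpoly θ z α) =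
      q z • tauProd z • sumLow n (bpoly θ z) := by
    intro z
    rw [smul_smul, ← map_smul, mul_comm (q z)]
    rfl
  simp only [h0]
  cases m with
  | zero =>
    have : bpoly θ (Fin.elim0 : Fin 0 → ℂ) = vac n := rfl
    simp [tens_zero, this, sumLow_vac]
  | succ m =>
    set G : (Fin (m + 1) → ℂ) → ℂ := fun z => (tauProd (tail z) * bpoly θ (tail z) α) *
      (q z * lowFactor θ (z 0) (tail z)) with hG
    have hGs : G ∈ sepAlg (m + 1) := by
      refine mul_mem (comp_tail_mem_sepAlg (f := fun z => tauProd z * bpoly θ z α) ?_)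
        (mul_mem (Sep.mem_sepAlg hq) (lowFactor_mem_sepAlg θ))
      exact Sep.mem_sepAlg (PSep.sep (PDeg.mul tauProd_mem_PDeg (bpoly_mem_PDeg m α)) θ)
    have hsum : (fun z : Fin (m + 1) → ℂ => (q z • tauProd z • sumLow n (bpoly θ z)) α) =
        ∑ p : Fin (m + 1), fun z => G (z ∘ p.cycleRange.symm) := by
      funext z
      rw [tauProd_smul_sumLow, Finset.smul_sum, Finset.sum_apply, Finset.sum_apply]
      refine sum_congr rfl fun p _ => ?_
      simp only [hG, hsymm]
      rw [← Fin.cons_removeNth_eq_comp_cycleRange_symm, tail_cons, cons_zero]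
      simp only [Pi.smul_apply, smul_eq_mul]
      ring
    rw [hsum, map_sum]
    refine sum_eq_zero fun p _ => ?_
    rw [tens_comp_perm _ hGs, tens_succ_inner _ hGs]
    have : (fun z : Fin m → ℂ => betheFun θ fun a => G (a ∷ z)) = 0 := by
      funext z
      have h1 : (fun a => G (a ∷ z)) = (tauProd z * bpoly θ z α) •
          fun a => q (a ∷ z) * lowFactor θ a z := by
        funext a
        simp [hG]
      rw [h1, map_smul, betheFun_lowFactor hθ hn (Sep.apply_mem hq z) (fun a => ?_) z, smul_zero]
      · rfl
      · have := hper 0 (a ∷ z)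
        rwa [Fin.update_cons_zero, cons_zero] at this
    rw [this, map_zero]
end

/-! ### Closing the contour -/

section

/-- `chi x * sinh (x/2)` as a function of `w = -x/2πi`. -/
def gfac (w : ℂ) : ℂ := chi (-(2 * iπ * w)) * sinh (-(iπ * w))

theorem gfac_add_one {w : ℂ} (hw : 2 ≤ w.re) : gfac (w + 1) * (w + 1) = gfac w * (w - 1 / 2) := by
  have h1 : w + 1 ≠ 0 := fun h => by
    have := congrArg re h
    simp at this; linarith
  have h2 : w - 1 / 2 ≠ 0 := fun h => by
    have := congrArg re h
    simp at this; linarith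
  have h3 := chi_shift (x := -(2 * iπ * (w + 1))) (by
      rw [neg_ne_zero]; exact mul_ne_zero two_ipi_ne_zero h1) (by
      rw [show -(2 * iπ * (w + 1)) + 3 * iπ = -(2 * iπ * (w - 1 / 2)) by ring, neg_ne_zero]
      exact mul_ne_zero two_ipi_ne_zero h2)
  rw [show -(2 * iπ * (w + 1)) + 2 * iπ = -(2 * iπ * w) by ring] at h3
  have h4 : sinh (-(iπ * (w + 1))) = -sinh (-(iπ * w)) := by
    rw [show -(iπ * w) = -(iπ * (w + 1)) + π * I by ring, Complex.sinh_add_pi_mul_I, neg_neg]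
  refine mul_left_cancel₀ two_ipi_ne_zero ?_
  simp only [gfac]
  rw [h4]
  linear_combination (-sinh (-(iπ * w))) * h3

theorem norm_gfac_add_one_le {w : ℂ} (hw : 2 ≤ w.re) :
    ‖gfac (w + 1)‖ ^ 2 * ‖w + 1‖ ^ 3 ≤ (1 + 1 / ‖w‖ ^ 2) * (‖gfac w‖ ^ 2 * ‖w‖ ^ 3) := by
  have hn : 2 ≤ ‖w‖ := hw.trans (re_le_norm w)
  have h1 := congrArg norm (gfac_add_one hw)
  rw [norm_mul, norm_mul] at h1
  have h2 : ‖w - 1 / 2‖ ^ 2 * ‖w + 1‖ ≤ ‖w‖ ^ 3 + ‖w‖ := by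
    rw [← norm_pow, ← norm_mul, show (w - 1 / 2) ^ 2 * (w + 1) = w ^ 3 - (3 / 4) * w + 1 / 4 by ring]
    refine (norm_add_le _ _).trans ?_
    have := norm_sub_le (w ^ 3) ((3 / 4) * w)
    rw [norm_mul, norm_pow] at this
    norm_num at this ⊢
    linarith
  have h3 : (1 + 1 / ‖w‖ ^ 2) * ‖w‖ ^ 3 = ‖w‖ ^ 3 + ‖w‖ := by field_simp
  calc ‖gfac (w + 1)‖ ^ 2 * ‖w + 1‖ ^ 3 = (‖gfac (w + 1)‖ * ‖w + 1‖) ^ 2 * ‖w + 1‖ := by ring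
    _ = ‖gfac w‖ ^ 2 * (‖w - 1 / 2‖ ^ 2 * ‖w + 1‖) := by rw [h1]; ring
    _ ≤ ‖gfac w‖ ^ 2 * (‖w‖ ^ 3 + ‖w‖) := by gcongr
    _ = _ := by rw [← h3]; ring

theorem norm_gfac_add_nat_le {w : ℂ} (hw : 2 ≤ w.re) (k : ℕ) :
    ‖gfac (w + k)‖ ^ 2 * ‖w + k‖ ^ 3 ≤ 2 * (‖gfac w‖ ^ 2 * ‖w‖ ^ 3) := by
  have h0 : 0 ≤ ‖gfac w‖ ^ 2 * ‖w‖ ^ 3 := by positivity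
  suffices h : ‖gfac (w + k)‖ ^ 2 * ‖w + k‖ ^ 3 ≤ (2 * (k + 1) / (k + 2)) * (‖gfac w‖ ^ 2 * ‖w‖ ^ 3) by
    refine h.trans (mul_le_mul_of_nonneg_right ?_ h0)
    rw [div_le_iff₀ (by positivity)]
    linarith
  induction k with
  | zero => simp
  | succ k ih =>
    have hre : 2 + (k : ℝ) ≤ (w + k).re := by simp; linarith
    have hk : (0 : ℝ) ≤ k := Nat.cast_nonneg k
    have hn : 2 + (k : ℝ) ≤ ‖w + k‖ := hre.trans (re_le_norm _)
    have h1 := norm_gfac_add_one_le (w := w + k) (by linarith)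
    have h2 : (1 + 1 / ‖w + k‖ ^ 2) ≤ 1 + 1 / (2 + (k : ℝ)) ^ 2 := by gcongr
    have h3 : (1 + 1 / (2 + (k : ℝ)) ^ 2) * (2 * (k + 1) / (k + 2)) ≤ 2 * ((k : ℝ) + 1 + 1) / (k + 1 + 2) := by
      have hpos : (0 : ℝ) < k + 2 := by positivity
      rw [show (1 + 1 / (2 + (k : ℝ)) ^ 2) * (2 * (k + 1) / (k + 2)) =
        (2 * (k + 1) * ((k + 2) ^ 2 + 1)) / (k + 2) ^ 3 by field_simp; ring]
      rw [div_le_div_iff₀ (by positivity) (by positivity)]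
      nlinarith
    push_cast
    rw [← add_assoc]
    calc _ ≤ (1 + 1 / ‖w + k‖ ^ 2) * (‖gfac (w + k)‖ ^ 2 * ‖w + k‖ ^ 3) := h1
      _ ≤ (1 + 1 / (2 + (k : ℝ)) ^ 2) * ((2 * (k + 1) / (k + 2)) * (‖gfac w‖ ^ 2 * ‖w‖ ^ 3)) := by
        gcongr
      _ = ((1 + 1 / (2 + (k : ℝ)) ^ 2) * (2 * (k + 1) / (k + 2))) * (‖gfac w‖ ^ 2 * ‖w‖ ^ 3) := by ring
      _ ≤ _ := by gcongr

theorem exists_norm_le_of_mem_Vdeg {d : ℕ} {Q : ℂ → ℂ} (hQ : Q ∈ Vdeg d 0) :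
    ∃ C : ℝ, 0 ≤ C ∧ ∀ z, ‖Q z‖ ≤ C * (1 + ‖z‖) ^ d := by
  induction hQ using span_induction with
  | mem f hf =>
    obtain ⟨a, ha, κ, hκ, rfl⟩ := hf
    refine ⟨1, zero_le_one, fun z => ?_⟩
    have : κ = 0 := abs_nonpos_iff.1 hκ
    subst this
    have h0 := norm_nonneg z
    simp only [ofReal_zero, zero_mul, exp_zero, mul_one, norm_pow, one_mul]
    calc ‖z‖ ^ a ≤ (1 + ‖z‖) ^ a := by gcongr; linarith
      _ ≤ _ := pow_le_pow_right₀ (by linarith) ha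
  | zero => exact ⟨0, le_rfl, fun z => by simp⟩
  | add f g _ _ hf hg =>
    obtain ⟨C, h0, hC⟩ := hf
    obtain ⟨C', h0', hC'⟩ := hg
    refine ⟨C + C', add_nonneg h0 h0', fun z => ?_⟩
    rw [add_mul]
    exact (norm_add_le _ _).trans (add_le_add (hC z) (hC' z))
  | smul c f _ hf =>
    obtain ⟨C, h0, hC⟩ := hf
    refine ⟨‖c‖ * C, by positivity, fun z => ?_⟩
    rw [Pi.smul_apply, norm_smul, mul_assoc]
    exact mul_le_mul_of_nonneg_left (hC z) (norm_nonneg c)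

variable {n : ℕ} {θ : Fin n → ℂ} {y : ℝ} {N : Fin n → ℕ}

/-- Far below, `kern θ` times the product of the `sinh ((z - θ_i)/2)` decays like `|z|^{-3n/2}`. -/
theorem exists_norm_kern_sinh_le (hy : ∀ i, y ≤ (θ i).im - 4 * π) (hk : KernHeight θ y) :
    ∃ C : ℝ, ∀ (k : ℕ) (x : ℝ), ‖kern θ (x + (y - 2 * π * k : ℝ) * I) *
      ∏ i, sinh ((x + (y - 2 * π * k : ℝ) * I - θ i) / 2)‖ ^ 2 * (1 + |x| + k) ^ (3 * n) ≤ C := by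
  have hπ := pi_pos
  obtain ⟨δ, hδ, C, hC⟩ := hk.exists_bound
  set A := ∑ i, |(θ i).re| with hA
  have hAi : ∀ i, |(θ i).re| ≤ A := fun i =>
    abs_le_sum_abs (fun i => (θ i).re) i
  have hA0 : 0 ≤ A := Finset.sum_nonneg fun i _ => abs_nonneg _
  set D := ∑ i, |(θ i).im| with hD
  have hDi : ∀ i, |(θ i).im| ≤ D := fun i =>
    abs_le_sum_abs (fun i => (θ i).im) i
  have hD0 : 0 ≤ D := Finset.sum_nonneg fun i _ => abs_nonneg _
  set w : ℝ → Fin n → ℂ := fun x i => (θ i - (x + y * I)) / (2 * π * I) with hw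
  have h2pi : (2 * π * I : ℂ) ≠ 0 := two_pi_I_ne_zero
  have hwre : ∀ x i, 2 ≤ (w x i).re := by
    intro x i
    simp only [hw]
    rw [re_div_two_pi_I, le_div_iff₀ (by positivity)]
    simp
    linarith [hy i]
  have hfac : ∀ (k : ℕ) (x : ℝ), kern θ (x + (y - 2 * π * k : ℝ) * I) *
      ∏ i, sinh ((x + (y - 2 * π * k : ℝ) * I - θ i) / 2) = ∏ i, gfac (w x i + k) := by
    intro k x
    rw [kern, ← prod_mul_distrib]
    refine prod_congr rfl fun i _ => ?_
    have h1 : 2 * iπ * (w x i + k) = θ i - (x + (y - 2 * π * k : ℝ) * I) := by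
      simp only [hw]
      push_cast
      field_simp
      ring
    have h2 : iπ * (w x i + k) = (θ i - (x + (y - 2 * π * k : ℝ) * I)) / 2 := by
      rw [← h1]; ring
    rw [gfac, h1, h2]
    congr 2 <;> ring
  have hlow : ∀ (k : ℕ) (x : ℝ) i, 1 + |x| + k ≤ (1 + 2 * π + A) * ‖w x i + k‖ := by
    intro k x i
    have h1 : 2 + (k : ℝ) ≤ (w x i + k).re := by simp; linarith [hwre x i]
    have h2 := h1.trans (re_le_norm (w x i + k))
    have h3 : |x - (θ i).re| ≤ 2 * π * ‖w x i + k‖ := by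
      have h4 := abs_im_le_norm (w x i + k)
      have h5 : (w x i + k).im = (x - (θ i).re) / (2 * π) := by
        simp only [hw, add_im, natCast_im, add_zero, ← div_div, div_I, neg_im, mul_im, I_re, I_im,
          mul_zero, mul_one]
        simp
        ring
      rw [h5, abs_div, abs_of_pos (by positivity : 0 < 2 * π), div_le_iff₀ (by positivity)] at h4
      linarith
    have h6 : |x| ≤ |x - (θ i).re| + |(θ i).re| := by
      have := abs_add_le (x - (θ i).re) (θ i).re
      simpa using this
    have h7 := hAi i
    have h8 : (0 : ℝ) ≤ k := Nat.cast_nonneg k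
    nlinarith
  have hup : ∀ (x : ℝ) i, ‖w x i‖ ≤ (1 + A + D + |y|) * (1 + |x|) := by
    intro x i
    have h1 : ‖θ i - (x + y * I)‖ ≤ A + D + |x| + |y| := by
      refine (norm_le_abs_re_add_abs_im _).trans ?_
      simp
      have := abs_sub (θ i).re x
      have := abs_sub (θ i).im y
      linarith [hAi i, hDi i]
    have h2 : ‖w x i‖ ≤ ‖θ i - (x + y * I)‖ := by
      simp only [hw, norm_div, norm_mul, norm_I, mul_one]
      refine div_le_self (norm_nonneg _) ?_
      simp [abs_of_pos hπ]
      linarith [Real.pi_gt_three]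
    have := abs_nonneg x
    have := abs_nonneg y
    nlinarith
  refine ⟨(1 + 2 * π + A) ^ (3 * n) * (2 ^ n * (C ^ 2 * rexp A ^ n *
    (1 + A + D + |y|) ^ (3 * n))), fun k x => ?_⟩
  have hC0 := (hC θ (by simp [hδ.le]) (x + y * I) (by simp [hδ.le])).2
  have hre : (x + y * I : ℂ).re = x := by simp
  rw [hre] at hC0
  have hs : ∏ i, ‖sinh ((x + y * I - θ i) / 2)‖ ^ 2 ≤ (rexp |x| * rexp A) ^ n := by
    rw [← prod_const]
    refine prod_le_prod (fun i _ => by positivity) fun i _ => ?_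
    rw [← Real.exp_add]
    calc _ ≤ (rexp |((x + y * I - θ i) / 2).re|) ^ 2 := by gcongr; exact norm_sinh_le _
      _ = rexp (|x - (θ i).re|) := by
        rw [← Real.exp_nat_mul]
        congr 1
        rw [show ((x + y * I - θ i) / 2 : ℂ).re = (x - (θ i).re) / 2 by simp, abs_div]
        norm_num
        ring
      _ ≤ _ := by
        refine Real.exp_le_exp.2 ?_
        have := abs_sub x (θ i).re
        linarith [hAi i]
  have hg0 : ∏ i, (‖gfac (w x i)‖ ^ 2 * ‖w x i‖ ^ 3) ≤
      C ^ 2 * rexp A ^ n * (1 + A + D + |y|) ^ (3 * n) := by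
    have h1 := hfac 0 x
    simp only [Nat.cast_zero, mul_zero, sub_zero, add_zero] at h1
    have hW := pow_pos (weight_pos x) n
    have h2 : ∏ i, ‖w x i‖ ^ 3 ≤ ((1 + A + D + |y|) ^ 3 * (1 + |x|) ^ 3) ^ n := by
      rw [← prod_const]
      refine prod_le_prod (fun i _ => by positivity) fun i _ => ?_
      rw [← mul_pow]
      exact pow_le_pow_left₀ (norm_nonneg _) (hup x i) 3
    rw [prod_mul_distrib, Finset.prod_pow, ← norm_prod, ← h1, norm_mul, mul_pow, norm_prod,
      ← Finset.prod_pow]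
    have hkk : ‖kern θ (x + y * I)‖ ^ 2 * ((1 + |x|) ^ 3 * rexp |x|) ^ n ≤ C ^ 2 := by
      rw [← weight_sq_pow, ← mul_pow]
      exact pow_le_pow_left₀ (by positivity) hC0 2
    calc _ ≤ ‖kern θ (x + y * I)‖ ^ 2 * (rexp |x| * rexp A) ^ n *
          ((1 + A + D + |y|) ^ 3 * (1 + |x|) ^ 3) ^ n := by gcongr
      _ = (‖kern θ (x + y * I)‖ ^ 2 * ((1 + |x|) ^ 3 * rexp |x|) ^ n) * (rexp A ^ n *
          (1 + A + D + |y|) ^ (3 * n)) := by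
        rw [pow_mul, mul_pow, mul_pow, mul_pow]
        generalize (1 + A + D + |y|) ^ 3 = a
        generalize (1 + |x|) ^ 3 = b
        ring
      _ ≤ C ^ 2 * (rexp A ^ n * (1 + A + D + |y|) ^ (3 * n)) := by gcongr
      _ = _ := by ring
  rw [hfac, norm_prod, ← Finset.prod_pow]
  have hp : (1 + |x| + k) ^ (3 * n) ≤ ∏ i, ((1 + 2 * π + A) ^ 3 * ‖w x i + k‖ ^ 3) := by
    rw [pow_mul, ← prod_const]
    refine prod_le_prod (fun i _ => by positivity) fun i _ => ?_
    rw [← mul_pow]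
    exact pow_le_pow_left₀ (by positivity) (hlow k x i) 3
  calc _ ≤ (∏ i, ‖gfac (w x i + k)‖ ^ 2) * ∏ i, ((1 + 2 * π + A) ^ 3 * ‖w x i + k‖ ^ 3) := by gcongr
    _ = (1 + 2 * π + A) ^ (3 * n) * ∏ i, (‖gfac (w x i + k)‖ ^ 2 * ‖w x i + k‖ ^ 3) := by
      rw [prod_mul_distrib, prod_mul_distrib, prod_const, pow_mul]
      ring
    _ ≤ (1 + 2 * π + A) ^ (3 * n) * ∏ i, (2 * (‖gfac (w x i)‖ ^ 2 * ‖w x i‖ ^ 3)) := by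
      refine mul_le_mul_of_nonneg_left (prod_le_prod (fun i _ => by positivity)
        fun i _ => norm_gfac_add_nat_le (hwre x i) k) (by positivity)
    _ = (1 + 2 * π + A) ^ (3 * n) * (2 ^ n * ∏ i, (‖gfac (w x i)‖ ^ 2 * ‖w x i‖ ^ 3)) := by
      rw [prod_mul_distrib, prod_const]
    _ ≤ _ := by gcongr

theorem sinh_half_mem_Vdeg (c : ℂ) : (fun z => sinh ((z - c) / 2)) ∈ Vdeg 0 (1 / 2) := by
  have h1 := smul_mem _ (exp (-c / 2) / 2) (exp_mem_Vdeg (K := 1 / 2) (κ := 1 / 2) (by norm_num [abs_of_pos]))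
  have h2 := smul_mem _ (exp (c / 2) / 2) (exp_mem_Vdeg (K := 1 / 2) (κ := -1 / 2) (by norm_num [abs_div]))
  convert sub_mem h1 h2 using 1
  funext z
  simp only [Complex.sinh, Pi.sub_apply, Pi.smul_apply, smul_eq_mul]
  rw [show -((z - c) / 2) = c / 2 + ((-1 / 2 : ℝ) : ℂ) * z by push_cast; ring,
    show (z - c) / 2 = -c / 2 + ((1 / 2 : ℝ) : ℂ) * z by push_cast; ring, exp_add, exp_add]
  ring

theorem mul_prod_sinh_mem_admissible {d : ℕ} {Q : ℂ → ℂ} (hQ : Q ∈ Vdeg d 0) (hd : 2 * d + 4 ≤ 3 * n)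
    (θ : Fin n → ℂ) : (fun z => Q z * ∏ i, sinh ((z - θ i) / 2)) ∈ admissible n := by
  have := mul_mem_Vdeg hQ (prod_mem_Vdeg Finset.univ fun i (_ : i ∈ Finset.univ) => sinh_half_mem_Vdeg (θ i))
  simp only [Finset.sum_const, Finset.card_univ, Fintype.card_fin, smul_zero, add_zero, zero_add,
    nsmul_eq_mul] at this
  exact Vdeg_le_admissible hd (by linarith) this

theorem poleSum_sinh_eq_zero (N : Fin n → ℕ) (Q : ℂ → ℂ) :
    poleSum θ N (fun z => Q z * ∏ i, sinh ((z - θ i) / 2)) = 0 := by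
  refine sum_eq_zero fun i _ => sum_eq_zero fun k _ => ?_
  simp only
  rw [prod_eq_zero (Finset.mem_univ i), mul_zero, mul_zero]
  rw [sinh_eq_zero_iff]
  exact ⟨-k, by push_cast; ring⟩

theorem lineInt_sinh_eq_zero (hθ : θ ∈ generic n) (h : GoodLine θ y N) {d : ℕ} {Q : ℂ → ℂ}
    (hQ : Q ∈ Vdeg d 0) (hd : 2 * d + 4 ≤ 3 * n) :
    lineInt θ y (fun z => Q z * ∏ i, sinh ((z - θ i) / 2)) = 0 := by
  have hπ := pi_pos
  set e : ℂ → ℂ := fun z => Q z * ∏ i, sinh ((z - θ i) / 2) with he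
  have had : e ∈ admissible n := mul_prod_sinh_mem_admissible hQ hd θ
  have hpole : ∀ N, poleSum θ N e = 0 := fun N => poleSum_sinh_eq_zero N Q
  have hline : ∀ {y y' N N'}, GoodLine θ y N → GoodLine θ y' N' → lineInt θ y e = lineInt θ y' e := by
    intro y y' N N' h h'
    have := lineFun_eq hθ h h' had
    simpa [lineFun, hpole] using this
  obtain ⟨y₀, hy₀, N₀, h₀⟩ := exists_goodLine θ (-(∑ i, |(θ i).im|) - 4 * π)
  have hy : ∀ i, y₀ ≤ (θ i).im - 4 * π := by
    intro i
    have h2 : |(θ i).im| ≤ ∑ i, |(θ i).im| :=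
      abs_le_sum_abs (fun i => (θ i).im) i
    linarith [neg_abs_le (θ i).im]
  have hgood : ∀ k : ℕ, GoodLine θ (y₀ - 2 * π * k) fun i => N₀ i + k := by
    intro k i
    obtain ⟨a1, a2, a3⟩ := h₀ i
    have : 0 ≤ 2 * π * k := by positivity
    push_cast
    exact ⟨by linarith, by linarith, by linarith⟩
  obtain ⟨C, hC⟩ := exists_norm_kern_sinh_le hy h₀.kernHeight
  obtain ⟨C', hC'0, hC'⟩ := exists_norm_le_of_mem_Vdeg hQ
  have hC0 : 0 ≤ C := le_trans (by positivity) (hC 0 0)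
  set B := 1 + |y₀| + 2 * π with hB
  set E := √(C * (C' * B ^ d) ^ 2) with hE
  have hbound : ∀ (k : ℕ) (x : ℝ), ‖kern θ (x + (y₀ - 2 * π * k : ℝ) * I) *
      e (x + (y₀ - 2 * π * k : ℝ) * I)‖ * (1 + |x| + k) ^ 2 ≤ E := by
    intro k x
    set z : ℂ := x + (y₀ - 2 * π * k : ℝ) * I with hz
    have hk0 : (0 : ℝ) ≤ k := Nat.cast_nonneg k
    have hx0 := abs_nonneg x
    have h1 : 1 + ‖z‖ ≤ B * (1 + |x| + k) := by
      have h2 := norm_le_abs_re_add_abs_im z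
      have h3 : z.re = x := by simp [hz]
      have h4 : z.im = y₀ - 2 * π * k := by simp [hz]
      have h5 := abs_sub y₀ (2 * π * k)
      rw [abs_of_nonneg (by positivity : 0 ≤ 2 * π * k)] at h5
      rw [h3, h4] at h2
      have := abs_nonneg y₀
      rw [hB]
      nlinarith [mul_nonneg this hx0, mul_nonneg this hk0, mul_nonneg hπ.le hx0]
    have h2 : ‖Q z‖ ≤ C' * B ^ d * (1 + |x| + k) ^ d := by
      refine (hC' z).trans ?_
      rw [mul_assoc, ← mul_pow]
      gcongr
    refine Real.le_sqrt_of_sq_le ?_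
    have h3 := hC k x
    rw [← hz] at h3
    have h4 : (1 + |x| + k) ^ (2 * d + 4) ≤ (1 + |x| + k) ^ (3 * n) :=
      pow_le_pow_right₀ (by linarith) hd
    calc (‖kern θ z * e z‖ * (1 + |x| + k) ^ 2) ^ 2
        = ‖kern θ z * ∏ i, sinh ((z - θ i) / 2)‖ ^ 2 * (‖Q z‖ ^ 2 * (1 + |x| + k) ^ 4) := by
          simp only [he, norm_mul]; ring
      _ ≤ ‖kern θ z * ∏ i, sinh ((z - θ i) / 2)‖ ^ 2 *
          ((C' * B ^ d * (1 + |x| + k) ^ d) ^ 2 * (1 + |x| + k) ^ 4) := by gcongr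
      _ = ‖kern θ z * ∏ i, sinh ((z - θ i) / 2)‖ ^ 2 * (1 + |x| + k) ^ (2 * d + 4) * (C' * B ^ d) ^ 2 := by
          ring
      _ ≤ ‖kern θ z * ∏ i, sinh ((z - θ i) / 2)‖ ^ 2 * (1 + |x| + k) ^ (3 * n) * (C' * B ^ d) ^ 2 := by
          gcongr
      _ ≤ _ := by gcongr
  have hlim : Tendsto (fun k : ℕ => lineInt θ (y₀ - 2 * π * k) e) atTop (𝓝 (∫ _ : ℝ, (0 : ℂ))) := by
    refine tendsto_integral_of_dominated_convergence (fun x => E * (1 + x ^ 2)⁻¹) ?_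
      (integrable_inv_one_add_sq.const_mul E) ?_ ?_
    · intro k
      exact (integrable_kern_line (hgood k).kernHeight had).aestronglyMeasurable
    · intro k
      refine Eventually.of_forall fun x => le_div_one_add_sq (norm_nonneg _) ?_
      refine le_trans (mul_le_mul_of_nonneg_left ?_ (norm_nonneg _)) (hbound k x)
      have : (0 : ℝ) ≤ k := Nat.cast_nonneg k
      have := abs_nonneg x
      exact pow_le_pow_left₀ (by positivity) (by linarith) 2
    · refine Eventually.of_forall fun x => ?_
      refine squeeze_zero_norm (a := fun k : ℕ => E * ((k : ℝ) + 1)⁻¹) (fun k => ?_) ?_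
      · have h1 := hbound k x
        have hk0 : (0 : ℝ) ≤ k := Nat.cast_nonneg k
        have hx0 := abs_nonneg x
        rw [← div_eq_mul_inv, le_div_iff₀ (by positivity)]
        refine le_trans (mul_le_mul_of_nonneg_left ?_ (norm_nonneg _)) h1
        nlinarith
      · have := (tendsto_one_div_add_atTop_nhds_zero_nat (𝕜 := ℝ)).const_mul E
        simpa using this
  rw [integral_zero] at hlim
  have hconst : (fun k : ℕ => lineInt θ (y₀ - 2 * π * k) e) = fun _ => lineInt θ y e :=
    funext fun k => hline (hgood k) h
  rw [hconst] at hlim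
  exact tendsto_nhds_unique tendsto_const_nhds hlim
end

section
variable {n : ℕ} {θ : Fin n → ℂ} {y : ℝ} {N : Fin n → ℕ} {e : ℂ → ℂ}

theorem betheFun_sinh_eq_zero (hθ : θ ∈ generic n) {d : ℕ} {Q : ℂ → ℂ} (hQ : Q ∈ Vdeg d 0)
    (hd : 2 * d + 4 ≤ 3 * n) : betheFun θ (fun z => Q z * ∏ i, sinh ((z - θ i) / 2)) = 0 := by
  obtain ⟨y, -, N, h⟩ := exists_goodLine θ 0
  rw [betheFun_eq hθ h (mul_prod_sinh_mem_admissible hQ hd θ), lineFun, lineInt_sinh_eq_zero hθ h hQ hd,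
    poleSum_sinh_eq_zero]
  simp

theorem kern_reflect (θ : Fin n → ℂ) (z : ℂ) : kern (fun i => iπ - θ i) (-z) = kern θ z := by
  refine prod_congr rfl fun i _ => ?_
  rw [← chi_symm]
  congr 1
  ring

theorem generic_reflect (hθ : θ ∈ generic n) : (fun i => iπ - θ i) ∈ generic n := fun i j hij k hk =>
  hθ i j hij (-k) (by push_cast; linear_combination -hk)

theorem tendsto_kern_upper_pole (hθ : θ ∈ generic n) (he : Differentiable ℂ e) (i : Fin n) (k : ℕ)
    (h0 : e (θ i + (2 * k - 1) * iπ) = 0) :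
    Tendsto (fun z => (z - (θ i + (2 * k - 1) * iπ)) * (kern θ z * e z))
      (𝓝[≠] (θ i + (2 * k - 1) * iπ)) (𝓝 0) := by
  have h := tendsto_kern_pole (generic_reflect hθ) (e := fun z => e (-z)) (he.comp differentiable_neg) i k
  have hp : -(iπ - θ i - 2 * k * iπ) = θ i + (2 * k - 1) * iπ := by ring
  rw [hp, h0, mul_zero] at h
  have h1 : Tendsto (fun z : ℂ => -z) (𝓝[≠] (θ i + (2 * k - 1) * iπ)) (𝓝[≠] (iπ - θ i - 2 * k * iπ)) :=
    tendsto_punctured (by fun_prop) (by ring) fun z hz => by linear_combination -hz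
  have h2 := (h.comp h1).neg
  rw [neg_zero] at h2
  refine h2.congr fun z => ?_
  simp only [Function.comp, kern_reflect, neg_neg]
  ring

/-- The contour can be moved above all poles if `e` vanishes at the upper ones. -/
theorem lineFun_eq_reflect (hθ : θ ∈ generic n) (h : GoodLine θ y N) {y' : ℝ} {N' : Fin n → ℕ}
    (h' : GoodLine (fun i => iπ - θ i) y' N') (hyy : y < -y') (he : e ∈ admissible n)
    (h0 : ∀ i (k : ℕ), e (θ i + (2 * k - 1) * iπ) = 0) :
    lineFun θ y N e = lineInt (fun i => iπ - θ i) y' fun z => e (-z) := by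
  classical
  have hπ := pi_pos
  have hkh : KernHeight θ (-y') := by
    intro i k
    obtain ⟨a1, a2⟩ := h'.kernHeight i k
    simp at a1 a2
    exact ⟨fun hk => a2 (by linarith), fun hk => a1 (by linarith)⟩
  have him : ∀ i, (iπ - θ i).im = π - (θ i).im := fun i => by simp
  set S : Finset ((Σ _ : Fin n, ℕ) ⊕ (Σ _ : Fin n, ℕ)) :=
    (Finset.univ.sigma fun i => Finset.range (N i)).disjSum
      (Finset.univ.sigma fun i => Finset.range (N' i)) with hS
  have hi1 := integrable_kern_line h.kernHeight he
  have hi2 := integrable_kern_line hkh he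
  have hmain := integral_strip_sub_indexed hyy S
    (Sum.elim (fun p => θ p.1 - 2 * p.2 * iπ) fun p => θ p.1 + (2 * p.2 - 1) * iπ)
    (Sum.elim (fun p => chiRes p.2 * kernOther θ p.1 (θ p.1 - 2 * p.2 * iπ) * e (θ p.1 - 2 * p.2 * iπ))
      fun _ => 0)
    (f := fun z => kern θ z * e z) ?_ ?_ ?_ ?_ (hi1.sub hi2) ?_
  · rw [hS, Finset.sum_disjSum, integral_sub hi1 hi2] at hmain
    simp only [Sum.elim_inl, Sum.elim_inr, Finset.sum_const_zero, add_zero, Finset.sum_sigma] at hmain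
    have h1 : lineInt (fun i => iπ - θ i) y' (fun z => e (-z)) =
        ∫ x : ℝ, kern θ (x + (-y' : ℝ) * I) * e (x + (-y' : ℝ) * I) := by
      rw [lineInt, ← integral_neg_eq_self]
      refine integral_congr_ae (Eventually.of_forall fun x => ?_)
      simp only
      rw [← kern_reflect θ]
      congr 2 <;> push_cast <;> ring
    rw [h1, lineFun, lineInt, poleSum]
    linear_combination hmain
  · have key : ∀ (i j : Fin n) (k l : ℤ), θ i + k * iπ = θ j + l * iπ → i = j ∧ k = l := by
      intro i j k l hij
      by_cases hne : i = j
      · subst hne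
        refine ⟨rfl, ?_⟩
        have : (2 * iπ) * ((k : ℂ) - l) = 0 := by linear_combination 2 * hij
        exact_mod_cast sub_eq_zero.1 ((mul_eq_zero.1 this).resolve_left two_ipi_ne_zero)
      · exact absurd (by push_cast; linear_combination hij) (hθ i j hne (l - k))
    rintro (⟨i, k⟩ | ⟨i, k⟩) - (⟨j, l⟩ | ⟨j, l⟩) - hij <;> simp only [Sum.elim_inl, Sum.elim_inr] at hij
    · obtain ⟨rfl, hkl⟩ := key i j (-(2 * k)) (-(2 * l)) (by push_cast; linear_combination hij)
      have : k = l := by omega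
      rw [this]
    · have := (key i j (-(2 * k)) (2 * l - 1) (by push_cast; linear_combination hij)).2
      omega
    · have := (key i j (2 * k - 1) (-(2 * l)) (by push_cast; linear_combination hij)).2
      omega
    · obtain ⟨rfl, hkl⟩ := key i j (2 * k - 1) (2 * l - 1) (by push_cast; linear_combination hij)
      have : k = l := by omega
      rw [this]
  · rintro (⟨i, k⟩ | ⟨i, k⟩) hp
    · simp only [hS, Finset.inl_mem_disjSum, Finset.mem_sigma, Finset.mem_univ, true_and,
        Finset.mem_range] at hp
      have h1 := (h.lt_iff i k).1 hp
      have h2 := (h' i).1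
      rw [him] at h2
      have : 0 ≤ π * k := by positivity
      simp
      constructor <;> linarith
    · simp only [hS, Finset.inr_mem_disjSum, Finset.mem_sigma, Finset.mem_univ, true_and,
        Finset.mem_range] at hp
      have h1 := (h'.lt_iff i k).1 hp
      rw [him] at h1
      have h2 := (h i).1
      have : 0 ≤ π * k := by positivity
      simp
      constructor <;> linarith
  · intro z h1 h2 hz
    refine (differentiableAt_kern fun i hi => ?_).mul (he.1 z)
    rw [rchi_eq_zero_iff] at hi
    obtain ⟨k, hk | hk⟩ := hi
    · have hzim : z.im = (θ i).im - 2 * π * k := by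
        have := congrArg im hk
        simp at this; linarith
      refine hz (.inl ⟨i, k⟩) ?_ (by simp only [Sum.elim_inl]; linear_combination hk)
      simp only [hS, Finset.inl_mem_disjSum, Finset.mem_sigma, Finset.mem_univ, true_and,
        Finset.mem_range]
      rw [h.lt_iff, ← hzim]
      exact lt_of_le_of_ne h1 fun h4 => (h.kernHeight i k).1 (by linarith)
    · have hzim : z.im = (θ i).im + (2 * k - 1) * π := by
        have := congrArg im hk
        simp at this; linarith
      refine hz (.inr ⟨i, k⟩) ?_ (by simp only [Sum.elim_inr]; linear_combination hk)
      simp only [hS, Finset.inr_mem_disjSum, Finset.mem_sigma, Finset.mem_univ, true_and,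
        Finset.mem_range]
      rw [h'.lt_iff, him]
      refine lt_of_le_of_ne (by linarith) fun h4 => (hkh i k).2 (by linarith)
  · rintro (⟨i, k⟩ | ⟨i, k⟩) -
    · exact tendsto_kern_pole hθ he.1 i k
    · exact tendsto_kern_upper_pole hθ he.1 i k (h0 i k)
  · exact exists_strip_bound y (-y') fun M => weak_growth_of_admissible he M

theorem comp_neg_mem_Vdeg {d : ℕ} {Q : ℂ → ℂ} (hQ : Q ∈ Vdeg d 0) : (fun z => Q (-z)) ∈ Vdeg d 0 := by
  induction hQ using span_induction with
  | mem f hf =>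
    obtain ⟨a, ha, κ, hκ, rfl⟩ := hf
    have h := smul_mem _ ((-1 : ℂ) ^ a) (mem_Vdeg (K := 0) (κ := -κ) ha (by rwa [abs_neg]))
    convert h using 1
    funext z
    simp [neg_pow z]
    ring
  | zero => exact zero_mem _
  | add f g _ _ hf hg => exact add_mem hf hg
  | smul c f _ hf => exact smul_mem _ c hf

theorem cosh_eq_sinh (z : ℂ) : cosh z = -I * sinh (z + iπ / 2) := by
  rw [Complex.sinh_add, show iπ / 2 = (π / 2 : ℝ) * I by push_cast; ring, Complex.sinh_mul_I,
    Complex.cosh_mul_I, ← Complex.ofReal_cos, ← Complex.ofReal_sin, Real.cos_pi_div_two,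
    Real.sin_pi_div_two]
  simp
  linear_combination cosh z * I_mul_I

theorem cosh_half_eq_zero {k : ℤ} {z : ℂ} (h : z = (2 * k - 1) * iπ) : cosh (z / 2) = 0 := by
  rw [cosh_eq_sinh, sinh_eq_zero_iff.2 ⟨k, by rw [h]; ring⟩, mul_zero]

theorem betheFun_cosh_eq_zero (hθ : θ ∈ generic n) {d : ℕ} {Q : ℂ → ℂ} (hQ : Q ∈ Vdeg d 0)
    (hd : 2 * d + 4 ≤ 3 * n) : betheFun θ (fun z => Q z * ∏ i, cosh ((z - θ i) / 2)) = 0 := by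
  set e : ℂ → ℂ := fun z => Q z * ∏ i, cosh ((z - θ i) / 2) with he
  have hfac : e = (-I) ^ n • fun z => Q z * ∏ i, sinh ((z - (θ i - iπ)) / 2) := by
    funext z
    simp only [he, Pi.smul_apply, smul_eq_mul]
    rw [mul_left_comm, ← prod_const, ← prod_mul_distrib]
    congr 1
    refine prod_congr rfl fun i _ => ?_
    rw [cosh_eq_sinh]
    ring_nf
  have had : e ∈ admissible n := by
    rw [hfac]
    exact smul_mem _ _ (mul_prod_sinh_mem_admissible hQ hd _)
  obtain ⟨y, hy, N, h⟩ := exists_goodLine θ 0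
  obtain ⟨y', hy', N', h'⟩ := exists_goodLine (fun i => iπ - θ i) 0
  have hz : lineInt (fun i => iπ - θ i) y' (fun z => e (-z)) = 0 := by
    have h1 := lineInt_sinh_eq_zero (generic_reflect hθ) h'
      (smul_mem _ (I ^ n) (comp_neg_mem_Vdeg hQ)) hd
    rw [← h1]
    congr 1
    funext z
    simp only [he, Pi.smul_apply, smul_eq_mul]
    rw [mul_right_comm, mul_comm (Q (-z)), ← prod_const, ← prod_mul_distrib]
    congr 1
    refine prod_congr rfl fun i _ => ?_
    rw [← Complex.cosh_neg, cosh_eq_sinh,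
      show -((-z - θ i) / 2) + iπ / 2 = (z - (iπ - θ i)) / 2 + π * I by ring, Complex.sinh_add_pi_mul_I]
    ring
  rw [betheFun_eq hθ h had, lineFun_eq_reflect hθ h h' (by linarith) had, hz, zero_div]
  intro i k
  simp only [he]
  rw [prod_eq_zero (Finset.mem_univ i), mul_zero]
  exact cosh_half_eq_zero (k := k) (by push_cast; ring)

theorem prod_pair_mul {M : Type*} [CommMonoid M] : ∀ {m : ℕ} (x : Fin m → M),
    ∏ i, ∏ j ∈ Finset.Ioi i, (x i * x j) = ∏ i, x i ^ (m - 1) := by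
  intro m
  induction m with
  | zero => intro x; simp
  | succ m ih =>
    intro x
    rw [prod_univ_succ, prod_univ_succ, Fin.prod_Ioi_zero, prod_mul_distrib, prod_const]
    simp only [Fin.prod_Ioi_succ, Nat.add_sub_cancel]
    rw [ih fun i => x i.succ, mul_assoc, ← prod_mul_distrib]
    congr 1
    refine prod_congr rfl fun i _ => ?_
    rw [← pow_succ', Nat.sub_add_cancel (Nat.one_le_of_lt i.pos)]

/-- The matrix of the functions `exp ((k - 2b) z)`, `0 ≤ b ≤ k`, at the points `z_i`. -/
def expMat {k : ℕ} (z : Fin (k + 1) → ℂ) : Matrix (Fin (k + 1)) (Fin (k + 1)) ℂ :=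
  Matrix.of fun i b => exp (z i) ^ k * exp (-2 * z i) ^ (b : ℕ)

theorem det_expMat {k : ℕ} (z : Fin (k + 1) → ℂ) :
    (expMat z).det = ∏ i, ∏ j ∈ Finset.Ioi i, (2 * sinh (z i - z j)) := by
  have h1 : expMat z = Matrix.of fun i b => exp (z i) ^ k * Matrix.vandermonde (fun i => exp (-2 * z i)) i b := rfl
  rw [h1, Matrix.det_mul_column, Matrix.det_vandermonde]
  have h2 := prod_pair_mul fun i => exp (z i)
  rw [Nat.add_sub_cancel] at h2
  rw [← h2, ← prod_mul_distrib]
  refine prod_congr rfl fun i _ => ?_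
  rw [← prod_mul_distrib]
  refine prod_congr rfl fun j _ => ?_
  rw [Complex.sinh, mul_sub, ← exp_add, ← exp_add, ← exp_add]
  rw [show z i + z j + -2 * z j = z i - z j by ring, show z i + z j + -2 * z i = -(z i - z j) by ring]
  ring

theorem sum_range_two_mul {M : Type*} [AddCommMonoid M] (f : ℕ → M) (k : ℕ) :
    ∑ j ∈ Finset.range (2 * k), f j = ∑ b ∈ Finset.range k, (f (2 * b) + f (2 * b + 1)) := by
  induction k with
  | zero => simp
  | succ k ih =>
    rw [show 2 * (k + 1) = 2 * k + 1 + 1 by ring, sum_range_succ, sum_range_succ, ih,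
      sum_range_succ, add_assoc]

theorem exists_prod_cosh_sub_prod_sinh {k : ℕ} (θ : Fin (2 * (k + 1)) → ℂ) :
    ∃ t : Fin (k + 1) → ℂ, ∀ z : ℂ, ∏ i, (2 * cosh ((z - θ i) / 2)) - ∏ i, (2 * sinh ((z - θ i) / 2)) =
      ∑ b : Fin (k + 1), exp z ^ k * exp (-2 * z) ^ (b : ℕ) * t b := by
  set P : Polynomial ℂ := ∏ i, (1 + Polynomial.C (exp (θ i)) * Polynomial.X) with hP
  have hdeg : P.natDegree < 2 * (k + 1) + 1 := by
    refine Nat.lt_succ_of_le ((Polynomial.natDegree_prod_le _ _).trans ?_)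
    refine (Finset.sum_le_card_nsmul _ _ 1 fun i _ => ?_).trans (by simp)
    compute_degree
  set K := ∏ i, exp (-(θ i) / 2) with hK
  refine ⟨fun b => 2 * K * P.coeff (2 * b + 1), fun z => ?_⟩
  have hPe : ∀ v, P.eval v = ∏ i, (1 + exp (θ i) * v) := fun v => by
    simp [hP, Polynomial.eval_prod]
  have hz : ∏ _i : Fin (2 * (k + 1)), exp (z / 2) = exp z ^ (k + 1) := by
    rw [prod_const, pow_mul, ← exp_nat_mul]
    congr 2; push_cast; ring
  have h1 : ∏ i, (2 * cosh ((z - θ i) / 2)) = exp z ^ (k + 1) * K * P.eval (exp (-z)) := by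
    rw [hPe, hK, ← hz, ← prod_mul_distrib, ← prod_mul_distrib]
    refine prod_congr rfl fun i _ => ?_
    rw [Complex.cosh, mul_add, ← exp_add, ← exp_add, ← exp_add]
    ring_nf
  have h2 : ∏ i, (2 * sinh ((z - θ i) / 2)) = exp z ^ (k + 1) * K * P.eval (-exp (-z)) := by
    rw [hPe, hK, ← hz, ← prod_mul_distrib, ← prod_mul_distrib]
    refine prod_congr rfl fun i _ => ?_
    rw [Complex.sinh, mul_add, mul_neg, mul_neg, ← exp_add, ← exp_add, ← exp_add]
    ring_nf
  have h3 : exp z * exp (-z) = 1 := by rw [← exp_add]; simp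
  rw [h1, h2, Polynomial.eval_eq_sum_range' hdeg, Polynomial.eval_eq_sum_range' hdeg, ← mul_sub,
    ← sum_sub_distrib, sum_range_succ, sum_range_two_mul, Finset.sum_range,
    Even.neg_pow (even_two_mul (k + 1)), sub_self, add_zero, mul_sum]
  refine sum_congr rfl fun b _ => ?_
  rw [Even.neg_pow (even_two_mul _), Odd.neg_pow (odd_two_mul_add_one _),
    show -2 * z = ((2 : ℕ) : ℂ) * -z by push_cast; ring, exp_nat_mul, ← pow_mul, pow_succ (exp z),
    pow_succ (exp (-z))]
  linear_combination (2 * K * P.coeff (2 * b + 1) * exp z ^ k * exp (-z) ^ (2 * (b : ℕ))) * h3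

theorem cons_comp_cycleRange {m : ℕ} (p : Fin (m + 1)) (a : ℂ) (z : Fin m → ℂ) :
    (a ∷ z) ∘ p.cycleRange = p.insertNth a z := by
  have := Fin.cons_removeNth_eq_comp_cycleRange_symm (p.insertNth a z : Fin (m + 1) → ℂ) p
  simp only [Fin.insertNth_apply_same, Fin.removeNth_insertNth] at this
  rw [this]
  funext i
  simp

theorem tens_eq_zero_of_slot {m : ℕ} (L : (ℂ → ℂ) →ₗ[ℂ] ℂ) {f : (Fin (m + 1) → ℂ) → ℂ}
    (hf : f ∈ sepAlg (m + 1)) (p : Fin (m + 1)) (h : ∀ z : Fin m → ℂ, L (fun a => f (p.insertNth a z)) = 0) :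
    tens L (m + 1) f = 0 := by
  have h1 : (fun z => f (z ∘ p.cycleRange)) ∈ sepAlg (m + 1) := by
    refine Sep.induction (P := fun f => (fun z => f (z ∘ p.cycleRange)) ∈ sepAlg (m + 1)) hf
      (fun e _ => prod_mem_sepAlg _ fun j _ => coord_mem_sepAlg (e j) _) (zero_mem _) (fun _ _ => add_mem)
      fun c _ hf => Subalgebra.smul_mem _ hf c
  rw [← tens_comp_perm L hf p.cycleRange, tens_succ_inner L h1]
  simp only [cons_comp_cycleRange, h]
  exact map_zero _

theorem det_mem_sepAlg {m k : ℕ} {M : (Fin m → ℂ) → Matrix (Fin k) (Fin k) ℂ}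
    (h : ∀ i j, (fun z => M z i j) ∈ sepAlg m) : (fun z => (M z).det) ∈ sepAlg m := by
  have : (fun z => (M z).det) = ∑ s : Equiv.Perm (Fin k), ((((Equiv.Perm.sign s : ℤˣ) : ℤ) : ℂ)) •
      fun z => ∏ i, M z (s i) i := by
    funext z
    rw [Matrix.det_apply', Finset.sum_apply]
    rfl
  rw [this]
  exact sum_mem fun s _ => Subalgebra.smul_mem _ (prod_mem_sepAlg _ fun i _ => h _ _) _

theorem prod_diff_mem_PDeg {X : Type*} [NormedAddCommGroup X] [NormedSpace ℂ X] {m : ℕ} :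
    (fun (_ : X) (z : Fin m → ℂ) => ∏ i, ∏ j ∈ Finset.Ioi i, (z i - z j)) ∈ PDeg X (fun _ => m - 1) 0 := by
  have hz : ∀ i : Fin m, (fun (_ : X) (z : Fin m → ℂ) => z i) ∈ PDeg X (Pi.single i 1) 0 := by
    intro i
    have := PDeg.coord (X := X) (m := m) i (pow_mem_Vdeg (le_refl 1))
    simpa using this
  have h := PDeg.prod (X := X) (m := m) Finset.univ fun i (_ : i ∈ Finset.univ) =>
    PDeg.prod (X := X) (m := m) (Finset.Ioi i) fun j (_ : j ∈ Finset.Ioi i) =>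
      sub_mem (PDeg.mono (hz i) (d' := Pi.single i 1 + Pi.single j 1) (K' := 0)
        (fun l => by simp) (fun l => le_rfl)) (PDeg.mono (hz j) (fun l => by simp) (fun l => le_rfl))
  refine PDeg.mono h (fun k => (sum_pair_single k).le) fun k => by simp

theorem cosh_half_ne_zero (hθ : θ ∈ generic n) (i j : Fin n) : cosh ((θ i - θ j) / 2) ≠ 0 := by
  by_cases hij : i = j
  · simp [hij]
  · intro h
    rw [cosh_eq_sinh, mul_eq_zero, or_iff_right (by simp), sinh_eq_zero_iff] at h
    obtain ⟨k, hk⟩ := h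
    exact hθ i j hij (2 * k - 1) (by push_cast; linear_combination 2 * hk)

/-- Constants do not contribute to the Bethe ansatz integral of weight zero. -/
theorem tens_const_eq_zero {m : ℕ} (hθ : θ ∈ generic n) (hn : n = 2 * m) (hm : 0 < m) (c : ℂ)
    (α : Fin n → Fin 2) : tens (betheFun θ) m (fun z => tauProd z * c * bpoly θ z α) = 0 := by
  obtain ⟨k, rfl⟩ : ∃ k, m = k + 1 := Nat.exists_eq_succ_of_ne_zero hm.ne'
  subst hn
  obtain ⟨t, ht⟩ := exists_prod_cosh_sub_prod_sinh θ
  set eS : ℂ → ℂ := fun z => ∏ i, (2 * cosh ((z - θ i) / 2)) - ∏ i, (2 * sinh ((z - θ i) / 2)) with heS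
  obtain ⟨b, hb⟩ : ∃ b, t b ≠ 0 := by
    by_contra! hall
    have h1 := ht (θ 0)
    simp only [hall, mul_zero, Finset.sum_const_zero] at h1
    have h2 : ∏ i, (2 * sinh ((θ 0 - θ i) / 2)) = 0 :=
      prod_eq_zero (Finset.mem_univ 0) (by simp)
    rw [h2, sub_zero] at h1
    exact prod_ne_zero_iff.2 (fun i _ => mul_ne_zero two_ne_zero (cosh_half_ne_zero hθ 0 i)) h1
  set A : (Fin (k + 1) → ℂ) → ℂ := fun z => (∏ i, ∏ j ∈ Finset.Ioi i, (z i - z j)) * bpoly θ z α with hA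
  have hAdeg : A ∈ Sep fun _ : Fin (k + 1) => Vdeg (k + (2 * (k + 1) - 1)) 0 := by
    have := PSep.sep (PDeg.mul (prod_diff_mem_PDeg (m := k + 1)) (bpoly_mem_PDeg (k + 1) α)) θ
    simpa using this
  have hAperm : ∀ (s : Equiv.Perm (Fin (k + 1))) z, A (z ∘ s) = (((Equiv.Perm.sign s : ℤˣ) : ℤ) : ℂ) * A z := by
    intro s z
    have h1 := s.prod_Ioi_comp_eq_sign_mul_prod (f := fun i j => z i - z j) (fun i j => by ring)
    simp only [hA, Function.comp]
    rw [h1, bpoly_comp_perm, mul_assoc]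
  have hsum : ∀ z : Fin (k + 1) → ℂ, t b * (∏ i, ∏ j ∈ Finset.Ioi i, (2 * sinh (z i - z j))) =
      ∑ p, (expMat z).adjugate b p * eS (z p) := by
    intro z
    have h1 : (expMat z).mulVec t = fun i => eS (z i) := by
      funext i
      exact (ht (z i)).symm
    have h2 := congrFun (congrArg (fun v => (expMat z).adjugate.mulVec v) h1) b
    simp only [Matrix.mulVec_mulVec, Matrix.adjugate_mul, Matrix.smul_mulVec, Matrix.one_mulVec] at h2
    rw [Pi.smul_apply, smul_eq_mul, det_expMat] at h2
    rw [mul_comm, h2]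
    rfl
  have hslot : ∀ p, tens (betheFun θ) (k + 1) (fun z => A z * ((expMat z).adjugate b p * eS (z p))) = 0 := by
    intro p
    refine tens_eq_zero_of_slot _ (mul_mem (Sep.mem_sepAlg hAdeg) (mul_mem ?_ (coord_mem_sepAlg eS p))) p ?_
    · simp only [Matrix.adjugate_apply]
      refine det_mem_sepAlg fun i j => ?_
      by_cases hi : i = p
      · subst hi
        simp only [Matrix.updateRow_self]
        exact const_mem_sepAlg _
      · simp only [Matrix.updateRow_ne hi]
        exact coord_mem_sepAlg (fun z => exp z ^ k * exp (-2 * z) ^ (j : ℕ)) i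
    · intro z
      have hadj : ∀ a, (expMat (p.insertNth a z)).adjugate b p = (expMat (p.insertNth 0 z)).adjugate b p := by
        intro a
        rw [Matrix.adjugate_apply, Matrix.adjugate_apply]
        congr 1
        funext i j
        by_cases hi : i = p
        · subst hi; simp
        · obtain ⟨l, rfl⟩ := Fin.exists_succAbove_eq hi
          simp [expMat]
      have hAa : ∀ a, A (p.insertNth a z) =
          (((Equiv.Perm.sign p.cycleRange : ℤˣ) : ℤ) : ℂ) * A (a ∷ z) := by
        intro a
        rw [← hAperm, cons_comp_cycleRange]
      have hQ := Sep.apply_mem hAdeg z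
      have hd : 2 * (k + (2 * (k + 1) - 1)) + 4 ≤ 3 * (2 * (k + 1)) := by omega
      have h1 := betheFun_cosh_eq_zero hθ hQ hd
      have h2 := betheFun_sinh_eq_zero hθ hQ hd
      have h3 : (fun a => A (p.insertNth a z) * ((expMat (p.insertNth a z)).adjugate b p *
          eS ((p.insertNth a z : Fin (k + 1) → ℂ) p))) =
          ((((Equiv.Perm.sign p.cycleRange : ℤˣ) : ℤ) : ℂ) * (expMat (p.insertNth 0 z)).adjugate b p *
            2 ^ (2 * (k + 1))) • ((fun a => A (a ∷ z) * ∏ i, cosh ((a - θ i) / 2)) -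
            fun a => A (a ∷ z) * ∏ i, sinh ((a - θ i) / 2)) := by
        funext a
        simp only [hAa, hadj, Fin.insertNth_apply_same, heS, Pi.smul_apply, Pi.sub_apply, smul_eq_mul,
          prod_mul_distrib, prod_const]
        ring
      rw [h3, map_smul, map_sub, h1, h2, sub_zero, smul_zero]
  have hfin : t b • tens (betheFun θ) (k + 1) (fun z => tauProd z * c * bpoly θ z α) =
      (c * (∏ i : Fin (k + 1), ∏ _j ∈ Finset.Ioi i, (8 * (π : ℂ) ^ 3)⁻¹)) •
        ∑ p, tens (betheFun θ) (k + 1) (fun z => A z * ((expMat z).adjugate b p * eS (z p))) := by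
    rw [← map_smul, ← map_sum, ← map_smul]
    congr 1
    funext z
    rw [Pi.smul_apply, Pi.smul_apply, Finset.sum_apply, ← mul_sum, ← hsum]
    have h1 : tauProd z = (∏ i, ∏ j ∈ Finset.Ioi i, (z i - z j)) *
        (∏ i, ∏ j ∈ Finset.Ioi i, (2 * sinh (z i - z j))) *
        (∏ i : Fin (k + 1), ∏ _j ∈ Finset.Ioi i, (8 * (π : ℂ) ^ 3)⁻¹) := by
      simp only [tauProd, ← prod_mul_distrib]
      refine prod_congr rfl fun i _ => prod_congr rfl fun j _ => ?_
      rw [tau_eq_sinhN, sinhN]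
      field_simp
      ring
    rw [h1]
    simp only [hA, smul_eq_mul]
    ring
  simp only [hslot, Finset.sum_const_zero, smul_eq_mul, mul_zero] at hfin
  exact (mul_eq_zero.1 hfin).resolve_left hb
end

/-! ### Pinching of the contour at `θ₁ = θ₂ + iπ` -/

section

theorem cons_cons_swap_eq {m : ℕ} {f : (Fin (m + 2) → ℂ) → ℂ}
    (hf : ∀ (s : Equiv.Perm (Fin (m + 2))) z, f (z ∘ s) = f z) (a b : ℂ) (z : Fin m → ℂ) :
    f (a ∷ b ∷ z) = f (b ∷ a ∷ z) := by
  rw [← hf (Equiv.swap 0 1), cons_cons_comp_swap]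

theorem perm_cons {m : ℕ} {f : (Fin (m + 1) → ℂ) → ℂ}
    (hf : ∀ (s : Equiv.Perm (Fin (m + 1))) z, f (z ∘ s) = f z) (a : ℂ) (s : Equiv.Perm (Fin m))
    (z : Fin m → ℂ) : f (a ∷ (z ∘ s)) = f (a ∷ z) := by
  rw [← hf (Equiv.Perm.decomposeFin.symm (0, s)) (a ∷ z)]
  congr 1
  funext i
  refine Fin.cases ?_ (fun i => ?_) i <;> simp

/-- Adding evaluations at finitely many points to the functional `L`, for functions that vanish if
two of the variables take such values. -/
theorem tens_add_eval {L L' : (ℂ → ℂ) →ₗ[ℂ] ℂ} (ρ x : Fin 2 → ℂ)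
    (hL : ∀ e, L' e = L e + ∑ c, ρ c * e (x c)) : ∀ (m : ℕ) (f : (Fin (m + 1) → ℂ) → ℂ),
    (∀ (s : Equiv.Perm (Fin (m + 1))) z, f (z ∘ s) = f z) →
    (∀ z i j c d, i ≠ j → z i = x c → z j = x d → f z = 0) →
    tens L' (m + 1) f = tens L (m + 1) f +
      (m + 1) * ∑ c, ρ c * tens L m fun z => f (x c ∷ z) := by
  intro m
  induction m with
  | zero =>
    intro f _ _
    simp only [tens_succ, tens_zero, hL]
    simp
  | succ m ih =>
    intro f hs h0
    have h1 : (fun a => tens L' (m + 1) fun z => f (a ∷ z)) =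
        (fun a => tens L (m + 1) fun z => f (a ∷ z)) + ((m : ℂ) + 1) • ∑ c, ρ c • fun a => tens L m
          fun z => f (x c ∷ a ∷ z) := by
      funext a
      rw [ih (fun z => f (a ∷ z)) (perm_cons hs a) fun z i j c d hij hi hj =>
        h0 _ i.succ j.succ c d (by simpa using hij) (by simpa using hi) (by simpa using hj)]
      simp only [Pi.add_apply, Pi.smul_apply, Finset.sum_apply, smul_eq_mul,
        cons_cons_swap_eq hs a]
    have hz : ∀ c d, tens L m (fun z => f (x c ∷ x d ∷ z)) = 0 := by
      intro c d
      have : (fun z => f (x c ∷ x d ∷ z)) = 0 :=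
        funext fun z => h0 _ 0 1 c d (by simp) rfl rfl
      rw [this, map_zero]
    rw [tens_succ, h1, hL, map_add, map_smul, map_sum]
    simp only [map_smul, Pi.add_apply, Pi.smul_apply, Finset.sum_apply, hz, smul_eq_mul, mul_zero,
      Finset.sum_const_zero, add_zero]
    rw [tens_succ L (m + 1) f]
    simp only [tens_succ L m]
    push_cast
    ring

theorem exists_limit_functional {ι : Type*} {l : Filter ι} [l.NeBot] (L : ι → (ℂ → ℂ) →ₗ[ℂ] ℂ)
    (V : Submodule ℂ (ℂ → ℂ)) (h : ∀ e ∈ V, ∃ c, Tendsto (fun i => L i e) l (𝓝 c)) :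
    ∃ L₀ : (ℂ → ℂ) →ₗ[ℂ] ℂ, ∀ e ∈ V, Tendsto (fun i => L i e) l (𝓝 (L₀ e)) := by
  choose c hc using h
  let f : V →ₗ[ℂ] ℂ :=
    { toFun := fun e => c e e.2
      map_add' := fun e e' => tendsto_nhds_unique (hc _ _)
        (((hc e e.2).add (hc e' e'.2)).congr fun i => (map_add (L i) (e : ℂ → ℂ) e').symm)
      map_smul' := fun a e => tendsto_nhds_unique (hc _ _)
        (((hc e e.2).const_mul a).congr fun i => (map_smul (L i) a (e : ℂ → ℂ)).symm) }
  obtain ⟨L₀, hL₀⟩ := f.exists_extend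
  refine ⟨L₀, fun e he => ?_⟩
  have : L₀ e = f ⟨e, he⟩ := by rw [← hL₀]; rfl
  rw [this]
  exact hc e he

variable {n : ℕ} {θ : Fin n → ℂ} {y : ℝ}

theorem kern_cons (a : ℂ) (θ : Fin n → ℂ) (z : ℂ) :
    kern (a ∷ θ) z = chi (z - a) * kern θ z := by
  simp [kern, prod_univ_succ]

theorem kernOther_cons_zero (a : ℂ) (θ : Fin n → ℂ) (z : ℂ) :
    kernOther (a ∷ θ) 0 z = kern θ z := by
  simp [kernOther, kern, prod_univ_succ, Fin.succ_ne_zero]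

theorem kernOther_cons_succ (a : ℂ) (θ : Fin n → ℂ) (i : Fin n) (z : ℂ) :
    kernOther (a ∷ θ) i.succ z = chi (z - a) * kernOther θ i z := by
  simp [kernOther, prod_univ_succ, (Fin.succ_ne_zero i).symm]

theorem continuousAt_chi_comp {f : ℂ → ℂ} {x : ℂ} (hf : ContinuousAt f x) (h : rchi (f x) ≠ 0) :
    ContinuousAt (fun x => chi (f x)) x :=
  ContinuousAt.comp (f := f) (differentiableAt_chi h).continuousAt hf

theorem rchi_odd_ne_zero {j : ℤ} (hj : Odd j) (h1 : j < -1) {x : ℂ} (hx : x = j * iπ) : rchi x ≠ 0 := by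
  rw [hx, Ne, rchi_eq_zero_iff]
  obtain ⟨l, rfl⟩ := hj
  rintro ⟨k, hk | hk⟩
  · have : ((2 * l + 1 : ℤ) : ℂ) = ((-(2 * k) : ℤ) : ℂ) :=
      mul_right_cancel₀ ipi_ne_zero (by push_cast at hk ⊢; linear_combination hk)
    have : (2 * l + 1 : ℤ) = -(2 * k) := by exact_mod_cast this
    omega
  · have : ((2 * l + 1 : ℤ) : ℂ) = ((2 * k - 1 : ℤ) : ℂ) :=
      mul_right_cancel₀ ipi_ne_zero (by push_cast at hk ⊢; linear_combination hk)
    have : (2 * l + 1 : ℤ) = 2 * k - 1 := by exact_mod_cast this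
    omega

theorem lineInt_sub_mul (h : KernHeight θ y) {e : ℂ → ℂ} (he : e ∈ admissible n)
    (hze : (fun z => z * e z) ∈ admissible n) (c : ℂ) :
    lineInt θ y (fun z => (c - z) * e z) = c * lineInt θ y e - lineInt θ y fun z => z * e z := by
  simp only [lineInt]
  rw [← integral_const_mul, ← integral_sub ((integrable_kern_line h he).const_mul c)
    (integrable_kern_line h hze)]
  congr 1
  funext x
  ring

/-- The functional `betheFun (θ₁, θ₂, …)` on the functions with a factor `θ₁ - z`, without the
contributions of the two poles that pinch the contour as `θ₁ → θ₂ + iπ`. -/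
def pinchReg (t : ℂ) (θ : Fin n → ℂ) (s : ℂ) : (ℂ → ℂ) →ₗ[ℂ] ℂ :=
  betheFun (s ∷ t ∷ θ) ∘ₗ mulFun (fun z => s - z) +
    (chi (s - t - 2 * iπ) * kern θ (s - 2 * iπ)) • LinearMap.proj (s - 2 * iπ) +
    ((s - t) / iπ * chi (t - s) * kern θ t) • LinearMap.proj (s - iπ)

theorem eventually_generic_cons {t : ℂ} (hgen : (t ∷ θ) ∈ generic (n + 1)) :
    ∀ᶠ s in 𝓝[≠] (t + iπ), (s ∷ t ∷ θ) ∈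
      generic (n + 2) := by
  have h1 : ∀ᶠ s in 𝓝[≠] (t + iπ), sinh (s - t) ≠ 0 := by
    have h : HasDerivAt (fun s : ℂ => sinh (s - t)) (cosh (t + iπ - t) * 1) (t + iπ) :=
      ((hasDerivAt_id (t + iπ)).sub_const t).csinh
    refine h.eventually_ne ?_
    rw [mul_one, add_sub_cancel_left, mul_comm, cosh_mul_I, Complex.cos_pi]
    simp
  have h2 : ∀ i, ∀ᶠ s in 𝓝[≠] (t + iπ), sinh (s - θ i) ≠ 0 := by
    intro i
    refine Filter.Eventually.filter_mono nhdsWithin_le_nhds ?_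
    have hc : ContinuousAt (fun s : ℂ => sinh (s - θ i)) (t + iπ) := by fun_prop
    refine hc.eventually_ne fun h => ?_
    obtain ⟨k, hk⟩ := sinh_eq_zero_iff.1 h
    exact (generic_cons_iff.1 hgen).2 i (k - 1) (by push_cast; linear_combination hk)
  filter_upwards [h1, eventually_all.2 h2] with s a1 a2
  refine generic_cons_iff.2 ⟨hgen, fun i k hk => ?_⟩
  refine Fin.cases (fun hk => ?_) (fun i hk => ?_) i hk
  · exact a1 (sinh_eq_zero_iff.2 ⟨k, by simpa using hk⟩)
  · exact a2 i (sinh_eq_zero_iff.2 ⟨k, by simpa using hk⟩)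

/-- `κ` compensates the factors of the kernel that belong to `θ₁ = t + iπ` and `θ₂ = t`. -/
structure PinchFactor (t : ℂ) (κ : ℂ → ℂ) (c : ℂ) : Prop where
  mem : κ ∈ Vdeg 2 1
  zero : ∀ k : ℤ, k ≠ 0 → κ (t - k * iπ) = 0
  self : κ t = 0
  deriv : HasDerivAt κ 0 t
  chi_mul : ∀ z, (∀ k : ℤ, z - t ≠ k * iπ) →
    chi (z - (t + iπ)) * chi (z - t) * ((t + iπ - z) * κ z) = c

theorem tendsto_sub_mul_chi (t : ℂ) :
    Tendsto (fun s : ℂ => (s - (t + iπ)) * chi (t - s)) (𝓝[≠] (t + iπ)) (𝓝 (chiRes 0)) ∧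
    Tendsto (fun s : ℂ => (s - (t + iπ)) * chi (s - t - 2 * iπ)) (𝓝[≠] (t + iπ)) (𝓝 (-chiRes 0)) := by
  have h1 : ∀ c : ℂ, Tendsto (fun s : ℂ => s - (t + iπ) + c) (𝓝[≠] (t + iπ)) (𝓝[≠] c) := fun c =>
    tendsto_punctured (by fun_prop) (by ring) fun s hs => by linear_combination hs
  have h2 := tendsto_chi_lower 0
  simp only [Nat.cast_zero, mul_zero, zero_mul, add_zero, neg_zero] at h2
  constructor
  · refine (h2.comp (h1 0)).congr fun s => ?_
    simp only [Function.comp, add_zero]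
    rw [← chi_symm (s - (t + iπ))]
    congr 2; ring
  · refine (tendsto_chi_upper.comp (h1 (-iπ))).congr fun s => ?_
    simp only [Function.comp]
    rw [neg_add_cancel_right]
    congr 2; ring

theorem exists_pinchReg_limit {t : ℂ} (hgen : (t ∷ θ) ∈ generic (n + 1)) {d : ℕ}
    {K : ℝ} (hd : 2 * d + 6 ≤ 3 * (n + 2)) (hK : 2 * K ≤ n + 2) :
    ∃ L₀ : (ℂ → ℂ) →ₗ[ℂ] ℂ,
      (∀ e ∈ Vdeg d K, Tendsto (fun s => pinchReg t θ s e) (𝓝[≠] (t + iπ)) (𝓝 (L₀ e))) ∧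
      ∀ κ c, PinchFactor t κ c → ∀ e ∈ admissible n, (fun z => κ z * e z) ∈ Vdeg d K →
        L₀ (fun z => κ z * e z) = c * betheFun θ e := by
  have hπ := pi_pos
  obtain ⟨hθ, htθ⟩ := generic_cons_iff.1 hgen
  set Θ : ℂ → Fin (n + 2) → ℂ := fun s => Fin.cons s (t ∷ θ) with hΘ
  obtain ⟨y, hy, N, hN⟩ := exists_goodLine (Θ (t + iπ)) (t.im - 4 * π)
  have him0 : (Θ (t + iπ) 0).im = t.im + π := by simp [hΘ]
  obtain ⟨a, ha⟩ : ∃ a, N 0 = a + 2 := ⟨N 0 - 2, by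
    have : 1 < N 0 := (hN.lt_iff 0 1).2 (by rw [him0]; push_cast; linarith)
    omega⟩
  obtain ⟨b, hb⟩ : ∃ b, N 1 = b + 1 := ⟨N 1 - 1, by
    have : 0 < N 1 := (hN.lt_iff 1 0).2 (by
      rw [show Θ (t + iπ) 1 = t from rfl]; push_cast; linarith)
    omega⟩
  have hN' : GoodLine θ y fun i => N i.succ.succ := fun i => by simpa [hΘ] using hN i.succ.succ
  have hcont : Continuous Θ := by
    refine continuous_pi fun i => ?_
    refine Fin.cases ?_ (fun i => ?_) i
    · exact continuous_id
    · simp only [hΘ, cons_succ]; exact continuous_const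
  set P : (ℂ → ℂ) → ℂ → ℂ := fun e s =>
    (∑ k ∈ Finset.range a, chiRes (k + 2) * (chi (s - 2 * (k + 2) * iπ - t) *
      kern θ (s - 2 * (k + 2) * iπ)) * (2 * (k + 2) * iπ * e (s - 2 * (k + 2) * iπ))) +
    (∑ k ∈ Finset.range b, chiRes (k + 1) * (chi (t - 2 * (k + 1) * iπ - s) *
      kern θ (t - 2 * (k + 1) * iπ)) * ((s - (t - 2 * (k + 1) * iπ)) * e (t - 2 * (k + 1) * iπ))) +
    ∑ i, ∑ k ∈ Finset.range (N i.succ.succ), chiRes k * (chi (θ i - 2 * k * iπ - s) *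
      (chi (θ i - 2 * k * iπ - t) * kernOther θ i (θ i - 2 * k * iπ))) *
      ((s - (θ i - 2 * k * iπ)) * e (θ i - 2 * k * iπ)) with hP
  set H : (ℂ → ℂ) → ℂ → ℂ := fun e s =>
    (s * lineInt (Θ s) y e - lineInt (Θ s) y (fun z => z * e z) - 2 * iπ * P e s) / constR with hH
  have hR := constR_ne_zero
  have hlim : ∀ e ∈ Vdeg d K, Tendsto (fun s => pinchReg t θ s e) (𝓝[≠] (t + iπ))
      (𝓝 (H e (t + iπ) + chiRes 0 * kern θ t * deriv e t)) := by
    intro e he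
    have hed := differentiable_of_mem_Vdeg he
    have had : e ∈ admissible (n + 2) := Vdeg_le_admissible (by omega) (by push_cast; linarith) he
    have hzad : (fun z => z * e z) ∈ admissible (n + 2) := by
      have := mul_mem_Vdeg (pow_mem_Vdeg (le_refl 1)) he
      simp only [pow_one] at this
      exact Vdeg_le_admissible (by omega) (by push_cast; linarith) this
    have hev : ∀ᶠ s in 𝓝[≠] (t + iπ), H e s + (s - t) / iπ * ((s - (t + iπ)) * chi (t - s)) * kern θ t *
        ((s - (t + iπ))⁻¹ * (e (s - iπ) - e t)) = pinchReg t θ s e := by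
      have hg : ∀ᶠ s in 𝓝[≠] (t + iπ), GoodLine (Θ s) y N :=
        (hcont.tendsto (t + iπ)).eventually (eventually_goodLine hN) |>.filter_mono nhdsWithin_le_nhds
      filter_upwards [hg, eventually_generic_cons hgen, self_mem_nhdsWithin] with s h1 h2 h3
      have h3' : s - (t + iπ) ≠ 0 := sub_ne_zero.2 h3
      have had2 : (fun z => (s - z) * e z) ∈ admissible (n + 2) := by
        convert sub_mem (smul_mem _ s had) hzad using 1
        funext z
        simp only [Pi.sub_apply, Pi.smul_apply, smul_eq_mul]
        ring
      have hps : poleSum (Θ s) N (fun z => (s - z) * e z) =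
          chiRes 1 * (chi (s - 2 * iπ - t) * kern θ (s - 2 * iπ)) * (2 * iπ * e (s - 2 * iπ)) +
          chiRes 0 * (chi (t - s) * kern θ t) * ((s - t) * e t) + P e s := by
        have hN1 : N (Fin.succ 0) = b + 1 := hb
        simp only [poleSum, Fin.sum_univ_succ, ha, hN1, Finset.sum_range_succ', hP, hΘ, cons_zero,
          cons_succ, kernOther_cons_zero, kernOther_cons_succ, kern_cons]
        push_cast
        simp only [mul_zero, zero_mul, sub_zero, sub_self, mul_one, sub_sub_cancel, add_assoc,
          one_add_one_eq_two, add_zero, mul_assoc]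
        ring
      have h4 : pinchReg t θ s e = betheFun (Θ s) (fun z => (s - z) * e z) +
          chi (s - t - 2 * iπ) * kern θ (s - 2 * iπ) * e (s - 2 * iπ) +
          (s - t) / iπ * chi (t - s) * kern θ t * e (s - iπ) := rfl
      rw [h4, betheFun_eq h2 h1 had2, lineFun, hps, lineInt_sub_mul h1.kernHeight had hzad]
      have h5 : (s - (t + iπ)) * (s - (t + iπ))⁻¹ = 1 := mul_inv_cancel₀ h3'
      have h6 : s - t - 2 * iπ = s - 2 * iπ - t := by ring
      have h7 : chiRes 1 = chiRes 0 / 2 := by simp [chiRes]; ring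
      rw [h6, h7]
      simp only [hH, constR_eq]
      have h8 := chiRes_zero_ne_zero
      have h9 := ipi_ne_zero
      generalize iπ = q at *
      field_simp
      ring
    have hHc : ContinuousAt (H e) (t + iπ) := by
      have hl : ∀ {e}, e ∈ admissible (n + 2) → ContinuousAt (fun s => lineInt (Θ s) y e) (t + iπ) :=
        fun he => ContinuousAt.comp (f := Θ) (analyticAt_lineInt hN.kernHeight he).continuousAt
          hcont.continuousAt
      have hec := hed.continuous
      refine ((((continuousAt_id.mul (hl had)).sub (hl hzad)).sub (ContinuousAt.mul continuousAt_const
        ?_))).div_const _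
      refine ((tendsto_finsetSum _ fun k _ => ?_).add (tendsto_finsetSum _ fun k _ => ?_)).add
        (tendsto_finsetSum _ fun i _ => tendsto_finsetSum _ fun k _ => ?_)
      · refine ContinuousAt.mul (ContinuousAt.mul continuousAt_const (ContinuousAt.mul
          (continuousAt_chi_comp (f := fun s => s - 2 * (k + 2) * iπ - t) (by fun_prop) ?_) ?_)) ?_
        · exact rchi_odd_ne_zero (j := -(2 * k + 3)) ⟨-k - 2, by ring⟩ (by omega) (by push_cast; ring)
        · refine ContinuousAt.comp (f := fun s => s - 2 * (k + 2) * iπ) (g := kern θ)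
            (differentiableAt_kern fun i => ?_).continuousAt (by fun_prop)
          refine rchi_ne_zero_of_generic fun j hj => htθ i (j + 2 * k + 3) ?_
          push_cast; linear_combination hj
        · fun_prop
      · refine ContinuousAt.mul (ContinuousAt.mul continuousAt_const (ContinuousAt.mul
          (continuousAt_chi_comp (f := fun s => t - 2 * (k + 1) * iπ - s) (by fun_prop) ?_)
          continuousAt_const)) (by fun_prop)
        exact rchi_odd_ne_zero (j := -(2 * k + 3)) ⟨-k - 2, by ring⟩ (by omega) (by push_cast; ring)
      · refine ContinuousAt.mul (ContinuousAt.mul continuousAt_const (ContinuousAt.mul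
          (continuousAt_chi_comp (f := fun s => θ i - 2 * k * iπ - s) (by fun_prop) ?_)
          continuousAt_const)) (by fun_prop)
        refine rchi_ne_zero_of_generic fun j hj => htθ i (-j - 2 * k - 1) ?_
        push_cast; linear_combination -hj
    have hslope : Tendsto (fun s => (s - (t + iπ))⁻¹ * (e (s - iπ) - e t)) (𝓝[≠] (t + iπ))
        (𝓝 (deriv e t)) := by
      have h1 : HasDerivAt (fun s => e (s - iπ)) (deriv e t) (t + iπ) := by
        have h2 := (hed (t + iπ - iπ)).hasDerivAt
        have := h2.comp_sub_const (t + iπ) iπ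
        rwa [add_sub_cancel_right] at this
      have h3 := hasDerivAt_iff_tendsto_slope.1 h1
      refine h3.congr fun s => ?_
      rw [slope_def_module, smul_eq_mul, add_sub_cancel_right]
    have h1 : Tendsto (fun s : ℂ => (s - t) / iπ) (𝓝[≠] (t + iπ)) (𝓝 1) := by
      have hc : ContinuousAt (fun s : ℂ => (s - t) / iπ) (t + iπ) := by fun_prop
      have := hc.tendsto.mono_left (nhdsWithin_le_nhds (s := {t + iπ}ᶜ))
      rwa [add_sub_cancel_left, div_self ipi_ne_zero] at this
    refine Tendsto.congr' hev ((hHc.tendsto.mono_left nhdsWithin_le_nhds).add ?_)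
    have := ((h1.mul (tendsto_sub_mul_chi t).1).mul_const (kern θ t)).mul hslope
    rwa [one_mul] at this
  obtain ⟨L₀, hL₀⟩ := exists_limit_functional (l := 𝓝[≠] (t + iπ)) (fun s => pinchReg t θ s) (Vdeg d K)
    fun e he => ⟨_, hlim e he⟩
  refine ⟨L₀, hL₀, fun κ c hκ e he hmem => ?_⟩
  rw [tendsto_nhds_unique (hL₀ _ hmem) (hlim _ hmem)]
  have hder : deriv (fun z => κ z * e z) t = 0 := by
    have := hκ.deriv.mul (he.1 t).hasDerivAt
    rw [zero_mul, hκ.self, zero_mul, add_zero] at this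
    exact this.deriv
  have had : (fun z => κ z * e z) ∈ admissible (n + 2) :=
    Vdeg_le_admissible (by omega) (by push_cast; linarith) hmem
  have hzad : (fun z => z * (κ z * e z)) ∈ admissible (n + 2) := by
    have := mul_mem_Vdeg (pow_mem_Vdeg (le_refl 1)) hmem
    simp only [pow_one] at this
    exact Vdeg_le_admissible (by omega) (by push_cast; linarith) this
  rw [hder, mul_zero, add_zero, betheFun_eq hθ hN' he]
  simp only [hH]
  rw [← lineInt_sub_mul hN.kernHeight had hzad, lineFun, mul_div_assoc']
  congr 1
  rw [mul_sub]
  congr 1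
  · rw [lineInt, lineInt, ← integral_const_mul]
    congr 1
    funext x
    rw [kern_cons, kern_cons, ← hκ.chi_mul (x + y * I)]
    · ring
    · intro k hk
      have h1 := congrArg im hk
      simp at h1
      have hk' : (k : ℝ) < -4 := by
        by_contra hge
        have : -4 ≤ (k : ℝ) := not_lt.1 hge
        nlinarith
      have hk2 : k < -4 := by exact_mod_cast hk'
      rcases Int.even_or_odd' k with ⟨j, rfl | rfl⟩
      · refine (hN.kernHeight 1 (-j).toNat).1 ?_
        rw [show Θ (t + iπ) 1 = t from rfl, show (((-j).toNat : ℕ) : ℝ) = ((-j : ℤ) : ℝ) by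
          exact_mod_cast Int.toNat_of_nonneg (by omega)]
        push_cast at h1 ⊢
        linarith
      · refine (hN.kernHeight 0 (-j).toNat).1 ?_
        rw [him0, show (((-j).toNat : ℕ) : ℝ) = ((-j : ℤ) : ℝ) by
          exact_mod_cast Int.toNat_of_nonneg (by omega)]
        push_cast at h1 ⊢
        linarith
  · rw [mul_left_comm c]
    refine congrArg (2 * iπ * ·) ?_
    simp only [hP]
    rw [sum_eq_zero fun k _ => ?_, sum_eq_zero fun k _ => ?_, zero_add, zero_add, poleSum,
      mul_sum]
    · refine sum_congr rfl fun i _ => ?_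
      rw [mul_sum]
      refine sum_congr rfl fun k _ => ?_
      rw [← hκ.chi_mul (θ i - 2 * k * iπ)]
      · ring
      · intro j hj
        exact htθ i (-j - 2 * k) (by push_cast; linear_combination -hj)
    · have := hκ.zero (2 * k + 2) (by omega)
      rw [show t - 2 * (k + 1) * iπ = t - ((2 * k + 2 : ℤ) : ℂ) * iπ by push_cast; ring, this]
      ring
    · have := hκ.zero (2 * k + 3) (by omega)
      rw [show t + iπ - 2 * (k + 2) * iπ = t - ((2 * k + 3 : ℤ) : ℂ) * iπ by push_cast; ring, this]
      ring
end

section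
variable {n m : ℕ} {θ : Fin n → ℂ}

theorem tau_int (k : ℤ) {x : ℂ} (hx : x = k * iπ) : tau x = 0 := by
  rw [tau_eq_sinhN, sinhN_eq_zero k hx, mul_zero]

theorem const_sub_mem_Vdeg (c : ℂ) : (fun z => c - z) ∈ Vdeg 1 0 := by
  convert sub_mem (smul_mem _ c (pow_mem_Vdeg (Nat.zero_le 1)))
    (pow_mem_Vdeg (le_refl 1)) using 1
  funext z
  simp

theorem tau_sub_mem_Vdeg (c : ℂ) : (fun z => tau (c - z)) ∈ Vdeg 1 1 := by
  have := smul_mem _ (-1 : ℂ) (mul_mem_Vdeg (const_sub_mem_Vdeg c) (sinhN_sub_mem_Vdeg c))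
  rw [zero_add] at this
  convert this using 1
  funext z
  rw [tau_eq_sinhN, Pi.smul_apply, smul_eq_mul, sinhN, sinhN, ← neg_sub z c, Complex.sinh_neg]
  ring

theorem hasDerivAt_mul_of_zero {g h : ℂ → ℂ} {t : ℂ} (hg : DifferentiableAt ℂ g t)
    (hh : DifferentiableAt ℂ h t) (hg0 : g t = 0) (hh0 : h t = 0) :
    HasDerivAt (fun z => g z * h z) 0 t := by
  have := hg.hasDerivAt.mul hh.hasDerivAt
  rw [hg0, hh0, mul_zero, zero_mul, add_zero] at this
  exact this

theorem chi_ne_zero {x : ℂ} (h : rchi x ≠ 0) : chi x ≠ 0 := by rw [chi_eq_inv]; exact inv_ne_zero h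

theorem chi_mul_tau {x : ℂ} (h : ∀ k : ℤ, x ≠ k * iπ) :
    chi (x - iπ) * chi x * ((iπ - x) * (tau (-x - iπ) * -x)) = 1 ∧
    chi (x - iπ) * chi x * ((iπ - x) * (tau (-x) * (-x - iπ))) = -1 := by
  have h0 : x ≠ 0 := by simpa using h 0
  have h1 : x - iπ ≠ 0 := sub_ne_zero.2 (by simpa using h 1)
  have h2 : x + iπ ≠ 0 := fun h' => h (-1) (by push_cast; linear_combination h')
  have hc1 : chi x ≠ 0 := chi_ne_zero (rchi_ne_zero_of_generic h)
  have hc2 : chi (x - iπ) ≠ 0 := chi_ne_zero (rchi_ne_zero_of_generic fun k hk =>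
    h (k + 1) (by push_cast; linear_combination hk))
  have j1 : jost (-x - iπ) = chi x * x := by
    rw [jost_eq_chi (by simpa using h0), chi_symm]; ring
  have j2 : jost (-x) = chi (x - iπ) * (x - iπ) := by
    rw [jost_eq_chi (fun h' => h1 (by linear_combination -h')), ← chi_symm (x - iπ)]
    ring_nf
  have j3 : jost (x + iπ) = jost (-x) := jost_add_ipi x
  have j4 : jost x = chi x * (-x - iπ) := jost_eq_chi h2
  have h3 : -x - iπ ≠ 0 := fun h' => h2 (by linear_combination -h')
  constructor
  · rw [tau, show -(-x - iπ) = x + iπ by ring, j3, j1, j2]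
    generalize iπ = q at *
    field_simp
    ring
  · rw [tau, neg_neg, j4, j2]
    generalize iπ = q at *
    field_simp
    ring

theorem pinchFactor_lower (t : ℂ) : PinchFactor t (fun z => tau (t - iπ - z) * (t - z)) 1 where
  mem := by
    have := mul_mem_Vdeg (tau_sub_mem_Vdeg (t - iπ)) (const_sub_mem_Vdeg t)
    simpa using this
  zero k _ := by rw [tau_int (k - 1) (by push_cast; ring), zero_mul]
  self := by simp
  deriv := hasDerivAt_mul_of_zero (differentiable_of_mem_Vdeg (tau_sub_mem_Vdeg _) t) (by fun_prop)
    (tau_int (-1) (by push_cast; ring)) (sub_self t)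
  chi_mul z hz := by
    rw [← (chi_mul_tau hz).1]
    ring_nf

theorem pinchFactor_upper (t : ℂ) : PinchFactor t (fun z => tau (t - z) * (t - z - iπ)) (-1) where
  mem := by
    have := mul_mem_Vdeg (tau_sub_mem_Vdeg t) (const_sub_mem_Vdeg (t - iπ))
    simp only [add_zero] at this
    convert this using 1
    funext z
    ring
  zero k _ := by rw [tau_int k (by ring), zero_mul]
  self := by rw [sub_self, tau_int 0 (by simp), zero_mul]
  deriv := by
    have : (fun z => tau (t - z) * (t - z - iπ)) = fun z => (t - z) * (sinhN (t - z) * (t - z - iπ)) := by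
      funext z
      rw [tau_eq_sinhN, mul_assoc]
    rw [this]
    refine hasDerivAt_mul_of_zero (by fun_prop) ?_ (sub_self t) ?_
    · unfold sinhN; fun_prop
    · rw [sub_self, sinhN_eq_zero 0 (by simp), zero_mul]
  chi_mul z hz := by
    rw [← (chi_mul_tau hz).2]
    ring_nf

theorem mul_tens (L : (ℂ → ℂ) →ₗ[ℂ] ℂ) (c : ℂ) (f : (Fin m → ℂ) → ℂ) :
    c * tens L m f = tens L m fun z => c * f z :=
  (map_smul (tens L m) c f).symm

/-- The off-shell Bethe ansatz integral of a weight `q`, continued analytically in `θ`. -/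
def betheVec (θ : Fin n → ℂ) (q : (Fin m → ℂ) → ℂ) : CoVec n := fun α =>
  tens (betheFun θ) m fun z => tauProd z * q z * bpoly θ z α

theorem differentiable_cons (θ : Fin n → ℂ) :
    Differentiable ℂ fun s : ℂ => (s ∷ θ) := by
  refine differentiable_pi.2 fun i => ?_
  refine Fin.cases ?_ (fun i => ?_) i
  · simp only [cons_zero]; fun_prop
  · simp only [cons_succ]; fun_prop

theorem integrand_mem_PDeg {X : Type*} [NormedAddCommGroup X] [NormedSpace ℂ X] {K : ℝ}
    {q : X → (Fin m → ℂ) → ℂ} (hq : q ∈ PDeg X (fun _ => 0) fun _ => K) {φ : X → Fin n → ℂ}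
    (hφ : Differentiable ℂ φ) (α : Fin n → Fin 2) :
    (fun x z => tauProd z * q x z * bpoly (φ x) z α) ∈
      PSep X fun _ => Vdeg (m - 1 + (n - 1)) (((m - 1 : ℕ) : ℝ) + K) := by
  refine PDeg.mono (PDeg.mul (PDeg.mul tauProd_mem_PDeg hq) (PSep.comp (bpoly_mem_PDeg m α) hφ))
    (fun j => le_of_eq ?_) fun j => le_of_eq ?_
  · simp
  · simp

theorem map_univ_prod (z : Fin m → ℂ) (g : ℂ → ℂ) :
    ((Finset.univ.val.map z).map g).prod = ∏ j, g (z j) := by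
  rw [Multiset.map_map]; rfl

theorem tendsto_pinch {w : ℕ} (hn : n = w + 2 * m) {t : ℂ}
    (hgen : (t ∷ θ) ∈ generic (n + 1))
    {p : (Fin (n + 2) → ℂ) → (Fin (m + 1) → ℂ) → ℂ}
    (hp : p ∈ PWeight w (n + 2))
    (hsymm : ∀ (s : Equiv.Perm (Fin (m + 1))) θ z, p θ (z ∘ s) = p θ z) (a : Fin 2) (α : Fin n → Fin 2) :
    Tendsto (fun s => (s - (t + iπ)) *
        betheVec (s ∷ t ∷ θ)
          (p (s ∷ t ∷ θ)) (0 ∷ a ∷ α))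
      (𝓝[≠] (t + iπ)) (𝓝 ((m + 1) * (iπ * chiRes 0) *
        (kern θ (t - iπ) * ((-1) ^ (a : ℕ) * tmat n θ (t - iπ) 0 (1 - a) (betheVec θ fun z =>
            p (t + iπ ∷ t ∷ θ) (t - iπ ∷ z)) α) +
          kd a 1 * (kern θ t * (∏ i, (θ i - t - iπ)) * (-1) ^ m * betheVec θ (fun z =>
            p (t + iπ ∷ t ∷ θ) (t ∷ z)) α)))) := by
  have hnR : (n : ℝ) = w + 2 * m := by rw [hn]; push_cast; ring
  set Θ : ℂ → Fin (n + 2) → ℂ := fun s => Fin.cons s (t ∷ θ) with hΘ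
  set β : Fin (n + 1) → Fin 2 := Fin.cons a α with hβ
  set f : ℂ → (Fin (m + 1) → ℂ) → ℂ := fun s z =>
    tauProd z * p (Θ s) z * bpoly (t ∷ θ) z β with hf
  have hpΘ := PSep.comp hp (differentiable_cons (t ∷ θ))
  have hfsep : f ∈ PSep ℂ fun _ => Vdeg (n + m) (1 + (n : ℝ) / 2) := by
    refine PSep.mono (integrand_mem_PDeg hpΘ (differentiable_const _) β) fun j => Vdeg_mono (by omega) ?_
    rw [Nat.add_sub_cancel]
    linarith
  obtain ⟨htgen, htθ⟩ := generic_cons_iff.1 hgen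
  obtain ⟨L₀, hL₀, hκ⟩ := exists_pinchReg_limit hgen (d := n + m) (K := 1 + (n : ℝ) / 2) (by omega)
    (by linarith)
  have hfperm : ∀ s (σ : Equiv.Perm (Fin (m + 1))) z, f s (z ∘ σ) = f s z := by
    intro s σ z
    simp only [hf, tauProd_comp_perm, hsymm, bpoly_comp_perm]
  have hsplit : ∀ s, betheVec (Θ s) (p (Θ s)) (0 ∷ β) = tens (pinchReg t θ s) (m + 1) (f s) +
      (m + 1) * (-(chi (s - t - 2 * iπ) * kern θ (s - 2 * iπ)) *
          tens (pinchReg t θ s) m (fun z => f s (s - 2 * iπ ∷ z)) +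
        -((s - t) / iπ * chi (t - s) * kern θ t) *
          tens (pinchReg t θ s) m (fun z => f s (s - iπ ∷ z))) := by
    intro s
    have h1 := tens_add_eval (L := pinchReg t θ s) (L' := betheFun (Θ s) ∘ₗ mulFun fun z => s - z)
      ![-(chi (s - t - 2 * iπ) * kern θ (s - 2 * iπ)), -((s - t) / iπ * chi (t - s) * kern θ t)]
      ![s - 2 * iπ, s - iπ] ?_ m (f s) (hfperm s) ?_
    · rw [sum_univ_two] at h1
      simp only [Matrix.cons_val_zero, Matrix.cons_val_one] at h1
      rw [← h1, tens_comp_mulFun, betheVec]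
      congr 1
      funext z
      have h2 := congrFun (slice_zero_bvec (Θ s) (Finset.univ.val.map z)) β
      rw [slice_apply, map_univ_prod z (fun x => Θ s 0 - x)] at h2
      rw [bpoly, h2]
      simp only [hf, Pi.smul_apply, smul_eq_mul, bpoly]
      rw [show tail (Θ s) = (t ∷ θ) from rfl, show Θ s 0 = s from rfl]
      ring
    · intro e
      rw [sum_univ_two]
      simp only [Matrix.cons_val_zero, Matrix.cons_val_one, pinchReg, LinearMap.add_apply,
        LinearMap.smul_apply, LinearMap.proj_apply, smul_eq_mul, hΘ]
      ring
    · intro z i j c d hij hi hj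
      have : ∃ k : ℤ, z i - z j = k * iπ := by
        rw [hi, hj]
        rcases fin_two_cases c with rfl | rfl <;> rcases fin_two_cases d with rfl | rfl <;>
          simp only [Matrix.cons_val_zero, Matrix.cons_val_one]
        · exact ⟨0, by simp⟩
        · exact ⟨-1, by push_cast; ring⟩
        · exact ⟨1, by push_cast; ring⟩
        · exact ⟨0, by simp⟩
      obtain ⟨k, hk⟩ := this
      simp only [hf, tauProd_eq_zero hij hk, zero_mul]
  have hdiff : ∀ e ∈ Vdeg (n + m) (1 + (n : ℝ) / 2), Differentiable ℂ e :=
    fun e he => differentiable_of_mem_Vdeg he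
  have hid : Tendsto (fun s : ℂ => s) (𝓝[≠] (t + iπ)) (𝓝 (t + iπ)) := nhdsWithin_le_nhds
  have hT : Tendsto (fun s => tens (pinchReg t θ s) (m + 1) (f s)) (𝓝[≠] (t + iπ))
      (𝓝 (tens L₀ (m + 1) (f (t + iπ)))) := PSep.tendsto_tens hfsep hid fun _ => hL₀
  have hTsub : ∀ c : ℂ, Tendsto (fun s => tens (pinchReg t θ s) m (fun z => f s (s - c ∷ z)))
      (𝓝[≠] (t + iπ)) (𝓝 (tens L₀ m fun z => f (t + iπ) (t + iπ - c ∷ z))) := fun c =>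
    PSep.tendsto_tens (PSep.subst hfsep hdiff (ζ := fun s => s - c) (by fun_prop)) hid fun _ => hL₀
  have heval : ∀ κ c, PinchFactor t κ c → ∀ x : ℂ, ∀ α',
      tens L₀ m (fun z => (∏ j, κ (z j)) *
        (tauProd z * p (Θ (t + iπ)) (x ∷ z) * bpoly θ z α')) =
      c ^ m * betheVec θ (fun z => p (Θ (t + iπ)) (x ∷ z)) α' := by
    intro κ c hc x α'
    have hq := PSep.subst hpΘ (fun e he => differentiable_of_mem_Vdeg he)
      (differentiable_const x : Differentiable ℂ fun _ : ℂ => x)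
    have hs := PSep.sep (integrand_mem_PDeg hq (differentiable_const θ) α') (t + iπ)
    rw [← tens_comp_mulFun L₀ κ, tens_congr_of_sep (L' := betheFun θ ∘ₗ mulFun fun _ => c) hs,
      tens_comp_mulFun, prod_const, betheVec, mul_tens]
    · intro j e he
      have hm : 1 ≤ m := Nat.one_le_of_lt j.pos
      have hmR : ((m - 1 : ℕ) : ℝ) = m - 1 := by rw [Nat.cast_sub hm, Nat.cast_one]
      have had : e ∈ admissible n := Vdeg_le_admissible (by omega) (by rw [hmR]; linarith) he
      have hmem : (fun z => κ z * e z) ∈ Vdeg (n + m) (1 + (n : ℝ) / 2) :=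
        Vdeg_mono (by omega) (by rw [hmR]; linarith) (mul_mem_Vdeg hc.mem he)
      have h1 : (betheFun θ ∘ₗ mulFun fun _ => c) e = c * betheFun θ e := map_smul (betheFun θ) c e
      rw [h1, ← hκ κ c hc e had hmem]
      rfl
  have hval1 : tens L₀ m (fun z => f (t + iπ) (t - iπ ∷ z)) =
      (-1) ^ (a : ℕ) * iπ * tmat n θ (t - iπ) 0 (1 - a) (betheVec θ fun z =>
        p (Θ (t + iπ)) (t - iπ ∷ z)) α := by
    have h1 : betheVec θ (fun z => p (Θ (t + iπ)) (t - iπ ∷ z)) = fun α' =>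
        tens L₀ m fun z => (∏ j, (tau (t - iπ - z j) * (t - z j))) *
          (tauProd z * p (Θ (t + iπ)) (t - iπ ∷ z) * bpoly θ z α') := by
      funext α'
      rw [heval _ _ (pinchFactor_lower t), one_pow, one_mul]
    rw [h1, tens_comp_linear L₀ (tmat n θ (t - iπ) 0 (1 - a)) (fun z α' =>
      (∏ j, (tau (t - iπ - z j) * (t - z j))) *
        (tauProd z * p (Θ (t + iπ)) (t - iπ ∷ z) * bpoly θ z α')), mul_tens]
    congr 1
    funext z
    have h2 : (fun α' => (∏ j, (tau (t - iπ - z j) * (t - z j))) *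
        (tauProd z * p (Θ (t + iπ)) (t - iπ ∷ z) * bpoly θ z α')) =
        ((∏ j, (tau (t - iπ - z j) * (t - z j))) * (tauProd z * p (Θ (t + iπ)) (t - iπ ∷ z))) •
          bpoly θ z := by
      funext α'
      simp only [Pi.smul_apply, smul_eq_mul, mul_assoc]
    have h3 : bpoly (t ∷ θ) (t - iπ ∷ z) β =
        (-1) ^ (a : ℕ) * (iπ * ∏ j, (t - z j)) * tmat n θ (t - iπ) 0 (1 - a) (bpoly θ z) α := by
      rw [bpoly, map_univ_cons, hβ]
      rcases fin_two_cases a with rfl | rfl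
      · have := congrFun (slice_zero_bvec_sub (t ∷ θ) (Finset.univ.val.map z)) α
        rw [map_univ_prod] at this
        refine this.trans ?_
        simp [bpoly, mul_assoc]
      · have := congrFun (slice_one_bvec_sub (t ∷ θ) (Finset.univ.val.map z)) α
        rw [map_univ_prod] at this
        refine this.trans ?_
        simp [bpoly, mul_assoc]
    rw [h2]
    simp only [hf, Pi.smul_apply, map_smul, smul_eq_mul, tauProd_cons, h3, prod_mul_distrib]
    ring
  have hval2 : tens L₀ m (fun z => f (t + iπ) (t ∷ z)) =
      -(kd a 1 * iπ * (∏ i, (θ i - t - iπ)) * ((-1) ^ m * betheVec θ (fun z =>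
        p (Θ (t + iπ)) (t ∷ z)) α)) := by
    rw [← heval _ _ (pinchFactor_upper t), ← neg_mul, mul_tens]
    congr 1
    funext z
    have h3 : bpoly (t ∷ θ) (t ∷ z) β =
        -(kd a 1 * iπ * (∏ i, (θ i - t - iπ)) * (∏ j, (t - z j - iπ)) * bpoly θ z α) := by
      rw [bpoly, map_univ_cons, hβ]
      rcases fin_two_cases a with rfl | rfl
      · have := congrFun (slice_zero_bvec_self (t ∷ θ) (Finset.univ.val.map z)) α
        refine this.trans ?_
        simp [kd_zero_one]
      · have := congrFun (slice_one_bvec_self (t ∷ θ) (Finset.univ.val.map z)) α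
        rw [map_univ_prod z fun x => (t ∷ θ) 0 - x - iπ] at this
        refine this.trans ?_
        simp [kd_same, bpoly, mul_assoc]
    simp only [hf, tauProd_cons, h3, prod_mul_distrib]
    ring
  have hδ : Tendsto (fun s : ℂ => s - (t + iπ)) (𝓝[≠] (t + iπ)) (𝓝 0) := by
    simpa using hid.sub_const (t + iπ)
  have hk : Tendsto (fun s => kern θ (s - 2 * iπ)) (𝓝[≠] (t + iπ)) (𝓝 (kern θ (t - iπ))) := by
    have h1 : ContinuousAt (kern θ) (t - iπ) := (differentiableAt_kern fun i =>
      rchi_ne_zero_of_generic fun j hj => htθ i (j + 1) (by push_cast; linear_combination hj)).continuousAt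
    refine h1.tendsto.comp ?_
    have := hid.sub_const (2 * iπ)
    rwa [show t + iπ - 2 * iπ = t - iπ by ring] at this
  have h1 : Tendsto (fun s : ℂ => (s - t) / iπ) (𝓝[≠] (t + iπ)) (𝓝 1) := by
    have := (hid.sub_const t).div_const iπ
    rwa [add_sub_cancel_left, div_self ipi_ne_zero] at this
  obtain ⟨hchi1, hchi2⟩ := tendsto_sub_mul_chi t
  have hA := hTsub (2 * iπ)
  have hB := hTsub iπ
  rw [show t + iπ - 2 * iπ = t - iπ by ring, hval1] at hA
  rw [add_sub_cancel_right, hval2] at hB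
  have := (hδ.mul hT).add (((((hchi2.mul hk).mul hA).add (((h1.mul hchi1).mul_const (kern θ t)).mul hB)
    ).neg).const_mul ((m : ℂ) + 1))
  convert this using 1
  · funext s
    rw [hsplit]
    ring
  · congr 1
    ring
end

/-! ### The form factors -/

section
variable {n m w : ℕ} {θ : Fin n → ℂ} {y r : ℝ}

theorem integrand_mem (hn : n = w + 2 * m) {X : Type*} [NormedAddCommGroup X] [NormedSpace ℂ X]
    {q : X → (Fin m → ℂ) → ℂ} (hq : q ∈ PDeg X (fun _ => 0) fun _ => 1 + (w : ℝ) / 2)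
    {φ : X → Fin n → ℂ} (hφ : Differentiable ℂ φ) (α : Fin n → Fin 2) :
    (fun x z => tauProd z * q x z * bpoly (φ x) z α) ∈ PSep X fun _ => admissible n := by
  refine PSep.mono (integrand_mem_PDeg hq hφ α) fun j => ?_
  have hm : 1 ≤ m := Nat.one_le_of_lt j.pos
  refine Vdeg_le_admissible (by omega) ?_
  rw [Nat.cast_sub hm, hn]
  push_cast
  linarith

theorem contourInt_congr (h : IsContour θ y r) {f g : ℂ → ℂ}
    (hfg : ∀ z, (∀ i, θ i - z - iπ ≠ 0) → f z = g z) : contourInt θ y r f = contourInt θ y r g := by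
  obtain ⟨h0, h1, h2⟩ := h
  rw [contourInt, contourInt]
  congr 1
  · refine integral_congr_ae (Eventually.of_forall fun x => hfg _ fun i hi => ?_)
    have := congrArg im hi
    simp at this
    linarith [(h1 i).2]
  · refine sum_congr rfl fun i _ => circleIntegral.integral_congr h0.le fun z hz => hfg z
      fun j hj => ?_
    rcases h2 i j (-1) with h3 | h3
    · exact absurd h3.2 (by norm_num)
    · rw [mem_sphere_iff_norm, ← norm_neg] at hz
      rw [← hz] at h3
      refine lt_irrefl _ (h3.trans_eq (congrArg norm ?_))
      push_cast
      linear_combination -hj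

theorem iterInt_congr (h : IsContour θ y r) {f g : (Fin m → ℂ) → ℂ}
    (hfg : ∀ z, (∀ j i, θ i - z j - iπ ≠ 0) → f z = g z) : iterInt θ y r m f = iterInt θ y r m g := by
  induction m with
  | zero => exact hfg _ fun j => j.elim0
  | succ m ih =>
    refine contourInt_congr h fun a ha => ?_
    rw [ih fun z hz => hfg (a ∷ z) fun j => ?_]
    exact Fin.cases (by simpa using ha) (fun j => by simpa using hz j) j

theorem iterInt_kern (h : IsContour θ y r) {f : (Fin m → ℂ) → ℂ} (hf : f ∈ Sep fun _ => admissible n) :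
    iterInt θ y r m (fun z => (∏ j, kern θ (z j)) * f z) = tens (betheFun θ) m f := by
  induction m with
  | zero => simp [iterInt, tens_zero]
  | succ m ih =>
    have h1 : ∀ a, iterInt θ y r m (fun z => (∏ j, kern θ ((a ∷ z) j)) *
        f (a ∷ z)) / constR =
        kern θ a * (constR⁻¹ • fun a => tens (betheFun θ) m fun z => f (a ∷ z)) a := by
      intro a
      have := ih (smul_mem _ (kern θ a) (Sep.cons hf a))
      simp only [prod_univ_succ, cons_zero, cons_succ]
      rw [map_smul, smul_eq_mul] at this
      rw [Pi.smul_apply, smul_eq_mul, mul_left_comm, ← this, div_eq_inv_mul]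
      congr 3
      funext z
      rw [Pi.smul_apply, smul_eq_mul]
      ring
    simp only [iterInt, h1]
    rw [contourInt_kern h (smul_mem _ _ (Sep.tens_mem hf _)), map_smul, smul_eq_mul,
      mul_inv_cancel_left₀ constR_ne_zero, tens_succ]

theorem betheInt_eq (h : IsContour θ y r) (hn : n = w + 2 * m) {q : (Fin m → ℂ) → ℂ}
    (hq : q ∈ Sep fun _ => Vdeg 0 (1 + (w : ℝ) / 2)) (α : Fin n → Fin 2) :
    betheInt θ y r q α = betheVec θ q α := by
  have hs := PSep.sep (integrand_mem hn (Sep.psep hq) (differentiable_const θ) α) 0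
  rw [betheVec, ← iterInt_kern h hs]
  refine iterInt_congr h fun z hz => ?_
  rw [bpoly_eq_betheCovector θ z hz, hTilde, Finset.prod_comm]
  have : ∏ j, ∏ i, jostT (θ i - z j) = (∏ j, kern θ (z j)) * ∏ j, ∏ i, (θ i - z j - iπ) := by
    simp only [kern, ← prod_mul_distrib]
    refine prod_congr rfl fun j _ => prod_congr rfl fun i _ => ?_
    rw [jostT, neg_sub, jost_eq_chi fun h' => hz j i (by linear_combination -h')]
    ring
  rw [this, tauProd]
  ring

/-- The product of the minimal form factors. -/
def minProd (θ : Fin n → ℂ) : ℂ := ∏ i, ∏ j ∈ Finset.Ioi i, minGlobal (θ i - θ j)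

theorem minProd_cons (a : ℂ) (θ : Fin n → ℂ) :
    minProd (a ∷ θ) = (∏ k, minGlobal (a - θ k)) * minProd θ := by
  simp [minProd, prod_univ_succ, Fin.prod_Ioi_succ]

theorem minProd_snoc (b : ℂ) : ∀ {n : ℕ} (θ : Fin n → ℂ),
    minProd (θ ∷ʳ b) = (∏ k, minGlobal (θ k - b)) * minProd θ
  | 0, _ => by simp [minProd]
  | n + 1, θ => by
    rw [← cons_self_tail θ, ← Fin.cons_snoc_eq_snoc_cons, minProd_cons, minProd_snoc b, minProd_cons,
      Fin.prod_univ_castSucc, prod_univ_succ]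
    simp
    ring

theorem minProd_swap : ∀ {n : ℕ} (θ : Fin n → ℂ) (i j : Fin n), (i : ℕ) + 1 = j →
    (∀ k : ℤ, θ i - θ j ≠ k * iπ) → minProd θ = ampA (θ i - θ j) * minProd (θ ∘ Equiv.swap i j)
  | 0, _, i, _, _, _ => i.elim0
  | n + 1, θ, i, j, hij, h => by
    obtain ⟨j, rfl⟩ : ∃ j' : Fin n, j = j'.succ := ⟨j.pred (by intro h; simp [h] at hij), by simp⟩
    rw [Fin.val_succ, add_left_inj] at hij
    obtain ⟨t, θ, rfl⟩ : ∃ t θ', θ = Fin.cons t θ' := ⟨θ 0, tail θ, (cons_self_tail θ).symm⟩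
    cases i using Fin.cases with
    | zero =>
      cases n with
      | zero => exact j.elim0
      | succ n =>
        obtain rfl : j = 0 := Fin.ext hij.symm
        obtain ⟨s, θ, rfl⟩ : ∃ t θ', θ = Fin.cons t θ' := ⟨θ 0, tail θ, (cons_self_tail θ).symm⟩
        simp only [cons_zero, cons_succ] at h ⊢
        rw [Fin.succ_zero_eq_one, cons_cons_comp_swap]
        simp only [minProd_cons, prod_univ_succ, cons_zero, cons_succ]
        rw [minGlobal_eq_ampA_mul h, neg_sub]
        ring
    | succ i =>
      simp only [cons_succ] at h ⊢
      rw [cons_comp_swap_succ, minProd_cons, minProd_cons, minProd_swap θ i j (by simpa using hij) h]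
      have := Equiv.prod_comp (Equiv.swap i j) fun k => minGlobal (t - θ k)
      simp only [Function.comp, this]
      ring

/-- The form factor with normalization constant `c` and p-function `p`. -/
def formFactor (c : ℂ) (p : (Fin n → ℂ) → (Fin m → ℂ) → ℂ) : CoVecFun n := fun θ =>
  (c / (m.factorial : ℂ) * minProd θ) • betheVec θ (p θ)

variable {c σ : ℂ} {p : (Fin n → ℂ) → (Fin m → ℂ) → ℂ}

theorem meroG_betheVec (hn : n = w + 2 * m)
    (hp : p ∈ PWeight w n) (α : Fin n → Fin 2)
    (x : Fin n → ℂ) : MeroG (fun θ => betheVec θ (p θ) α) x :=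
  PSep.meroG_tens (integrand_mem hn hp differentiable_id α) fun _ _ he => meroG_betheFun he x

theorem givenByAnsatz_formFactor (hn : n = w + 2 * m)
    (hp : p ∈ PWeight w n) :
    GivenByAnsatz c p (formFactor c p) := by
  have h : ∀ α x, MeroG (fun θ => formFactor c p θ α) x := fun α x =>
    ((MeroG.const _).mul (MeroG.prod _ fun i _ => MeroG.prod _ fun j hj =>
      meroG_minGlobal (Finset.mem_Ioi.1 hj).ne x)).mul (meroG_betheVec hn hp α x)
  refine ⟨fun α x => (h α x).meroAt, fun α x hx => (h α x).analyticAt hx, fun θ y r hc α => ?_⟩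
  rw [ansatz, funK, betheInt_eq hc hn (PSep.sep hp θ), formFactor, Pi.smul_apply, smul_eq_mul,
    mul_right_comm, minProd]
  congr 1
  refine prod_congr rfl fun i _ => prod_congr rfl fun j _ => minGlobal_eq_minFF ?_ ?_ <;>
    rw [sub_im] <;> linarith [(hc.2.1 i).1, (hc.2.1 i).2, (hc.2.1 j).1, (hc.2.1 j).2, pi_pos]

theorem betheVec_comp_perm (hn : n = w + 2 * m) (hθ : θ ∈ generic n) {q : (Fin m → ℂ) → ℂ}
    (hq : q ∈ Sep fun _ => Vdeg 0 (1 + (w : ℝ) / 2)) (s : Equiv.Perm (Fin n)) (α : Fin n → Fin 2) :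
    betheVec (θ ∘ s) q α = tens (betheFun θ) m fun z => tauProd z * q z * bpoly (θ ∘ s) z α :=
  tens_congr_of_sep (PSep.sep (integrand_mem hn (Sep.psep hq) (differentiable_const (θ ∘ s)) α) 0)
    fun _ _ he => betheFun_comp_perm hθ s he

theorem watson_formFactor (hn : n = w + 2 * m)
    (hp : p ∈ PWeight w n) (hs : PSymm p) :
    Watson (formFactor c p) := by
  intro i j hij θ hθ α
  have hne : i ≠ j := fun h => by simp [h] at hij
  set x := θ i - θ j with hx
  have hx1 : x - iπ ≠ 0 := fun h => hθ i j hne 1 (by push_cast; linear_combination h)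
  have h1 : exch i j x (betheVec (θ ∘ Equiv.swap i j) (p θ)) = (x - iπ) • betheVec θ (p θ) := by
    rw [show betheVec (θ ∘ Equiv.swap i j) (p θ) = _ from
      funext (betheVec_comp_perm hn hθ (PSep.sep hp θ) _), tens_comp_linear (betheFun θ) (exch i j x)
      fun z α => tauProd z * p θ z * bpoly (θ ∘ Equiv.swap i j) z α]
    funext β
    rw [Pi.smul_apply, smul_eq_mul, betheVec, mul_tens]
    congr 1
    funext z
    have h2 := congrFun (congrArg (fun v => (tauProd z * p θ z) • v)
      (exch_bvec θ i j hij (Finset.univ.val.map z))) β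
    simp only [← map_smul] at h2
    refine h2.trans ?_
    simp only [Pi.smul_apply, smul_eq_mul, bpoly]
    ring
  have h2 := congrFun h1 α
  rw [exch_apply, Pi.smul_apply, smul_eq_mul] at h2
  have hu1 : Function.update (Function.update α i (α j)) j (α i) = α ∘ Equiv.swap i j := by
    funext k
    simp only [Function.update_apply, Function.comp, Equiv.swap_apply_def]
    split_ifs <;> simp_all
  have hu2 : Function.update (Function.update α i (α i)) j (α j) = α := by simp
  have hsum : ∀ (V : CoVec n) (a b : Fin 2), ∑ δ : Fin 2, ∑ γ : Fin 2,
      V (Function.update (Function.update α i δ) j γ) * Smat x a b δ γ =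
      ampA x * (V (Function.update (Function.update α i b) j a) * ampBt x +
        V (Function.update (Function.update α i a) j b) * ampCt x) := by
    intro V a b
    simp only [Smat, Stilde]
    rcases fin_two_cases a with rfl | rfl <;> rcases fin_two_cases b with rfl | rfl <;>
      simp [sum_univ_two] <;> ring
  rw [hsum, hu1, hu2, formFactor, formFactor, minProd_swap θ i j hij (hθ i j hne), ← hx,
    show p (θ ∘ Equiv.swap i j) = p θ from funext (hs.1 _ θ)]
  simp only [Pi.smul_apply, smul_eq_mul, ampBt, ampCt]
  field_simp
  linear_combination (-(c / (m.factorial : ℂ) * ampA x * minProd (θ ∘ Equiv.swap i j))) * h2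

theorem sumLow_formFactor (hn : n = w + 2 * m)
    (hp : p ∈ PWeight w n) (hs : PSymm p) (hsh : PShift p σ)
    (hθ : θ ∈ generic n) : sumLow n (formFactor c p θ) = 0 := by
  rw [formFactor, map_smul]
  have := sumLow_tens hθ hn (PSep.sep hp θ) (fun s z => hs.2 s θ z) fun j z => by
    rw [← hsh.2 j θ z]; ring_nf
  rw [show sumLow n (betheVec θ (p θ)) = 0 from this, smul_zero]

theorem slice_one_eq {v : CoVec (n + 1)} (h : sumLow (n + 1) v = 0) : slice 1 v = -sumLow n (slice 0 v) := by
  have := slice_sumLow 0 v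
  rw [h, map_zero, kd_same, one_smul] at this
  exact eq_neg_of_add_eq_zero_right this.symm

theorem crossing_formFactor (hn : n = w + 2 * m)
    (hp : p ∈ PWeight w n) (hs : PSymm p) (hsh : PShift p σ) :
    Crossing n (formFactor c p) σ := by
  cases n with
  | zero => trivial
  | succ n =>
  intro θ₁ θ hgen
  obtain ⟨hθ, hθ₁⟩ := generic_cons_iff.1 hgen
  obtain ⟨t, rfl⟩ : ∃ t, θ₁ = t + iπ := ⟨θ₁ - iπ, by ring⟩
  rw [add_sub_cancel_right, show t + iπ + iπ = t + 2 * iπ by ring]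
  have hg1 : (t ∷ θ) ∈ generic (n + 1) := generic_cons_iff.2
    ⟨hθ, fun i k hk => hθ₁ i (k + 1) (by push_cast; linear_combination hk)⟩
  have hg2 : (t + 2 * iπ ∷ θ) ∈ generic (n + 1) := generic_cons_iff.2
    ⟨hθ, fun i k hk => hθ₁ i (k - 1) (by push_cast; linear_combination hk)⟩
  have hrot : θ ∷ʳ t = (t ∷ θ) ∘ finRotate (n + 1) :=
    Fin.snoc_eq_cons_rotate _ _
  have hg3 : θ ∷ʳ t ∈ generic (n + 1) := by
    rw [hrot]; exact generic_comp_perm hg1 _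
  have hshp : ∀ z, σ * p (t + 2 * iπ ∷ θ) z = (-1) ^ (m + 1) * p (t ∷ θ) z := by
    intro z
    rw [← hsh.1 0 (t ∷ θ) z, Fin.update_cons_zero, cons_zero]
    ring_nf
  have h0 : σ • slice 0 (formFactor c p (t + 2 * iπ ∷ θ)) =
      -sliceLast 0 (formFactor c p (θ ∷ʳ t)) := by
    have hM : minProd (θ ∷ʳ t) = minProd (t + 2 * iπ ∷ θ) := by
      rw [minProd_snoc, minProd_cons]
      congr 1
      refine prod_congr rfl fun k _ => ?_
      rw [← minGlobal_reflect]
      ring_nf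
    funext α
    simp only [formFactor, map_smul, Pi.smul_apply, Pi.neg_apply, smul_eq_mul, hM, slice_apply, sliceLast_apply]
    have hV : σ * betheVec (t + 2 * iπ ∷ θ) (p (t + 2 * iπ ∷ θ)) (0 ∷ α) =
        -betheVec (θ ∷ʳ t) (p (θ ∷ʳ t))
          (α ∷ʳ 0) := by
      set q := p (t ∷ θ) with hq
      have hq' : p (θ ∷ʳ t) = q := by rw [hrot]; funext z; exact hs.1 _ _ z
      set g : (Fin m → ℂ) → ℂ := fun z => tauProd z * q z * bpoly θ z α with hg
      have hgs := PSep.sep (integrand_mem_PDeg hp (φ := tail) (differentiable_pi.2 fun i =>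
        differentiable_apply (𝕜 := ℂ) (F' := fun _ : Fin (n + 1) => ℂ) i.succ) α) (t ∷ θ)
      simp only [tail_cons] at hgs
      have e1 : σ * betheVec (t + 2 * iπ ∷ θ) (p (t + 2 * iπ ∷ θ)) (0 ∷ α) =
          -tens (betheFun (t + 2 * iπ ∷ θ) ∘ₗ mulFun fun z => z - t - 2 * iπ) m g := by
        rw [tens_comp_mulFun, betheVec, mul_tens, neg_eq_neg_one_mul, mul_tens]
        congr 1
        funext z
        have h2 := congrFun (slice_zero_bvec (t + 2 * iπ ∷ θ)
          (Finset.univ.val.map z)) α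
        rw [slice_apply, map_univ_prod] at h2
        have h3 : ∏ j, (t + 2 * iπ - z j) = (-1) ^ m * ∏ j, (z j - t - 2 * iπ) := by
          rw [← prod_const, ← prod_mul_distrib]
          exact prod_congr rfl fun j _ => by ring
        rw [bpoly, h2]
        simp only [cons_zero, tail_cons, Pi.smul_apply, smul_eq_mul, h3, hg, bpoly]
        have h4 : ((-1 : ℂ) ^ m) * (-1) ^ m = 1 := by rw [← mul_pow]; simp
        linear_combination (tauProd z * bvec θ (Finset.univ.val.map z) α * ∏ j, (z j - t - 2 * iπ)) *
          ((-1) ^ m * hshp z - q z * h4)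
      have e2 : betheVec (θ ∷ʳ t) q (α ∷ʳ 0) =
          tens (betheFun (t ∷ θ) ∘ₗ mulFun fun z => t - z - iπ) m g := by
        rw [tens_comp_mulFun, hrot, betheVec_comp_perm hn hg1 (PSep.sep hp _), ← hrot]
        congr 1
        funext z
        have h2 := congrFun (sliceLast_zero_bvec (θ ∷ʳ t)
          (Finset.univ.val.map z)) α
        rw [sliceLast_apply, map_univ_prod] at h2
        rw [bpoly, h2]
        simp only [Fin.snoc_last, Fin.init_snoc, Pi.smul_apply, smul_eq_mul, hg, bpoly]
        ring
      rw [e1, hq', e2]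
      congr 1
      refine tens_congr_of_sep hgs fun j e he => ?_
      have hm : 1 ≤ m := Nat.one_le_of_lt j.pos
      have had : ∀ a b : ℂ, (fun z => (a + b * z) * e z) ∈ admissible (n + 1) := by
        intro a b
        have hl : (fun z => a + b * z) ∈ Vdeg 1 0 := by
          convert add_mem (smul_mem _ a (pow_mem_Vdeg (Nat.zero_le 1)))
            (smul_mem _ b (pow_mem_Vdeg (le_refl 1))) using 1
          funext z
          simp
        refine Vdeg_le_admissible (by omega) ?_ (mul_mem_Vdeg hl he)
        rw [Nat.cast_sub hm, hn]
        push_cast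
        linarith
      refine betheFun_cons_shift hg1 ?_ ?_
      · convert had (-t - 2 * iπ) 1 using 3; ring
      · convert had (t - iπ) (-1) using 3; ring
    linear_combination (c / (m.factorial : ℂ) * minProd (t + 2 * iπ ∷ θ)) * hV
  have h1 : σ • slice 1 (formFactor c p (t + 2 * iπ ∷ θ)) =
      -sliceLast 1 (formFactor c p (θ ∷ʳ t)) := by
    have h2 := sliceLast_sumLow 0 (formFactor c p (θ ∷ʳ t))
    rw [sumLow_formFactor hn hp hs hsh hg3, map_zero, kd_same, one_smul] at h2
    rw [slice_one_eq (sumLow_formFactor hn hp hs hsh hg2), smul_neg, ← map_smul, h0, map_neg, neg_neg]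
    exact eq_neg_of_add_eq_zero_left h2.symm
  intro β α
  have h0' := congrFun h0 α
  have h1' := congrFun h1 α
  simp only [Pi.smul_apply, Pi.neg_apply, smul_eq_mul, slice_apply, sliceLast_apply] at h0' h1'
  rcases fin_two_cases β with rfl | rfl <;> simp [sum_univ_two, epsUp]
  · linear_combination -h1'
  · linear_combination h0'
end

/-! ### The annihilation pole -/

section
variable {n m w : ℕ} {θ : Fin n → ℂ} {c N σ t : ℂ}

theorem isContour_of_near_natCast {x : Fin n → ℂ} (hx : dist x (fun i => ((i : ℕ) : ℂ)) < 1 / 8) :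
    IsContour x (-(3 * π / 2)) (1 / 4) := by
  have h : ∀ i, |(x i).re - (i : ℕ)| < 1 / 8 ∧ |(x i).im| < 1 / 8 := fun i => by
    have h1 := ((dist_le_pi_dist x _ i).trans_lt hx)
    rw [dist_eq_norm] at h1
    exact ⟨lt_of_le_of_lt (by simpa using abs_re_le_norm (x i - (i : ℕ))) h1,
      lt_of_le_of_lt (by simpa using abs_im_le_norm (x i - (i : ℕ))) h1⟩
  have hπ := Real.pi_gt_three
  refine ⟨by norm_num, fun i => ?_, fun i j k => ?_⟩
  · have := abs_lt.1 (h i).2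
    constructor <;> linarith
  · rcases eq_or_ne i j with rfl | hij
    · rcases eq_or_ne k 0 with rfl | hk
      · exact Or.inl ⟨rfl, rfl⟩
      · have hk1 : (1 : ℝ) ≤ |(k : ℝ)| := by exact_mod_cast Int.one_le_abs hk
        right
        simp only [sub_self, zero_sub, norm_neg, norm_mul, norm_I, norm_intCast, norm_real, one_mul,
          norm_eq_abs, abs_of_pos pi_pos]
        nlinarith
    · right
      refine lt_of_lt_of_le ?_ (abs_re_le_norm _)
      have hk1 : (1 : ℝ) ≤ |((i : ℕ) : ℝ) - (j : ℕ)| := by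
        have : ((i : ℕ) : ℤ) - (j : ℕ) ≠ 0 := sub_ne_zero.2 fun h' => hij (Fin.ext (by exact_mod_cast h'))
        simpa using (Int.cast_le (R := ℝ)).2 (Int.one_le_abs this)
      have h1 := abs_lt.1 (h i).1
      have h2 := abs_lt.1 (h j).1
      simp only [sub_re, mul_re, I_re, I_im, ofReal_re, ofReal_im, intCast_re, intCast_im, zero_mul,
        mul_zero, sub_zero]
      rw [lt_abs]
      rcases le_abs.1 hk1 with h3 | h3
      · left; linarith
      · right; linarith

theorem betheVec_eq_zero_of_negligible (hn : n = w + 2 * m) {u : (Fin n → ℂ) → (Fin m → ℂ) → ℂ}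
    (hu : u ∈ PWeight w n) (h : ∀ θ, Negligible θ (u θ))
    (hθ : θ ∈ generic n) : betheVec θ (u θ) = 0 := by
  funext α
  refine eq_zero_on_generic (fun x hx => (meroG_betheVec hn hu α x).analyticAt hx)
    (natCast_mem_generic n) ?_ θ hθ
  filter_upwards [Metric.ball_mem_nhds _ (by norm_num : (0 : ℝ) < 1 / 8)] with x hx
  have hc := isContour_of_near_natCast hx
  rcases h x with ⟨hn', hm, c, hc'⟩ | h'
  · simp only [betheVec, hc']
    exact tens_const_eq_zero hc.generic hn' hm c α
  · rw [← betheInt_eq hc hn (PSep.sep hu x) α]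
    exact h' _ _ hc α

theorem betheVec_sub (θ : Fin n → ℂ) (a b : ℂ) (f g : (Fin m → ℂ) → ℂ) :
    betheVec θ (fun z => a * f z - b * g z) = a • betheVec θ f - b • betheVec θ g := by
  funext α
  simp only [Pi.sub_apply, Pi.smul_apply, smul_eq_mul, betheVec, mul_tens]
  rw [← map_sub]
  congr 1
  funext z
  simp only [Pi.sub_apply]
  ring

variable {p' : (Fin (n + 2) → ℂ) → (Fin (m + 1) → ℂ) → ℂ} {p : (Fin n → ℂ) → (Fin m → ℂ) → ℂ}

theorem betheVec_recursion (hn : n = w + 2 * m)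
    (hp' : p' ∈ PWeight w (n + 2))
    (hp : p ∈ PWeight w n) (hsh : PShift p' σ)
    (hσ : σ ^ 2 = (-1) ^ n) (hrec : PRecursion p' p σ) (hθ : θ ∈ generic n) (t : ℂ) :
    (betheVec θ fun z => p' (t + iπ ∷ t ∷ θ) (t - iπ ∷ z)) =
      ((-1) ^ n * σ) • betheVec θ (p θ) ∧
    ((-1 : ℂ) ^ m • betheVec θ fun z => p' (t + iπ ∷ t ∷ θ)
      (t ∷ z)) = betheVec θ (p θ) := by
  have hφ : Differentiable ℂ fun θ : Fin n → ℂ =>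
      (t + iπ ∷ t ∷ θ) :=
    differentiable_pi.2 <| Fin.cases (differentiable_const _) <| Fin.cases (differentiable_const _)
      fun i => differentiable_apply (𝕜 := ℂ) (F' := fun _ : Fin n => ℂ) i
  have hu : ∀ a b x : ℂ, (∀ θ, Negligible θ fun z =>
      a * p' (t + iπ ∷ t ∷ θ) (x ∷ z) - b * p θ z) →
      (a • betheVec θ fun z => p' (t + iπ ∷ t ∷ θ) (x ∷ z)) =
        b • betheVec θ (p θ) := by
    intro a b x h
    rw [← sub_eq_zero, ← betheVec_sub]
    exact betheVec_eq_zero_of_negligible hn (sub_mem (smul_mem _ a (PSep.subst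
      (PSep.comp hp' hφ) (fun e he => differentiable_of_mem_Vdeg he) (differentiable_const x)))
      (smul_mem _ b hp)) h hθ
  have hσ0 : σ ≠ 0 := fun h => by rw [h] at hσ; exact pow_ne_zero n (by norm_num : (-1 : ℂ) ≠ 0) (by simpa using hσ.symm)
  constructor
  · have h1 := hu 1 σ (t + iπ) fun θ => by
      obtain ⟨q, _, hq, _, h⟩ := hrec (t + iπ) t θ (by ring)
      convert hq using 2 with z
      rw [(h z).1]; ring
    rw [one_smul] at h1
    rw [mul_smul, ← h1]
    have h2 := betheVec_sub θ ((-1) ^ n) 0 (fun z =>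
      p' (t + iπ ∷ t ∷ θ) (t + iπ ∷ z)) 0
    rw [zero_smul, sub_zero] at h2
    rw [← h2]
    congr 1
    funext z
    have h3 := hsh.2 0 (t + iπ ∷ t ∷ θ) (t - iπ ∷ z)
    rw [Fin.update_cons_zero, cons_zero, show t - iπ + 2 * π * I = t + iπ by ring, pow_add] at h3
    rw [h3]
    have h4 : ((-1 : ℂ) ^ n) * (-1) ^ n = 1 := by rw [← mul_pow]; simp
    linear_combination -p' _ (t - iπ ∷ z) * h4
  · have h1 := hu ((-1) ^ m * σ) σ t fun θ => by
      obtain ⟨_, q, _, hq, h⟩ := hrec (t + iπ) t θ (by ring)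
      convert hq using 2 with z
      rw [(h z).2]; ring
    rw [mul_comm, mul_smul] at h1
    exact smul_right_injective _ hσ0 h1

theorem tendsto_minProd (hgen : (t ∷ θ) ∈ generic (n + 1)) :
    Tendsto (fun s => minProd (s ∷ t ∷ θ))
      (𝓝[≠] (t + iπ)) (𝓝 (minFF iπ * (∏ i, (jost (t - θ i))⁻¹) * minProd θ)) := by
  have hπ := pi_pos
  obtain ⟨-, hne⟩ := generic_cons_iff.1 hgen
  have hc : ContinuousAt minGlobal (iπ) := by
    refine ((differentiableAt_minFFStrip (θ := iπ) (by simpa) (by simp; linarith)).congr_of_eventuallyEq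
      ?_).continuousAt
    have ho : IsOpen {z : ℂ | 0 < z.im ∧ z.im < 2 * π} :=
      (isOpen_lt continuous_const continuous_im).inter (isOpen_lt continuous_im continuous_const)
    filter_upwards [ho.mem_nhds (show iπ ∈ _ by simp; constructor <;> linarith)] with z hz
    rw [minGlobal_eq_minFF (by linarith [hz.1]) hz.2, minFF, if_pos hz.1]
  have hlim : ∀ {x : ℂ}, ContinuousAt minGlobal (t + iπ - x) →
      Tendsto (fun s => minGlobal (s - x)) (𝓝[≠] (t + iπ)) (𝓝 (minGlobal (t + iπ - x))) := fun h =>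
    (h.tendsto.comp ((continuous_id.sub continuous_const).tendsto _)).mono_left nhdsWithin_le_nhds
  have h1 : Tendsto (fun s => ∏ i, minGlobal (s - θ i)) (𝓝[≠] (t + iπ))
      (𝓝 (∏ i, minGlobal (t + iπ - θ i))) := tendsto_finsetProd _ fun i _ => hlim (x := θ i)
    (differentiableAt_minGlobal fun k hk => hne i (k - 1)
      (by push_cast; linear_combination hk)).continuousAt
  convert ((hlim (x := t) (by rwa [add_sub_cancel_left])).mul h1).mul_const ((∏ k, minGlobal (t - θ k)) * minProd θ) using 2
  · simp only [minProd_cons, prod_univ_succ, cons_zero, cons_succ]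
  · have h2 : ∏ i, (jost (t - θ i))⁻¹ = (∏ i, minGlobal (t + iπ - θ i)) * ∏ i, minGlobal (t - θ i) := by
      rw [← prod_mul_distrib]
      refine prod_congr rfl fun i _ => inv_eq_of_mul_eq_one_right ?_
      rw [← jost_mul_minGlobal (hne i)]
      ring_nf
    rw [add_sub_cancel_left, minGlobal_eq_minFF (by simp; linarith) (by simp; linarith), h2]
    ring

theorem tendsto_formFactor_succ (hn : n = w + 2 * m)
    (hp' : p' ∈ PWeight w (n + 2))
    (hp : p ∈ PWeight w n) (hs : PSymm p') (hsh : PShift p' σ)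
    (hσ : σ ^ 2 = (-1) ^ n) (hrec : PRecursion p' p σ)
    (hN : iπ * jostT iπ * minFF iπ * N = 2 * I * c)
    (hgen : (t ∷ θ) ∈ generic (n + 1)) (a : Fin 2) (α : Fin n → Fin 2) :
    Tendsto (fun s => (s - t - iπ) * formFactor N p' (s ∷ t ∷ θ)
      (0 ∷ a ∷ α)) (𝓝[≠] (t + iπ))
      (𝓝 (2 * I * (kd a 1 * formFactor c p θ α - σ * scAct t θ a 1 (formFactor c p θ) α))) := by
  obtain ⟨hθ, hne⟩ := generic_cons_iff.1 hgen
  have h1 := ((tendsto_minProd hgen).const_mul (N / ((m + 1).factorial : ℂ))).mul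
    (tendsto_pinch hn hgen hp' hs.2 a α)
  obtain ⟨e1, e2⟩ := betheVec_recursion hn hp' hp hsh hσ hrec hθ t
  have hy : ∀ i, t - θ i - iπ ≠ 0 := fun i h => hne i 1 (by push_cast; linear_combination h)
  have hj : ∀ i, jost (t - θ i) ≠ 0 := fun i h => by
    have := jost_mul_minGlobal (hne i); rw [h] at this; simp at this
  have hR : jostT iπ = chiRes 0 := by
    have : -iπ / (2 * π * I) = -1 / 2 := by field_simp [pi_ne_zero']
    rw [jostT, jost, this, chiRes]; norm_num
  have k1 : (∏ i, (jost (t - θ i))⁻¹) * kern θ (t - iπ) * (-1) ^ n =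
      ∏ i, (-ampA (t - θ i) / (t - θ i - iπ)) := by
    rw [kern, ← prod_const, ← prod_mul_distrib, ← prod_mul_distrib]
    refine prod_congr rfl fun i _ => ?_
    rw [ampA_eq (hne i), jost_eq_chi (x := -(t - θ i)) (fun h => hy i (by linear_combination -h)),
      ← chi_symm (t - iπ - θ i)]
    have := hy i
    field_simp [hj i]
    ring_nf
  have k2 : (∏ i, (jost (t - θ i))⁻¹) * (kern θ t * ∏ i, (θ i - t - iπ)) = 1 := by
    rw [kern, ← prod_mul_distrib, ← prod_mul_distrib]
    refine Finset.prod_eq_one fun i _ => ?_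
    rw [inv_mul_eq_one₀ (hj i), jost_eq_chi fun h => hne i (-1) (by push_cast; linear_combination h)]
    ring
  convert h1 using 2
  · simp only [formFactor, Pi.smul_apply, smul_eq_mul]; ring
  · have e2' := congrFun e2 α
    rw [Pi.smul_apply, smul_eq_mul] at e2'
    have hf : N / ((m + 1).factorial : ℂ) * (m + 1) = N / (m.factorial : ℂ) := by
      have h1 : (m + 1 : ℂ) ≠ 0 := by exact_mod_cast Nat.succ_ne_zero m
      have h2 : (m.factorial : ℂ) ≠ 0 := by exact_mod_cast m.factorial_ne_zero
      rw [Nat.factorial_succ]; push_cast; field_simp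
    rw [hR] at hN
    rw [e1, map_smul, scAct_eq t θ hy, ← k1]
    simp only [formFactor, map_smul, Pi.smul_apply, smul_eq_mul, Fin.val_one, sub_self, pow_succ]
    generalize (∏ i, (jost (t - θ i))⁻¹) = J at *
    generalize ∏ i, (θ i - t - iπ) = D at *
    generalize tmat n θ (t - iπ) 0 (1 - a) (betheVec θ (p θ)) α = T
    generalize betheVec θ (p θ) α = V at *
    generalize betheVec θ (fun z => p' _ (t ∷ z)) α = B at *
    generalize kern θ (t - iπ) = K at *
    linear_combination (-(minProd θ / (m.factorial : ℂ)) * (σ * (-1) ^ (a : ℕ) * J * K * (-1) ^ n * T +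
      kd a 1 * V)) * hN - iπ * chiRes 0 * minFF iπ * N / (m.factorial : ℂ) * minProd θ * kd a 1 *
      (V * k2 + J * kern θ t * D * e2') - minFF iπ * J * minProd θ * (iπ * chiRes 0 *
      (K * ((-1) ^ (a : ℕ) * ((-1) ^ n * σ * T)) + kd a 1 * (kern θ t * D * (-1) ^ m * B))) * hf

theorem annihilation_of_tendsto {F : CoVecFun (n + 2)} {G : CoVecFun n}
    (hF : ∀ θ ∈ generic (n + 2), sumLow (n + 2) (F θ) = 0) (hG : ∀ θ ∈ generic n, sumLow n (G θ) = 0)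
    (h : ∀ {t : ℂ} {θ : Fin n → ℂ}, (t ∷ θ) ∈ generic (n + 1) →
      ∀ (a : Fin 2) (α : Fin n → Fin 2), Tendsto (fun s => (s - t - iπ) *
        F (s ∷ t ∷ θ) (0 ∷ a ∷ α))
        (𝓝[≠] (t + iπ)) (𝓝 (2 * I * (kd a 1 * G θ α - σ * scAct t θ a 1 (G θ) α)))) :
    Annihilation F G σ := by
  intro t θ hgen a₁ a α
  obtain ⟨hθ, hne⟩ := generic_cons_iff.1 hgen
  rcases fin_two_cases a₁ with rfl | rfl
  · convert h hgen a α using 2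
    simp only [sum_univ_two, epsLow, scAct]
    rcases fin_two_cases a with rfl | rfl <;> simp [kd]
  · set v : CoVec (n + 1) := fun β => 2 * I * (kd (β 0) 1 * G θ (tail β) -
      σ * scAct t θ (β 0) 1 (G θ) (tail β)) with hv
    have h1 : Tendsto (fun s => (s - t - iπ) • slice 0 (F (s ∷ t ∷ θ)))
        (𝓝[≠] (t + iπ)) (𝓝 v) := by
      refine tendsto_pi_nhds.2 fun β => ?_
      have := h hgen (β 0) (tail β)
      rwa [cons_self_tail] at this
    have h2 := tendsto_pi_nhds.1 ((((sumLow (n + 1)).continuous_of_finiteDimensional.tendsto v).comp h1).neg)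
      (a ∷ α)
    refine (h2.congr' ?_).trans (le_of_eq (congrArg _ ?_))
    · filter_upwards [eventually_generic_cons hgen] with s hs
      have h3 := congrFun (slice_one_eq (hF _ hs)) (a ∷ α)
      rw [slice_apply] at h3
      rw [h3]
      simp
    · have h4 : ∀ b, slice b v = (2 * I) • (kd b 1 • G θ - σ • scAct t θ b 1 (G θ)) := fun b => by
        funext β; simp [slice_apply, hv, tail_cons]
      have h5 := congrFun (slice_sumLow a v) α
      rw [slice_apply, h4, h4] at h5
      simp only [map_smul, map_sub, hG θ hθ, sumLow_scAct t θ (fun i h => hne i 1 (by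
        push_cast; linear_combination h)) (hG θ hθ)] at h5
      rw [Pi.neg_apply, h5]
      simp only [sum_univ_two, epsLow]
      rcases fin_two_cases a with rfl | rfl <;> simp [kd, scAct]; ring

theorem annihilation_formFactor (hn : n = w + 2 * m)
    (hp' : p' ∈ PWeight w (n + 2))
    (hp : p ∈ PWeight w n) (hs' : PSymm p') (hsh' : PShift p' σ)
    {σ₀ : ℂ} (hs : PSymm p) (hsh : PShift p σ₀) (hσ : σ ^ 2 = (-1) ^ n) (hrec : PRecursion p' p σ)
    (hN : iπ * jostT iπ * minFF iπ * N = 2 * I * c) :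
    Annihilation (formFactor N p') (formFactor c p) σ :=
  annihilation_of_tendsto (fun _ h => sumLow_formFactor (by omega) hp' hs' hsh' h)
    (fun _ h => sumLow_formFactor hn hp hs hsh h)
    fun hgen => tendsto_formFactor_succ hn hp' hp hs' hsh' hσ hrec hN hgen

theorem annihilationLowest_formFactor : ∀ {n : ℕ} {p : (Fin n → ℂ) → (Fin 0 → ℂ) → ℂ},
    p ∈ PWeight w n →
      AnnihilationLowest n (formFactor c p) σ
  | 0, _, _ => trivial
  | 1, _, _ => trivial
  | n + 2, p, hp => by
    intro t θ hgen a₁ a α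
    have hd := differentiable_cons (t ∷ θ)
    have h0 : Tendsto (fun s => s - t - iπ) (𝓝[≠] (t + iπ)) (𝓝 0) := by
      have : Continuous fun s => s - t - iπ := by fun_prop
      simpa using (this.tendsto (t + iπ)).mono_left nhdsWithin_le_nhds
    have h1 := PSep.tendsto_tens (integrand_mem_PDeg (PSep.comp hp hd) hd
      (a₁ ∷ a ∷ α)) (tendsto_id.mono_left nhdsWithin_le_nhds)
      (L := fun s => betheFun (s ∷ t ∷ θ)) (L₀ := 0)
      (l := 𝓝[≠] (t + iπ)) fun j => j.elim0
    convert h0.mul (((tendsto_minProd hgen).const_mul (c / (Nat.factorial 0 : ℂ))).mul h1) using 2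
    · rfl
    · simp
end

end
end SU2

/-- The SU(2) form factors of an operator of weight `w = n - 2m`. The data belonging to the
`n`-particle form factor with `n = w + 2m` and `m` integrations carry the index `m`. -/
theorem mainTheorem3 (w : ℕ)
    (p : (m : ℕ) → (Fin (w + 2 * m) → ℂ) → (Fin m → ℂ) → ℂ)
    (σ N : ℕ → ℂ)
    (hσ : ∀ m, σ m ^ 2 = (-1) ^ (w + 2 * m))
    (hreg : ∀ m, SU2.PRegular w (p m))
    (hsymm : ∀ m, SU2.PSymm (p m))
    (hshift : ∀ m, SU2.PShift (p m) (σ m))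
    (hrec : ∀ m, SU2.PRecursion (n := w + 2 * m) (p (m + 1)) (p m) (σ (m + 1)))
    (hN : ∀ m, Complex.I * Real.pi * SU2.jostT (Complex.I * Real.pi) *
      SU2.minFF (Complex.I * Real.pi) * N (m + 1) = 2 * Complex.I * N m) :
    ∃ F : (m : ℕ) → SU2.CoVecFun (w + 2 * m),
      (∀ m, SU2.GivenByAnsatz (N m) (p m) (F m)) ∧
      (∀ m, SU2.Watson (F m)) ∧
      (∀ m, SU2.Crossing (w + 2 * m) (F m) (σ m)) ∧
      (∀ m, SU2.Annihilation (n := w + 2 * m) (F (m + 1)) (F m) (σ (m + 1))) ∧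
      SU2.AnnihilationLowest (w + 2 * 0) (F 0) (σ 0) := by
  have hp := fun m => (hreg m).mem_PDeg (hshift m) (by rw [pow_add, pow_mul]; simp)
  refine ⟨fun m => SU2.formFactor (N m) (p m), fun m => SU2.givenByAnsatz_formFactor rfl (hp m),
    fun m => SU2.watson_formFactor rfl (hp m) (hsymm m),
    fun m => SU2.crossing_formFactor rfl (hp m) (hsymm m) (hshift m),
    fun m => SU2.annihilation_formFactor rfl (hp (m + 1)) (hp m) (hsymm (m + 1)) (hshift (m + 1))
      (hsymm m) (hshift m) ?_ (hrec m) (hN m), SU2.annihilationLowest_formFactor (hp 0)⟩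
  rw [hσ, mul_add, ← add_assoc, pow_add]
  simp
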